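/- **Lemma 5.1.** Let $n\ge 2$, $n/(n+1)<p<\infty$, $0<\Lambda<\infty$, $0<C_0<\infty$ and $0<\alpha\le 1$. Write points of $\mathbb R^{n+1}$ as $X=(x,t)$ with $x\in\mathbb R^n$, $t\in\mathbb R$, and put $\mathbb R^{n+1}_\pm=\{(x,t):\pm t>0\}$. Let $L=-\operatorname{div}A(x)\nabla$, where $A$ is an $(n+1)\times(n+1)$ matrix of measurable, complex, $t$-independent coefficients such that $\operatorname{Re}\langle A(x)\xi,\xi\rangle\ge\Lambda^{-1}|\xi|^2$ and $|A(x)\xi|\le\Lambda|\xi|$ for a.e. $x\in\mathbb R^n$ and all $\xi\in\mathbb C^{n+1}$, and let $L^*=-\operatorname{div}A^*\nabla$ with $A^*$ the Hermitian adjoint matrix. A solution of $Lu=0$ in a domain $\Omega$ is a $u\in L^2_{\rm loc}(\Omega)$ with weak gradient $\nabla u\in L^2_{\rm loc}(\Omega)$ and $\int_\Omega A\nabla u\cdot\nabla\Phi=0$ for all $\Phi\in C_0^\infty(\Omega)$. Assume that all solutions $u$ of $Lu=0$, and all solutions of $L^*u=0$, in any domain $\Omega\subset\mathbb R^{n+1}$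 satisfy (after modification on a null set) $$|u(Y)-u(Z)|\le C_0\Big(\frac{|Y-Z|}{R}\Big)^{\alpha}\Big(\frac1{|B(X,2R)|}\int_{B(X,2R)}|u|^2\Big)^{1/2}\qquad\text{whenever } B(X,2R)\subset\Omega,\ Y,Z\in B(X,R).$$ Solutions are identified with their continuous representatives. For $x_0\in\mathbb R^n$ let $\Gamma^\pm(x_0)=\{(x,t)\in\mathbb R^{n+1}_\pm:|x_0-x|<|t|\}$ and $$\widetilde N^\pm_*(F)(x_0)=\sup_{(x,t)\in\Gamma^\pm(x_0)}\Big(\frac{1}{|B((x,t),|t|/4)|}\int_{B((x,t),|t|/4)}|F|^2\Big)^{1/2}.$$ For $p>1$ let $H^p(\mathbb R^n)=L^p(\mathbb R^n)$ and let $\dot H^{1,p}(\mathbb R^n)=\dot L^p_1(\mathbb R^n)$ be the completion of $C_0^\infty(\mathbb R^n)$ in the norm $\|\nabla f\|_p$, realized in $L^1_{\rm loc}(\mathbb R^n)/\mathbb C$. For $p\le1$ let $H^p(\mathbb R^n)$ be the classical atomic Hardy space, with quasi-norm $\inf(\sum_j|\lambda_j|^p)^{1/p}$ over atomic decompositions,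 and let $\dot H^{1,p}(\mathbb R^n)$ be the space of tempered distributions $f$ modulo constants such that $\nabla f=\sum_j\lambda_j\nabla a_j$ with convergence in $H^p(\mathbb R^n)$, where $(\lambda_j)\in\ell^p$ and each $a_j\in\dot L^2_1(\mathbb R^n)$ is supported in a cube $Q_j$ with $\|\nabla a_j\|_{L^2(Q_j)}\le|Q_j|^{1/2-1/p}$, with quasi-norm $\inf(\sum_j|\lambda_j|^p)^{1/p}$ over such representations. There is a constant $C<\infty$ depending only on $n,\Lambda,C_0,\alpha,p$ such that, for either choice of sign, if $Lu=0$ in $\mathbb R^{n+1}_\pm$ and $\widetilde N^\pm_*(\nabla u)\in L^p(\mathbb R^n)$, then: 1. There is a unique $g\in H^p(\mathbb R^n)$ (the variational co-normal derivative $\partial_\nu u(\cdot,0)$) such that $$\int_{\mathbb R^{n+1}_\pm}A\nabla u\cdot\nabla\Phi\,dX=\pm\langle g,\Phi(\cdot,0)\rangle\qquad\text{for all }\Phi\in C_0^\infty(\mathbb R^{n+1}),$$ with absolutely convergent integrals, where $\langle g,\varphi\rangle=\int_{\mathbb R^n}g\varphi\,dx$ (and $g\in L^p(\mathbb R^n)$)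 if $p\ge1$, and $\langle g,\varphi\rangle$ is the pairing of a tempered distribution with a test function if $p<1$. It satisfies $\|g\|_{H^p(\mathbb R^n)}\le C\|\widetilde N^\pm_*(\nabla u)\|_{L^p(\mathbb R^n)}$. 2. There is a unique $f\in\dot H^{1,p}(\mathbb R^n)$, represented by a locally integrable function, such that $u\to f$ non-tangentially, that is, $\lim_{\Gamma^\pm(x)\ni(y,t)\to(x,0)}u(y,t)=f(x)$ for a.e. $x\in\mathbb R^n$. It satisfies $\|f\|_{\dot H^{1,p}(\mathbb R^n)}\le C\|\widetilde N^\pm_*(\nabla u)\|_{L^p(\mathbb R^n)}$. -/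

import Mathlib

open MeasureTheory Filter Topology
open scoped ENNReal NNReal ContDiff SchwartzMap Matrix LineDeriv

namespace EllipticBoundary

noncomputable section

/-! ### Coordinates in the half-spaces -/

/-- Real Euclidean space `ℝ^d`. -/
abbrev E (d : ℕ) : Type := EuclideanSpace ℝ (Fin d)

/-- Complex Euclidean space `ℂ^d`. -/
abbrev V (d : ℕ) : Type := EuclideanSpace ℂ (Fin d)

/-- The component `x ∈ ℝ^n` of `X = (x, t) ∈ ℝ^{n+1}`. -/
def horiz {n : ℕ} (X : E (n + 1)) : E n := WithLp.toLp 2 fun i => X i.castSucc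

/-- The component `t` of `X = (x, t) ∈ ℝ^{n+1}`. -/
def height {n : ℕ} (X : E (n + 1)) : ℝ := X (Fin.last n)

/-- The boundary point `(x, 0) ∈ ℝ^{n+1}`. -/
def bdryPt {n : ℕ} (x : E n) : E (n + 1) :=
  WithLp.toLp 2 (Fin.snoc (α := fun _ => ℝ) (fun i => x i) 0)

/-- The half-space `{(x, t) : σ t > 0}`: the upper one for `σ = 1`, the lower one for `σ = -1`. -/
def halfSpace (n : ℕ) (σ : ℝ) : Set (E (n + 1)) := {X | 0 < σ * height X}

/-- The cone `{(x, t) : |x₀ - x| < σ t}` with vertex `(x₀, 0)`, where `σ = 1` or `σ = -1`. -/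
def cone {n : ℕ} (σ : ℝ) (x₀ : E n) : Set (E (n + 1)) := {X | ‖x₀ - horiz X‖ < σ * height X}

/-! ### Test functions and weak gradients -/

/-- `φ ∈ C_0^∞(Ω)`, complex valued. -/
def IsTestFunction {d : ℕ} (Ω : Set (E d)) (φ : E d → ℂ) : Prop :=
  ContDiff ℝ ∞ φ ∧ HasCompactSupport φ ∧ tsupport φ ⊆ Ω

/-- The classical gradient `(∂_1 φ, …, ∂_d φ)`. -/
def grad {d : ℕ} (φ : E d → ℂ) (X : E d) : V d :=
  WithLp.toLp 2 fun i => fderiv ℝ φ X (EuclideanSpace.single i 1)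

/-- `G` is the weak (distributional) gradient of `u` on `Ω`. -/
def HasWeakGradOn {d : ℕ} (Ω : Set (E d)) (u : E d → ℂ) (G : E d → V d) : Prop :=
  LocallyIntegrableOn u Ω ∧ LocallyIntegrableOn G Ω ∧
    ∀ φ, IsTestFunction Ω φ → ∀ i,
      ∫ X in Ω, u X * grad φ X i = -∫ X in Ω, G X i * φ X

/-- `f ∈ L²_loc(Ω)`. -/
def MemL2Loc {d : ℕ} {F : Type*} [NormedAddCommGroup F] (Ω : Set (E d)) (f : E d → F) : Prop :=
  ∀ K ⊆ Ω, IsCompact K → MemLp f 2 (volume.restrict K)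

/-! ### The operator `L = -div A(x) ∇` -/

/-- A `t`-independent coefficient matrix on `ℝ^{n+1}`. -/
abbrev Coeff (n : ℕ) : Type := E n → Matrix (Fin (n + 1)) (Fin (n + 1)) ℂ

/-- `A` is measurable, accretive with constant `1/Λ` and bounded (in operator norm) by `Λ`. -/
def IsUniformlyElliptic {n : ℕ} (Λ : ℝ) (A : Coeff n) : Prop :=
  (∀ i j, AEStronglyMeasurable (fun x => A x i j) volume) ∧
    ∀ᵐ x : E n, ∀ ξ : V (n + 1),
      Λ⁻¹ * ‖ξ‖ ^ 2 ≤ (∑ i, ∑ j, A x i j * ξ j * star (ξ i)).re ∧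
      ‖(WithLp.toLp 2 (A x *ᵥ ξ.ofLp) : V (n + 1))‖ ≤ Λ * ‖ξ‖

/-- The coefficients `A^*` of the Hermitian adjoint `L^*`. -/
def adjointCoeff {n : ℕ} (A : Coeff n) : Coeff n := fun x => (A x)ᴴ

/-- The integrand `A∇u · ∇Φ` (bilinear dot product), where `G` stands for `∇u`. -/
def energy {n : ℕ} (A : Coeff n) (G : E (n + 1) → V (n + 1)) (Φ : E (n + 1) → ℂ)
    (X : E (n + 1)) : ℂ :=
  ∑ i, ∑ j, A (horiz X) i j * G X j * grad Φ X i

/-- `u` is a weak solution of `Lu = 0` in `Ω`, with weak gradient `G = ∇u`: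
`u ∈ L²_{1,loc}(Ω)` and `∫ A∇u · ∇Φ = 0` for all `Φ ∈ C_0^∞(Ω)`. -/
def IsSolution {n : ℕ} (A : Coeff n) (Ω : Set (E (n + 1))) (u : E (n + 1) → ℂ)
    (G : E (n + 1) → V (n + 1)) : Prop :=
  MemL2Loc Ω u ∧ MemL2Loc Ω G ∧ HasWeakGradOn Ω u G ∧
    ∀ Φ, IsTestFunction Ω Φ → ∫ X in Ω, energy A G Φ X = 0

/-- The De Giorgi/Nash estimate for the (everywhere defined) function `v` on `Ω`. Moser's local
boundedness estimate is a consequence. The right side is infinite if `v ∉ L²(2B)`. -/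
def DeGiorgiNashOn {d : ℕ} (C₀ α : ℝ) (Ω : Set (E d)) (v : E d → ℂ) : Prop :=
  ∀ (X : E d) (R : ℝ), 0 < R → Metric.ball X (2 * R) ⊆ Ω →
    ∀ Y ∈ Metric.ball X R, ∀ Z ∈ Metric.ball X R,
      ‖v Y - v Z‖ₑ ≤ ENNReal.ofReal (C₀ * (‖Y - Z‖ / R) ^ α) *
        (⨍⁻ W in Metric.ball X (2 * R), ‖v W‖ₑ ^ 2 ∂volume) ^ (1 / 2 : ℝ)

/-- Every solution of `Lu = 0` in a domain agrees almost everywhere there with a function that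
satisfies the De Giorgi/Nash estimate with the constants `C₀` and `α`. -/
def SatisfiesDGN {n : ℕ} (A : Coeff n) (C₀ α : ℝ) : Prop :=
  ∀ (Ω : Set (E (n + 1))) (u : E (n + 1) → ℂ) (G : E (n + 1) → V (n + 1)),
    IsOpen Ω → IsConnected Ω → IsSolution A Ω u G →
      ∃ v, v =ᵐ[volume.restrict Ω] u ∧ DeGiorgiNashOn C₀ α Ω v

/-! ### Non-tangential maximal function and convergence -/

/-- The non-tangential maximal function `Ñ_*^±(F)(x₀)`, built from `L²` averages. -/
def ntMax {n : ℕ} (σ : ℝ) (F : E (n + 1) → V (n + 1)) (x₀ : E n) : ℝ≥0∞ :=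
  ⨆ X ∈ cone σ x₀, (⨍⁻ Y in Metric.ball X (σ * height X / 4), ‖F Y‖ₑ ^ 2 ∂volume) ^ (1 / 2 : ℝ)

/-- The `L^p(ℝ^n)` (quasi-)norm of a nonnegative function, `0 < p < ∞`. -/
def lpQuasiNorm {n : ℕ} (p : ℝ) (N : E n → ℝ≥0∞) : ℝ≥0∞ := (∫⁻ x, N x ^ p) ^ (1 / p)

/-- `u → f` non-tangentially. -/
def NTConverges {n : ℕ} (σ : ℝ) (u : E (n + 1) → ℂ) (f : E n → ℂ) : Prop :=
  ∀ᵐ x : E n, Tendsto u (𝓝[cone σ x] (bdryPt x)) (𝓝 (f x))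

/-! ### The scale `H^p(ℝ^n)` -/

/-- The tempered distribution `T` is (integration against) the locally integrable function `h`. -/
def Represents {n : ℕ} (T : 𝓢'(E n, ℂ)) (h : E n → ℂ) : Prop :=
  LocallyIntegrable h ∧
    ∀ φ : 𝓢(E n, ℂ), Integrable (fun x => h x * φ x) ∧ T φ = ∫ x, h x * φ x

/-- `a` is an atom for `H^p(ℝ^n)`, `n/(n+1) < p ≤ 1`; in this range the vanishing of the moments
up to order `n(1/p - 1) < 1` is the vanishing of the mean. -/
def IsAtom {n : ℕ} (p : ℝ) (a : E n → ℂ) : Prop :=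
  AEStronglyMeasurable a volume ∧ ∃ (c : E n) (r : ℝ), 0 < r ∧
    (∀ᵐ x, x ∉ Metric.ball c r → a x = 0) ∧
    (∀ᵐ x, ‖a x‖ ≤ volume.real (Metric.ball c r) ^ (-(1 / p))) ∧
    ∫ x, a x = 0

/-- The atomic quasi-norm `inf (∑ |λ_j|^p)^{1/p}` over the representations `T = ∑ λ_j a_j`
in `𝓢'(ℝ^n)` by atoms; it is `∞` if there is none with `(λ_j) ∈ ℓ^p`. -/
def atomicNorm {n : ℕ} (p : ℝ) (T : 𝓢'(E n, ℂ)) : ℝ≥0∞ :=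
  ⨅ (l : ℕ → ℂ) (a : ℕ → E n → ℂ) (_ : ∀ j, IsAtom p (a j))
    (_ : ∀ φ : 𝓢(E n, ℂ), HasSum (fun j => l j * ∫ x, a j x * φ x) (T φ)),
    (∑' j, ‖l j‖ₑ ^ p) ^ (1 / p)

/-- The (quasi-)norm of `H^p(ℝ^n)`, `n/(n+1) < p < ∞`: the norm of `L^p` if `p > 1`, the atomic
quasi-norm if `p ≤ 1`. The space `H^p(ℝ^n)` is the set where it is finite. -/
def hardyNorm {n : ℕ} (p : ℝ) (T : 𝓢'(E n, ℂ)) : ℝ≥0∞ :=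
  if 1 < p then ⨅ (h : E n → ℂ) (_ : Represents T h), eLpNorm h (ENNReal.ofReal p) volume
  else atomicNorm p T

/-! ### The scale `Ḣ^{1,p}(ℝ^n)` -/

/-- `f`, modulo constants, belongs to the homogeneous Sobolev space `L̇^p_1(ℝ^n)`, the completion
of `C_0^∞(ℝ^n)` in the norm `‖∇f‖_p` realized in `L¹_loc/ℂ`, and `G = ∇f`. -/
def IsHomSobolev {n : ℕ} (p : ℝ≥0∞) (f : E n → ℂ) (G : E n → V n) : Prop :=
  HasWeakGradOn Set.univ f G ∧ MemLp G p volume ∧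
    ∃ φ : ℕ → E n → ℂ, (∀ k, IsTestFunction Set.univ (φ k)) ∧
      Tendsto (fun k => eLpNorm (fun x => grad (φ k) x - G x) p volume) atTop (𝓝 0)

/-- The closed cube with sides of length `ℓ` parallel to the axes and lower corner `c`. -/
def cube {n : ℕ} (c : E n) (ℓ : ℝ) : Set (E n) := {x | ∀ i, c i ≤ x i ∧ x i ≤ c i + ℓ}

/-- A regular atom `a ∈ L̇²_1(ℝ^n)`, together with its gradient `∇a`. -/
structure RegularAtom (n : ℕ) (p : ℝ) where
  toFun : E n → ℂ
  gradient : E n → V n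
  isHomSobolev : IsHomSobolev 2 toFun gradient
  exists_cube : ∃ (c : E n) (ℓ : ℝ), 0 < ℓ ∧ (∀ᵐ x, x ∉ cube c ℓ → toFun x = 0) ∧
    eLpNorm gradient 2 (volume.restrict (cube c ℓ)) ≤ volume (cube c ℓ) ^ (1 / 2 - 1 / p)

/-- The tempered distribution `∂_i a ∈ L²(ℝ^n)` for a regular atom `a`. -/
def RegularAtom.partialDist {n : ℕ} {p : ℝ} (a : RegularAtom n p) (i : Fin n) : 𝓢'(E n, ℂ) :=
  Lp.toTemperedDistribution
    ((a.isHomSobolev.2.1.continuousLinearMap_comp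
      (EuclideanSpace.proj i : V n →L[ℂ] ℂ)).toLp _)

/-- The quasi-norm of `Ḣ^{1,p}_at(ℝ^n)` for a tempered distribution `F` (modulo constants):
`inf (∑ |λ_j|^p)^{1/p}` over all representations `∇F = ∑ λ_j ∇a_j` by regular atoms, with
convergence in `H^p(ℝ^n)`. -/
def atomicHardySobolevNorm {n : ℕ} (p : ℝ) (F : 𝓢'(E n, ℂ)) : ℝ≥0∞ :=
  ⨅ (l : ℕ → ℂ) (a : ℕ → RegularAtom n p)
    (_ : ∀ i : Fin n, Tendsto
      (fun N => atomicNorm p (LineDeriv.lineDerivOp (EuclideanSpace.single i (1 : ℝ)) F -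
        ∑ j ∈ Finset.range N, l j • (a j).partialDist i)) atTop (𝓝 0)),
    (∑' j, ‖l j‖ₑ ^ p) ^ (1 / p)

/-- The (quasi-)norm of `Ḣ^{1,p}(ℝ^n)`, `n/(n+1) < p < ∞`, for the class modulo constants of a
function `f`. The function belongs to the space if and only if it is finite. -/
def hardySobolevNorm {n : ℕ} (p : ℝ) (f : E n → ℂ) : ℝ≥0∞ :=
  if 1 < p then
    ⨅ (G : E n → V n) (_ : IsHomSobolev (ENNReal.ofReal p) f G),
      eLpNorm G (ENNReal.ofReal p) volume
  else ⨅ (F : 𝓢'(E n, ℂ)) (_ : Represents F f), atomicHardySobolevNorm p F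

/-! ### The variational co-normal derivative -/

theorem bdryPt_isometry (n : ℕ) : Isometry (bdryPt : E n → E (n + 1)) := by
  refine Isometry.of_dist_eq fun x y => ?_
  simp [EuclideanSpace.dist_eq, bdryPt, Fin.sum_univ_castSucc]

theorem bdryPt_contDiff (n : ℕ) : ContDiff ℝ ∞ (bdryPt : E n → E (n + 1)) := by
  refine contDiff_euclidean.2 fun i => ?_
  refine Fin.lastCases ?_ (fun j => ?_) i
  · simpa [bdryPt] using contDiff_const
  · simpa [bdryPt] using (EuclideanSpace.proj j : E n →L[ℝ] ℝ).contDiff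

/-- The trace `Φ(·, 0)` of `Φ ∈ C_0^∞(ℝ^{n+1})`, as a Schwartz function on `ℝ^n`. -/
def traceTest {n : ℕ} (Φ : E (n + 1) → ℂ) (hΦ : IsTestFunction Set.univ Φ) : 𝓢(E n, ℂ) :=
  (hΦ.2.1.comp_isClosedEmbedding (bdryPt_isometry n).isClosedEmbedding).toSchwartzMap
    (hΦ.1.comp (bdryPt_contDiff n))

theorem traceTest_apply {n : ℕ} (Φ : E (n + 1) → ℂ) (hΦ : IsTestFunction Set.univ Φ) (x : E n) :
    traceTest Φ hΦ x = Φ (bdryPt x) := rfl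

/-- `g` is the variational co-normal derivative `∂_ν u(·, 0)`, where `G = ∇u`:
`∫ A∇u · ∇Φ = ± ⟨g, Φ(·, 0)⟩` for all `Φ ∈ C_0^∞(ℝ^{n+1})`, the integral over the half-space
being absolutely convergent. -/
def IsConormal {n : ℕ} (A : Coeff n) (σ : ℝ) (G : E (n + 1) → V (n + 1)) (g : 𝓢'(E n, ℂ)) :
    Prop :=
  ∀ (Φ : E (n + 1) → ℂ) (hΦ : IsTestFunction Set.univ Φ),
    IntegrableOn (energy A G Φ) (halfSpace n σ) ∧
      ∫ X in halfSpace n σ, energy A G Φ X = (σ : ℂ) * g (traceTest Φ hΦ)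

end

end EllipticBoundary

open EllipticBoundary

open MeasureTheory Filter Topology
open scoped ENNReal NNReal ContDiff SchwartzMap Matrix LineDeriv

namespace EllipticBoundary

noncomputable section

/-! ### Dyadic sums -/

/-! Both boundary values are controlled through one size function on the boundary, `ntMax σ G`,
written N below. The condition p > n/(n+1) enters as the convergence of a power of the scale.

Co-normal derivative. For φ on the boundary let ℓ(φ) be ± the integral of A∇u·∇Φ, where Φ is any
smooth compactly supported extension of φ. The choice of Φ is irrelevant: if Φ vanishes on the
boundary then |Φ| ≤ L|t|, so cutting Φ off below height 1/k keeps it uniformly Lipschitz, and the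
equation passes to the limit (`integral_energy_eq_zero`). A bump φ of height a and scale r may
therefore be extended at its own scale, with gradient of order a/r on a box of size r. Choose q with
n/(n+1) < q < p and q ≤ 1. The integral of |∇u| over such a box is at most C r^(n+1) H(y), where H =
M(N^q)^(1/q) and M is the Hardy–Littlewood maximal operator (`exists_lintegral_bdryBox_le`). Hence
|ℓ(φ)| ≤ C a r^n H(y) for every y near the bump, and H lies in L^p because p/q > 1. In substance
this is control of the grand maximal function of ℓ, and `exists_hardy_of_bump` turns it into
membership in H^p.

For p ≥ 1 the bump bound makes ℓ continuous for a weighted L¹ norm, so ℓ is a function dominated by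
a multiple of H. For p ≤ 1 a Calderón–Zygmund argument is run directly on the functional. At each
level 2^k take a Whitney partition of unity of {H > 2^k} and let b_k be the bad part, that is, ℓ
localized to the Whitney balls and tested on φ minus its mean on each ball. The differences b_k -
b_(k+1) split into multiples of atoms (`Level.exists_atom`), b_k tends to 0 as k → +∞ and to ℓ as k
→ -∞, so the telescoping sum is an atomic decomposition of ℓ (`exists_atomic_of_bump`).

Trace. The Poincaré inequality and the De Giorgi–Nash estimate bound the oscillation of u on a ball
of radius t/8 at height t in the cone over x by C t N(x) (`exists_oscillation_le`). Chaining down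
the cone gives a limit f(x) with |u(X) - f(x)| ≤ C t N(x) (`exists_nt_limit`). The point at height
|x - y| over the midpoint of x and y lies in both cones, so |f(x) - f(y)| ≤ C|x - y|(N(x) + N(y)): a
multiple of N is a Hajłasz gradient of f.

A function f with a Hajłasz gradient h in L^p is in Ḣ^(1,p) (`exists_hardySobolev_of_hajlasz`). It
is Lipschitz with constant 2·2^k on {h ≤ 2^k}; extend it from there to a Lipschitz function f_k. The
differences f_(k+1) - f_k vanish on {h ≤ 2^k}, and a Whitney partition of the complement cuts them
into Lipschitz pieces supported in Whitney balls. These pieces are multiples of regular atoms with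
coefficients summable in ℓ^p. For p > 1 their gradients add up pointwise to at most C h. -/

theorem tsum_zpow_rpow_lt_le {s : ℝ} (hs : 0 < s) : ∃ C : ℝ≥0, ∀ x : ℝ≥0∞,
    ∑' k : ℤ, (if (2 : ℝ≥0∞) ^ k < x then ((2 : ℝ≥0∞) ^ k) ^ s else 0) ≤ C * x ^ s := by
  have h2 : (2 : ℝ≥0∞) ^ (-s) < 1 := by
    rw [ENNReal.rpow_neg, ENNReal.inv_lt_one]
    exact ENNReal.one_lt_rpow (by norm_num) hs
  have hC : (1 - (2 : ℝ≥0∞) ^ (-s))⁻¹ ≠ ⊤ := by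
    rw [ENNReal.inv_ne_top]
    exact (tsub_pos_of_lt h2).ne'
  refine ⟨((1 - (2 : ℝ≥0∞) ^ (-s))⁻¹).toNNReal, fun x => ?_⟩
  rw [ENNReal.coe_toNNReal hC]
  rcases eq_or_ne x 0 with rfl | hx0
  · simp
  rcases eq_or_ne x ⊤ with rfl | hxt
  · rw [ENNReal.top_rpow_of_pos hs, ENNReal.mul_top (by simp)]
    exact le_top
  -- With 2^K < x ≤ 2^(K+1), only the indices k ≤ K contribute, and they form a geometric series
  -- with ratio 2^(-s).
  obtain ⟨K, hK1, hK2⟩ := ENNReal.exists_mem_Ioc_zpow hx0 hxt (y := 2) (by norm_num) (by norm_num)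
  have hinj : Function.Injective (fun j : ℕ => K - (j : ℤ)) := fun a b h => by
    simpa using h
  rw [← hinj.tsum_eq]
  · have : ∀ j : ℕ, (if (2 : ℝ≥0∞) ^ (K - (j : ℤ)) < x then ((2 : ℝ≥0∞) ^ (K - (j : ℤ))) ^ s
        else 0) ≤ x ^ s * ((2 : ℝ≥0∞) ^ (-s)) ^ j := by
      intro j
      split_ifs
      · have e : ((2 : ℝ≥0∞) ^ (K - (j : ℤ))) ^ s = ((2 : ℝ≥0∞) ^ K) ^ s * ((2 : ℝ≥0∞) ^ (-s)) ^ j := by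
          rw [← ENNReal.rpow_intCast, ← ENNReal.rpow_intCast, ← ENNReal.rpow_natCast,
            ← ENNReal.rpow_mul, ← ENNReal.rpow_mul, ← ENNReal.rpow_mul,
            ← ENNReal.rpow_add _ _ (by norm_num) (by norm_num)]
          congr 1
          push_cast
          ring
        rw [e]
        gcongr
      · exact zero_le
    refine (ENNReal.tsum_le_tsum this).trans ?_
    rw [ENNReal.tsum_mul_left, ENNReal.tsum_geometric, mul_comm]
  · intro k hk
    by_contra hk'
    apply hk
    have : K < k := by
      by_contra! h
      exact hk' ⟨(K - k).toNat, by simp [Int.toNat_of_nonneg (sub_nonneg.2 h)]⟩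
    simp only
    rw [if_neg]
    rw [not_lt]
    exact hK2.trans (ENNReal.zpow_le_of_le (by norm_num) (by omega))

/-- The largest dyadic number below x already suffices, and 2^s pays for the gap between it and x.
Together with the reverse bound this is the layer-cake formula in dyadic form. -/
theorem rpow_le_tsum_zpow {s : ℝ} (hs : 0 < s) (x : ℝ≥0∞) :
    x ^ s ≤ 2 ^ s * ∑' k : ℤ, (if (2 : ℝ≥0∞) ^ k < x then ((2 : ℝ≥0∞) ^ k) ^ s else 0) := by
  rcases eq_or_ne x 0 with rfl | hx0
  · simp [ENNReal.zero_rpow_of_pos hs]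
  rcases eq_or_ne x ⊤ with rfl | hxt
  · have h1 : ∑' k : ℤ, (if (2 : ℝ≥0∞) ^ k < ⊤ then ((2 : ℝ≥0∞) ^ k) ^ s else 0) = ⊤ := by
      have ht : ∑' _ : ℕ, (1 : ℝ≥0∞) = ⊤ := ENNReal.tsum_const_eq_top_of_ne_zero one_ne_zero
      refine top_le_iff.1 (ht.symm.le.trans ?_)
      refine le_trans (ENNReal.tsum_le_tsum fun j : ℕ => ?_)
        (ENNReal.tsum_comp_le_tsum_of_injective (f := fun j : ℕ => (j : ℤ)) Nat.cast_injective _)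
      rw [if_pos (ENNReal.zpow_lt_top (by norm_num) (by norm_num) _)]
      apply ENNReal.one_le_rpow _ hs
      rw [zpow_natCast]
      exact one_le_pow₀ (by norm_num)
    rw [h1, ENNReal.mul_top (by simp)]
    exact le_top
  obtain ⟨K, hK1, hK2⟩ := ENNReal.exists_mem_Ioc_zpow hx0 hxt (y := 2) (by norm_num) (by norm_num)
  refine le_trans ?_ (mul_le_mul_right (ENNReal.le_tsum K) _)
  rw [if_pos hK1, ← ENNReal.mul_rpow_of_nonneg _ _ hs.le]
  refine ENNReal.rpow_le_rpow (hK2.trans (le_of_eq ?_)) hs.le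
  rw [ENNReal.zpow_add (by norm_num) (by norm_num), zpow_one, mul_comm]

/-! ### The Hardy–Littlewood maximal function -/

theorem volume_ball_eq {d : ℕ} (x : E d) {r : ℝ} (hr : 0 < r) :
    volume (Metric.ball x r) = ENNReal.ofReal (r ^ d) * volume (Metric.ball (0 : E d) 1) := by
  rw [Measure.addHaar_ball_of_pos _ _ hr, finrank_euclideanSpace_fin]

theorem volume_unitBall_pos (d : ℕ) : 0 < volume (Metric.ball (0 : E d) 1) :=
  Metric.measure_ball_pos _ _ one_pos

theorem volume_unitBall_lt_top (d : ℕ) : volume (Metric.ball (0 : E d) 1) < ⊤ :=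
  measure_ball_lt_top

/-- The non-centred Hardy–Littlewood maximal function. -/
def hlMax {d : ℕ} (f : E d → ℝ≥0∞) (y : E d) : ℝ≥0∞ :=
  ⨆ (x : E d) (r : ℝ) (_ : y ∈ Metric.ball x r),
    (∫⁻ z in Metric.ball x r, f z) / volume (Metric.ball x r)

theorem lintegral_ball_le_hlMax {d : ℕ} (f : E d → ℝ≥0∞) {x y : E d} {r : ℝ}
    (hy : y ∈ Metric.ball x r) :
    ∫⁻ z in Metric.ball x r, f z ≤ hlMax f y * volume (Metric.ball x r) := by
  have hr : 0 < r := Metric.pos_of_mem_ball hy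
  rw [← ENNReal.div_le_iff (Metric.measure_ball_pos _ _ hr).ne' measure_ball_lt_top.ne]
  exact le_iSup₂_of_le x r (le_iSup_of_le hy le_rfl)

theorem lt_hlMax_iff {d : ℕ} {f : E d → ℝ≥0∞} {y : E d} {a : ℝ≥0∞} :
    a < hlMax f y ↔ ∃ (x : E d) (r : ℝ), y ∈ Metric.ball x r ∧
      a < (∫⁻ z in Metric.ball x r, f z) / volume (Metric.ball x r) := by
  simp only [hlMax, lt_iSup_iff, exists_prop]

/-- The supremum runs over open balls containing the point, not centred at it, so a ball that
witnesses a large value serves all nearby points. The superlevel sets must be open for the Whitney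
coverings used later. -/
theorem lowerSemicontinuous_hlMax {d : ℕ} (f : E d → ℝ≥0∞) : LowerSemicontinuous (hlMax f) := by
  rw [lowerSemicontinuous_iff_isOpen_preimage]
  intro a
  rw [isOpen_iff_mem_nhds]
  intro y hy
  obtain ⟨x, r, hyr, h⟩ := lt_hlMax_iff.1 (Set.mem_Ioi.1 hy)
  filter_upwards [Metric.isOpen_ball.mem_nhds hyr] with z hz
  exact lt_hlMax_iff.2 ⟨x, r, hz, h⟩

/-- The weak (1,1) bound: Vitali's lemma extracts disjoint balls whose fivefold enlargements cover
the superlevel set, and on each of them the average of f exceeds a. -/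
theorem volume_lt_hlMax_le {d : ℕ} (hd : 0 < d) (f : E d → ℝ≥0∞) {a : ℝ≥0∞} (ha : a ≠ 0)
    (ha' : a ≠ ⊤) :
    a * volume {y | a < hlMax f y} ≤ 5 ^ d * ∫⁻ z, f z := by
  rcases eq_or_ne (∫⁻ z, f z) ⊤ with hf | hf
  · rw [hf, ENNReal.mul_top (by positivity)]
    exact le_top
  have key : ∀ y : {y | a < hlMax f y}, ∃ (x : E d) (r : ℝ), y.1 ∈ Metric.ball x r ∧
      a < (∫⁻ z in Metric.ball x r, f z) / volume (Metric.ball x r) :=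
    fun y => lt_hlMax_iff.1 y.2
  choose x r hyr hlt using key
  have hr : ∀ y, 0 < r y := fun y => Metric.pos_of_mem_ball (hyr y)
  have hvol : ∀ y, a * volume (Metric.ball (x y) (r y)) ≤ ∫⁻ z in Metric.ball (x y) (r y), f z := by
    intro y
    exact (ENNReal.le_div_iff_mul_le (Or.inl (Metric.measure_ball_pos _ _ (hr y)).ne')
      (Or.inl measure_ball_lt_top.ne)).1 (hlt y).le
  set v := volume (Metric.ball (0 : E d) 1) with hv
  have hv0 : v ≠ 0 := (volume_unitBall_pos d).ne'
  have hvt : v ≠ ⊤ := (volume_unitBall_lt_top d).ne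
  -- Vitali's lemma needs bounded radii. A ball on which the average of f exceeds a has volume at
  -- most ∫f / a, and r ≤ r^d when r ≥ 1.
  have hbd : ∀ y, r y ≤ max 1 ((∫⁻ z, f z) / (a * v)).toReal := by
    intro y
    rcases le_total (r y) 1 with h | h
    · exact h.trans (le_max_left _ _)
    · refine le_trans ?_ (le_max_right _ _)
      have h1 : ENNReal.ofReal (r y) ≤ (∫⁻ z, f z) / (a * v) := by
        rw [ENNReal.le_div_iff_mul_le (Or.inl (mul_ne_zero ha hv0))
          (Or.inl (ENNReal.mul_ne_top ha' hvt))]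
        calc ENNReal.ofReal (r y) * (a * v) ≤ ENNReal.ofReal (r y ^ d) * (a * v) := by
              gcongr
              exact le_self_pow₀ h hd.ne'
          _ = a * volume (Metric.ball (x y) (r y)) := by rw [volume_ball_eq _ (hr y)]; ring
          _ ≤ _ := (hvol y).trans (setLIntegral_le_lintegral _ _)
      refine (ENNReal.ofReal_le_iff_le_toReal ?_).1 h1
      exact ENNReal.div_ne_top hf (mul_ne_zero ha hv0)
  obtain ⟨u, -, hdisj, hcov⟩ := Vitali.exists_disjoint_subfamily_covering_enlargement_ball
    Set.univ x r _ (fun y _ => hbd y) 5 (by norm_num)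
  have hu : u.Countable := hdisj.countable_of_nonempty_interior fun y _ => by
    rw [Metric.isOpen_ball.interior_eq]
    exact ⟨_, hyr y⟩
  have hsub : {y | a < hlMax f y} ⊆ ⋃ b ∈ u, Metric.ball (x b) (5 * r b) := by
    intro y hy
    obtain ⟨b, hb, h⟩ := hcov ⟨y, hy⟩ trivial
    exact Set.mem_biUnion hb (h (hyr ⟨y, hy⟩))
  have : Countable u := hu.to_subtype
  calc a * volume {y | a < hlMax f y}
      ≤ a * ∑' b : u, volume (Metric.ball (x b) (5 * r b)) := by
        gcongr
        exact (measure_mono hsub).trans (measure_biUnion_le _ hu _)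
    _ = 5 ^ d * ∑' b : u, a * volume (Metric.ball (x b) (r b)) := by
        rw [← ENNReal.tsum_mul_left, ← ENNReal.tsum_mul_left]
        congr 1 with b
        rw [volume_ball_eq _ (hr _), volume_ball_eq _ (mul_pos (by norm_num) (hr _)), mul_pow,
          ENNReal.ofReal_mul (by positivity)]
        have : ENNReal.ofReal ((5 : ℝ) ^ d) = 5 ^ d := by
          rw [ENNReal.ofReal_pow (by norm_num)]; norm_num
        rw [this]
        ring
    _ ≤ 5 ^ d * ∑' b : u, ∫⁻ z in Metric.ball (x b) (r b), f z := by
        gcongr with b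
        exact hvol _
    _ = 5 ^ d * ∫⁻ z in ⋃ b : u, Metric.ball (x b) (r b), f z := by
        rw [lintegral_iUnion (fun _ => measurableSet_ball)]
        intro b b' hbb
        exact hdisj b.2 b'.2 (fun h => hbb (Subtype.ext h))
    _ ≤ _ := by
        exact mul_le_mul_right (setLIntegral_le_lintegral _ _) _

/-- Marcinkiewicz interpolation by hand: at level a only the part of f above a/2 matters, and the
weak type bound is applied to it. Summing over dyadic a first, at a fixed point z, leaves a multiple
of f(z)·f(z)^(s-1), which uses s > 1. -/
theorem tsum_volume_lt_hlMax_le {d : ℕ} (hd : 0 < d) {s : ℝ} (hs : 1 < s) :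
    ∃ C : ℝ≥0, ∀ f : E d → ℝ≥0∞, Measurable f →
      ∑' k : ℤ, ((2 : ℝ≥0∞) ^ k) ^ s * volume {y | (2 : ℝ≥0∞) ^ k < hlMax f y} ≤
        C * ∫⁻ z, f z ^ s := by
  obtain ⟨C, hC⟩ := tsum_zpow_rpow_lt_le (sub_pos.2 hs)
  refine ⟨2 * 5 ^ d * C * (2 : ℝ≥0) ^ (s - 1), fun f hf => ?_⟩
  have h2 : ∀ k : ℤ, (2 : ℝ≥0∞) ^ k ≠ 0 := fun k => (ENNReal.zpow_pos (by norm_num) (by norm_num) k).ne'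
  have h2' : ∀ k : ℤ, (2 : ℝ≥0∞) ^ k ≠ ⊤ := fun k => (ENNReal.zpow_lt_top (by norm_num) (by norm_num) k).ne
  have step : ∀ k : ℤ, ((2 : ℝ≥0∞) ^ k) ^ s * volume {y | (2 : ℝ≥0∞) ^ k < hlMax f y} ≤
      2 * 5 ^ d * ∫⁻ z, f z * (if (2 : ℝ≥0∞) ^ k < 2 * f z then ((2 : ℝ≥0∞) ^ k) ^ (s - 1) else 0) := by
    intro k
    set a := (2 : ℝ≥0∞) ^ k with ha
    set g : E d → ℝ≥0∞ := fun z => if a < 2 * f z then f z else 0 with hg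
    have hgm : Measurable g := Measurable.ite (measurableSet_lt measurable_const (hf.const_mul 2)) hf
      measurable_const
    have hfg : ∀ z, f z ≤ g z + a / 2 := by
      intro z
      by_cases h : a < 2 * f z
      · simp [hg, h]
      · simp only [hg, h, if_false, zero_add]
        rw [ENNReal.le_div_iff_mul_le (by simp) (by simp), mul_comm]
        exact not_lt.1 h
    -- The discarded part of f is at most a/2, hence so are its averages, and an average of f above
    -- a forces an average of g above a/2.
    have hsub : {y | a < hlMax f y} ⊆ {y | a / 2 < hlMax g y} := by
      intro y hy
      obtain ⟨x, r, hyr, h⟩ := lt_hlMax_iff.1 hy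
      have hr : 0 < r := Metric.pos_of_mem_ball hyr
      refine lt_hlMax_iff.2 ⟨x, r, hyr, ?_⟩
      have hv0 := (Metric.measure_ball_pos volume x hr).ne'
      have hvt := (measure_ball_lt_top (μ := volume) (x := x) (r := r)).ne
      have h1 : ∫⁻ z in Metric.ball x r, f z ≤
          (∫⁻ z in Metric.ball x r, g z) + a / 2 * volume (Metric.ball x r) := by
        refine (lintegral_mono hfg).trans ?_
        rw [lintegral_add_right _ measurable_const, lintegral_const, Measure.restrict_apply_univ]
      have h3 : a < (∫⁻ z in Metric.ball x r, g z) / volume (Metric.ball x r) + a / 2 := by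
        refine h.trans_le ((ENNReal.div_le_div_right h1 _).trans ?_)
        rw [ENNReal.add_div, ENNReal.mul_div_cancel_right hv0 hvt]
      by_contra! h4
      have := h3.trans_le (add_le_add_left h4 _)
      rw [ENNReal.add_halves] at this
      exact lt_irrefl _ this
    have hw := volume_lt_hlMax_le hd g (a := a / 2) (by simp [h2 k, ha])
      (ENNReal.div_ne_top (h2' k) (by simp))
    calc a ^ s * volume {y | a < hlMax f y}
        = 2 * a ^ (s - 1) * (a / 2 * volume {y | a < hlMax f y}) := by
          have e1 : a ^ s = a ^ (s - 1) * a := by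
            conv_rhs => rw [← ENNReal.rpow_one a, ← ENNReal.rpow_mul]
            rw [one_mul, ← ENNReal.rpow_add _ _ (h2 k) (h2' k)]
            congr 1; ring
          have e2 : a = 2 * (a / 2) := (ENNReal.mul_div_cancel (by simp) (by simp)).symm
          rw [e1]
          conv_lhs => rw [show a ^ (s - 1) * a = a ^ (s - 1) * (2 * (a / 2)) by rw [← e2]]
          ring
      _ ≤ 2 * a ^ (s - 1) * (5 ^ d * ∫⁻ z, g z) := by
          exact mul_le_mul_right ((mul_le_mul_right (measure_mono hsub) _).trans hw) _
      _ = 2 * 5 ^ d * ∫⁻ z, a ^ (s - 1) * g z := by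
          rw [lintegral_const_mul _ hgm]; ring
      _ = _ := by
          congr 2 with z
          by_cases h : a < 2 * f z
          · simp [hg, mul_comm]
          · simp [hg, h]
  calc _ ≤ ∑' k : ℤ, 2 * 5 ^ d * ∫⁻ z, f z * (if (2 : ℝ≥0∞) ^ k < 2 * f z then
          ((2 : ℝ≥0∞) ^ k) ^ (s - 1) else 0) := ENNReal.tsum_le_tsum step
    _ = 2 * 5 ^ d * ∫⁻ z, f z * ∑' k : ℤ, (if (2 : ℝ≥0∞) ^ k < 2 * f z then
          ((2 : ℝ≥0∞) ^ k) ^ (s - 1) else 0) := by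
        rw [ENNReal.tsum_mul_left, ← lintegral_tsum]
        · simp_rw [ENNReal.tsum_mul_left]
        · intro k
          exact (hf.mul (Measurable.ite (measurableSet_lt measurable_const (hf.const_mul 2))
            measurable_const measurable_const)).aemeasurable
    _ ≤ 2 * 5 ^ d * ∫⁻ z, (C * 2 ^ (s - 1)) * f z ^ s := by
        refine mul_le_mul_right (lintegral_mono fun z => ?_) _
        refine (mul_le_mul_right (hC _) _).trans (le_of_eq ?_)
        rw [ENNReal.mul_rpow_of_nonneg _ _ (by linarith)]
        have : f z * f z ^ (s - 1) = f z ^ s := by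
          conv_lhs => rw [← ENNReal.rpow_one (f z), ← ENNReal.rpow_mul, one_mul]
          rw [← ENNReal.rpow_add_of_nonneg _ _ zero_le_one (by linarith)]
          congr 1; ring
        rw [← this]; ring
    _ = _ := by
        rw [lintegral_const_mul _ (hf.pow_const _)]
        push_cast
        rw [ENNReal.coe_rpow_of_nonneg _ (by linarith)]
        push_cast
        ring

theorem lintegral_hlMax_rpow_le {d : ℕ} (hd : 0 < d) {s : ℝ} (hs : 1 < s) :
    ∃ C : ℝ≥0, ∀ f : E d → ℝ≥0∞, Measurable f →
      ∫⁻ y, hlMax f y ^ s ≤ C * ∫⁻ z, f z ^ s := by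
  obtain ⟨C, hC⟩ := tsum_volume_lt_hlMax_le hd hs
  refine ⟨2 ^ s * C, fun f hf => ?_⟩
  have hm : Measurable (hlMax f) := (lowerSemicontinuous_hlMax f).measurable
  calc ∫⁻ y, hlMax f y ^ s
      ≤ ∫⁻ y, 2 ^ s * ∑' k : ℤ, (if (2 : ℝ≥0∞) ^ k < hlMax f y then ((2 : ℝ≥0∞) ^ k) ^ s else 0) :=
        lintegral_mono fun y => rpow_le_tsum_zpow (by linarith) _
    _ = 2 ^ s * ∑' k : ℤ, ((2 : ℝ≥0∞) ^ k) ^ s * volume {y | (2 : ℝ≥0∞) ^ k < hlMax f y} := by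
        have hmk : ∀ k : ℤ, MeasurableSet {y | (2 : ℝ≥0∞) ^ k < hlMax f y} := fun k =>
          measurableSet_lt measurable_const hm
        have hmi : ∀ k : ℤ, Measurable fun y =>
            (if (2 : ℝ≥0∞) ^ k < hlMax f y then ((2 : ℝ≥0∞) ^ k) ^ s else 0) := fun k =>
          Measurable.ite (hmk k) measurable_const measurable_const
        rw [lintegral_const_mul _ (Measurable.tsum hmi), lintegral_tsum fun k => (hmi k).aemeasurable]
        congr 2 with k
        rw [← lintegral_indicator_const (hmk k)]
        simp only [Set.indicator_apply, Set.mem_ofPred_eq]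
    _ ≤ 2 ^ s * (C * ∫⁻ z, f z ^ s) := by
        gcongr
        exact hC f hf
    _ = _ := by
        push_cast
        rw [ENNReal.coe_rpow_of_nonneg _ (by linarith)]
        push_cast
        ring

/-! ### Whitney coverings and partitions of unity -/

/-- A Whitney covering of `{ρ > 0}` by balls of radius comparable to `ρ`; a vanishing radius marks
an unused index. -/
structure WhitneyCover {d : ℕ} (ρ : E d → ℝ) where
  c : ℕ → E d
  r : ℕ → ℝ
  r_nonneg : ∀ m, 0 ≤ r m
  r_eq : ∀ m, 0 < r m → r m = ρ (c m)
  disj : Pairwise (Function.onFun Disjoint fun m => Metric.ball (c m) (r m))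
  cover : ∀ x, 0 < ρ x → ∃ m, 0 < r m ∧ x ∈ Metric.ball (c m) (6 * r m)

/-- Vitali's lemma for closed balls of radius ρ gives enlargement by 5, and 6 leaves room for open
balls. The countable family is listed along ℕ by an encoding; numbers that encode nothing get radius
0. -/
theorem exists_whitneyCover {d : ℕ} (ρ : E d → ℝ) (R : ℝ) (hR : ∀ x, ρ x ≤ R) :
    Nonempty (WhitneyCover ρ) := by
  obtain ⟨u, hut, hdisj, hcov⟩ := Vitali.exists_disjoint_subfamily_covering_enlargement_closedBall
    {x : E d | 0 < ρ x} id ρ R (fun x _ => hR x) 5 (by norm_num)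
  have hu : u.Countable := hdisj.countable_of_nonempty_interior fun y hy =>
    ⟨y, Metric.ball_subset_interior_closedBall (Metric.mem_ball_self (hut hy))⟩
  have : Encodable u := hu.toEncodable
  have hdec : ∀ y : u, Encodable.decode₂ u (Encodable.encode y) = some y := fun y =>
    Encodable.encodek₂ y
  refine ⟨⟨fun m => (Encodable.decode₂ u m).elim 0 (fun y => y.1),
    fun m => (Encodable.decode₂ u m).elim 0 (fun y => ρ y.1), fun m => ?_, fun m => ?_, ?_, ?_⟩⟩
  · rcases h : Encodable.decode₂ u m with _ | y
    · simp
    · exact (hut y.2).le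
  · rcases h : Encodable.decode₂ u m with _ | y
    · simp
    · simp
  · intro a b hab
    simp only [Function.onFun]
    rcases ha : Encodable.decode₂ u a with _ | y
    · simp
    rcases hb : Encodable.decode₂ u b with _ | z
    · simp
    have hyz : y.1 ≠ z.1 := by
      intro h
      have h' : y = z := Subtype.ext h
      apply hab
      rw [← Encodable.mem_decode₂.1 ha, ← Encodable.mem_decode₂.1 hb, h']
    exact (hdisj y.2 z.2 hyz).mono Metric.ball_subset_closedBall Metric.ball_subset_closedBall
  · intro x hx
    obtain ⟨b, hb, h⟩ := hcov x hx
    have hb0 : 0 < ρ b := hut hb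
    refine ⟨Encodable.encode (⟨b, hb⟩ : u), ?_⟩
    rw [hdec]
    refine ⟨hb0, ?_⟩
    have := h (Metric.mem_closedBall_self (le_of_lt hx))
    simp only [id] at this
    refine Metric.closedBall_subset_ball ?_ this
    simp only [Option.elim]
    linarith

/-- A smooth bump function that is `1` on the ball of radius `6` and supported in that of
radius `7`. -/
def stdBump (d : ℕ) : ContDiffBump (0 : E d) := ⟨6, 7, by norm_num, by norm_num⟩

theorem exists_stdBump_fderiv_le (d : ℕ) : ∃ K : ℝ≥0, ∀ x, ‖fderiv ℝ (stdBump d) x‖ ≤ K := by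
  have hc : Continuous (fderiv ℝ (stdBump d)) :=
    (stdBump d).contDiff.continuous_fderiv (n := ∞) (by simp)
  have hs : HasCompactSupport (fderiv ℝ (stdBump d)) := (stdBump d).hasCompactSupport.fderiv ℝ
  obtain ⟨K, hK⟩ := hs.exists_bound_of_continuous hc
  exact ⟨K.toNNReal, fun x => (hK x).trans (Real.le_coe_toNNReal K)⟩

/-- A bound for the gradient of the standard bump function. -/
def bumpConst (d : ℕ) : ℝ≥0 := (exists_stdBump_fderiv_le d).choose

theorem norm_fderiv_stdBump_le {d : ℕ} (x : E d) : ‖fderiv ℝ (stdBump d) x‖ ≤ bumpConst d :=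
  (exists_stdBump_fderiv_le d).choose_spec x

namespace WhitneyCover

variable {d : ℕ} {ρ : E d → ℝ} (W : WhitneyCover ρ)

/-- The bump function adapted to a Whitney ball. -/
def bump (m : ℕ) (x : E d) : ℝ :=
  if 0 < W.r m then stdBump d ((W.r m)⁻¹ • (x - W.c m)) else 0

theorem bump_contDiff (m : ℕ) : ContDiff ℝ ∞ (W.bump m) := by
  unfold bump
  split_ifs
  · exact (stdBump d).contDiff.comp (by fun_prop)
  · exact contDiff_const

theorem bump_nonneg (m : ℕ) (x : E d) : 0 ≤ W.bump m x := by
  unfold bump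
  split_ifs
  · exact (stdBump d).nonneg
  · exact le_rfl

theorem bump_le_one (m : ℕ) (x : E d) : W.bump m x ≤ 1 := by
  unfold bump
  split_ifs
  · exact (stdBump d).le_one
  · exact zero_le_one

theorem norm_smul_sub {m : ℕ} (h : 0 < W.r m) (x : E d) :
    ‖(W.r m)⁻¹ • (x - W.c m)‖ = dist x (W.c m) / W.r m := by
  rw [norm_smul, norm_inv, Real.norm_of_nonneg h.le, dist_eq_norm, div_eq_inv_mul]

theorem bump_eq_one {m : ℕ} (h : 0 < W.r m) {x : E d}
    (hx : x ∈ Metric.closedBall (W.c m) (6 * W.r m)) : W.bump m x = 1 := by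
  rw [bump, if_pos h]
  apply (stdBump d).one_of_mem_closedBall
  rw [mem_closedBall_zero_iff, W.norm_smul_sub h, div_le_iff₀ h]
  exact hx

theorem bump_eq_zero {m : ℕ} {x : E d} (hx : x ∉ Metric.ball (W.c m) (7 * W.r m)) :
    W.bump m x = 0 := by
  unfold bump
  split_ifs with h
  · apply (stdBump d).zero_of_le_dist
    rw [dist_zero_right, W.norm_smul_sub h, le_div_iff₀ h]
    exact not_lt.1 hx
  · rfl

theorem fderiv_comp_smul_sub {g : E d → ℝ} {s : ℝ} {c x : E d}
    (hg : DifferentiableAt ℝ g (s • (x - c))) :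
    fderiv ℝ (fun x => g (s • (x - c))) x =
      (fderiv ℝ g (s • (x - c))).comp (s • ContinuousLinearMap.id ℝ (E d)) :=
  (hg.hasFDerivAt.comp x (((hasFDerivAt_id x).sub_const c).const_smul s)).fderiv

theorem norm_fderiv_bump_le (m : ℕ) (x : E d) : ‖fderiv ℝ (W.bump m) x‖ ≤ bumpConst d / W.r m := by
  by_cases h : 0 < W.r m
  · have e : W.bump m = fun x => stdBump d ((W.r m)⁻¹ • (x - W.c m)) := by
      ext x; simp [bump, h]
    have hb : DifferentiableAt ℝ (stdBump d) ((W.r m)⁻¹ • (x - W.c m)) :=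
      (stdBump d).contDiff.contDiffAt.differentiableAt (n := ∞) (by simp)
    rw [e, fderiv_comp_smul_sub hb]
    calc _ ≤ ‖fderiv ℝ (stdBump d) ((W.r m)⁻¹ • (x - W.c m))‖ *
          ‖(W.r m)⁻¹ • ContinuousLinearMap.id ℝ (E d)‖ := ContinuousLinearMap.opNorm_comp_le _ _
      _ ≤ bumpConst d * (W.r m)⁻¹ := by
          gcongr
          · exact norm_fderiv_stdBump_le _
          · rw [norm_smul, norm_inv, Real.norm_of_nonneg h.le]
            exact mul_le_of_le_one_right (by positivity) ContinuousLinearMap.norm_id_le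
      _ = _ := by rw [div_eq_mul_inv]
  · have e : W.bump m = fun _ => 0 := by
      ext x; simp [bump, h]
    rw [e]
    simp only [fderiv_fun_const, Pi.zero_apply, norm_zero]
    exact div_nonneg (NNReal.coe_nonneg _) (W.r_nonneg m)

/-- The Whitney partition of unity on `{ρ > 0}`. -/
def eta (m : ℕ) (x : E d) : ℝ := W.bump m x * ∏ j ∈ Finset.range m, (1 - W.bump j x)

theorem prod_contDiff (m : ℕ) :
    ContDiff ℝ ∞ fun x => ∏ j ∈ Finset.range m, (1 - W.bump j x) :=
  contDiff_prod fun j _ => contDiff_const.sub (W.bump_contDiff j)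

theorem eta_contDiff (m : ℕ) : ContDiff ℝ ∞ (W.eta m) :=
  (W.bump_contDiff m).mul (W.prod_contDiff m)

theorem prod_nonneg (m : ℕ) (x : E d) : 0 ≤ ∏ j ∈ Finset.range m, (1 - W.bump j x) :=
  Finset.prod_nonneg fun j _ => sub_nonneg.2 (W.bump_le_one j x)

theorem prod_le_one (m : ℕ) (x : E d) : ∏ j ∈ Finset.range m, (1 - W.bump j x) ≤ 1 :=
  Finset.prod_le_one (fun j _ => sub_nonneg.2 (W.bump_le_one j x))
    fun j _ => sub_le_self _ (W.bump_nonneg j x)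

theorem eta_nonneg (m : ℕ) (x : E d) : 0 ≤ W.eta m x :=
  mul_nonneg (W.bump_nonneg m x) (W.prod_nonneg m x)

theorem eta_le_one (m : ℕ) (x : E d) : W.eta m x ≤ 1 :=
  mul_le_one₀ (W.bump_le_one m x) (W.prod_nonneg m x) (W.prod_le_one m x)

theorem abs_eta_le_one (m : ℕ) (x : E d) : |W.eta m x| ≤ 1 := by
  rw [abs_of_nonneg (W.eta_nonneg m x)]
  exact W.eta_le_one m x

theorem eta_eq_zero {m : ℕ} {x : E d} (hx : x ∉ Metric.ball (W.c m) (7 * W.r m)) :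
    W.eta m x = 0 := by
  rw [eta, W.bump_eq_zero hx, zero_mul]

theorem eta_eq_zero_of_r {m : ℕ} (h : W.r m = 0) (x : E d) : W.eta m x = 0 :=
  W.eta_eq_zero (by simp [h])

theorem tsupport_eta_subset (m : ℕ) :
    tsupport (W.eta m) ⊆ Metric.closedBall (W.c m) (7 * W.r m) := by
  refine closure_minimal (fun x hx => ?_) Metric.isClosed_closedBall
  by_contra h
  exact hx (W.eta_eq_zero fun h' => h (Metric.ball_subset_closedBall h'))

/-- The products telescope. Where a bump of index below N equals 1 the sum is exactly 1 and all
later terms vanish, so the partition of unity needs no division by a sum of bumps. -/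
theorem sum_range_eta (N : ℕ) (x : E d) :
    ∑ i ∈ Finset.range N, W.eta i x = 1 - ∏ j ∈ Finset.range N, (1 - W.bump j x) := by
  induction N with
  | zero => simp
  | succ N ih =>
    rw [Finset.sum_range_succ, ih, Finset.prod_range_succ, eta]
    ring

theorem exists_sum_eta_eq_one {K : Set (E d)} (hK : IsCompact K) (hKρ : ∀ x ∈ K, 0 < ρ x) :
    ∃ N : ℕ, ∀ x ∈ K, ∑ i ∈ Finset.range N, W.eta i x = 1 ∧ ∀ i ≥ N, W.eta i x = 0 := by
  have hcov : K ⊆ ⋃ m : {m // 0 < W.r m}, Metric.ball (W.c m) (6 * W.r m) := by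
    intro x hx
    obtain ⟨m, hm, h⟩ := W.cover x (hKρ x hx)
    exact Set.mem_iUnion.2 ⟨⟨m, hm⟩, h⟩
  obtain ⟨t, ht⟩ := hK.elim_finite_subcover _ (fun _ => Metric.isOpen_ball) hcov
  refine ⟨(t.image Subtype.val).sup id + 1, fun x hx => ?_⟩
  obtain ⟨m, hm, hxm⟩ := Set.mem_iUnion₂.1 (ht hx)
  have h1 : 1 - W.bump m x = 0 := by
    rw [W.bump_eq_one m.2 (Metric.ball_subset_closedBall hxm), sub_self]
  have hlt : m.1 < (t.image Subtype.val).sup id + 1 :=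
    Nat.lt_succ_of_le (Finset.le_sup (f := id) (Finset.mem_image_of_mem _ hm))
  constructor
  · rw [W.sum_range_eta, Finset.prod_eq_zero (Finset.mem_range.2 hlt) h1, sub_zero]
  · intro i hi
    rw [eta, Finset.prod_eq_zero (Finset.mem_range.2 (hlt.trans_le hi)) h1, mul_zero]

theorem norm_fderiv_prod_le (m : ℕ) (x : E d) :
    ‖fderiv ℝ (fun x => ∏ j ∈ Finset.range m, (1 - W.bump j x)) x‖ ≤
      ∑ j ∈ Finset.range m, ‖fderiv ℝ (W.bump j) x‖ := by
  induction m with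
  | zero => simp
  | succ m ih =>
    simp_rw [Finset.prod_range_succ]
    rw [Finset.sum_range_succ, fderiv_fun_mul ((W.prod_contDiff m).contDiffAt.differentiableAt (by simp))
      ((contDiff_const.sub (W.bump_contDiff m)).contDiffAt.differentiableAt (by simp)),
      fderiv_const_sub]
    refine (norm_add_le _ _).trans ?_
    rw [add_comm, norm_smul, norm_smul, norm_neg]
    refine add_le_add ?_ ?_
    · refine le_trans (mul_le_of_le_one_left (norm_nonneg _) ?_) ih
      rw [Real.norm_of_nonneg (sub_nonneg.2 (W.bump_le_one m x))]
      exact sub_le_self _ (W.bump_nonneg m x)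
    · refine mul_le_of_le_one_left (norm_nonneg _) ?_
      rw [Real.norm_of_nonneg (W.prod_nonneg m x)]
      exact W.prod_le_one m x

theorem norm_fderiv_eta_le_sum (m : ℕ) (x : E d) :
    ‖fderiv ℝ (W.eta m) x‖ ≤ ∑ j ∈ Finset.range (m + 1), ‖fderiv ℝ (W.bump j) x‖ := by
  unfold eta
  rw [fderiv_fun_mul ((W.bump_contDiff m).contDiffAt.differentiableAt (by simp))
    ((W.prod_contDiff m).contDiffAt.differentiableAt (by simp)), Finset.sum_range_succ]
  refine (norm_add_le _ _).trans ?_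
  rw [norm_smul, norm_smul]
  refine add_le_add ?_ ?_
  · refine le_trans (mul_le_of_le_one_left (norm_nonneg _) ?_) (W.norm_fderiv_prod_le m x)
    rw [Real.norm_of_nonneg (W.bump_nonneg m x)]
    exact W.bump_le_one m x
  · refine mul_le_of_le_one_left (norm_nonneg _) ?_
    rw [Real.norm_of_nonneg (W.prod_nonneg m x)]
    exact W.prod_le_one m x

theorem abs_sub_r_le (hρ : ∀ x y, |ρ x - ρ y| ≤ dist x y / 64) {m : ℕ} (hm : 0 < W.r m) (x : E d) :
    |ρ x - W.r m| ≤ dist x (W.c m) / 64 := by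
  rw [W.r_eq m hm]
  exact hρ _ _

/-- Since ρ has Lipschitz constant 1/64, every ball whose 20-fold enlargement contains x has radius
between 3/4 ρ(x) and 3/2 ρ(x). The balls of radius 3/4 ρ(x) about the same centres are disjoint and
lie in a ball about x that is 43 times larger, so volumes bound their number. -/
theorem card_le (hρ : ∀ x y, |ρ x - ρ y| ≤ dist x y / 64) {x : E d} {S : Finset ℕ}
    (hS : ∀ m ∈ S, 0 < W.r m ∧ x ∈ Metric.closedBall (W.c m) (20 * W.r m)) :
    S.card ≤ 43 ^ d := by
  rcases S.eq_empty_or_nonempty with rfl | ⟨m₀, hm₀⟩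
  · simp
  have hlow : ∀ m ∈ S, 3 / 4 * ρ x ≤ W.r m ∧ W.r m ≤ 3 / 2 * ρ x := by
    intro m hm
    obtain ⟨h0, hx⟩ := hS m hm
    have h1 := abs_le.1 (W.abs_sub_r_le hρ h0 x)
    have h2 : dist x (W.c m) ≤ 20 * W.r m := hx
    constructor <;> linarith
  have hρx : 0 < ρ x := by
    have := (hS m₀ hm₀).1
    have := (hlow m₀ hm₀).2
    linarith
  have hsub : ∀ m ∈ S, Metric.ball (W.c m) (3 / 4 * ρ x) ⊆ Metric.ball x (129 / 4 * ρ x) := by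
    intro m hm y hy
    obtain ⟨h0, hx⟩ := hS m hm
    have h2 : dist x (W.c m) ≤ 20 * W.r m := hx
    have h3 : dist y (W.c m) < 3 / 4 * ρ x := hy
    have h4 := (hlow m hm).2
    have := dist_triangle_right y x (W.c m)
    rw [Metric.mem_ball]
    linarith
  have hdisj : Set.PairwiseDisjoint (S : Set ℕ) fun m => Metric.ball (W.c m) (3 / 4 * ρ x) := by
    intro a ha b hb hab
    exact (W.disj hab).mono (Metric.ball_subset_ball (hlow a ha).1)
      (Metric.ball_subset_ball (hlow b hb).1)
  have hv0 := (volume_unitBall_pos d).ne'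
  have hvt := (volume_unitBall_lt_top d).ne
  have e : (129 / 4 * ρ x) = 43 * (3 / 4 * ρ x) := by ring
  have hpos : 0 < 3 / 4 * ρ x := by linarith
  have h1 : ∑ m ∈ S, volume (Metric.ball (W.c m) (3 / 4 * ρ x)) ≤
      volume (Metric.ball x (43 * (3 / 4 * ρ x))) := by
    rw [← e]
    rw [← measure_biUnion_finset hdisj fun _ _ => measurableSet_ball]
    exact measure_mono (Set.iUnion₂_subset hsub)
  generalize 3 / 4 * ρ x = t at h1 hpos
  rw [Finset.sum_congr rfl fun m _ => volume_ball_eq (W.c m) hpos, Finset.sum_const,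
    volume_ball_eq x (by positivity), mul_pow,
    ENNReal.ofReal_mul (by positivity), nsmul_eq_mul, mul_assoc] at h1
  have hne0 : ENNReal.ofReal (t ^ d) * volume (Metric.ball (0 : E d) 1) ≠ 0 :=
    mul_ne_zero (by simpa using by positivity) hv0
  have hnet : ENNReal.ofReal (t ^ d) * volume (Metric.ball (0 : E d) 1) ≠ ⊤ :=
    ENNReal.mul_ne_top ENNReal.ofReal_ne_top hvt
  rw [ENNReal.mul_le_mul_iff_left hne0 hnet, ENNReal.ofReal_pow (by norm_num)] at h1
  have h43 : ENNReal.ofReal 43 = (43 : ℕ) := by norm_num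
  rw [h43] at h1
  exact_mod_cast h1

theorem tsum_overlap_le (hρ : ∀ x y, |ρ x - ρ y| ≤ dist x y / 64) (x : E d) :
    ∑' m, (Metric.ball (W.c m) (20 * W.r m)).indicator (1 : E d → ℝ≥0∞) x ≤ 43 ^ d := by
  classical
  rw [ENNReal.tsum_eq_iSup_sum]
  refine iSup_le fun S => ?_
  simp_rw [Set.indicator_apply, Pi.one_apply]
  rw [Finset.sum_ite, Finset.sum_const_zero, add_zero, Finset.sum_const, nsmul_one]
  have := W.card_le hρ (x := x) (S := S.filter fun m => x ∈ Metric.ball (W.c m) (20 * W.r m))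
    (fun m hm => by
      have h := (Finset.mem_filter.1 hm).2
      exact ⟨by linarith [Metric.pos_of_mem_ball h], Metric.ball_subset_closedBall h⟩)
  exact_mod_cast this

/-- By the product rule the gradient of η_m is at most the sum of the gradients of all bumps of
index up to m. At a given point at most 43^d of them are nonzero, and their radii satisfy r_m ≤ 2
r_j, so each term is at most 2 `bumpConst` / r_m. -/
theorem norm_fderiv_eta_le (hρ : ∀ x y, |ρ x - ρ y| ≤ dist x y / 64) (m : ℕ) (x : E d) :
    ‖fderiv ℝ (W.eta m) x‖ ≤ (2 * 43 ^ d * bumpConst d) / W.r m := by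
  by_cases hx : x ∈ Metric.closedBall (W.c m) (7 * W.r m)
  swap
  · have : fderiv ℝ (W.eta m) x = 0 := by
      have h : W.eta m =ᶠ[𝓝 x] fun _ => 0 := by
        filter_upwards [Metric.isClosed_closedBall.isOpen_compl.mem_nhds hx] with y hy
        exact W.eta_eq_zero fun h => hy (Metric.ball_subset_closedBall h)
      rw [h.fderiv_eq]
      simp
    rw [this, norm_zero]
    have := W.r_nonneg m
    positivity
  rcases (W.r_nonneg m).eq_or_lt with h0 | h0
  · have : W.eta m = fun _ => 0 := by
      ext y; exact W.eta_eq_zero_of_r h0.symm y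
    rw [this, ← h0]
    simp
  refine (W.norm_fderiv_eta_le_sum m x).trans ?_
  classical
  set S := (Finset.range (m + 1)).filter fun j => 0 < W.r j ∧
    x ∈ Metric.closedBall (W.c j) (20 * W.r j) with hS
  have hcard := W.card_le hρ (x := x) (S := S) (fun j hj => (Finset.mem_filter.1 hj).2)
  have hzero : ∀ j, ¬ (0 < W.r j ∧ x ∈ Metric.closedBall (W.c j) (7 * W.r j)) →
      fderiv ℝ (W.bump j) x = 0 := by
    intro j hj
    have h : W.bump j =ᶠ[𝓝 x] fun _ => 0 := by
      by_cases hr : 0 < W.r j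
      · have hx' : x ∉ Metric.closedBall (W.c j) (7 * W.r j) := fun h => hj ⟨hr, h⟩
        filter_upwards [Metric.isClosed_closedBall.isOpen_compl.mem_nhds hx'] with y hy
        exact W.bump_eq_zero fun h => hy (Metric.ball_subset_closedBall h)
      · filter_upwards with y
        simp [bump, hr]
    rw [h.fderiv_eq]
    simp
  have hbound : ∀ j ∈ S, ‖fderiv ℝ (W.bump j) x‖ ≤ 2 * bumpConst d / W.r m := by
    intro j _
    by_cases hj : 0 < W.r j ∧ x ∈ Metric.closedBall (W.c j) (7 * W.r j)
    swap
    · rw [hzero j hj, norm_zero]; positivity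
    refine (W.norm_fderiv_bump_le j x).trans ?_
    have h1 := abs_le.1 (W.abs_sub_r_le hρ hj.1 x)
    have h2 := abs_le.1 (W.abs_sub_r_le hρ h0 x)
    have h3 : dist x (W.c j) ≤ 7 * W.r j := hj.2
    have h4 : dist x (W.c m) ≤ 7 * W.r m := hx
    have h5 : W.r m ≤ 2 * W.r j := by linarith
    rw [div_le_div_iff₀ hj.1 h0]
    calc (bumpConst d : ℝ) * W.r m ≤ bumpConst d * (2 * W.r j) := by gcongr
      _ = _ := by ring
  have hsum : ∑ j ∈ Finset.range (m + 1), ‖fderiv ℝ (W.bump j) x‖ =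
      ∑ j ∈ S, ‖fderiv ℝ (W.bump j) x‖ := by
    refine (Finset.sum_subset (Finset.filter_subset _ _) fun j hj hjS => ?_).symm
    rw [hzero j, norm_zero]
    intro h
    refine hjS (Finset.mem_filter.2 ⟨hj, h.1, Metric.closedBall_subset_closedBall ?_ h.2⟩)
    linarith [h.1]
  rw [hsum]
  calc _ ≤ S.card • (2 * (bumpConst d : ℝ) / W.r m) := Finset.sum_le_card_nsmul _ _ _ hbound
    _ ≤ (43 ^ d : ℝ) * (2 * (bumpConst d : ℝ) / W.r m) := by
        rw [nsmul_eq_mul]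
        gcongr
        exact_mod_cast hcard
    _ = _ := by ring

theorem tsum_volume_le {S : Set (E d)} (hS : ∀ m, Metric.ball (W.c m) (W.r m) ⊆ S) :
    ∑' m, volume (Metric.ball (W.c m) (W.r m)) ≤ volume S := by
  rw [← measure_iUnion W.disj fun _ => measurableSet_ball]
  exact measure_mono (Set.iUnion_subset hS)

end WhitneyCover

/-! ### Bump functions and linear functionals on test functions -/

/-- `φ` is a smooth bump function of height `a` on the ball of radius `r` about `x`. -/
structure IsBump {d : ℕ} (φ : E d → ℂ) (x : E d) (r a : ℝ) : Prop where
  contDiff : ContDiff ℝ ∞ φ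
  tsupport_subset : tsupport φ ⊆ Metric.closedBall x r
  norm_le : ∀ y, ‖φ y‖ ≤ a
  fderiv_le : ∀ y, ‖fderiv ℝ φ y‖ ≤ a / r

theorem IsBump.isTestFunction {d : ℕ} {φ : E d → ℂ} {x : E d} {r a : ℝ} (h : IsBump φ x r a) :
    IsTestFunction Set.univ φ :=
  ⟨h.contDiff, (isCompact_closedBall x r).of_isClosed_subset (isClosed_tsupport _)
    h.tsupport_subset, Set.subset_univ _⟩

theorem IsBump.nonneg {d : ℕ} {φ : E d → ℂ} {x : E d} {r a : ℝ} (h : IsBump φ x r a) : 0 ≤ a :=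
  (norm_nonneg _).trans (h.norm_le x)

theorem norm_fderiv_smul_le {d : ℕ} {ψ : E d → ℝ} {φ : E d → ℂ} (hψ : ContDiff ℝ ∞ ψ)
    (hφ : ContDiff ℝ ∞ φ) (y : E d) :
    ‖fderiv ℝ (fun z => ψ z • φ z) y‖ ≤ |ψ y| * ‖fderiv ℝ φ y‖ + ‖fderiv ℝ ψ y‖ * ‖φ y‖ := by
  rw [fderiv_fun_smul (hψ.contDiffAt.differentiableAt (by simp))
    (hφ.contDiffAt.differentiableAt (by simp))]
  refine (norm_add_le _ _).trans ?_
  rw [norm_smul, Real.norm_eq_abs]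
  gcongr
  rw [ContinuousLinearMap.norm_smulRight_apply]

theorem tsupport_smul_subset {d : ℕ} (ψ : E d → ℝ) (φ : E d → ℂ) :
    tsupport (fun z => ψ z • φ z) ⊆ tsupport ψ ∩ tsupport φ := by
  refine Set.subset_inter (closure_mono fun z hz => ?_) (closure_mono fun z hz => ?_)
  · exact fun h => hz (by simp [h])
  · exact fun h => hz (by simp [h])

theorem IsTestFunction.smul {d : ℕ} {ψ : E d → ℝ} {φ : E d → ℂ} (hφ : IsTestFunction Set.univ φ)
    (hψ : ContDiff ℝ ∞ ψ) : IsTestFunction Set.univ fun z => ψ z • φ z :=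
  ⟨hψ.smul hφ.1, hφ.2.1.of_isClosed_subset (isClosed_tsupport _)
    ((tsupport_smul_subset ψ φ).trans Set.inter_subset_right), Set.subset_univ _⟩

theorem IsTestFunction.exists_fderiv_le {d : ℕ} {Ω : Set (E d)} {φ : E d → ℂ}
    (hφ : IsTestFunction Ω φ) : ∃ L : ℝ≥0, ∀ y, ‖fderiv ℝ φ y‖ ≤ L := by
  obtain ⟨K, hK⟩ := (hφ.2.1.fderiv ℝ).exists_bound_of_continuous
    (hφ.1.continuous_fderiv (by simp))
  exact ⟨K.toNNReal, fun x => (hK x).trans (Real.le_coe_toNNReal K)⟩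

theorem IsTestFunction.exists_norm_le {d : ℕ} {Ω : Set (E d)} {φ : E d → ℂ}
    (hφ : IsTestFunction Ω φ) : ∃ L : ℝ≥0, ∀ y, ‖φ y‖ ≤ L := by
  obtain ⟨K, hK⟩ := hφ.2.1.exists_bound_of_continuous hφ.1.continuous
  exact ⟨K.toNNReal, fun x => (hK x).trans (Real.le_coe_toNNReal K)⟩

theorem norm_sub_le_of_fderiv_le {d : ℕ} {φ : E d → ℂ} (hφ : ContDiff ℝ ∞ φ) {L : ℝ}
    (hL : ∀ y, ‖fderiv ℝ φ y‖ ≤ L) (y z : E d) : ‖φ y - φ z‖ ≤ L * dist y z := by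
  rw [dist_eq_norm]
  exact Convex.norm_image_sub_le_of_norm_fderiv_le (𝕜 := ℝ)
    (fun x _ => hφ.contDiffAt.differentiableAt (by simp)) (fun x _ => hL x) convex_univ
    (Set.mem_univ _) (Set.mem_univ _)

/-- A bound for the gradients in a Whitney partition of unity. -/
def etaConst (d : ℕ) : ℝ≥0 := 2 * 43 ^ d * bumpConst d

theorem WhitneyCover.norm_fderiv_eta_le' {d : ℕ} {ρ : E d → ℝ} (W : WhitneyCover ρ)
    (hρ : ∀ x y, |ρ x - ρ y| ≤ dist x y / 64) (m : ℕ) (x : E d) :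
    ‖fderiv ℝ (W.eta m) x‖ ≤ etaConst d / W.r m := by
  refine (W.norm_fderiv_eta_le hρ m x).trans (le_of_eq ?_)
  simp [etaConst]

/-- A locally bounded functional is bounded by a weighted `L¹` norm. -/
theorem enorm_le_lintegral_of_isBump (d : ℕ) : ∃ C : ℝ≥0, ∀ (B : (E d → ℂ) →ₗ[ℂ] ℂ)
    (w : E d → ℝ≥0∞), Measurable w → (∀ K, IsCompact K → ∫⁻ y in K, w y < ⊤) →
    ∀ ε₀ : ℝ, 0 < ε₀ → (∀ φ x ε a, 0 < ε → ε ≤ ε₀ → IsBump φ x ε a →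
      ∀ y ∈ Metric.closedBall x ε, ‖B φ‖ₑ ≤ ENNReal.ofReal (a * ε ^ d) * w y) →
    ∀ φ, IsTestFunction Set.univ φ → ‖B φ‖ₑ ≤ C * ∫⁻ y, ‖φ y‖ₑ * w y := by
  have hv0 := (volume_unitBall_pos d).ne'
  have hvt := (volume_unitBall_lt_top d).ne
  set v := volume (Metric.ball (0 : E d) 1) with hv
  set C₁ : ℝ := 1 + 7 * etaConst d with hC₁
  have hC₁0 : 0 ≤ C₁ := by positivity
  set C : ℝ≥0∞ := ENNReal.ofReal (C₁ * 7 ^ d) / v with hC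
  have hCt : C ≠ ⊤ := ENNReal.div_ne_top ENNReal.ofReal_ne_top hv0
  refine ⟨C.toNNReal, fun B w hw hwK ε₀ hε₀ hB φ hφ => ?_⟩
  rw [ENNReal.coe_toNNReal hCt]
  obtain ⟨L, hL⟩ := hφ.exists_fderiv_le
  have hLip := norm_sub_le_of_fderiv_le hφ.1 hL
  set K₁ := Metric.cthickening 8 (tsupport φ) with hK₁
  have hK₁c : IsCompact K₁ := IsCompact.cthickening hφ.2.1
  -- Cut φ by a partition of unity of constant radius r. Each piece is a bump of radius 7r whose
  -- height is comparable to |φ(y)| + 14rL for every y in the small ball, so the hypothesis may be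
  -- averaged over y. The small balls are disjoint, hence the averages add up. The 8-neighbourhood
  -- of the support contains all balls involved because r ≤ 1.
  have main : ∀ r : ℝ, 0 < r → 7 * r ≤ ε₀ → r ≤ 1 →
      ‖B φ‖ₑ ≤ C * ((∫⁻ y, ‖φ y‖ₑ * w y) + ENNReal.ofReal (14 * r * L) * ∫⁻ y in K₁, w y) := by
    intro r hr hrε hr1
    obtain ⟨W⟩ := exists_whitneyCover (fun _ : E d => r) r (fun _ => le_rfl)
    have hρ : ∀ x y : E d, |(fun _ : E d => r) x - (fun _ : E d => r) y| ≤ dist x y / 64 := by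
      intro x y
      simp only [sub_self, abs_zero]
      positivity
    obtain ⟨N, hN⟩ := W.exists_sum_eta_eq_one (K := tsupport φ) hφ.2.1 (fun _ _ => hr)
    have hsum : φ = ∑ i ∈ Finset.range N, fun z => W.eta i z • φ z := by
      ext z
      rw [Finset.sum_apply, ← Finset.sum_smul]
      by_cases hz : z ∈ tsupport φ
      · rw [(hN z hz).1, one_smul]
      · rw [image_eq_zero_of_notMem_tsupport hz, smul_zero]
    have hpiece : ∀ i, ‖B fun z => W.eta i z • φ z‖ₑ ≤
        C * ∫⁻ y in Metric.ball (W.c i) (W.r i) ∩ K₁, (‖φ y‖ₑ + ENNReal.ofReal (14 * r * L)) * w y := by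
      intro i
      by_cases hne : ∃ z, W.eta i z • φ z ≠ 0
      swap
      · push Not at hne
        have : (fun z => W.eta i z • φ z) = 0 := funext hne
        rw [this, map_zero, enorm_zero]
        exact zero_le
      obtain ⟨z₀, hz₀⟩ := hne
      have hz₀' : z₀ ∈ Metric.ball (W.c i) (7 * W.r i) := by
        by_contra h
        exact hz₀ (by rw [W.eta_eq_zero h, zero_smul])
      have hri : 0 < W.r i := by linarith [Metric.pos_of_mem_ball hz₀']
      have hrr : W.r i = r := W.r_eq i hri
      rw [hrr] at hz₀' ⊢
      have hz₀s : z₀ ∈ tsupport φ := by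
        by_contra h
        exact hz₀ (by rw [image_eq_zero_of_notMem_tsupport h, smul_zero])
      have hballK : Metric.ball (W.c i) r ⊆ K₁ := by
        intro y hy
        refine Metric.mem_cthickening_of_dist_le y z₀ 8 _ hz₀s ?_
        have h1 : dist y (W.c i) < r := hy
        have h2 : dist z₀ (W.c i) < 7 * r := hz₀'
        have := dist_triangle_right y z₀ (W.c i)
        linarith
      rw [Set.inter_eq_self_of_subset_left hballK]
      have hbump : ∀ y ∈ Metric.ball (W.c i) r, IsBump (fun z => W.eta i z • φ z) (W.c i) (7 * r)
          (C₁ * (‖φ y‖ + 14 * r * L)) := by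
        intro y hy
        have hy' : dist y (W.c i) < r := hy
        have hφz : ∀ z ∈ Metric.closedBall (W.c i) (7 * r), ‖φ z‖ ≤ ‖φ y‖ + 14 * r * L := by
          intro z hz
          have hz' : dist z (W.c i) ≤ 7 * r := hz
          have h1 := hLip z y
          have h2 := dist_triangle_right z y (W.c i)
          have h3 : ‖φ z‖ ≤ ‖φ y‖ + ‖φ z - φ y‖ := by
            have := norm_add_le (φ y) (φ z - φ y)
            simpa using this
          have h4 : (L : ℝ) * dist z y ≤ L * (14 * r) := by
            gcongr
            linarith
          linarith
        have hnn : 0 ≤ ‖φ y‖ + 14 * r * L := by positivity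
        have hout : ∀ z ∉ Metric.closedBall (W.c i) (7 * r), (fun z => W.eta i z • φ z) =ᶠ[𝓝 z]
            fun _ => 0 := by
          intro z hz
          filter_upwards [Metric.isClosed_closedBall.isOpen_compl.mem_nhds hz] with y hy
          rw [W.eta_eq_zero, zero_smul]
          intro h
          rw [hrr] at h
          exact hy (Metric.ball_subset_closedBall h)
        refine ⟨(W.eta_contDiff i).smul hφ.1, ?_, fun z => ?_, fun z => ?_⟩
        · have := (tsupport_smul_subset (W.eta i) φ).trans Set.inter_subset_left
          exact this.trans (by simpa [hrr] using W.tsupport_eta_subset i)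
        · by_cases hz : z ∈ Metric.closedBall (W.c i) (7 * r)
          · rw [norm_smul, Real.norm_eq_abs]
            calc |W.eta i z| * ‖φ z‖ ≤ 1 * (‖φ y‖ + 14 * r * L) := by
                  gcongr
                  · exact W.abs_eta_le_one i z
                  · exact hφz z hz
              _ ≤ _ := by
                  gcongr
                  rw [hC₁]
                  have : (0 : ℝ) ≤ etaConst d := NNReal.coe_nonneg _
                  linarith
          · have h : W.eta i z • φ z = 0 := (hout z hz).eq_of_nhds
            rw [h, norm_zero]
            positivity
        · by_cases hz : z ∈ Metric.closedBall (W.c i) (7 * r)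
          · refine (norm_fderiv_smul_le (W.eta_contDiff i) hφ.1 z).trans ?_
            have h1 := W.norm_fderiv_eta_le' hρ i z
            rw [hrr] at h1
            calc _ ≤ 1 * (L : ℝ) + etaConst d / r * (‖φ y‖ + 14 * r * L) := by
                  gcongr
                  · exact W.abs_eta_le_one i z
                  · exact hL z
                  · exact hφz z hz
              _ ≤ _ := by
                  rw [le_div_iff₀ (by positivity), add_mul]
                  have e : etaConst d / r * (‖φ y‖ + 14 * r * L) * (7 * r) =
                      7 * etaConst d * (‖φ y‖ + 14 * r * L) := by
                    field_simp
                  rw [e, hC₁, add_mul]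
                  refine add_le_add ?_ le_rfl
                  have : 0 ≤ ‖φ y‖ := norm_nonneg _
                  have : 0 ≤ r * L := by positivity
                  linarith
          · rw [(hout z hz).fderiv_eq]
            simp only [fderiv_fun_const, Pi.zero_apply, norm_zero]
            positivity
      have hpt : ∀ y ∈ Metric.ball (W.c i) r, ‖B fun z => W.eta i z • φ z‖ₑ ≤
          ENNReal.ofReal (C₁ * (7 * r) ^ d) * ((‖φ y‖ₑ + ENNReal.ofReal (14 * r * L)) * w y) := by
        intro y hy
        have hy' : y ∈ Metric.closedBall (W.c i) (7 * r) :=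
          Metric.closedBall_subset_closedBall (by linarith) (Metric.ball_subset_closedBall hy)
        refine (hB _ _ _ _ (by positivity) hrε (hbump y hy) y hy').trans (le_of_eq ?_)
        rw [← ofReal_norm, ← ENNReal.ofReal_add (norm_nonneg _) (by positivity), ← mul_assoc,
          ← ENNReal.ofReal_mul (by positivity)]
        congr 2
        ring
      have hint := setLIntegral_mono' (μ := volume) measurableSet_ball hpt
      rw [lintegral_const, Measure.restrict_apply_univ, volume_ball_eq _ hr,
        lintegral_const_mul' _ _ ENNReal.ofReal_ne_top, mul_pow, ← mul_assoc C₁,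
        ENNReal.ofReal_mul (by positivity)] at hint
      have hrd0 : ENNReal.ofReal (r ^ d) ≠ 0 := by simpa using by positivity
      rw [hC, ENNReal.div_eq_inv_mul, mul_assoc, ← ENNReal.div_eq_inv_mul,
        ENNReal.le_div_iff_mul_le (Or.inl hv0) (Or.inl hvt)]
      rw [← ENNReal.mul_le_mul_iff_left hrd0 ENNReal.ofReal_ne_top]
      calc _ = ‖B fun z => W.eta i z • φ z‖ₑ * (ENNReal.ofReal (r ^ d) * v) := by ring
        _ ≤ _ := hint
        _ = _ := by ring
    calc ‖B φ‖ₑ = ‖∑ i ∈ Finset.range N, B fun z => W.eta i z • φ z‖ₑ := by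
          conv_lhs => rw [hsum, map_sum]
      _ ≤ ∑ i ∈ Finset.range N, ‖B fun z => W.eta i z • φ z‖ₑ := enorm_sum_le _ _
      _ ≤ ∑' i, ‖B fun z => W.eta i z • φ z‖ₑ := ENNReal.sum_le_tsum _
      _ ≤ ∑' i, C * ∫⁻ y in Metric.ball (W.c i) (W.r i) ∩ K₁,
            (‖φ y‖ₑ + ENNReal.ofReal (14 * r * L)) * w y := ENNReal.tsum_le_tsum hpiece
      _ = C * ∫⁻ y in ⋃ i, Metric.ball (W.c i) (W.r i) ∩ K₁,
            (‖φ y‖ₑ + ENNReal.ofReal (14 * r * L)) * w y := by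
          rw [ENNReal.tsum_mul_left, lintegral_iUnion
            (fun i => measurableSet_ball.inter hK₁c.isClosed.measurableSet)]
          exact fun i j hij => (W.disj hij).mono Set.inter_subset_left Set.inter_subset_left
      _ ≤ C * ∫⁻ y in K₁, (‖φ y‖ₑ + ENNReal.ofReal (14 * r * L)) * w y :=
          mul_le_mul_right (lintegral_mono_set (Set.iUnion_subset fun i => Set.inter_subset_right)) _
      _ ≤ _ := by
          refine mul_le_mul_right ?_ _
          simp_rw [add_mul]
          have hm : Measurable fun y => ‖φ y‖ₑ * w y := hφ.1.continuous.measurable.enorm.mul hw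
          rw [lintegral_add_left hm, lintegral_const_mul _ hw]
          exact add_le_add_left (setLIntegral_le_lintegral _ _) _
  -- The error term disappears as r → 0 because the weight has finite integral over the compact set
  -- K₁.
  have hlim : Tendsto (fun r : ℝ => C * ((∫⁻ y, ‖φ y‖ₑ * w y) +
      ENNReal.ofReal (14 * r * L) * ∫⁻ y in K₁, w y)) (𝓝[>] 0)
      (𝓝 (C * ((∫⁻ y, ‖φ y‖ₑ * w y) + ENNReal.ofReal (14 * 0 * L) * ∫⁻ y in K₁, w y))) := by
    refine ENNReal.Tendsto.const_mul (tendsto_const_nhds.add ?_) (Or.inr hCt)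
    refine ENNReal.Tendsto.mul_const ?_ (Or.inr (hwK _ hK₁c).ne)
    refine (ENNReal.continuous_ofReal.tendsto _).comp ?_
    exact ((by fun_prop : Continuous fun r : ℝ => 14 * r * (L : ℝ)).tendsto 0).mono_left
      nhdsWithin_le_nhds
  have hle := ge_of_tendsto hlim (b := ‖B φ‖ₑ) (by
    have h1 : ∀ᶠ r : ℝ in 𝓝[>] 0, r < min 1 (ε₀ / 7) :=
      nhdsWithin_le_nhds (Iio_mem_nhds (by positivity))
    filter_upwards [h1, self_mem_nhdsWithin] with r hr hr0
    have h2 := hr.trans_le (min_le_left _ _)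
    have h3 := hr.trans_le (min_le_right _ _)
    exact main r hr0 (by linarith) h2.le)
  simpa using hle

/-- The space `C_0^∞(ℝ^d)`. -/
def testSpace (d : ℕ) : Submodule ℂ (E d → ℂ) where
  carrier := {φ | IsTestFunction Set.univ φ}
  add_mem' ha hb := ⟨ha.1.add hb.1, ha.2.1.add hb.2.1, Set.subset_univ _⟩
  zero_mem' := ⟨contDiff_const, HasCompactSupport.zero, Set.subset_univ _⟩
  smul_mem' _ _ hφ := ⟨contDiff_const.smul hφ.1, HasCompactSupport.smul_left hφ.2.1,
    Set.subset_univ _⟩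

/-- A linear functional dominated by the norm of a linear image in a Hilbert space is
represented by a vector. -/
theorem exists_inner_eq_of_norm_le {X H : Type*} [AddCommGroup X] [Module ℂ X]
    [NormedAddCommGroup H] [InnerProductSpace ℂ H] [CompleteSpace H] (ι : X →ₗ[ℂ] H)
    (f : X →ₗ[ℂ] ℂ) (C : ℝ) (hf : ∀ x, ‖f x‖ ≤ C * ‖ι x‖) :
    ∃ k : H, ∀ x, f x = inner ℂ k (ι x) := by
  obtain ⟨s, hs⟩ := LinearMap.exists_rightInverse_of_surjective ι.rangeRestrict
    (LinearMap.range_eq_top.2 ι.surjective_rangeRestrict)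
  have hs' : ∀ y, ι (s y) = y := fun y => by
    have := LinearMap.congr_fun hs y
    exact congrArg Subtype.val this
  let g : StrongDual ℂ ι.range := (f ∘ₗ s).mkContinuous C fun y => by
    have := hf (s y)
    rw [hs'] at this
    exact this
  obtain ⟨G, hG, -⟩ := exists_extension_norm_eq _ g
  refine ⟨(InnerProductSpace.toDual ℂ H).symm G, fun x => ?_⟩
  rw [InnerProductSpace.toDual_symm_apply]
  have h1 := hG (ι.rangeRestrict x)
  have h2 : g (ι.rangeRestrict x) = f (s (ι.rangeRestrict x)) := rfl
  rw [h2] at h1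
  -- The chosen preimage may differ from x, but the difference has image 0 under ι, and the norm
  -- bound then forces f to vanish on it.
  have h3 : f (s (ι.rangeRestrict x)) = f x := by
    have := hf (s (ι.rangeRestrict x) - x)
    rw [map_sub, map_sub, hs'] at this
    simpa [sub_eq_zero] using this
  rw [h3] at h1
  exact h1.symm

/-- A functional dominated by a weighted `L¹` norm is given by a function dominated by the
weight. -/
theorem exists_eq_integral_of_enorm_le {d : ℕ} (B : (E d → ℂ) →ₗ[ℂ] ℂ) {w : E d → ℝ≥0∞}
    (hw : Measurable w) (N : ℕ) (hwN : ∫⁻ y, w y / ENNReal.ofReal ((1 + ‖y‖) ^ N) < ⊤)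
    (hB : ∀ φ, IsTestFunction Set.univ φ → ‖B φ‖ₑ ≤ ∫⁻ y, ‖φ y‖ₑ * w y) :
    ∃ h : E d → ℂ, AEStronglyMeasurable h volume ∧ (∀ᵐ y, ‖h y‖ₑ ≤ w y) ∧ LocallyIntegrable h ∧
      ∀ φ, IsTestFunction Set.univ φ → B φ = ∫ y, h y * φ y := by
  have hp0 : ∀ y : E d, (0 : ℝ) < (1 + ‖y‖) ^ N := fun y => by positivity
  have hwt : ∀ᵐ y : E d, w y < ⊤ := by
    filter_upwards [ae_lt_top (by fun_prop) hwN.ne] with y hy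
    by_contra h
    rw [not_lt, top_le_iff] at h
    rw [h, ENNReal.top_div_of_ne_top ENNReal.ofReal_ne_top] at hy
    exact lt_irrefl _ hy
  set p : E d → ℝ := fun y => (1 + ‖y‖) ^ N with hp
  have hpc : Continuous p := by fun_prop
  set wr : E d → ℝ := fun y => (w y).toReal with hwr
  have hwrm : Measurable wr := hw.ennreal_toReal
  have hwr0 : ∀ y, 0 ≤ wr y := fun y => ENNReal.toReal_nonneg
  have hwe : ∀ᵐ y : E d, ‖wr y‖ₑ = w y := by
    filter_upwards [hwt] with y hy
    rw [Real.enorm_of_nonneg (hwr0 y), ENNReal.ofReal_toReal hy.ne]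
  have hdiv : Integrable (fun y => wr y / p y) := by
    refine ⟨(hwrm.div hpc.measurable).aestronglyMeasurable, ?_⟩
    refine lt_of_le_of_lt (lintegral_mono_ae ?_) hwN
    filter_upwards [hwe] with y hy
    rw [Real.enorm_of_nonneg (div_nonneg (hwr0 y) (hp0 y).le), ENNReal.ofReal_div_of_pos (hp0 y),
      ← Real.enorm_of_nonneg (hwr0 y), hy]
  have hcont : ∀ g : E d → ℝ, Continuous g → HasCompactSupport g →
      Integrable (fun y => g y * wr y) := by
    intro g hg hgs
    have h1 : ∃ C, ∀ y, ‖g y * p y‖ ≤ C :=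
      (hgs.mul_right (f' := p)).exists_bound_of_continuous (hg.mul hpc)
    obtain ⟨C, hC⟩ := h1
    have := hdiv.bdd_mul (c := C) (f := fun y => g y * p y) (hg.mul hpc).aestronglyMeasurable
      (ae_of_all _ hC)
    refine this.congr (ae_of_all _ fun y => ?_)
    have := (hp0 y).ne'
    simp only [hp]
    field_simp
  have hwloc : LocallyIntegrable wr := by
    rw [locallyIntegrable_iff]
    intro K hK
    obtain ⟨C, hC⟩ := hK.exists_bound_of_continuousOn hpc.continuousOn
    have := (hdiv.restrict (s := K)).bdd_mul (c := C) (f := p) hpc.aestronglyMeasurable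
      ((ae_restrict_iff' hK.isClosed.measurableSet).2 (ae_of_all _ hC))
    refine this.congr (ae_of_all _ fun y => ?_)
    exact mul_div_cancel₀ _ (hp0 y).ne'
  -- Cauchy–Schwarz in the form ∫|φ|w = ∫(|φ|√(wp))·√(w/p), where w/p is integrable, bounds B by the
  -- L² norm of φm with m = √(wp). The Riesz theorem then represents B by the conjugate of an L²
  -- function times m.
  set m : E d → ℝ := fun y => Real.sqrt (wr y * p y) with hm
  have hmm : Measurable m := (hwrm.mul hpc.measurable).sqrt
  have hm2 : ∀ y, m y ^ 2 = wr y * p y := fun y =>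
    Real.sq_sqrt (mul_nonneg (hwr0 y) (hp0 y).le)
  have hmem : ∀ φ : testSpace d, MemLp (fun y => φ.1 y * (m y : ℂ)) 2 volume := by
    intro φ
    have hφc : Continuous φ.1 := φ.2.1.continuous
    have hms : AEStronglyMeasurable (fun y => φ.1 y * (m y : ℂ)) volume :=
      hφc.aestronglyMeasurable.mul (Complex.measurable_ofReal.comp hmm).aestronglyMeasurable
    rw [memLp_two_iff_integrable_sq_norm hms]
    have h1 := hcont (fun y => ‖φ.1 y‖ ^ 2 * p y) (by fun_prop) (by
      refine HasCompactSupport.mul_right ?_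
      have := φ.2.2.1.norm
      exact this.comp_left (g := fun t : ℝ => t ^ 2) (by simp))
    refine h1.congr (ae_of_all _ fun y => ?_)
    simp only [norm_mul, Complex.norm_real, mul_pow, Real.norm_eq_abs, sq_abs, hm2]
    ring
  let ι : testSpace d →ₗ[ℂ] Lp ℂ 2 (volume : Measure (E d)) :=
    { toFun := fun φ => (hmem φ).toLp _
      map_add' := fun φ ψ => by
        rw [← MemLp.toLp_add]
        congr 1
        ext y
        simp [add_mul]
      map_smul' := fun c φ => by
        rw [RingHom.id_apply, ← MemLp.toLp_const_smul]
        congr 1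
        ext y
        simp [mul_assoc] }
  have hdiv2 : MemLp (fun y => Real.sqrt (wr y / p y)) 2 (volume : Measure (E d)) := by
    have hms : AEStronglyMeasurable (fun y => Real.sqrt (wr y / p y)) volume :=
      (hwrm.div hpc.measurable).sqrt.aestronglyMeasurable
    rw [memLp_two_iff_integrable_sq hms]
    refine hdiv.congr (ae_of_all _ fun y => ?_)
    simp only
    rw [Real.sq_sqrt (div_nonneg (hwr0 y) (hp0 y).le)]
  obtain ⟨k, hk⟩ := exists_inner_eq_of_norm_le ι (B ∘ₗ (testSpace d).subtype)
    (eLpNorm (fun y => Real.sqrt (wr y / p y)) 2 (volume : Measure (E d))).toReal (by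
      intro φ
      have h1 : ‖B φ.1‖ₑ ≤ eLpNorm (fun y => Real.sqrt (wr y / p y)) 2 volume *
          eLpNorm (fun y => φ.1 y * (m y : ℂ)) 2 volume := by
        refine (hB φ.1 φ.2).trans ?_
        have h2 : ∫⁻ y, ‖φ.1 y‖ₑ * w y =
            eLpNorm ((fun y => Real.sqrt (wr y / p y)) • (fun y => φ.1 y * (m y : ℂ))) 1 volume := by
          rw [eLpNorm_one_eq_lintegral_enorm]
          refine lintegral_congr_ae ?_
          filter_upwards [hwe] with y hy
          have e : ((fun y => Real.sqrt (wr y / p y)) • fun y => φ.1 y * (m y : ℂ)) y =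
            Real.sqrt (wr y / p y) • (φ.1 y * (m y : ℂ)) := rfl
          rw [e, ← hy, ← enorm_norm (φ.1 y), ← enorm_mul,
            ← enorm_norm (Real.sqrt (wr y / p y) • (φ.1 y * (m y : ℂ)))]
          congr 1
          rw [norm_smul, norm_mul, Complex.norm_real, Real.norm_of_nonneg (Real.sqrt_nonneg _),
            Real.norm_of_nonneg (Real.sqrt_nonneg _), mul_left_comm, ← Real.sqrt_mul'
            _ (mul_nonneg (hwr0 y) (hp0 y).le)]
          congr 1
          have : wr y / p y * (wr y * p y) = wr y ^ 2 := by
            have := (hp0 y).ne'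
            simp only [hp]
            field_simp
          rw [this, Real.sqrt_sq (hwr0 y)]
        rw [h2]
        exact eLpNorm_smul_le_mul_eLpNorm (hmem φ).1 hdiv2.1
      have h3 := ENNReal.toReal_mono (ENNReal.mul_ne_top hdiv2.2.ne (hmem φ).2.ne) h1
      rw [toReal_enorm, ENNReal.toReal_mul] at h3
      have h4 : ‖ι φ‖ = (eLpNorm (fun y => φ.1 y * (m y : ℂ)) 2 volume).toReal :=
        Lp.norm_toLp _ (hmem φ)
      rw [h4]
      exact h3)
  set h : E d → ℂ := fun y => star (k y) * (m y : ℂ) with hh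
  have hrep : ∀ φ, IsTestFunction Set.univ φ → B φ = ∫ y, h y * φ y := by
    intro φ hφ
    have := hk ⟨φ, hφ⟩
    simp only [LinearMap.comp_apply, Submodule.subtype_apply] at this
    rw [this, L2.inner_def]
    refine integral_congr_ae ?_
    filter_upwards [(hmem ⟨φ, hφ⟩).coeFn_toLp] with y hy
    have : (ι ⟨φ, hφ⟩ : E d → ℂ) y = φ y * (m y : ℂ) := hy
    rw [this, RCLike.inner_apply]
    simp only [hh, RCLike.star_def]
    ring
  have hhm : AEStronglyMeasurable h volume :=
    (Lp.aestronglyMeasurable k).star.mul (Complex.measurable_ofReal.comp hmm).aestronglyMeasurable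
  have hhloc : LocallyIntegrable h := by
    rw [locallyIntegrable_iff]
    intro K hK
    have hk2 : Integrable (fun y => ‖k y‖ ^ 2) :=
      (memLp_two_iff_integrable_sq_norm (Lp.aestronglyMeasurable k)).1 (Lp.memLp k)
    have hm2i : IntegrableOn (fun y => m y ^ 2) K := by
      simp_rw [hm2]
      obtain ⟨C, hC⟩ := hK.exists_bound_of_continuousOn hpc.continuousOn
      have := (hwloc.integrableOn_isCompact hK).bdd_mul (c := C) (f := p) hpc.aestronglyMeasurable
        ((ae_restrict_iff' hK.isClosed.measurableSet).2 (ae_of_all _ hC))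
      refine this.congr (ae_of_all _ fun y => ?_)
      ring
    refine Integrable.mono' (hk2.integrableOn.add hm2i) hhm.restrict (ae_of_all _ fun y => ?_)
    simp only [hh, norm_mul, norm_star, Complex.norm_real, Real.norm_eq_abs, Pi.add_apply]
    have h1 := sq_abs (m y)
    nlinarith [sq_nonneg (‖k y‖ - |m y|), sq_nonneg ‖k y‖, sq_nonneg |m y|]
  refine ⟨h, hhm, ?_, hhloc, hrep⟩
  -- The pointwise bound |h| ≤ w comes from testing B on an approximate identity: the mollified h is
  -- at most the mollified w, and both converge almost everywhere.
  let b : ℕ → ContDiffBump (0 : E d) := fun j =>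
    ⟨1 / (j + 1 : ℝ) / 2, 1 / (j + 1 : ℝ), by positivity, half_lt_self (by positivity)⟩
  have hb : Tendsto (fun j => (b j).rOut) atTop (𝓝 0) := tendsto_one_div_add_atTop_nhds_zero_nat
  have hb' : ∀ᶠ j in atTop, (b j).rOut ≤ 2 * (b j).rIn :=
    Eventually.of_forall fun j => le_of_eq (by simp only [b]; ring)
  filter_upwards [ContDiffBump.ae_convolution_tendsto_right_of_locallyIntegrable hb hb' hhloc,
    ContDiffBump.ae_convolution_tendsto_right_of_locallyIntegrable hb hb' hwloc, hwe]
    with y hy1 hy2 hy3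
  have key : ∀ j, ‖convolution ((b j).normed volume) h (ContinuousLinearMap.lsmul ℝ ℝ) volume y‖ ≤
      convolution ((b j).normed volume) wr (ContinuousLinearMap.lsmul ℝ ℝ) volume y := by
    intro j
    rw [convolution_eq_swap, convolution_eq_swap]
    set g : E d → ℝ := fun t => (b j).normed volume (y - t) with hg
    have hgc : ContDiff ℝ ∞ g := (b j).contDiff_normed.comp (contDiff_const.sub contDiff_id)
    have hgs : HasCompactSupport g := by
      have := (b j).hasCompactSupport_normed (μ := volume)
      exact this.comp_homeomorph (Homeomorph.subLeft y)
    have hg0 : ∀ t, 0 ≤ g t := fun t => (b j).nonneg_normed _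
    have hgt : IsTestFunction Set.univ fun t => (g t : ℂ) :=
      ⟨Complex.ofRealCLM.contDiff.comp hgc, hgs.comp_left (g := ((↑) : ℝ → ℂ)) (by simp),
        Set.subset_univ _⟩
    have h1 : ∫ t, ContinuousLinearMap.lsmul ℝ ℝ (g t) (h t) = B fun t => (g t : ℂ) := by
      rw [hrep _ hgt]
      refine integral_congr_ae (ae_of_all _ fun t => ?_)
      simp [mul_comm]
    have h2 : ∫⁻ t, ‖(g t : ℂ)‖ₑ * w t = ENNReal.ofReal (∫ t, ContinuousLinearMap.lsmul ℝ ℝ (g t) (wr t)) := by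
      have := hcont g hgc.continuous hgs
      simp only [ContinuousLinearMap.lsmul_apply, smul_eq_mul]
      rw [ofReal_integral_eq_lintegral_ofReal this (ae_of_all _ fun t => mul_nonneg (hg0 t) (hwr0 t))]
      refine lintegral_congr_ae ?_
      filter_upwards [hwe] with t ht
      rw [← ht, ← enorm_norm (g t : ℂ), ← enorm_mul, Complex.norm_real, Real.norm_of_nonneg (hg0 t),
        Real.enorm_of_nonneg (mul_nonneg (hg0 t) (hwr0 t))]
    have h3 := hB _ hgt
    rw [h2, ← h1, ← ofReal_norm] at h3
    refine (ENNReal.ofReal_le_ofReal_iff ?_).1 h3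
    refine integral_nonneg fun t => ?_
    exact mul_nonneg (hg0 t) (hwr0 t)
  have hle := le_of_tendsto_of_tendsto' hy1.norm hy2 key
  rw [← hy3, ← ofReal_norm, Real.enorm_of_nonneg (hwr0 y)]
  exact ENNReal.ofReal_le_ofReal hle

/-! ### Tempered distributions -/

/-- Only one weighted supremum of φ and the supremum of its gradient enter. This is what pairings
with atoms and with functions of polynomial growth provide. -/
theorem exists_tempered_of_bound {d : ℕ} (A : 𝓢(E d, ℂ) →ₗ[ℂ] ℂ) (N : ℕ) {C : ℝ} (hC : 0 ≤ C)
    (h : ∀ (φ : 𝓢(E d, ℂ)) (S : ℝ), (∀ x, (1 + ‖x‖) ^ N * ‖φ x‖ ≤ S) →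
      (∀ x, ‖fderiv ℝ φ x‖ ≤ S) → ‖A φ‖ ≤ C * S) :
    ∃ T : 𝓢'(E d, ℂ), ∀ φ, T φ = A φ := by
  let A' : 𝓢(E d, ℂ) →L[ℂ] ℂ := SchwartzMap.mkCLMtoNormedSpace (σ := RingHom.id ℂ) A
    (map_add A) (map_smul A) (by
      refine ⟨Finset.Iic (N, 1), C * 2 ^ N, by positivity, fun φ => ?_⟩
      rw [mul_assoc]
      refine h φ _ (fun x => ?_) (fun x => ?_)
      · have := SchwartzMap.one_add_le_sup_seminorm_apply (𝕜 := ℂ) (m := (N, 1)) (k := N) (n := 0)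
          le_rfl (by norm_num) φ x
        rw [norm_iteratedFDeriv_zero] at this
        exact this
      · have := SchwartzMap.one_add_le_sup_seminorm_apply (𝕜 := ℂ) (m := (N, 1)) (k := 0) (n := 1)
          (by simp) le_rfl φ x
        rw [norm_iteratedFDeriv_one, pow_zero, one_mul] at this
        exact this)
  exact ⟨ContinuousLinearMap.toPointwiseConvergenceCLM _ _ _ _ A', fun φ => rfl⟩

theorem exists_schwartz_bound {d : ℕ} (N : ℕ) (φ : 𝓢(E d, ℂ)) :
    ∃ S : ℝ, 0 ≤ S ∧ (∀ x, (1 + ‖x‖) ^ N * ‖φ x‖ ≤ S) ∧ ∀ x, ‖fderiv ℝ φ x‖ ≤ S := by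
  refine ⟨2 ^ N * (Finset.Iic (N, 1)).sup (fun m => SchwartzMap.seminorm ℂ m.1 m.2) φ,
    by positivity, fun x => ?_, fun x => ?_⟩
  · have := SchwartzMap.one_add_le_sup_seminorm_apply (𝕜 := ℂ) (m := (N, 1)) (k := N) (n := 0)
      le_rfl (by norm_num) φ x
    rwa [norm_iteratedFDeriv_zero] at this
  · have := SchwartzMap.one_add_le_sup_seminorm_apply (𝕜 := ℂ) (m := (N, 1)) (k := 0) (n := 1)
      (by simp) le_rfl φ x
    rwa [norm_iteratedFDeriv_one, pow_zero, one_mul] at this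

theorem norm_mul_le_of_growth {d : ℕ} {f : E d → ℂ} {N : ℕ} {φ : E d → ℂ} {S : ℝ}
    (hS : ∀ x, (1 + ‖x‖) ^ N * ‖φ x‖ ≤ S) (x : E d) :
    ‖f x * φ x‖ ≤ S * (‖f x‖ / (1 + ‖x‖) ^ N) := by
  have hp : (0 : ℝ) < (1 + ‖x‖) ^ N := by positivity
  rw [norm_mul, ← mul_div_assoc, le_div_iff₀ hp]
  calc ‖f x‖ * ‖φ x‖ * (1 + ‖x‖) ^ N = ‖f x‖ * ((1 + ‖x‖) ^ N * ‖φ x‖) := by ring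
    _ ≤ ‖f x‖ * S := by gcongr; exact hS x
    _ = _ := mul_comm _ _

theorem exists_represents {d : ℕ} {f : E d → ℂ} (N : ℕ) (hm : AEStronglyMeasurable f volume)
    (hf : Integrable fun x => ‖f x‖ / (1 + ‖x‖) ^ N) : ∃ T : 𝓢'(E d, ℂ), Represents T f := by
  have hi : ∀ φ : 𝓢(E d, ℂ), Integrable fun x => f x * φ x := by
    intro φ
    obtain ⟨S, -, hS, -⟩ := exists_schwartz_bound N φ
    exact (hf.const_mul S).mono' (hm.mul φ.continuous.aestronglyMeasurable)
      (ae_of_all _ fun x => norm_mul_le_of_growth hS x)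
  obtain ⟨T, hT⟩ := exists_tempered_of_bound (d := d)
    { toFun := fun φ => ∫ x, f x * φ x
      map_add' := fun φ ψ => by
        rw [← integral_add (hi φ) (hi ψ)]
        simp [mul_add]
      map_smul' := fun c φ => by
        rw [RingHom.id_apply, smul_eq_mul, ← integral_const_mul]
        congr 1 with x
        simp only [smul_apply, smul_eq_mul]
        ring } N (C := ∫ x, ‖f x‖ / (1 + ‖x‖) ^ N) (integral_nonneg fun x => by positivity) (by
      intro φ S hS _
      refine (norm_integral_le_of_norm_le (hf.const_mul S)
        (ae_of_all _ fun x => norm_mul_le_of_growth hS x)).trans (le_of_eq ?_)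
      rw [integral_const_mul, mul_comm])
  refine ⟨T, ?_, fun φ => ⟨hi φ, hT φ⟩⟩
  rw [locallyIntegrable_iff]
  intro K hK
  have hpc : Continuous fun x : E d => (1 + ‖x‖) ^ N := by fun_prop
  obtain ⟨C, hC⟩ := hK.exists_bound_of_continuousOn hpc.continuousOn
  have := (hf.restrict (s := K)).bdd_mul (c := C) hpc.aestronglyMeasurable
    ((ae_restrict_iff' hK.isClosed.measurableSet).2 (ae_of_all _ hC))
  refine Integrable.mono' this hm.restrict (ae_of_all _ fun x => ?_)
  rw [mul_div_cancel₀ _ (by positivity)]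

/-- The function `1 - χ(x / R)` cut off to the outside of a large ball. -/
theorem exists_cutoff (d : ℕ) : ∃ χ : E d → ℝ, ContDiff ℝ ∞ χ ∧ HasCompactSupport χ ∧
    ∀ x, ‖x‖ ≤ 1 → χ x = 1 := by
  let b : ContDiffBump (0 : E d) := ⟨1, 2, by norm_num, by norm_num⟩
  exact ⟨b, b.contDiff, b.hasCompactSupport, fun x hx => b.one_of_mem_closedBall (by simpa using hx)⟩

/-- Compactly supported functions are dense in the Schwartz space. -/
theorem exists_seq_compactSupport_tendsto {d : ℕ} (φ : 𝓢(E d, ℂ)) : ∃ φs : ℕ → 𝓢(E d, ℂ),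
    (∀ j, HasCompactSupport (φs j)) ∧ Tendsto φs atTop (𝓝 φ) := by
  obtain ⟨χ, hχ, hχs, hχ1⟩ := exists_cutoff d
  have hR : ∀ j : ℕ, (0 : ℝ) < (j + 1 : ℝ)⁻¹ := fun j => by positivity
  have hcd : ∀ j : ℕ, ContDiff ℝ ∞ fun x : E d => χ ((j + 1 : ℝ)⁻¹ • x) := fun j =>
    hχ.comp (by fun_prop)
  have hcs : ∀ j : ℕ, HasCompactSupport fun x : E d => χ ((j + 1 : ℝ)⁻¹ • x) := fun j =>
    hχs.comp_homeomorph (Homeomorph.smulOfNeZero _ (hR j).ne')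
  have hs : ∀ j : ℕ, HasCompactSupport fun x : E d => χ ((j + 1 : ℝ)⁻¹ • x) • φ x := fun j =>
    (hcs j).smul_right
  let φs : ℕ → 𝓢(E d, ℂ) := fun j => (hs j).toSchwartzMap ((hcd j).smul (φ.smooth ⊤))
  refine ⟨φs, fun j => hs j, ?_⟩
  rw [(schwartz_withSeminorms ℂ (E d) ℂ).tendsto_nhds]
  rintro ⟨k, m⟩ ε hε
  have hone : ContDiff ℝ ∞ fun x => 1 - χ x := contDiff_const.sub hχ
  have hbd : ∀ i : ℕ, ∃ C : ℝ, 0 ≤ C ∧ ∀ x, ‖iteratedFDeriv ℝ i (fun x => 1 - χ x) x‖ ≤ C := by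
    intro i
    have h1 : ∃ C, ∀ x, ‖iteratedFDeriv ℝ i χ x‖ ≤ C :=
      (hχs.iteratedFDeriv (𝕜 := ℝ) i).exists_bound_of_continuous
        (hχ.continuous_iteratedFDeriv (by exact_mod_cast le_top))
    obtain ⟨C, hC⟩ := h1
    refine ⟨‖iteratedFDeriv ℝ i (fun _ : E d => (1 : ℝ)) 0‖ + C,
      add_nonneg (norm_nonneg _) ((norm_nonneg _).trans (hC 0)), fun x => ?_⟩
    have e : (fun x => 1 - χ x) = (fun _ => (1 : ℝ)) - χ := rfl
    rw [e, iteratedFDeriv_sub_apply contDiff_const.contDiffAt (hχ.contDiffAt.of_le (by exact_mod_cast le_top))]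
    refine (norm_sub_le _ _).trans (add_le_add (le_of_eq ?_) (hC x))
    rcases Nat.eq_zero_or_pos i with rfl | hi
    · simp
    · rw [iteratedFDeriv_const_of_ne hi.ne']; simp
  choose C hC0 hC using hbd
  set S := ∑ i ∈ Finset.range (m + 1), (m.choose i : ℝ) * C i *
    SchwartzMap.seminorm ℂ (k + 1) (m - i) φ with hS
  have hS0 : 0 ≤ S := Finset.sum_nonneg fun i _ =>
    mul_nonneg (mul_nonneg (Nat.cast_nonneg _) (hC0 i)) (apply_nonneg _ _)
  have hbound : ∀ j : ℕ, SchwartzMap.seminorm ℂ k m (φs j - φ) ≤ (j + 1 : ℝ)⁻¹ * S := by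
    intro j
    refine SchwartzMap.seminorm_le_bound ℂ k m _ (by positivity) fun x => ?_
    set g : E d → ℝ := fun x => 1 - χ ((j + 1 : ℝ)⁻¹ • x) with hg
    have hgc : ContDiff ℝ ∞ g := contDiff_const.sub (hcd j)
    have e : (⇑(φs j - φ) : E d → ℂ) = fun x => -(g x • φ x) := by
      ext y
      change χ ((j + 1 : ℝ)⁻¹ • y) • φ y - φ y = _
      simp only [hg, sub_smul, one_smul]
      ring
    have e2 : iteratedFDeriv ℝ m (⇑(φs j - φ) : E d → ℂ) x =
        -iteratedFDeriv ℝ m (fun x => g x • φ x) x := by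
      rw [e]
      exact iteratedFDeriv_neg_apply
    rw [e2, norm_neg]
    -- Inside the ball of radius j+1 the cutoff is 1 and the difference vanishes identically.
    -- Outside, 1 ≤ |x|/(j+1), so one more power of |x| in the seminorm buys the factor 1/(j+1).
    by_cases hx : ‖x‖ < j + 1
    · have hz : (fun x => g x • φ x) =ᶠ[𝓝 x] fun _ => 0 := by
        have : Metric.ball (0 : E d) (j + 1) ∈ 𝓝 x :=
          Metric.isOpen_ball.mem_nhds (by simpa using hx)
        filter_upwards [this] with y hy
        have hy' : ‖y‖ < j + 1 := by simpa using hy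
        have : χ ((j + 1 : ℝ)⁻¹ • y) = 1 := by
          apply hχ1
          rw [norm_smul, Real.norm_of_nonneg (hR j).le, inv_mul_le_iff₀ (by positivity), mul_one]
          exact hy'.le
        simp [hg, this]
      rw [(hz.iteratedFDeriv ℝ m).eq_of_nhds]
      have h0 : iteratedFDeriv ℝ m (fun _ : E d => (0 : ℂ)) x = 0 := by
        have := congrFun (iteratedFDeriv_fun_zero (𝕜 := ℝ) (E := E d) (F := ℂ) (n := m)) x
        simpa using this
      rw [h0, norm_zero, mul_zero]
      positivity
    · rw [not_lt] at hx
      have hL := norm_iteratedFDeriv_smul_le (𝕜 := ℝ) hgc (φ.smooth ⊤) x (n := m)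
        (by exact_mod_cast le_top)
      have hgb : ∀ i, ‖iteratedFDeriv ℝ i g x‖ ≤ C i := by
        intro i
        have e3 : g = fun x => (fun y => 1 - χ y) ((j + 1 : ℝ)⁻¹ • x) := rfl
        rw [e3, iteratedFDeriv_comp_const_smul (i := i) _ (hone.of_le (by exact_mod_cast le_top)),
          norm_smul, norm_pow, Real.norm_of_nonneg (hR j).le]
        refine le_trans (mul_le_of_le_one_left (norm_nonneg _) ?_) (hC i _)
        exact pow_le_one₀ (hR j).le (inv_le_one_of_one_le₀ (by simp))
      calc ‖x‖ ^ k * ‖iteratedFDeriv ℝ m (fun x => g x • φ x) x‖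
          ≤ ((j + 1 : ℝ)⁻¹ * ‖x‖) * ‖x‖ ^ k * ‖iteratedFDeriv ℝ m (fun x => g x • φ x) x‖ := by
            rw [mul_assoc]
            refine le_mul_of_one_le_left (by positivity) ?_
            rw [inv_mul_eq_div, one_le_div (by positivity)]
            exact hx
        _ = (j + 1 : ℝ)⁻¹ * (‖x‖ ^ (k + 1) * ‖iteratedFDeriv ℝ m (fun x => g x • φ x) x‖) := by
            ring
        _ ≤ (j + 1 : ℝ)⁻¹ * S := by
            gcongr
            refine (mul_le_mul_of_nonneg_left hL (by positivity)).trans ?_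
            rw [Finset.mul_sum, hS]
            refine Finset.sum_le_sum fun i _ => ?_
            calc ‖x‖ ^ (k + 1) * ((m.choose i : ℝ) * ‖iteratedFDeriv ℝ i g x‖ *
                  ‖iteratedFDeriv ℝ (m - i) φ x‖)
                = (m.choose i : ℝ) * ‖iteratedFDeriv ℝ i g x‖ *
                  (‖x‖ ^ (k + 1) * ‖iteratedFDeriv ℝ (m - i) φ x‖) := by ring
              _ ≤ _ := by
                  refine mul_le_mul (mul_le_mul_of_nonneg_left (hgb i) (Nat.cast_nonneg _))
                    (SchwartzMap.le_seminorm ℂ (k + 1) (m - i) φ x) (by positivity)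
                    (mul_nonneg (Nat.cast_nonneg _) (hC0 i))
  have hlim : Tendsto (fun j : ℕ => (j + 1 : ℝ)⁻¹ * S) atTop (𝓝 (0 * S)) := by
    refine Tendsto.mul_const _ ?_
    simpa using tendsto_one_div_add_atTop_nhds_zero_nat (𝕜 := ℝ)
  rw [zero_mul] at hlim
  filter_upwards [hlim.eventually_lt_const hε] with j hj
  exact (hbound j).trans_lt hj

theorem tempered_ext {d : ℕ} {T₁ T₂ : 𝓢'(E d, ℂ)}
    (h : ∀ φ : 𝓢(E d, ℂ), HasCompactSupport φ → T₁ φ = T₂ φ) : T₁ = T₂ := by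
  ext φ
  obtain ⟨φs, hs, hlim⟩ := exists_seq_compactSupport_tendsto φ
  refine tendsto_nhds_unique ((T₁.continuous.tendsto φ).comp hlim) ?_
  refine ((T₂.continuous.tendsto φ).comp hlim).congr fun j => ?_
  exact (h _ (hs j)).symm

/-! ### Series of atoms -/

/-- The total power of r on the left is n + 1 - n/p, which is positive exactly when p > n/(n+1). -/
theorem rpow_neg_mul_rpow_le {n : ℕ} {p r v : ℝ} (hp0 : 0 < p) (hp : (n : ℝ) / (n + 1) < p) (hv : 0 < v)
    (hr : 0 < r) (hr1 : r ≤ 1) :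
    (v * r ^ n) ^ (-(1 / p)) * (v * r ^ n) * r ≤ v ^ (-(1 / p)) * v := by
  rw [Real.mul_rpow hv.le (by positivity)]
  have h1 : (r ^ n) ^ (-(1 / p)) * r ^ n * r ≤ 1 := by
    rw [← Real.rpow_natCast, ← Real.rpow_mul hr.le, ← Real.rpow_add hr]
    nth_rewrite 2 [← Real.rpow_one r]
    rw [← Real.rpow_add hr]
    apply Real.rpow_le_one hr.le hr1
    rw [div_lt_iff₀ (by positivity)] at hp
    have : (n : ℝ) * (1 / p) ≤ n + 1 := by
      rw [mul_one_div, div_le_iff₀ hp0]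
      linarith
    linarith
  calc _ = v ^ (-(1 / p)) * v * ((r ^ n) ^ (-(1 / p)) * r ^ n * r) := by ring
    _ ≤ v ^ (-(1 / p)) * v * 1 := by gcongr
    _ = _ := mul_one _

theorem volume_real_ball {d : ℕ} (x : E d) {r : ℝ} (hr : 0 < r) :
    volume.real (Metric.ball x r) = volume.real (Metric.ball (0 : E d) 1) * r ^ d := by
  rw [Measure.real, volume_ball_eq x hr, ENNReal.toReal_mul, ENNReal.toReal_ofReal (by positivity),
    mul_comm, Measure.real]

theorem volume_real_unitBall_pos (d : ℕ) : 0 < volume.real (Metric.ball (0 : E d) 1) :=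
  ENNReal.toReal_pos (volume_unitBall_pos d).ne' (volume_unitBall_lt_top d).ne

theorem IsAtom.integrable {n : ℕ} {p : ℝ} {a : E n → ℂ} (ha : IsAtom p a) : Integrable a := by
  obtain ⟨hm, c, r, hr, h1, h2, -⟩ := ha
  have hi : IntegrableOn a (Metric.ball c r) :=
    Measure.integrableOn_of_bounded measure_ball_lt_top.ne hm (ae_restrict_of_ae h2)
  refine hi.integrable_of_ae_notMem_eq_zero ?_
  exact h1

/-- On a ball of radius r ≤ 1 the vanishing mean lets φ be replaced by φ - φ(c), which gains a
factor Lr and compensates for the height of the atom. On larger balls the atom is bounded by a fixed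
constant and the L¹ norm of φ suffices. The bound is uniform over all atoms. -/
theorem exists_norm_integral_atom_le {n : ℕ} {p : ℝ} (hp0 : 0 < p) (hp : (n : ℝ) / (n + 1) < p) :
    ∃ C : ℝ, 0 ≤ C ∧ ∀ a : E n → ℂ, IsAtom p a → ∀ (φ : E n → ℂ) (L : ℝ), 0 ≤ L →
      Continuous φ → Integrable φ → (∀ x y, ‖φ x - φ y‖ ≤ L * dist x y) →
      ‖∫ x, a x * φ x‖ ≤ C * ((∫ x, ‖φ x‖) + L) := by
  set v := volume.real (Metric.ball (0 : E n) 1) with hv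
  have hv0 : 0 < v := volume_real_unitBall_pos n
  refine ⟨v ^ (-(1 / p)) * v + v ^ (-(1 / p)), by positivity, ?_⟩
  rintro a ha φ L hL0 hφc hφi hL
  have hai := ha.integrable
  obtain ⟨hm, c, r, hr, h1, h2, h3⟩ := ha
  have hI : 0 ≤ ∫ x, ‖φ x‖ := integral_nonneg fun _ => norm_nonneg _
  have hvol := volume_real_ball c hr
  rw [hvol, ← hv] at h2
  rcases le_total r 1 with hr1 | hr1
  · have hbi : Integrable ((Metric.ball c r).indicator
        fun _ => (v * r ^ n) ^ (-(1 / p)) * (L * r)) := by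
      rw [integrable_indicator_iff measurableSet_ball]
      exact integrableOn_const measure_ball_lt_top.ne
    have hb : ∀ᵐ x, ‖a x * (φ x - φ c)‖ ≤ (Metric.ball c r).indicator
        (fun _ => (v * r ^ n) ^ (-(1 / p)) * (L * r)) x := by
      filter_upwards [h1, h2] with x hx1 hx2
      by_cases hx : x ∈ Metric.ball c r
      · rw [Set.indicator_of_mem hx, norm_mul]
        gcongr
        refine (hL x c).trans ?_
        gcongr
        exact (Metric.mem_ball.1 hx).le
      · rw [Set.indicator_of_notMem hx, hx1 hx, zero_mul, norm_zero]
    have hi : Integrable fun x => a x * (φ x - φ c) :=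
      hbi.mono' (hm.mul (hφc.sub continuous_const).aestronglyMeasurable) hb
    have e : ∫ x, a x * φ x = ∫ x, a x * (φ x - φ c) := by
      have : ∀ x, a x * φ x = a x * (φ x - φ c) + a x * φ c := fun x => by ring
      simp_rw [this]
      rw [integral_add hi (hai.mul_const _), integral_mul_const, h3, zero_mul, add_zero]
    rw [e]
    refine (norm_integral_le_of_norm_le hbi hb).trans ?_
    rw [integral_indicator_const _ measurableSet_ball, hvol, ← hv, smul_eq_mul]
    calc v * r ^ n * ((v * r ^ n) ^ (-(1 / p)) * (L * r))
        = (v * r ^ n) ^ (-(1 / p)) * (v * r ^ n) * r * L := by ring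
      _ ≤ v ^ (-(1 / p)) * v * L := by
          exact mul_le_mul_of_nonneg_right (rpow_neg_mul_rpow_le hp0 hp hv0 hr hr1) hL0
      _ ≤ _ := by
          gcongr
          · exact le_add_of_nonneg_right (by positivity)
          · exact le_add_of_nonneg_left hI
  · have hA : (v * r ^ n) ^ (-(1 / p)) ≤ v ^ (-(1 / p)) := by
      refine Real.rpow_le_rpow_of_nonpos hv0 ?_ (by simpa using hp0.le)
      exact le_mul_of_one_le_right hv0.le (one_le_pow₀ hr1)
    refine (norm_integral_le_of_norm_le (hφi.norm.const_mul (v ^ (-(1 / p)))) ?_).trans ?_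
    · filter_upwards [h2] with x hx
      rw [norm_mul]
      gcongr
      exact hx.trans hA
    · rw [integral_const_mul]
      gcongr
      · exact le_add_of_nonneg_left (by positivity)
      · exact le_add_of_nonneg_right hL0

/-- The inclusion ℓ^p ⊂ ℓ¹ for p ≤ 1: all but finitely many terms are below 1, and there f ≤ f^p. -/
theorem nnreal_summable_of_rpow {p : ℝ} (hp0 : 0 < p) (hp1 : p ≤ 1) {f : ℕ → ℝ≥0}
    (h1 : Summable fun j => f j ^ p) : Summable f := by
  have h2 := NNReal.tendsto_cofinite_zero_of_summable h1
  rw [← NNReal.summable_coe]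
  have h3 : Summable fun j => ((f j ^ p : ℝ≥0) : ℝ) := NNReal.summable_coe.2 h1
  refine Summable.of_norm_bounded_eventually h3 ?_
  filter_upwards [h2.eventually_lt_const one_pos] with j hj
  have h5 : f j < 1 := by
    by_contra h
    exact absurd hj (not_lt.2 (NNReal.one_le_rpow (not_lt.1 h) hp0.le))
  rw [Real.norm_of_nonneg (NNReal.coe_nonneg _), NNReal.coe_rpow]
  exact Real.self_le_rpow_of_le_one (NNReal.coe_nonneg _) (by exact_mod_cast h5.le) hp1

theorem summable_norm_of_tsum_rpow_lt_top {p : ℝ} (hp0 : 0 < p) (hp1 : p ≤ 1) {l : ℕ → ℂ}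
    (hl : ∑' j, ‖l j‖ₑ ^ p < ⊤) : Summable fun j => ‖l j‖ := by
  have e : ∀ j, ‖l j‖ₑ ^ p = ((‖l j‖₊ ^ p : ℝ≥0) : ℝ≥0∞) := fun j => by
    rw [ENNReal.coe_rpow_of_nonneg _ hp0.le, enorm_eq_nnnorm]
  have h1 : Summable fun j => ‖l j‖₊ ^ p := by
    rw [← ENNReal.tsum_coe_ne_top_iff_summable, ← tsum_congr e]
    exact hl.ne
  have := nnreal_summable_of_rpow hp0 hp1 h1
  exact NNReal.summable_coe.2 this

/-- Pairings of atoms with a fixed Schwartz function are uniformly bounded by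
`exists_norm_integral_atom_le`, and the coefficients are in ℓ^p ⊂ ℓ¹. The series therefore converges
absolutely, with a bound by Schwartz seminorms. -/
theorem exists_tempered_of_atoms {n : ℕ} {p : ℝ} (hp0 : 0 < p) (hp : (n : ℝ) / (n + 1) < p)
    (hp1 : p ≤ 1) {l : ℕ → ℂ} {a : ℕ → E n → ℂ} (ha : ∀ j, IsAtom p (a j))
    (hl : ∑' j, ‖l j‖ₑ ^ p < ⊤) :
    ∃ T : 𝓢'(E n, ℂ), ∀ φ : 𝓢(E n, ℂ), HasSum (fun j => l j * ∫ x, a j x * φ x) (T φ) := by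
  obtain ⟨C, hC0, hC⟩ := exists_norm_integral_atom_le (n := n) hp0 hp
  have hls := summable_norm_of_tsum_rpow_lt_top hp0 hp1 hl
  have hw : Integrable fun x : E n => (1 + ‖x‖) ^ (-((n + 1 : ℕ) : ℝ)) :=
    integrable_one_add_norm (by rw [finrank_euclideanSpace_fin]; exact_mod_cast Nat.lt_succ_self n)
  set I := ∫ x : E n, (1 + ‖x‖) ^ (-((n + 1 : ℕ) : ℝ)) with hI
  have hI0 : 0 ≤ I := integral_nonneg fun x => by positivity
  have hb : ∀ (j : ℕ) (φ : 𝓢(E n, ℂ)) (S : ℝ), (∀ x, (1 + ‖x‖) ^ (n + 1) * ‖φ x‖ ≤ S) →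
      (∀ x, ‖fderiv ℝ φ x‖ ≤ S) → ‖l j * ∫ x, a j x * φ x‖ ≤ ‖l j‖ * (C * ((I + 1) * S)) := by
    intro j φ S hS hS'
    rw [norm_mul]
    gcongr
    refine (hC (a j) (ha j) φ S ((norm_nonneg _).trans (hS' 0)) φ.continuous φ.integrable
      (norm_sub_le_of_fderiv_le (φ.smooth ⊤) hS')).trans ?_
    gcongr
    have h1 : ∫ x, ‖φ x‖ ≤ ∫ x : E n, S * (1 + ‖x‖) ^ (-((n + 1 : ℕ) : ℝ)) := by
      refine integral_mono φ.integrable.norm (hw.const_mul S) fun x => ?_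
      simp only
      rw [Real.rpow_neg (by positivity), Real.rpow_natCast, ← div_eq_mul_inv,
        le_div_iff₀ (by positivity), mul_comm]
      exact hS x
    rw [integral_const_mul] at h1
    linarith
  have hsum : ∀ φ : 𝓢(E n, ℂ), Summable fun j => l j * ∫ x, a j x * φ x := by
    intro φ
    obtain ⟨S, -, hS, hS'⟩ := exists_schwartz_bound (n + 1) φ
    exact Summable.of_norm_bounded (hls.mul_right (C * ((I + 1) * S))) fun j => hb j φ S hS hS'
  have hai : ∀ (j : ℕ) (φ : 𝓢(E n, ℂ)), Integrable fun x => a j x * φ x := by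
    intro j φ
    obtain ⟨K, hK⟩ : ∃ K, ∀ x, ‖φ x‖ ≤ K :=
      ⟨_, fun x => SchwartzMap.norm_le_seminorm ℂ φ x⟩
    exact (ha j).integrable.mul_bdd (c := K) φ.continuous.aestronglyMeasurable (ae_of_all _ hK)
  obtain ⟨T, hT⟩ := exists_tempered_of_bound (d := n)
    { toFun := fun φ => ∑' j, l j * ∫ x, a j x * φ x
      map_add' := fun φ ψ => by
        rw [← (hsum φ).tsum_add (hsum ψ)]
        congr 1 with j
        rw [← mul_add, ← integral_add (hai j φ) (hai j ψ)]
        simp [mul_add]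
      map_smul' := fun c φ => by
        rw [RingHom.id_apply, smul_eq_mul, ← tsum_mul_left]
        congr 1 with j
        have h : ∫ x, a j x * (c • φ) x = ∫ x, c * (a j x * φ x) := by
          congr 1 with x
          simp only [smul_apply, smul_eq_mul]
          ring
        rw [h, integral_const_mul]
        ring } (n + 1) (C := (∑' j, ‖l j‖) * (C * (I + 1))) (by positivity) (by
      intro φ S hS hS'
      refine (tsum_of_norm_bounded (hls.mul_right (C * ((I + 1) * S))).hasSum
        fun j => hb j φ S hS hS').trans (le_of_eq ?_)
      rw [tsum_mul_right]
      ring)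
  exact ⟨T, fun φ => by rw [hT]; exact (hsum φ).hasSum⟩

theorem isAtom_of_bounded {n : ℕ} {p : ℝ} {A : E n → ℂ} {c : E n} {r b : ℝ}
    (hA : AEStronglyMeasurable A volume) (hr : 0 < r) (hb : 0 < b)
    (hsupp : ∀ᵐ x, x ∉ Metric.ball c r → A x = 0) (hbd : ∀ᵐ x, ‖A x‖ ≤ b) (hmean : ∫ x, A x = 0) :
    IsAtom p fun x => ((b * volume.real (Metric.ball c r) ^ (1 / p) : ℝ) : ℂ)⁻¹ * A x := by
  have hv : 0 < volume.real (Metric.ball c r) := by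
    rw [volume_real_ball c hr]
    have := volume_real_unitBall_pos n
    positivity
  refine ⟨hA.const_mul _, c, r, hr, ?_, ?_, ?_⟩
  · filter_upwards [hsupp] with x hx h
    rw [hx h, mul_zero]
  · filter_upwards [hbd] with x hx
    rw [norm_mul, norm_inv, Complex.norm_real, Real.norm_of_nonneg (by positivity),
      Real.rpow_neg hv.le, inv_mul_le_iff₀ (by positivity), mul_assoc, mul_inv_cancel₀ (by positivity),
      mul_one]
    exact hx
  · rw [integral_const_mul, hmean, mul_zero]

theorem isAtom_zero {n : ℕ} (p : ℝ) : IsAtom p (fun _ : E n => (0 : ℂ)) :=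
  ⟨aestronglyMeasurable_const, 0, 1, one_pos, ae_of_all _ fun _ _ => rfl,
    ae_of_all _ fun _ => by rw [norm_zero]; positivity, by simp⟩

theorem atomicNorm_le {n : ℕ} {p : ℝ} {T : 𝓢'(E n, ℂ)} (l : ℕ → ℂ) (a : ℕ → E n → ℂ)
    (ha : ∀ j, IsAtom p (a j))
    (hT : ∀ φ : 𝓢(E n, ℂ), HasSum (fun j => l j * ∫ x, a j x * φ x) (T φ)) :
    atomicNorm p T ≤ (∑' j, ‖l j‖ₑ ^ p) ^ (1 / p) :=
  iInf₂_le_of_le l a (iInf₂_le_of_le ha hT le_rfl)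

/-! ### The Calderón–Zygmund decomposition of a functional -/

/-- The functionals below are defined by series and integrals whose additivity is only known on test
functions. An arbitrary linear extension makes them linear maps on all functions; only values on
test functions are ever used. -/
theorem exists_linearMap_of_test {d : ℕ} (f : (E d → ℂ) → ℂ)
    (hadd : ∀ φ ψ, IsTestFunction Set.univ φ → IsTestFunction Set.univ ψ → f (φ + ψ) = f φ + f ψ)
    (hsmul : ∀ (c : ℂ) φ, IsTestFunction Set.univ φ → f (c • φ) = c * f φ) :
    ∃ B : (E d → ℂ) →ₗ[ℂ] ℂ, ∀ φ, IsTestFunction Set.univ φ → B φ = f φ := by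
  let B₀ : testSpace d →ₗ[ℂ] ℂ :=
    { toFun := fun φ => f φ.1
      map_add' := fun φ ψ => hadd φ.1 ψ.1 φ.2 ψ.2
      map_smul' := fun c φ => hsmul c φ.1 φ.2 }
  obtain ⟨B, hB⟩ := LinearMap.exists_extend B₀
  exact ⟨B, fun φ hφ => LinearMap.congr_fun hB ⟨φ, hφ⟩⟩

theorem volume_ball_eq' {d : ℕ} (hd : 0 < d) (x : E d) {r : ℝ} (hr : 0 ≤ r) :
    volume (Metric.ball x r) = ENNReal.ofReal (r ^ d) * volume (Metric.ball (0 : E d) 1) := by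
  rcases hr.eq_or_lt with rfl | hr
  · simp [zero_pow hd.ne']
  · exact volume_ball_eq x hr

/-- A closed set with complement of finite measure, a Whitney covering of its complement, and a
bound for the size of a functional near the set. -/
structure Level (n : ℕ) where
  F : Set (E n)
  isClosed : IsClosed F
  nonempty : F.Nonempty
  volume_compl : volume Fᶜ < ⊤
  W : WhitneyCover fun x => Metric.infDist x F / 64
  lam : ℝ≥0∞
  lam_ne_top : lam ≠ ⊤

namespace Level

variable {n : ℕ} (D : Level n)

theorem lipschitz (x y : E n) :
    |(fun x => Metric.infDist x D.F / 64) x - (fun x => Metric.infDist x D.F / 64) y| ≤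
      dist x y / 64 := by
  have h1 := Metric.infDist_le_infDist_add_dist (s := D.F) (x := x) (y := y)
  have h2 := Metric.infDist_le_infDist_add_dist (s := D.F) (x := y) (y := x)
  rw [dist_comm y x] at h2
  rw [abs_le]
  constructor <;> linarith

theorem infDist_pos {x : E n} (hx : x ∉ D.F) : 0 < Metric.infDist x D.F / 64 := by
  have := (D.isClosed.notMem_iff_infDist_pos D.nonempty).1 hx
  positivity

theorem infDist_c {j : ℕ} (hj : 0 < D.W.r j) : Metric.infDist (D.W.c j) D.F = 64 * D.W.r j := by
  have := D.W.r_eq j hj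
  linarith

/-- The nearest point of F is at distance 64r from the centre, and 64 ≤ 10·7. So a bump on the
sevenfold Whitney ball is close enough to F for `Bounds` to apply. -/
theorem exists_mem_closedBall {j : ℕ} (hj : 0 < D.W.r j) :
    ∃ y ∈ D.F, y ∈ Metric.closedBall (D.W.c j) (10 * (7 * D.W.r j)) := by
  obtain ⟨y, hy, h⟩ := D.isClosed.exists_infDist_eq_dist D.nonempty (D.W.c j)
  refine ⟨y, hy, ?_⟩
  rw [Metric.mem_closedBall, dist_comm, ← h, D.infDist_c hj]
  linarith

theorem ball_subset_compl (j : ℕ) : Metric.ball (D.W.c j) (D.W.r j) ⊆ D.Fᶜ := by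
  intro x hx hxF
  have hj : 0 < D.W.r j := Metric.pos_of_mem_ball hx
  have h1 := Metric.infDist_le_dist_of_mem (x := D.W.c j) hxF
  rw [D.infDist_c hj, dist_comm] at h1
  have h2 : dist x (D.W.c j) < D.W.r j := hx
  linarith

theorem notMem_of_mem_ball {j : ℕ} {x : E n} (hx : x ∈ Metric.closedBall (D.W.c j) (7 * D.W.r j))
    (hj : 0 < D.W.r j) : x ∉ D.F := by
  intro hxF
  have h1 := Metric.infDist_le_dist_of_mem (x := D.W.c j) hxF
  rw [D.infDist_c hj, dist_comm] at h1
  have h2 : dist x (D.W.c j) ≤ 7 * D.W.r j := hx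
  linarith

theorem tsum_ofReal_le (hn : 0 < n) :
    ∑' j, ENNReal.ofReal (D.W.r j ^ n) * volume (Metric.ball (0 : E n) 1) ≤ volume D.Fᶜ := by
  simp only [fun j => (volume_ball_eq' hn (D.W.c j) (D.W.r_nonneg j)).symm]
  exact D.W.tsum_volume_le D.ball_subset_compl

theorem ofReal_r_pow_le (hn : 0 < n) (j : ℕ) :
    ENNReal.ofReal (D.W.r j ^ n) ≤ volume D.Fᶜ / volume (Metric.ball (0 : E n) 1) := by
  rw [ENNReal.le_div_iff_mul_le (Or.inl (volume_unitBall_pos n).ne')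
    (Or.inl (volume_unitBall_lt_top n).ne)]
  exact (ENNReal.le_tsum j).trans (D.tsum_ofReal_le hn)

theorem exists_r_le (hn : 0 < n) : ∃ R : ℝ, 0 ≤ R ∧ ∀ j, D.W.r j ≤ R := by
  set V := volume D.Fᶜ / volume (Metric.ball (0 : E n) 1) with hV
  have hVt : V ≠ ⊤ := ENNReal.div_ne_top D.volume_compl.ne (volume_unitBall_pos n).ne'
  refine ⟨max 1 V.toReal, by positivity, fun j => ?_⟩
  rcases le_total (D.W.r j) 1 with h | h
  · exact h.trans (le_max_left _ _)
  · refine le_trans ?_ (le_max_right _ _)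
    refine (le_self_pow₀ h hn.ne').trans ?_
    exact (ENNReal.ofReal_le_iff_le_toReal hVt).1 (D.ofReal_r_pow_le hn j)

/-- The functional is bounded by `lam` on bump functions near `F`. -/
def Bounds (ℓ : (E n → ℂ) →ₗ[ℂ] ℂ) : Prop :=
  ∀ φ x r a, 0 < r → IsBump φ x r a → (∃ y ∈ D.F, y ∈ Metric.closedBall x (10 * r)) →
    ‖ℓ φ‖ₑ ≤ ENNReal.ofReal (a * r ^ n) * D.lam

theorem isBump_eta_smul {j : ℕ} (hj : 0 < D.W.r j) {g : E n → ℂ} (hg : ContDiff ℝ ∞ g) {S T : ℝ}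
    (hS0 : 0 ≤ S) (hT0 : 0 ≤ T)
    (hS : ∀ x ∈ Metric.closedBall (D.W.c j) (7 * D.W.r j), ‖g x‖ ≤ S)
    (hT : ∀ x ∈ Metric.closedBall (D.W.c j) (7 * D.W.r j), ‖fderiv ℝ g x‖ ≤ T) :
    IsBump (fun x => D.W.eta j x • g x) (D.W.c j) (7 * D.W.r j)
      (S * (1 + 7 * etaConst n) + 7 * D.W.r j * T) := by
  have hK : (0 : ℝ) ≤ etaConst n := NNReal.coe_nonneg _
  have hA : S ≤ S * (1 + 7 * etaConst n) + 7 * D.W.r j * T := by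
    have : 0 ≤ S * (7 * etaConst n) := by positivity
    have : 0 ≤ 7 * D.W.r j * T := by positivity
    linarith
  have hout : ∀ z ∉ Metric.closedBall (D.W.c j) (7 * D.W.r j), (fun z => D.W.eta j z • g z) =ᶠ[𝓝 z]
      fun _ => 0 := by
    intro z hz
    filter_upwards [Metric.isClosed_closedBall.isOpen_compl.mem_nhds hz] with y hy
    rw [D.W.eta_eq_zero, zero_smul]
    exact fun h => hy (Metric.ball_subset_closedBall h)
  refine ⟨(D.W.eta_contDiff j).smul hg, ?_, fun z => ?_, fun z => ?_⟩
  · exact ((tsupport_smul_subset (D.W.eta j) g).trans Set.inter_subset_left).trans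
      (D.W.tsupport_eta_subset j)
  · by_cases hz : z ∈ Metric.closedBall (D.W.c j) (7 * D.W.r j)
    · rw [norm_smul, Real.norm_eq_abs]
      calc |D.W.eta j z| * ‖g z‖ ≤ 1 * S := by
            gcongr
            · exact D.W.abs_eta_le_one j z
            · exact hS z hz
        _ ≤ _ := by rw [one_mul]; exact hA
    · have h : D.W.eta j z • g z = 0 := (hout z hz).eq_of_nhds
      rw [h, norm_zero]
      exact hS0.trans hA
  · by_cases hz : z ∈ Metric.closedBall (D.W.c j) (7 * D.W.r j)
    · refine (norm_fderiv_smul_le (D.W.eta_contDiff j) hg z).trans ?_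
      have h1 := D.W.norm_fderiv_eta_le' D.lipschitz j z
      calc _ ≤ 1 * T + etaConst n / D.W.r j * S := by
            gcongr
            · exact D.W.abs_eta_le_one j z
            · exact hT z hz
            · exact hS z hz
        _ ≤ _ := by
            rw [le_div_iff₀ (by positivity), add_mul]
            have e : etaConst n / D.W.r j * S * (7 * D.W.r j) = S * (7 * etaConst n) := by
              field_simp
            rw [e]
            linarith
    · rw [(hout z hz).fderiv_eq]
      simp only [fderiv_fun_const, Pi.zero_apply, norm_zero]
      exact div_nonneg (hS0.trans hA) (by positivity)

theorem eta_smul_eq_zero {j : ℕ} (hj : D.W.r j = 0) (g : E n → ℂ) :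
    (fun x => D.W.eta j x • g x) = 0 := by
  ext x
  rw [D.W.eta_eq_zero_of_r hj, zero_smul]
  rfl

theorem enorm_eta_smul_le {ℓ : (E n → ℂ) →ₗ[ℂ] ℂ} (hℓ : D.Bounds ℓ) (j : ℕ) {g : E n → ℂ}
    (hg : ContDiff ℝ ∞ g) {S T : ℝ} (hS0 : 0 ≤ S) (hT0 : 0 ≤ T)
    (hS : ∀ x ∈ Metric.closedBall (D.W.c j) (7 * D.W.r j), ‖g x‖ ≤ S)
    (hT : ∀ x ∈ Metric.closedBall (D.W.c j) (7 * D.W.r j), ‖fderiv ℝ g x‖ ≤ T) :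
    ‖ℓ fun x => D.W.eta j x • g x‖ₑ ≤
      ENNReal.ofReal ((S * (1 + 7 * etaConst n) + 7 * D.W.r j * T) * (7 * D.W.r j) ^ n) * D.lam := by
  rcases (D.W.r_nonneg j).eq_or_lt with hj | hj
  · rw [D.eta_smul_eq_zero hj.symm, map_zero, enorm_zero]
    exact zero_le
  · exact hℓ _ _ _ _ (by positivity) (D.isBump_eta_smul hj hg hS0 hT0 hS hT)
      (D.exists_mem_closedBall hj)

theorem hasSum_eta_smul (ℓ : (E n → ℂ) →ₗ[ℂ] ℂ) {g : E n → ℂ} (hg : IsTestFunction Set.univ g)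
    (hgF : ∀ x ∈ tsupport g, x ∉ D.F) :
    HasSum (fun j => ℓ fun x => D.W.eta j x • g x) (ℓ g) := by
  obtain ⟨N, hN⟩ := D.W.exists_sum_eta_eq_one (K := tsupport g) hg.2.1
    (fun x hx => D.infDist_pos (hgF x hx))
  have hsum : g = ∑ i ∈ Finset.range N, fun z => D.W.eta i z • g z := by
    ext z
    rw [Finset.sum_apply, ← Finset.sum_smul]
    by_cases hz : z ∈ tsupport g
    · rw [(hN z hz).1, one_smul]
    · rw [image_eq_zero_of_notMem_tsupport hz, smul_zero]
  have e : ℓ g = ∑ i ∈ Finset.range N, ℓ fun z => D.W.eta i z • g z := by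
    conv_lhs => rw [hsum, map_sum]
  rw [e]
  refine hasSum_sum_of_ne_finset_zero fun j hj => ?_
  have : (fun z => D.W.eta j z • g z) = 0 := by
    ext z
    by_cases hz : z ∈ tsupport g
    · rw [(hN z hz).2 j (by simpa using hj), zero_smul]; rfl
    · rw [image_eq_zero_of_notMem_tsupport hz, smul_zero]; rfl
  rw [this, map_zero]

/-- The average of `φ` over a Whitney ball. -/
def avg (j : ℕ) (φ : E n → ℂ) : ℂ := ⨍ x in Metric.ball (D.W.c j) (D.W.r j), φ x

theorem avg_add (j : ℕ) {φ ψ : E n → ℂ} (hφ : IsTestFunction Set.univ φ)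
    (hψ : IsTestFunction Set.univ ψ) : D.avg j (φ + ψ) = D.avg j φ + D.avg j ψ := by
  simp only [avg, setAverage_eq, Pi.add_apply]
  rw [integral_add (hφ.1.continuous.integrable_of_hasCompactSupport hφ.2.1).integrableOn
    (hψ.1.continuous.integrable_of_hasCompactSupport hψ.2.1).integrableOn, smul_add]

theorem avg_smul (j : ℕ) (c : ℂ) (φ : E n → ℂ) : D.avg j (c • φ) = c * D.avg j φ := by
  simp only [avg, setAverage_eq, Pi.smul_apply]
  rw [integral_smul, smul_comm, smul_eq_mul]

theorem enorm_avg_mul_le (j : ℕ) (φ : E n → ℂ) :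
    ‖D.avg j φ‖ₑ * volume (Metric.ball (D.W.c j) (D.W.r j)) ≤
      ∫⁻ x in Metric.ball (D.W.c j) (D.W.r j), ‖φ x‖ₑ := by
  rcases (D.W.r_nonneg j).eq_or_lt with hj | hj
  · simp [← hj]
  have h0 := (Metric.measure_ball_pos volume (D.W.c j) hj).ne'
  have ht := (measure_ball_lt_top (μ := volume) (x := D.W.c j) (r := D.W.r j)).ne
  have hv : 0 < volume.real (Metric.ball (D.W.c j) (D.W.r j)) := ENNReal.toReal_pos h0 ht
  rw [avg, setAverage_eq, enorm_smul, Real.enorm_of_nonneg (by positivity),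
    ENNReal.ofReal_inv_of_pos hv, Measure.real, ENNReal.ofReal_toReal ht]
  calc _ = ‖∫ x in Metric.ball (D.W.c j) (D.W.r j), φ x‖ₑ *
        ((volume (Metric.ball (D.W.c j) (D.W.r j)))⁻¹ * volume (Metric.ball (D.W.c j) (D.W.r j))) := by ring
    _ = ‖∫ x in Metric.ball (D.W.c j) (D.W.r j), φ x‖ₑ := by
        rw [ENNReal.inv_mul_cancel h0 ht, mul_one]
    _ ≤ _ := enorm_integral_le_lintegral_enorm _

theorem norm_sub_avg_le {j : ℕ} (hj : 0 < D.W.r j) {φ : E n → ℂ} (hφ : ContDiff ℝ ∞ φ) {L : ℝ}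
    (hL : ∀ y, ‖fderiv ℝ φ y‖ ≤ L) {x : E n} (hx : x ∈ Metric.closedBall (D.W.c j) (7 * D.W.r j)) :
    ‖φ x - D.avg j φ‖ ≤ 8 * D.W.r j * L := by
  have hL0 : 0 ≤ L := (norm_nonneg _).trans (hL 0)
  have h0 := (Metric.measure_ball_pos volume (D.W.c j) hj).ne'
  have ht := (measure_ball_lt_top (μ := volume) (x := D.W.c j) (r := D.W.r j)).ne
  have hv : 0 < volume.real (Metric.ball (D.W.c j) (D.W.r j)) := ENNReal.toReal_pos h0 ht
  have hc : IntegrableOn (fun _ => φ x) (Metric.ball (D.W.c j) (D.W.r j)) := integrableOn_const ht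
  have hi : IntegrableOn φ (Metric.ball (D.W.c j) (D.W.r j)) :=
    (hφ.continuous.continuousOn.integrableOn_compact
      (isCompact_closedBall (D.W.c j) (D.W.r j))).mono_set Metric.ball_subset_closedBall
  have e : φ x - D.avg j φ = ⨍ y in Metric.ball (D.W.c j) (D.W.r j), (φ x - φ y) := by
    rw [avg, setAverage_eq, setAverage_eq, integral_sub hc hi,
      setIntegral_const, smul_sub, ← smul_assoc, smul_eq_mul, inv_mul_cancel₀ hv.ne', one_smul]
  rw [e, setAverage_eq, norm_smul, norm_inv, Real.norm_of_nonneg hv.le, inv_mul_le_iff₀ hv]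
  have := norm_setIntegral_le_of_norm_le_const (μ := volume) (f := fun y => φ x - φ y)
    (C := 8 * D.W.r j * L) (s := Metric.ball (D.W.c j) (D.W.r j)) ht.lt_top (fun y hy => by
      refine (norm_sub_le_of_fderiv_le hφ hL x y).trans ?_
      have h1 : dist x (D.W.c j) ≤ 7 * D.W.r j := hx
      have h2 : dist y (D.W.c j) < D.W.r j := hy
      have h3 := dist_triangle_right x y (D.W.c j)
      rw [mul_comm]
      gcongr
      linarith)
  rw [mul_comm]
  exact this

/-- A piece of the bad part of the functional, localized by `ψ`. -/
def piece (ℓ : (E n → ℂ) →ₗ[ℂ] ℂ) (ψ : E n → ℝ) (j : ℕ) (φ : E n → ℂ) : ℂ :=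
  ℓ fun x => D.W.eta j x • (ψ x • (φ x - D.avg j φ))

theorem piece_eq (ℓ : (E n → ℂ) →ₗ[ℂ] ℂ) (ψ : E n → ℝ) (j : ℕ) (φ : E n → ℂ) :
    D.piece ℓ ψ j φ = (ℓ fun x => D.W.eta j x • (ψ x • φ x)) -
      D.avg j φ * ℓ fun x => D.W.eta j x • (ψ x • 1) := by
  rw [piece, ← smul_eq_mul, ← map_smul, ← map_sub]
  congr 1
  ext x
  simp only [Pi.sub_apply, Pi.smul_apply, Complex.real_smul, smul_eq_mul]
  ring

end Level

namespace Level

variable {n : ℕ} (D : Level n)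

theorem _root_.EllipticBoundary.summable_of_tsum_enorm_lt_top {ι : Type*} {f : ι → ℂ}
    (h : ∑' i, ‖f i‖ₑ < ⊤) : Summable f := by
  refine Summable.of_nnnorm ?_
  exact ENNReal.tsum_coe_ne_top_iff_summable.1 h.ne

theorem tsum_setLIntegral_le (μ : Measure (E n)) (f : E n → ℝ≥0∞) :
    ∑' j, ∫⁻ x in Metric.ball (D.W.c j) (D.W.r j), f x ∂μ ≤ ∫⁻ x, f x ∂μ := by
  rw [← lintegral_iUnion (fun _ => measurableSet_ball) D.W.disj]
  exact setLIntegral_le_lintegral _ _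

theorem ofReal_r_pow_eq (hn : 0 < n) (j : ℕ) : ENNReal.ofReal (D.W.r j ^ n) =
    volume (Metric.ball (D.W.c j) (D.W.r j)) / volume (Metric.ball (0 : E n) 1) := by
  rw [volume_ball_eq' hn _ (D.W.r_nonneg j), ENNReal.mul_div_cancel_right
    (volume_unitBall_pos n).ne' (volume_unitBall_lt_top n).ne]

theorem tsum_r_pow_le (hn : 0 < n) : ∑' j, ENNReal.ofReal (D.W.r j ^ n) ≤
    volume D.Fᶜ / volume (Metric.ball (0 : E n) 1) := by
  rw [ENNReal.le_div_iff_mul_le (Or.inl (volume_unitBall_pos n).ne')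
    (Or.inl (volume_unitBall_lt_top n).ne), ← ENNReal.tsum_mul_right]
  exact D.tsum_ofReal_le hn

/-- The volume of one Whitney ball is at most that of the complement of F, so r^n is at most V =
|Fᶜ|/|B(0,1)| and the additional power of r costs V^(1/n). The exponent 1 + 1/n produced here is the
source of the condition p > n/(n+1) in the telescoping arguments. -/
theorem tsum_r_pow_succ_le (hn : 0 < n) : ∑' j, ENNReal.ofReal (D.W.r j ^ (n + 1)) ≤
    (volume D.Fᶜ / volume (Metric.ball (0 : E n) 1)) ^ (1 + 1 / n : ℝ) := by
  set V := volume D.Fᶜ / volume (Metric.ball (0 : E n) 1) with hV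
  have hn' : (n : ℝ) ≠ 0 := by exact_mod_cast hn.ne'
  have h1 : ∀ j, ENNReal.ofReal (D.W.r j ^ (n + 1)) ≤
      V ^ (1 / n : ℝ) * ENNReal.ofReal (D.W.r j ^ n) := by
    intro j
    have e : ENNReal.ofReal (D.W.r j) = ENNReal.ofReal (D.W.r j ^ n) ^ (1 / n : ℝ) := by
      rw [ENNReal.ofReal_rpow_of_nonneg (pow_nonneg (D.W.r_nonneg j) n) (by positivity),
        ← Real.rpow_natCast, ← Real.rpow_mul (D.W.r_nonneg j), mul_one_div_cancel hn',
        Real.rpow_one]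
    rw [pow_succ', ENNReal.ofReal_mul (D.W.r_nonneg j)]
    refine mul_le_mul_left ?_ _
    rw [e]
    exact ENNReal.rpow_le_rpow (D.ofReal_r_pow_le hn j) (by positivity)
  calc _ ≤ ∑' j, V ^ (1 / n : ℝ) * ENNReal.ofReal (D.W.r j ^ n) := ENNReal.tsum_le_tsum h1
    _ = V ^ (1 / n : ℝ) * ∑' j, ENNReal.ofReal (D.W.r j ^ n) := ENNReal.tsum_mul_left
    _ ≤ V ^ (1 / n : ℝ) * V := mul_le_mul_right (D.tsum_r_pow_le hn) _
    _ = _ := by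
      conv_lhs => rw [← ENNReal.rpow_one V, ← ENNReal.rpow_mul, one_mul]
      rw [add_comm, ENNReal.rpow_add_of_nonneg _ _ (by positivity) (by positivity)]

/-- A constant in the estimates of the localized functionals. -/
def _root_.EllipticBoundary.levelConst (n : ℕ) (K : ℝ≥0) : ℝ≥0 :=
  (1 + 7 * etaConst n + 7 * K) * 7 ^ n

theorem enorm_eta_smul_le_of_mul_le {ℓ : (E n → ℂ) →ₗ[ℂ] ℂ} (hℓ : D.Bounds ℓ) (j : ℕ) {g : E n → ℂ}
    (hg : ContDiff ℝ ∞ g) {S T : ℝ} {K : ℝ≥0} (hS0 : 0 ≤ S) (hT0 : 0 ≤ T)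
    (hK : D.W.r j * T ≤ S * K)
    (hS : ∀ x ∈ Metric.closedBall (D.W.c j) (7 * D.W.r j), ‖g x‖ ≤ S)
    (hT : ∀ x ∈ Metric.closedBall (D.W.c j) (7 * D.W.r j), ‖fderiv ℝ g x‖ ≤ T) :
    ‖ℓ fun x => D.W.eta j x • g x‖ₑ ≤
      ENNReal.ofReal (S * levelConst n K) * ENNReal.ofReal (D.W.r j ^ n) * D.lam := by
  refine (D.enorm_eta_smul_le hℓ j hg hS0 hT0 hS hT).trans ?_
  refine mul_le_mul_left ?_ _
  have h0 := D.W.r_nonneg j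
  rw [← ENNReal.ofReal_mul (by positivity)]
  refine ENNReal.ofReal_le_ofReal ?_
  rw [mul_pow, ← mul_assoc]
  refine mul_le_mul_of_nonneg_right ?_ (by positivity)
  rw [levelConst]
  push_cast
  rw [← mul_assoc]
  refine mul_le_mul_of_nonneg_right ?_ (by positivity)
  linarith

theorem eta_smul_eq_zero_of_disjoint {j : ℕ} {g : E n → ℂ}
    (h : ∀ x ∈ Metric.closedBall (D.W.c j) (7 * D.W.r j), x ∉ tsupport g) :
    (fun x => D.W.eta j x • g x) = 0 := by
  ext x
  by_cases hx : x ∈ Metric.closedBall (D.W.c j) (7 * D.W.r j)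
  · rw [image_eq_zero_of_notMem_tsupport (h x hx), smul_zero]
    rfl
  · rw [D.W.eta_eq_zero (fun h' => hx (Metric.ball_subset_closedBall h')), zero_smul]
    rfl

theorem tsum_enorm_eta_smul_lt_top (hn : 0 < n) {ℓ : (E n → ℂ) →ₗ[ℂ] ℂ} (hℓ : D.Bounds ℓ)
    {g : E n → ℂ} (hg : IsTestFunction Set.univ g) :
    ∑' j, ‖ℓ fun x => D.W.eta j x • g x‖ₑ < ⊤ := by
  obtain ⟨S, hS⟩ := hg.exists_norm_le
  obtain ⟨T, hT⟩ := hg.exists_fderiv_le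
  obtain ⟨R, hR0, hR⟩ := D.exists_r_le hn
  have h1 : ∀ j, ‖ℓ fun x => D.W.eta j x • g x‖ₑ ≤
      ENNReal.ofReal ((1 + S) * levelConst n (R.toNNReal * T)) * ENNReal.ofReal (D.W.r j ^ n) *
        D.lam := by
    intro j
    refine D.enorm_eta_smul_le_of_mul_le hℓ j hg.1 (by positivity) T.2 ?_
      (fun x _ => (hS x).trans (by linarith)) (fun x _ => hT x)
    rw [NNReal.coe_mul, Real.coe_toNNReal R hR0]
    have h2 : D.W.r j * T ≤ R * T := mul_le_mul_of_nonneg_right (hR j) T.2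
    have h3 : 0 ≤ (S : ℝ) * (R * T) := by positivity
    calc D.W.r j * T ≤ R * T := h2
      _ ≤ (1 + S) * (R * T) := by rw [add_mul, one_mul]; linarith
  refine (ENNReal.tsum_le_tsum h1).trans_lt ?_
  rw [ENNReal.tsum_mul_right, ENNReal.tsum_mul_left]
  refine ENNReal.mul_lt_top (ENNReal.mul_lt_top ENNReal.ofReal_lt_top
    ((D.tsum_r_pow_le hn).trans_lt ?_)) D.lam_ne_top.lt_top
  exact ENNReal.div_lt_top D.volume_compl.ne (volume_unitBall_pos n).ne'

theorem summable_eta_smul (hn : 0 < n) {ℓ : (E n → ℂ) →ₗ[ℂ] ℂ} (hℓ : D.Bounds ℓ)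
    {g : E n → ℂ} (hg : IsTestFunction Set.univ g) :
    Summable fun j => ℓ fun x => D.W.eta j x • g x :=
  summable_of_tsum_enorm_lt_top (D.tsum_enorm_eta_smul_lt_top hn hℓ hg)

/-- The part of a functional that does not see the complement of `F`. -/
theorem enorm_sub_tsum_eta_smul_le (hn : 0 < n) : ∃ C : ℝ≥0, ∀ (D : Level n)
    (ℓ : (E n → ℂ) →ₗ[ℂ] ℂ), D.Bounds ℓ → ∀ (ψ : E n → ℝ) (T δ : ℝ) (S : Set (E n)),
    ContDiff ℝ ∞ ψ → (∀ x, |ψ x| ≤ 1) → (∀ x, ‖fderiv ℝ ψ x‖ ≤ T) → MeasurableSet S → 0 < δ →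
    (∀ x ∈ tsupport ψ, Metric.ball x δ ⊆ S) → ∀ φ, IsTestFunction Set.univ φ →
    ‖(ℓ fun x => ψ x • φ x) - ∑' j, ℓ fun x => D.W.eta j x • (ψ x • φ x)‖ₑ ≤
      C * (D.lam * ∫⁻ x in S, ‖φ x‖ₑ) := by
  obtain ⟨C₁, hC₁⟩ := enorm_le_lintegral_of_isBump n
  set C₂ : ℝ≥0 := 2 + levelConst n 2 * 2 ^ n with hC₂
  refine ⟨C₁ * C₂, fun D ℓ hℓ ψ T δ S hψ hψ1 hψT hS hδ hSδ => ?_⟩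
  have hT0 : 0 ≤ T := (norm_nonneg _).trans (hψT 0)
  have hv0 := (volume_unitBall_pos n).ne'
  have hvt := (volume_unitBall_lt_top n).ne
  obtain ⟨B, hB⟩ := exists_linearMap_of_test
    (fun φ => (ℓ fun x => ψ x • φ x) - ∑' j, ℓ fun x => D.W.eta j x • (ψ x • φ x))
    (by
      intro φ φ' hφ hφ'
      have e1 : (ℓ fun x => ψ x • (φ + φ') x) = (ℓ fun x => ψ x • φ x) + ℓ fun x => ψ x • φ' x := by
        rw [← map_add]; congr 1; ext x; simp only [Pi.add_apply, smul_add]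
      have e2 : ∀ j, (ℓ fun x => D.W.eta j x • (ψ x • (φ + φ') x)) =
          (ℓ fun x => D.W.eta j x • (ψ x • φ x)) + ℓ fun x => D.W.eta j x • (ψ x • φ' x) := by
        intro j
        rw [← map_add]; congr 1; ext x; simp only [Pi.add_apply, smul_add]
      rw [e1, tsum_congr e2, (D.summable_eta_smul hn hℓ (hφ.smul hψ)).tsum_add
        (D.summable_eta_smul hn hℓ (hφ'.smul hψ))]
      ring)
    (by
      intro c φ hφ
      have e1 : (ℓ fun x => ψ x • (c • φ) x) = c * (ℓ fun x => ψ x • φ x) := by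
        rw [← smul_eq_mul, ← map_smul]; congr 1; ext x
        simp only [Pi.smul_apply, smul_comm c]
      have e2 : ∀ j, (ℓ fun x => D.W.eta j x • (ψ x • (c • φ) x)) =
          c * (ℓ fun x => D.W.eta j x • (ψ x • φ x)) := by
        intro j
        rw [← smul_eq_mul, ← map_smul]; congr 1; ext x
        simp only [Pi.smul_apply, smul_comm c]
      rw [e1, tsum_congr e2, tsum_mul_left]
      ring)
  have key := hC₁ B (S.indicator fun _ => C₂ * D.lam) (measurable_const.indicator hS)
    (fun K hK => by
      refine (lintegral_mono (Set.indicator_le_self' (fun _ _ => zero_le))).trans_lt ?_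
      rw [setLIntegral_const]
      exact ENNReal.mul_lt_top (ENNReal.mul_lt_top ENNReal.coe_lt_top D.lam_ne_top.lt_top)
        hK.measure_lt_top)
    -- The bound δ/3 keeps every point of a small ball that meets the support of ψ inside S. The
    -- bound 1/(1+T) gives εT ≤ 1, so that ψφ is a bump of height 2a at the same scale.
    (min (δ / 3) (1 / (1 + T))) (by positivity) (by
      intro φ x ε a hε hεmin hφ y hy
      have hεδ : ε ≤ δ / 3 := hεmin.trans (min_le_left _ _)
      have hεT : ε * T ≤ 1 := by
        have h := hεmin.trans (min_le_right _ _)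
        rw [le_div_iff₀ (by positivity)] at h
        linarith
      have ha := hφ.nonneg
      rw [hB φ hφ.isTestFunction]
      -- On a ball that misses F the partition of unity sums to 1 and the difference is 0. Only
      -- balls that meet F remain, and there ℓ itself is bounded by `lam`.
      by_cases hF : ∀ z ∈ Metric.closedBall x ε, z ∉ D.F
      · have hs : ∀ z ∈ tsupport fun x => ψ x • φ x, z ∉ D.F := fun z hz =>
          hF z (hφ.tsupport_subset (tsupport_smul_subset ψ φ hz).2)
        rw [(D.hasSum_eta_smul ℓ (hφ.isTestFunction.smul hψ) hs).tsum_eq, sub_self, enorm_zero]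
        exact zero_le
      push Not at hF
      obtain ⟨z, hz, hzF⟩ := hF
      by_cases hψx : ∀ z ∈ Metric.closedBall x ε, z ∉ tsupport ψ
      · have h0 : (fun x => ψ x • φ x) = 0 := by
          ext w
          by_cases hw : w ∈ Metric.closedBall x ε
          · rw [image_eq_zero_of_notMem_tsupport (hψx w hw), zero_smul]; rfl
          · rw [image_eq_zero_of_notMem_tsupport (fun h => hw (hφ.tsupport_subset h)), smul_zero]
            rfl
        have h1 : ∀ j, (fun x => D.W.eta j x • (ψ x • φ x)) = 0 := by
          intro j; ext w
          have := congrFun h0 w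
          rw [this]; simp
        simp only [h0, h1, map_zero, tsum_zero, sub_zero, enorm_zero]
        exact zero_le
      push Not at hψx
      obtain ⟨w, hw, hwψ⟩ := hψx
      have hyS : y ∈ S := hSδ w hwψ (by
        rw [Metric.mem_closedBall] at hy hw
        rw [Metric.mem_ball]
        linarith [dist_triangle_right y w x])
      rw [Set.indicator_of_mem hyS]
      have hg0 : ∀ v, ‖ψ v • φ v‖ ≤ a := by
        intro v
        rw [norm_smul, Real.norm_eq_abs]
        calc _ ≤ 1 * a := mul_le_mul (hψ1 v) (hφ.norm_le v) (norm_nonneg _) zero_le_one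
          _ = a := one_mul a
      have hg1 : ∀ v, ‖fderiv ℝ (fun x => ψ x • φ x) v‖ ≤ 2 * a / ε := by
        intro v
        refine (norm_fderiv_smul_le hψ hφ.contDiff v).trans ?_
        calc _ ≤ 1 * (a / ε) + T * a := by
              gcongr
              · exact hψ1 v
              · exact hφ.fderiv_le v
              · exact hψT v
              · exact hφ.norm_le v
          _ ≤ _ := by
              rw [one_mul, div_add' _ _ _ hε.ne', div_le_div_iff_of_pos_right hε]
              nlinarith
      have hb1 : ‖ℓ fun x => ψ x • φ x‖ₑ ≤ ENNReal.ofReal (a * ε ^ n) * (2 * D.lam) := by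
        have hb : IsBump (fun x => ψ x • φ x) x ε (2 * a) :=
          ⟨hψ.smul hφ.contDiff, ((tsupport_smul_subset ψ φ).trans
            Set.inter_subset_right).trans hφ.tsupport_subset,
            fun v => (hg0 v).trans (by linarith), hg1⟩
        refine (hℓ _ x ε (2 * a) hε hb ⟨z, hzF, ?_⟩).trans (le_of_eq ?_)
        · rw [Metric.mem_closedBall] at hz ⊢
          linarith
        · rw [mul_assoc, ENNReal.ofReal_mul (by norm_num), ENNReal.ofReal_ofNat]
          ring
      have hb2 : ∀ j, ‖ℓ fun x => D.W.eta j x • (ψ x • φ x)‖ₑ ≤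
          ENNReal.ofReal (a * levelConst n 2) * D.lam / volume (Metric.ball (0 : E n) 1) *
          ∫⁻ _ in Metric.ball (D.W.c j) (D.W.r j), 1 ∂(volume.restrict (Metric.ball x (2 * ε))) := by
        intro j
        by_cases hj : ∀ z ∈ Metric.closedBall (D.W.c j) (7 * D.W.r j),
            z ∉ tsupport fun x => ψ x • φ x
        · rw [D.eta_smul_eq_zero_of_disjoint hj, map_zero, enorm_zero]
          exact zero_le
        push Not at hj
        obtain ⟨w, hw, hwφ⟩ := hj
        have hwx := hφ.tsupport_subset (tsupport_smul_subset ψ φ hwφ).2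
        have hr0 := D.W.r_nonneg j
        -- The centre of a Whitney ball is 64r away from F but at most 7r + 2ε away from z in F.
        -- Hence 57r ≤ 2ε: the Whitney balls that interact with the bump are small, disjoint and
        -- contained in B(x, 2ε), so the sum of their r^n is of order ε^n.
        have hrε : 57 * D.W.r j ≤ 2 * ε := by
          rcases hr0.eq_or_lt with h | h
          · rw [← h]; linarith
          have h1 := Metric.infDist_le_dist_of_mem (x := D.W.c j) hzF
          rw [D.infDist_c h] at h1
          rw [Metric.mem_closedBall] at hw hwx hz
          have h2 := dist_triangle4 (D.W.c j) w x z
          rw [dist_comm (D.W.c j) w, dist_comm x z] at h2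
          linarith
        have hsub : Metric.ball (D.W.c j) (D.W.r j) ⊆ Metric.ball x (2 * ε) := by
          intro v hv
          rw [Metric.mem_closedBall] at hw hwx
          rw [Metric.mem_ball] at hv ⊢
          have h2 := dist_triangle4 v (D.W.c j) w x
          rw [dist_comm (D.W.c j) w] at h2
          linarith
        rw [setLIntegral_one, Measure.restrict_apply measurableSet_ball,
          Set.inter_eq_left.2 hsub]
        refine (D.enorm_eta_smul_le_of_mul_le hℓ j (K := 2) (hψ.smul hφ.contDiff) ha
          (T := 2 * a / ε) (by positivity) ?_ (fun v _ => hg0 v) (fun v _ => hg1 v)).trans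
          (le_of_eq ?_)
        · rw [mul_div_assoc', div_le_iff₀ hε]
          push_cast
          nlinarith
        · rw [D.ofReal_r_pow_eq hn]
          simp only [div_eq_mul_inv]
          ring
      have hb3 : ‖∑' j, ℓ fun x => D.W.eta j x • (ψ x • φ x)‖ₑ ≤
          ENNReal.ofReal (a * ε ^ n) * (levelConst n 2 * 2 ^ n * D.lam) := by
        refine enorm_tsum_le_tsum_enorm.trans ?_
        refine (ENNReal.tsum_le_tsum hb2).trans ?_
        rw [ENNReal.tsum_mul_left]
        refine (mul_le_mul_right (D.tsum_setLIntegral_le _ _) _).trans (le_of_eq ?_)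
        rw [lintegral_one, Measure.restrict_apply_univ, volume_ball_eq x (by positivity),
          mul_pow, ENNReal.ofReal_mul ha, ENNReal.ofReal_mul ha,
          ENNReal.ofReal_mul (p := 2 ^ n) (by positivity), ENNReal.ofReal_coe_nnreal, ENNReal.ofReal_pow (by norm_num) n,
          ENNReal.ofReal_ofNat]
        calc _ = ENNReal.ofReal a * ENNReal.ofReal (ε ^ n) * (levelConst n 2 * 2 ^ n * D.lam) *
              (volume (Metric.ball (0 : E n) 1) / volume (Metric.ball (0 : E n) 1)) := by
              simp only [div_eq_mul_inv]
              ring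
          _ = _ := by rw [ENNReal.div_self hv0 hvt, mul_one]
      refine enorm_sub_le.trans ((add_le_add hb1 hb3).trans (le_of_eq ?_))
      rw [hC₂]
      push_cast
      ring)
  intro φ hφ
  rw [← hB φ hφ]
  refine (key φ hφ).trans (le_of_eq ?_)
  have e : ∀ y, ‖φ y‖ₑ * S.indicator (fun _ => C₂ * D.lam) y =
      S.indicator (fun y => (C₂ * D.lam) * ‖φ y‖ₑ) y := by
    intro y
    by_cases hy : y ∈ S
    · simp only [Set.indicator_of_mem hy, mul_comm]
    · simp only [Set.indicator_of_notMem hy, mul_zero]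
  simp_rw [e]
  rw [lintegral_indicator hS, lintegral_const_mul' _ _
    (ENNReal.mul_ne_top ENNReal.coe_ne_top D.lam_ne_top)]
  push_cast
  ring

end Level

namespace Level

variable {n : ℕ} (D : Level n)

/-- On the support of η_j the function φ differs from its mean by at most 8rL. Subtracting the mean
thus gains one power of r, which makes the bad part summable and small at high levels. -/
theorem enorm_piece_le {ℓ : (E n → ℂ) →ₗ[ℂ] ℂ} (hℓ : D.Bounds ℓ) (j : ℕ) {ψ : E n → ℝ} {T : ℝ}
    {K : ℝ≥0} (hT0 : 0 ≤ T) (hψ : ContDiff ℝ ∞ ψ) (hψ1 : ∀ x, |ψ x| ≤ 1)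
    (hψT : ∀ x, ‖fderiv ℝ ψ x‖ ≤ T) (hK : D.W.r j * T ≤ K) {φ : E n → ℂ} (hφ : ContDiff ℝ ∞ φ)
    {L : ℝ} (hL : ∀ y, ‖fderiv ℝ φ y‖ ≤ L) :
    ‖D.piece ℓ ψ j φ‖ₑ ≤
      ENNReal.ofReal (8 * L * levelConst n (1 + K)) * ENNReal.ofReal (D.W.r j ^ (n + 1)) * D.lam := by
  have hL0 : 0 ≤ L := (norm_nonneg _).trans (hL 0)
  rcases (D.W.r_nonneg j).eq_or_lt with hj | hj
  · rw [piece, D.eta_smul_eq_zero hj.symm, map_zero, enorm_zero]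
    exact zero_le
  have hg : ContDiff ℝ ∞ fun x => φ x - D.avg j φ := hφ.sub contDiff_const
  have hfd : ∀ x, fderiv ℝ (fun x => φ x - D.avg j φ) x = fderiv ℝ φ x := fun x =>
    fderiv_sub_const _
  refine (D.enorm_eta_smul_le_of_mul_le hℓ j (S := 8 * D.W.r j * L)
    (T := L + T * (8 * D.W.r j * L)) (K := 1 + K) (hψ.smul hg) (by positivity) (by positivity) ?_
    (fun x hx => ?_) (fun x hx => ?_)).trans (le_of_eq ?_)
  · push_cast
    have h1 : 0 ≤ D.W.r j * L := by positivity
    have h2 : D.W.r j * T * (8 * D.W.r j * L) ≤ K * (8 * D.W.r j * L) := by gcongr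
    nlinarith
  · change ‖ψ x • (φ x - D.avg j φ)‖ ≤ _
    rw [norm_smul, Real.norm_eq_abs]
    calc _ ≤ 1 * (8 * D.W.r j * L) := by
          gcongr
          · exact hψ1 x
          · exact D.norm_sub_avg_le hj hφ hL hx
      _ = _ := one_mul _
  · change ‖fderiv ℝ (fun z => ψ z • (φ z - D.avg j φ)) x‖ ≤ _
    refine (norm_fderiv_smul_le hψ hg x).trans ?_
    rw [hfd]
    calc _ ≤ 1 * L + T * (8 * D.W.r j * L) := by
          gcongr
          · exact hψ1 x
          · exact hL x
          · exact hψT x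
          · exact D.norm_sub_avg_le hj hφ hL hx
      _ = _ := by rw [one_mul]
  · rw [← ENNReal.ofReal_mul (by positivity), ← ENNReal.ofReal_mul (by positivity)]
    congr 2
    ring

theorem piece_eq_zero {ℓ : (E n → ℂ) →ₗ[ℂ] ℂ} {j : ℕ} {ψ : E n → ℝ} (φ : E n → ℂ)
    (h : ∀ x ∈ Metric.closedBall (D.W.c j) (7 * D.W.r j), x ∉ tsupport ψ) :
    D.piece ℓ ψ j φ = 0 := by
  rw [piece, D.eta_smul_eq_zero_of_disjoint, map_zero]
  exact fun x hx hx' => h x hx (tsupport_smul_subset ψ _ hx').1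

/-- The total size of the pieces of the bad part. -/
theorem tsum_enorm_piece_one_le (hn : 0 < n) {ℓ : (E n → ℂ) →ₗ[ℂ] ℂ} (hℓ : D.Bounds ℓ)
    {φ : E n → ℂ} (hφ : ContDiff ℝ ∞ φ) {L : ℝ} (hL : ∀ y, ‖fderiv ℝ φ y‖ ≤ L) :
    ∑' j, ‖D.piece ℓ (fun _ => 1) j φ‖ₑ ≤ ENNReal.ofReal (8 * L * levelConst n 1) *
      (volume D.Fᶜ / volume (Metric.ball (0 : E n) 1)) ^ (1 + 1 / n : ℝ) * D.lam := by
  have h1 : ∀ j, ‖D.piece ℓ (fun _ => 1) j φ‖ₑ ≤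
      ENNReal.ofReal (8 * L * levelConst n 1) * ENNReal.ofReal (D.W.r j ^ (n + 1)) * D.lam := by
    intro j
    have := D.enorm_piece_le hℓ j (ψ := fun _ => (1 : ℝ)) (T := 0) (K := 0) le_rfl contDiff_const
      (by simp) (by simp) (by simp) hφ hL
    rwa [add_zero] at this
  refine (ENNReal.tsum_le_tsum h1).trans ?_
  rw [ENNReal.tsum_mul_right, ENNReal.tsum_mul_left]
  exact mul_le_mul_left (mul_le_mul_right (D.tsum_r_pow_succ_le hn) _) _

theorem tsum_enorm_piece_one_lt_top (hn : 0 < n) {ℓ : (E n → ℂ) →ₗ[ℂ] ℂ} (hℓ : D.Bounds ℓ)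
    {φ : E n → ℂ} (hφ : IsTestFunction Set.univ φ) :
    ∑' j, ‖D.piece ℓ (fun _ => 1) j φ‖ₑ < ⊤ := by
  obtain ⟨L, hL⟩ := hφ.exists_fderiv_le
  refine (D.tsum_enorm_piece_one_le hn hℓ hφ.1 hL).trans_lt ?_
  refine ENNReal.mul_lt_top (ENNReal.mul_lt_top ENNReal.ofReal_lt_top
    (ENNReal.rpow_lt_top_of_nonneg (by positivity) ?_)) D.lam_ne_top.lt_top
  exact (ENNReal.div_lt_top D.volume_compl.ne (volume_unitBall_pos n).ne').ne

/-- `ψ` varies slowly at the scale of the Whitney covering, and lives on `S`. -/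
structure Adapted (ψ : E n → ℝ) (T δ : ℝ) (K : ℝ≥0) (S : Set (E n)) : Prop where
  contDiff : ContDiff ℝ ∞ ψ
  abs_le : ∀ x, |ψ x| ≤ 1
  fderiv_le : ∀ x, ‖fderiv ℝ ψ x‖ ≤ T
  measurableSet : MeasurableSet S
  pos : 0 < δ
  ball_subset : ∀ x ∈ tsupport ψ, Metric.ball x δ ⊆ S
  scale : ∀ j, 0 < D.W.r j → ∀ x ∈ Metric.closedBall (D.W.c j) (7 * D.W.r j), x ∈ tsupport ψ →
    D.W.r j * T ≤ K ∧ Metric.ball (D.W.c j) (D.W.r j) ⊆ S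

/-- The mean times the volume of a Whitney ball is at most the integral of |φ| over it, and ℓ of the
localized constant is at most C·`lam` times that volume. The balls are disjoint and those that
matter lie in S. -/
theorem tsum_enorm_avg_mul_le (hn : 0 < n) {ℓ : (E n → ℂ) →ₗ[ℂ] ℂ} (hℓ : D.Bounds ℓ) {ψ : E n → ℝ}
    {T δ : ℝ} {K : ℝ≥0} {S : Set (E n)} (hψ : D.Adapted ψ T δ K S) (φ : E n → ℂ) :
    ∑' j, ‖D.avg j φ * ℓ fun x => D.W.eta j x • (ψ x • 1)‖ₑ ≤
      levelConst n K / volume (Metric.ball (0 : E n) 1) * (D.lam * ∫⁻ x in S, ‖φ x‖ₑ) := by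
  have hT0 : 0 ≤ T := (norm_nonneg _).trans (hψ.fderiv_le 0)
  have h1 : ∀ j, ‖D.avg j φ * ℓ fun x => D.W.eta j x • (ψ x • 1)‖ₑ ≤
      levelConst n K / volume (Metric.ball (0 : E n) 1) * D.lam *
        ∫⁻ x in Metric.ball (D.W.c j) (D.W.r j), ‖φ x‖ₑ ∂(volume.restrict S) := by
    intro j
    by_cases hj : ∀ x ∈ Metric.closedBall (D.W.c j) (7 * D.W.r j),
        x ∉ tsupport fun x => ψ x • (1 : ℂ)
    · rw [D.eta_smul_eq_zero_of_disjoint hj, map_zero, mul_zero, enorm_zero]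
      exact zero_le
    push Not at hj
    obtain ⟨w, hw, hwψ⟩ := hj
    rcases (D.W.r_nonneg j).eq_or_lt with h | h
    · rw [D.eta_smul_eq_zero h.symm, map_zero, mul_zero, enorm_zero]
      exact zero_le
    obtain ⟨hK, hsub⟩ := hψ.scale j h w hw (tsupport_smul_subset ψ _ hwψ).1
    have h2 := D.enorm_eta_smul_le_of_mul_le hℓ j (g := fun x => ψ x • (1 : ℂ)) (S := 1) (T := T)
      (hψ.contDiff.smul contDiff_const) zero_le_one hT0 (by rwa [one_mul])
      (fun x _ => by simpa using hψ.abs_le x) (fun x _ => by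
        refine (norm_fderiv_smul_le hψ.contDiff contDiff_const x).trans ?_
        simpa using hψ.fderiv_le x)
    rw [enorm_mul, Measure.restrict_restrict measurableSet_ball, Set.inter_eq_left.2 hsub]
    calc _ ≤ ‖D.avg j φ‖ₑ * _ := mul_le_mul_right h2 _
      _ = levelConst n K / volume (Metric.ball (0 : E n) 1) * D.lam *
          (‖D.avg j φ‖ₑ * volume (Metric.ball (D.W.c j) (D.W.r j))) := by
          rw [D.ofReal_r_pow_eq hn, one_mul, ENNReal.ofReal_coe_nnreal]
          simp only [div_eq_mul_inv]
          ring
      _ ≤ _ := mul_le_mul_right (D.enorm_avg_mul_le j φ) _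
  refine (ENNReal.tsum_le_tsum h1).trans ?_
  rw [ENNReal.tsum_mul_left, ← mul_assoc]
  exact mul_le_mul_right (D.tsum_setLIntegral_le _ _) _

theorem summable_avg_mul (hn : 0 < n) {ℓ : (E n → ℂ) →ₗ[ℂ] ℂ} (hℓ : D.Bounds ℓ) {ψ : E n → ℝ}
    {T δ : ℝ} {K : ℝ≥0} {S : Set (E n)} (hψ : D.Adapted ψ T δ K S) {φ : E n → ℂ}
    (hφ : IsTestFunction Set.univ φ) :
    Summable fun j => D.avg j φ * ℓ fun x => D.W.eta j x • (ψ x • 1) := by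
  refine summable_of_tsum_enorm_lt_top ((D.tsum_enorm_avg_mul_le hn hℓ hψ φ).trans_lt ?_)
  refine ENNReal.mul_lt_top (ENNReal.div_lt_top ENNReal.coe_ne_top (volume_unitBall_pos n).ne')
    (ENNReal.mul_lt_top D.lam_ne_top.lt_top ?_)
  exact (hφ.1.continuous.integrable_of_hasCompactSupport hφ.2.1).integrableOn.2

theorem summable_piece (hn : 0 < n) {ℓ : (E n → ℂ) →ₗ[ℂ] ℂ} (hℓ : D.Bounds ℓ) {ψ : E n → ℝ}
    {T δ : ℝ} {K : ℝ≥0} {S : Set (E n)} (hψ : D.Adapted ψ T δ K S) {φ : E n → ℂ}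
    (hφ : IsTestFunction Set.univ φ) : Summable fun j => D.piece ℓ ψ j φ := by
  simp only [D.piece_eq]
  exact (D.summable_eta_smul hn hℓ (hφ.smul hψ.contDiff)).sub (D.summable_avg_mul hn hℓ hψ hφ)

theorem piece_add (ℓ : (E n → ℂ) →ₗ[ℂ] ℂ) (ψ : E n → ℝ) (j : ℕ) {φ φ' : E n → ℂ}
    (hφ : IsTestFunction Set.univ φ) (hφ' : IsTestFunction Set.univ φ') :
    D.piece ℓ ψ j (φ + φ') = D.piece ℓ ψ j φ + D.piece ℓ ψ j φ' := by
  rw [piece, piece, piece, ← map_add, D.avg_add j hφ hφ']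
  congr 1
  ext x
  simp only [Pi.add_apply, ← smul_add]
  congr 2
  ring

theorem piece_smul (ℓ : (E n → ℂ) →ₗ[ℂ] ℂ) (ψ : E n → ℝ) (j : ℕ) (c : ℂ) (φ : E n → ℂ) :
    D.piece ℓ ψ j (c • φ) = c * D.piece ℓ ψ j φ := by
  rw [piece, piece, ← smul_eq_mul, ← map_smul, D.avg_smul j]
  congr 1
  ext x
  simp only [Pi.smul_apply, smul_comm c, smul_eq_mul, ← mul_sub]

/-- The good part of a functional. -/
theorem enorm_sub_tsum_piece_le (hn : 0 < n) (K : ℝ≥0) : ∃ C : ℝ≥0, ∀ (D : Level n)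
    (ℓ : (E n → ℂ) →ₗ[ℂ] ℂ), D.Bounds ℓ → ∀ (ψ : E n → ℝ) (T δ : ℝ) (S : Set (E n)),
    D.Adapted ψ T δ K S → ∀ φ, IsTestFunction Set.univ φ →
    ‖(ℓ fun x => ψ x • φ x) - ∑' j, D.piece ℓ ψ j φ‖ₑ ≤ C * (D.lam * ∫⁻ x in S, ‖φ x‖ₑ) := by
  obtain ⟨C₁, hC₁⟩ := enorm_sub_tsum_eta_smul_le hn
  have hv0 := (volume_unitBall_pos n).ne'
  set C₂ : ℝ≥0∞ := levelConst n K / volume (Metric.ball (0 : E n) 1) with hC₂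
  have hC₂t : C₂ ≠ ⊤ := ENNReal.div_ne_top ENNReal.coe_ne_top hv0
  refine ⟨C₁ + C₂.toNNReal, fun D ℓ hℓ ψ T δ S hψ φ hφ => ?_⟩
  have e : (ℓ fun x => ψ x • φ x) - ∑' j, D.piece ℓ ψ j φ =
      ((ℓ fun x => ψ x • φ x) - ∑' j, ℓ fun x => D.W.eta j x • (ψ x • φ x)) +
        ∑' j, D.avg j φ * ℓ fun x => D.W.eta j x • (ψ x • 1) := by
    simp only [D.piece_eq]
    rw [(D.summable_eta_smul hn hℓ (hφ.smul hψ.contDiff)).tsum_sub (D.summable_avg_mul hn hℓ hψ hφ)]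
    ring
  rw [e]
  refine (enorm_add_le _ _).trans ((add_le_add (hC₁ D ℓ hℓ ψ T δ S hψ.contDiff hψ.abs_le
    hψ.fderiv_le hψ.measurableSet hψ.pos hψ.ball_subset φ hφ)
    (enorm_tsum_le_tsum_enorm.trans (D.tsum_enorm_avg_mul_le hn hℓ hψ φ))).trans (le_of_eq ?_))
  rw [ENNReal.coe_add, ENNReal.coe_toNNReal hC₂t, add_mul]

theorem adapted_one : D.Adapted (fun _ => 1) 0 1 0 Set.univ :=
  ⟨contDiff_const, by simp, by simp, MeasurableSet.univ, one_pos, fun _ _ => Set.subset_univ _,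
    fun _ _ _ _ _ => ⟨by simp, Set.subset_univ _⟩⟩

/-! ### Two levels -/

variable (D' : Level n)

/-- A larger closed set has smaller distances, so 64r' ≤ 64r + 7r + 7r' and hence 57r' ≤ 71r. Balls
of the higher level are at most slightly larger than the balls of the lower level that they touch.
-/
theorem r_le_of_mem (hF : D.F ⊆ D'.F) {i j : ℕ} (hi : 0 < D.W.r i) (hj : 0 < D'.W.r j) {x : E n}
    (hxi : x ∈ Metric.closedBall (D.W.c i) (7 * D.W.r i))
    (hxj : x ∈ Metric.closedBall (D'.W.c j) (7 * D'.W.r j)) : 4 * D'.W.r j ≤ 5 * D.W.r i := by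
  have h1 := Metric.infDist_le_infDist_of_subset hF D.nonempty (x := D'.W.c j)
  rw [D'.infDist_c hj] at h1
  have h2 := Metric.infDist_le_infDist_add_dist (s := D.F) (x := D'.W.c j) (y := D.W.c i)
  rw [D.infDist_c hi] at h2
  rw [Metric.mem_closedBall] at hxi hxj
  have h3 := dist_triangle_left (D'.W.c j) (D.W.c i) x
  linarith

/-- A lower-level partition function varies slowly at the scale of the higher-level balls that it
meets, by `r_le_of_mem`. Such balls lie within 7r + 8r' ≤ 17r of the centre, which explains the
radius 20r. -/
theorem adapted_eta (hF : D.F ⊆ D'.F) {i : ℕ} (hi : 0 < D.W.r i) :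
    D'.Adapted (D.W.eta i) (etaConst n / D.W.r i) (D.W.r i) (2 * etaConst n)
      (Metric.ball (D.W.c i) (20 * D.W.r i)) := by
  refine ⟨D.W.eta_contDiff i, D.W.abs_eta_le_one i, D.W.norm_fderiv_eta_le' D.lipschitz i,
    measurableSet_ball, hi, fun x hx y hy => ?_, fun j hj x hx hxi => ?_⟩
  · have h1 := D.W.tsupport_eta_subset i hx
    rw [Metric.mem_closedBall] at h1
    rw [Metric.mem_ball] at hy ⊢
    linarith [dist_triangle y x (D.W.c i)]
  · have hxi := D.W.tsupport_eta_subset i hxi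
    have h1 := D.r_le_of_mem D' hF hi hj hxi hx
    have hK : (0 : ℝ) ≤ etaConst n := NNReal.coe_nonneg _
    refine ⟨?_, fun y hy => ?_⟩
    · rw [mul_div_assoc', div_le_iff₀ hi]
      push_cast
      nlinarith
    · rw [Metric.mem_closedBall] at hxi hx
      rw [Metric.mem_ball] at hy ⊢
      have h2 := dist_triangle4 y (D'.W.c j) x (D.W.c i)
      rw [dist_comm (D'.W.c j) x] at h2
      linarith

/-- A multiple of an atom, in terms of the functional. -/
def atomPart (ℓ : (E n → ℂ) →ₗ[ℂ] ℂ) (i : ℕ) (φ : E n → ℂ) : ℂ :=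
  D.piece ℓ (fun _ => 1) i φ - ∑' j, D'.piece ℓ (D.W.eta i) j φ

/-- The functional is the good part, at the higher level, of ℓ localized by η_i, minus a mean
correction at the lower level. Both are at most C·λ' times the L¹ norm of φ on the 20-fold ball,
where λ' is the higher level, so a function of size C·λ' supported there represents the functional.
Its mean vanishes because pieces annihilate functions that are constant near their supports. -/
theorem exists_atomPart_eq (hn : 0 < n) : ∃ C : ℝ≥0, ∀ (D D' : Level n) (ℓ : (E n → ℂ) →ₗ[ℂ] ℂ),
    D.Bounds ℓ → D'.Bounds ℓ → D.F ⊆ D'.F → D.lam ≤ D'.lam → ∀ i, 0 < D.W.r i →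
    ∃ a : E n → ℂ, AEStronglyMeasurable a volume ∧
      (∀ᵐ x, ‖a x‖ₑ ≤ (Metric.ball (D.W.c i) (20 * D.W.r i)).indicator (fun _ => C * D'.lam) x) ∧
      LocallyIntegrable a ∧ ∫ x, a x = 0 ∧
      ∀ φ, IsTestFunction Set.univ φ → D.atomPart D' ℓ i φ = ∫ x, a x * φ x := by
  obtain ⟨C₁, hC₁⟩ := enorm_sub_tsum_piece_le hn (2 * etaConst n)
  have hv0 := (volume_unitBall_pos n).ne'
  set C₂ : ℝ≥0∞ := levelConst n 0 / volume (Metric.ball (0 : E n) 1) with hC₂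
  have hC₂t : C₂ ≠ ⊤ := ENNReal.div_ne_top ENNReal.coe_ne_top hv0
  refine ⟨C₁ + C₂.toNNReal, fun D D' ℓ hℓ hℓ' hF hlam i hi => ?_⟩
  set S := Metric.ball (D.W.c i) (20 * D.W.r i) with hS
  have hsub : Metric.ball (D.W.c i) (D.W.r i) ⊆ S := Metric.ball_subset_ball (by linarith)
  have had := D.adapted_eta D' hF hi
  have hbd : ∀ φ, IsTestFunction Set.univ φ →
      ‖D.atomPart D' ℓ i φ‖ₑ ≤ (C₁ + C₂.toNNReal : ℝ≥0) * D'.lam * ∫⁻ x in S, ‖φ x‖ₑ := by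
    intro φ hφ
    have h1 := hC₁ D' ℓ hℓ' _ _ _ _ had φ hφ
    have h2 : ‖D.avg i φ * ℓ fun x => D.W.eta i x • ((1 : ℝ) • 1)‖ₑ ≤
        C₂ * (D'.lam * ∫⁻ x in S, ‖φ x‖ₑ) := by
      rw [enorm_mul]
      have h3 := D.enorm_eta_smul_le_of_mul_le hℓ i (g := fun x => (1 : ℝ) • (1 : ℂ)) (S := 1)
        (T := 0) (K := 0) contDiff_const zero_le_one le_rfl (by simp) (by simp) (by simp)
      calc _ ≤ ‖D.avg i φ‖ₑ * _ := mul_le_mul_right h3 _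
        _ = C₂ * D.lam * (‖D.avg i φ‖ₑ * volume (Metric.ball (D.W.c i) (D.W.r i))) := by
            rw [D.ofReal_r_pow_eq hn, one_mul, ENNReal.ofReal_coe_nnreal, hC₂]
            simp only [div_eq_mul_inv]
            ring
        _ ≤ C₂ * D.lam * ∫⁻ x in S, ‖φ x‖ₑ :=
            mul_le_mul_right ((D.enorm_avg_mul_le i φ).trans (lintegral_mono_set hsub)) _
        _ ≤ C₂ * (D'.lam * ∫⁻ x in S, ‖φ x‖ₑ) := by
            rw [mul_assoc]
            exact mul_le_mul_right (mul_le_mul_left hlam _) _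
    have e : D.atomPart D' ℓ i φ = ((ℓ fun x => D.W.eta i x • φ x) -
        ∑' j, D'.piece ℓ (D.W.eta i) j φ) - D.avg i φ * ℓ fun x => D.W.eta i x • ((1 : ℝ) • 1) := by
      rw [atomPart, piece_eq]
      simp only [one_smul]
      ring
    rw [e]
    refine enorm_sub_le.trans ((add_le_add h1 h2).trans (le_of_eq ?_))
    rw [ENNReal.coe_add, ENNReal.coe_toNNReal hC₂t]
    ring
  obtain ⟨B, hB⟩ := exists_linearMap_of_test (D.atomPart D' ℓ i)
    (fun φ φ' hφ hφ' => by
      rw [atomPart, atomPart, atomPart, D.piece_add ℓ _ i hφ hφ',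
        tsum_congr fun j => D'.piece_add ℓ _ j hφ hφ',
        (D'.summable_piece hn hℓ' had hφ).tsum_add (D'.summable_piece hn hℓ' had hφ')]
      ring)
    (fun c φ _ => by
      rw [atomPart, atomPart, D.piece_smul, tsum_congr fun j => D'.piece_smul ℓ _ j c φ,
        tsum_mul_left]
      ring)
  set lam' : ℝ≥0∞ := (C₁ + C₂.toNNReal : ℝ≥0) * D'.lam with hlam'
  have hlt : lam' ≠ ⊤ := ENNReal.mul_ne_top ENNReal.coe_ne_top D'.lam_ne_top
  obtain ⟨a, ham, hab, hai, ha⟩ := exists_eq_integral_of_enorm_le B (w := S.indicator fun _ => lam')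
    (measurable_const.indicator measurableSet_ball) 0 (by
      simp only [pow_zero, ENNReal.ofReal_one, div_one]
      rw [lintegral_indicator measurableSet_ball, setLIntegral_const]
      exact ENNReal.mul_lt_top hlt.lt_top measure_ball_lt_top)
    (fun φ hφ => by
      rw [hB φ hφ]
      refine (hbd φ hφ).trans (le_of_eq ?_)
      rw [← lintegral_const_mul' _ _ hlt, ← lintegral_indicator (s := S) measurableSet_ball]
      refine lintegral_congr fun x => ?_
      by_cases hx : x ∈ S
      · simp only [Set.indicator_of_mem hx, mul_comm]
      · simp only [Set.indicator_of_notMem hx, mul_zero])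
  refine ⟨a, ham, hab, hai, ?_, fun φ hφ => by rw [← hB φ hφ, ha φ hφ]⟩
  -- A test function equal to 1 on the ball of radius 40r, which contains the support of a and the
  -- supports of all pieces involved at both levels.
  let b : ContDiffBump (D.W.c i) := ⟨40 * D.W.r i, 41 * D.W.r i, by positivity, by linarith⟩
  set φ : E n → ℂ := fun x => (b x : ℂ) with hφdef
  have hφ : IsTestFunction Set.univ φ := by
    refine ⟨Complex.ofRealCLM.contDiff.comp b.contDiff, ?_, Set.subset_univ _⟩
    exact b.hasCompactSupport.comp_left (g := fun t : ℝ => (t : ℂ)) Complex.ofReal_zero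
  have hφ1 : ∀ x ∈ Metric.closedBall (D.W.c i) (40 * D.W.r i), φ x = 1 := fun x hx => by
    simp only [hφdef, b.one_of_mem_closedBall hx, Complex.ofReal_one]
  have hone : ∀ (D'' : Level n) (ψ : E n → ℝ) (j : ℕ),
      Metric.closedBall (D''.W.c j) (7 * D''.W.r j) ⊆ Metric.closedBall (D.W.c i) (40 * D.W.r i) →
      0 < D''.W.r j → D''.piece ℓ ψ j φ = 0 := by
    intro D'' ψ j hsub' hj
    have havg : D''.avg j φ = 1 := by
      have h0 := (Metric.measure_ball_pos volume (D''.W.c j) hj).ne'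
      have ht := (measure_ball_lt_top (μ := volume) (x := D''.W.c j) (r := D''.W.r j)).ne
      rw [avg, setAverage_eq, setIntegral_congr_fun (g := fun _ => (1 : ℂ)) measurableSet_ball
        (fun x hx => hφ1 x (hsub' (Metric.ball_subset_closedBall
          (Metric.ball_subset_ball (by linarith) hx)))), setIntegral_const, ← smul_assoc,
        smul_eq_mul, inv_mul_cancel₀, one_smul]
      exact (ENNReal.toReal_pos h0 ht).ne'
    have : (fun x => D''.W.eta j x • (ψ x • (φ x - D''.avg j φ))) = 0 := by
      ext x
      by_cases hx : x ∈ Metric.closedBall (D''.W.c j) (7 * D''.W.r j)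
      · rw [hφ1 x (hsub' hx), havg, sub_self, smul_zero, smul_zero]; rfl
      · rw [D''.W.eta_eq_zero (fun h' => hx (Metric.ball_subset_closedBall h')), zero_smul]; rfl
    rw [piece, this, map_zero]
  have h0 : D.atomPart D' ℓ i φ = 0 := by
    have h1 : ∀ j, D'.piece ℓ (D.W.eta i) j φ = 0 := by
      intro j
      by_cases hj : ∀ x ∈ Metric.closedBall (D'.W.c j) (7 * D'.W.r j), x ∉ tsupport (D.W.eta i)
      · exact D'.piece_eq_zero φ hj
      push Not at hj
      obtain ⟨w, hw, hwi⟩ := hj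
      have hwi := D.W.tsupport_eta_subset i hwi
      rcases (D'.W.r_nonneg j).eq_or_lt with h | h
      · rw [piece, D'.eta_smul_eq_zero h.symm, map_zero]
      refine hone D' _ j (fun y hy => ?_) h
      have h1 := D.r_le_of_mem D' hF hi h hwi hw
      rw [Metric.mem_closedBall] at hy hw hwi ⊢
      have h2 := dist_triangle4 y (D'.W.c j) w (D.W.c i)
      rw [dist_comm (D'.W.c j) w] at h2
      linarith
    rw [atomPart, hone D _ i (Metric.closedBall_subset_closedBall (by linarith)) hi, tsum_congr h1,
      tsum_zero, sub_zero]
  rw [← h0, ← hB φ hφ, ha φ hφ]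
  refine integral_congr_ae ?_
  filter_upwards [hab] with x hx
  by_cases hxS : x ∈ S
  · have : x ∈ Metric.closedBall (D.W.c i) (40 * D.W.r i) :=
      Metric.ball_subset_closedBall (Metric.ball_subset_ball (by linarith) hxS)
    rw [hφ1 x this, mul_one]
  · rw [Set.indicator_of_notMem hxS, nonpos_iff_eq_zero, enorm_eq_zero] at hx
    rw [hx, zero_mul]

end Level

namespace Level

variable {n : ℕ} (D D' : Level n)

/-- A higher-level Whitney ball stays in the complement of the larger set, hence of the smaller one,
where the lower-level partition of unity sums to 1. This redistributes the higher-level bad part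
over the lower-level balls. -/
theorem hasSum_piece_eta (ℓ : (E n → ℂ) →ₗ[ℂ] ℂ) (hF : D.F ⊆ D'.F) (j : ℕ) (φ : E n → ℂ) :
    HasSum (fun i => D'.piece ℓ (D.W.eta i) j φ) (D'.piece ℓ (fun _ => 1) j φ) := by
  rcases (D'.W.r_nonneg j).eq_or_lt with h | h
  · simp only [piece, D'.eta_smul_eq_zero h.symm, map_zero]
    exact hasSum_zero
  obtain ⟨N, hN⟩ := D.W.exists_sum_eta_eq_one
    (isCompact_closedBall (D'.W.c j) (7 * D'.W.r j))
    (fun x hx => D.infDist_pos fun hxF => D'.notMem_of_mem_ball hx h (hF hxF))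
  have e : D'.piece ℓ (fun _ => 1) j φ = ∑ i ∈ Finset.range N, D'.piece ℓ (D.W.eta i) j φ := by
    simp only [piece]
    rw [← map_sum]
    congr 1
    ext x
    rw [Finset.sum_apply]
    by_cases hx : x ∈ Metric.closedBall (D'.W.c j) (7 * D'.W.r j)
    · rw [← Finset.smul_sum, ← Finset.sum_smul, (hN x hx).1]
    · simp [D'.W.eta_eq_zero (fun h' => hx (Metric.ball_subset_closedBall h'))]
  rw [e]
  refine hasSum_sum_of_ne_finset_zero fun i hi => ?_
  have : (fun x => D'.W.eta j x • (D.W.eta i x • (φ x - D'.avg j φ))) = 0 := by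
    ext x
    by_cases hx : x ∈ Metric.closedBall (D'.W.c j) (7 * D'.W.r j)
    · rw [(hN x hx).2 i (by simpa using hi), zero_smul, smul_zero]; rfl
    · rw [D'.W.eta_eq_zero (fun h' => hx (Metric.ball_subset_closedBall h')), zero_smul]; rfl
  rw [piece, this, map_zero]

/-- If η_i meets the j-th higher-level ball then the centre of that ball lies in the 20-fold i-th
ball. By bounded overlap at most 43^n indices i count for each j. This absolute convergence
justifies exchanging the two sums. -/
theorem tsum_tsum_piece_eta_lt_top (hn : 0 < n) {ℓ : (E n → ℂ) →ₗ[ℂ] ℂ} (hℓ' : D'.Bounds ℓ)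
    (hF : D.F ⊆ D'.F) {φ : E n → ℂ} (hφ : IsTestFunction Set.univ φ) :
    ∑' j, ∑' i, ‖D'.piece ℓ (D.W.eta i) j φ‖ₑ < ⊤ := by
  obtain ⟨L, hL⟩ := hφ.exists_fderiv_le
  have hK : (0 : ℝ) ≤ etaConst n := NNReal.coe_nonneg _
  have h1 : ∀ j i, ‖D'.piece ℓ (D.W.eta i) j φ‖ₑ ≤
      ENNReal.ofReal (8 * L * levelConst n (1 + 2 * etaConst n)) *
        ENNReal.ofReal (D'.W.r j ^ (n + 1)) * D'.lam *
        (Metric.ball (D.W.c i) (20 * D.W.r i)).indicator 1 (D'.W.c j) := by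
    intro j i
    by_cases hj : ∀ x ∈ Metric.closedBall (D'.W.c j) (7 * D'.W.r j), x ∉ tsupport (D.W.eta i)
    · rw [D'.piece_eq_zero φ hj, enorm_zero]
      exact zero_le
    push Not at hj
    obtain ⟨w, hw, hwi⟩ := hj
    rcases (D'.W.r_nonneg j).eq_or_lt with h | h
    · rw [piece, D'.eta_smul_eq_zero h.symm, map_zero, enorm_zero]
      exact zero_le
    have hi : 0 < D.W.r i := by
      refine (D.W.r_nonneg i).lt_of_ne fun h0 => ?_
      have : D.W.eta i = 0 := funext fun x => D.W.eta_eq_zero_of_r h0.symm x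
      rw [this] at hwi
      simp at hwi
    have hwi := D.W.tsupport_eta_subset i hwi
    have hr := D.r_le_of_mem D' hF hi h hwi hw
    have hmem : D'.W.c j ∈ Metric.ball (D.W.c i) (20 * D.W.r i) := by
      rw [Metric.mem_closedBall] at hw hwi
      rw [Metric.mem_ball]
      have := dist_triangle_left (D'.W.c j) (D.W.c i) w
      linarith
    rw [Set.indicator_of_mem hmem, Pi.one_apply, mul_one]
    refine D'.enorm_piece_le hℓ' j (T := etaConst n / D.W.r i) (by positivity) (D.W.eta_contDiff i)
      (D.W.abs_eta_le_one i) (D.W.norm_fderiv_eta_le' D.lipschitz i) ?_ hφ.1 hL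
    rw [mul_div_assoc', div_le_iff₀ hi]
    push_cast
    nlinarith
  calc _ ≤ ∑' j, ENNReal.ofReal (8 * L * levelConst n (1 + 2 * etaConst n)) *
        ENNReal.ofReal (D'.W.r j ^ (n + 1)) * D'.lam * 43 ^ n := by
        refine ENNReal.tsum_le_tsum fun j => (ENNReal.tsum_le_tsum (h1 j)).trans ?_
        rw [ENNReal.tsum_mul_left]
        exact mul_le_mul_right (D.W.tsum_overlap_le D.lipschitz _) _
    _ < ⊤ := by
        rw [ENNReal.tsum_mul_right, ENNReal.tsum_mul_right, ENNReal.tsum_mul_left]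
        refine ENNReal.mul_lt_top (ENNReal.mul_lt_top (ENNReal.mul_lt_top ENNReal.ofReal_lt_top
          ((D'.tsum_r_pow_succ_le hn).trans_lt ?_)) D'.lam_ne_top.lt_top)
          (ENNReal.pow_lt_top (by norm_num))
        exact ENNReal.rpow_lt_top_of_nonneg (by positivity)
          (ENNReal.div_lt_top D'.volume_compl.ne (volume_unitBall_pos n).ne').ne

/-- The difference of two consecutive bad parts, regrouped by the lower-level balls. This is one
term of the telescoping series. -/
theorem hasSum_atomPart (hn : 0 < n) {ℓ : (E n → ℂ) →ₗ[ℂ] ℂ} (hℓ : D.Bounds ℓ)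
    (hℓ' : D'.Bounds ℓ) (hF : D.F ⊆ D'.F) {φ : E n → ℂ} (hφ : IsTestFunction Set.univ φ) :
    HasSum (fun i => D.atomPart D' ℓ i φ)
      (∑' i, D.piece ℓ (fun _ => 1) i φ - ∑' j, D'.piece ℓ (fun _ => 1) j φ) := by
  have hs : Summable fun q : ℕ × ℕ => D'.piece ℓ (D.W.eta q.2) q.1 φ := by
    refine summable_of_tsum_enorm_lt_top ?_
    rw [ENNReal.tsum_prod (f := fun j i => ‖D'.piece ℓ (D.W.eta i) j φ‖ₑ)]
    exact D.tsum_tsum_piece_eta_lt_top D' hn hℓ' hF hφ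
  have h1 : HasSum (fun i => ∑' j, D'.piece ℓ (D.W.eta i) j φ)
      (∑' j, D'.piece ℓ (fun _ => 1) j φ) := by
    have e : ∑' j, D'.piece ℓ (fun _ => 1) j φ = ∑' q : ℕ × ℕ, D'.piece ℓ (D.W.eta q.2) q.1 φ := by
      rw [hs.tsum_prod]
      exact tsum_congr fun j => (D.hasSum_piece_eta D' ℓ hF j φ).tsum_eq.symm
    rw [e]
    have h2 := hs.prod_symm
    have h3 : ∑' q : ℕ × ℕ, D'.piece ℓ (D.W.eta q.2) q.1 φ =
        ∑' q : ℕ × ℕ, D'.piece ℓ (D.W.eta q.swap.2) q.swap.1 φ :=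
      ((Equiv.prodComm ℕ ℕ).tsum_eq fun q : ℕ × ℕ => D'.piece ℓ (D.W.eta q.2) q.1 φ).symm
    rw [h3]
    exact h2.hasSum.prod_fiberwise fun i => (h2.prod_factor i).hasSum
  exact (summable_of_tsum_enorm_lt_top (D.tsum_enorm_piece_one_lt_top hn hℓ hφ)).hasSum.sub h1

end Level

/-! ### Atomic and L^p representations of functionals controlled on bump functions. -/

theorem exists_infDist_le {n : ℕ} (hn : 0 < n) {F : Set (E n)} (hF : volume Fᶜ < ⊤) :
    ∃ R : ℝ, ∀ x, Metric.infDist x F ≤ R := by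
  set V := volume Fᶜ / volume (Metric.ball (0 : E n) 1) with hV
  have hVt : V ≠ ⊤ := ENNReal.div_ne_top hF.ne (volume_unitBall_pos n).ne'
  refine ⟨max 1 V.toReal, fun x => ?_⟩
  rcases le_total (Metric.infDist x F) 1 with h | h
  · exact h.trans (le_max_left _ _)
  · refine le_trans ?_ (le_max_right _ _)
    refine (le_self_pow₀ h hn.ne').trans ?_
    refine (ENNReal.ofReal_le_iff_le_toReal hVt).1 ?_
    rw [hV, ENNReal.le_div_iff_mul_le (Or.inl (volume_unitBall_pos n).ne')
      (Or.inl (volume_unitBall_lt_top n).ne), ← volume_ball_eq' hn x (by linarith)]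
    exact measure_mono (Metric.disjoint_ball_infDist (x := x) (s := F)).subset_compl_right

theorem volume_univ_eq_top {n : ℕ} (hn : 0 < n) : volume (Set.univ : Set (E n)) = ⊤ := by
  have : Nonempty (Fin n) := ⟨⟨0, hn⟩⟩
  exact measure_univ_of_isAddLeftInvariant volume

/-- The sublevel set of a lower semicontinuous function, with a Whitney covering. -/
theorem exists_level {n : ℕ} (hn : 0 < n) {M : E n → ℝ≥0∞} (hM : LowerSemicontinuous M) {t : ℝ≥0∞}
    (ht : t ≠ ⊤) (hv : volume {x | t < M x} < ⊤) :
    ∃ D : Level n, D.F = {x | M x ≤ t} ∧ D.lam = t := by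
  have hc : ({x | M x ≤ t} : Set (E n))ᶜ = {x | t < M x} := by
    ext x
    simp
  obtain ⟨R, hR⟩ := exists_infDist_le hn (F := {x | M x ≤ t}) (by rwa [hc])
  obtain ⟨W⟩ := exists_whitneyCover (fun x => Metric.infDist x {x | M x ≤ t} / 64) (R / 64)
    (fun x => by linarith [hR x])
  refine ⟨⟨{x | M x ≤ t}, ?_, ?_, by rwa [hc], W, t, ht⟩, rfl, rfl⟩
  · exact hM.isClosed_preimage t
  · by_contra h
    rw [Set.not_nonempty_iff_eq_empty] at h
    rw [← hc, h, Set.compl_empty, volume_univ_eq_top hn] at hv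
    exact lt_irrefl _ hv

theorem Level.exists_atom {n : ℕ} (hn : 0 < n) {p : ℝ} (hp0 : 0 < p) :
    ∃ C : ℝ≥0, ∀ (D D' : Level n) (ℓ : (E n → ℂ) →ₗ[ℂ] ℂ),
    D.Bounds ℓ → D'.Bounds ℓ → D.F ⊆ D'.F → D.lam ≤ D'.lam → D'.lam ≠ 0 → ∀ i,
    ∃ (l : ℂ) (a : E n → ℂ), IsAtom p a ∧
      ‖l‖ₑ ^ p ≤ C * (D'.lam ^ p * volume (Metric.ball (D.W.c i) (D.W.r i))) ∧
      ∀ φ, IsTestFunction Set.univ φ → D.atomPart D' ℓ i φ = l * ∫ x, a x * φ x := by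
  obtain ⟨C, hC⟩ := Level.exists_atomPart_eq hn
  have hCt : ((C : ℝ≥0∞) + 1) ^ p * 20 ^ n ≠ ⊤ :=
    ENNReal.mul_ne_top (ENNReal.rpow_ne_top_of_nonneg hp0.le (by simp)) (by simp)
  refine ⟨(((C : ℝ≥0∞) + 1) ^ p * 20 ^ n).toNNReal, fun D D' ℓ hℓ hℓ' hF hlam hlam0 i => ?_⟩
  rw [ENNReal.coe_toNNReal hCt]
  rcases (D.W.r_nonneg i).eq_or_lt with hi | hi
  · refine ⟨0, fun _ => 0, isAtom_zero p, ?_, fun φ _ => ?_⟩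
    · rw [enorm_zero, ENNReal.zero_rpow_of_pos hp0]
      exact zero_le
    · rw [Level.atomPart, Level.piece, D.eta_smul_eq_zero hi.symm, map_zero, zero_mul, zero_sub,
        neg_eq_zero]
      refine (tsum_congr fun j => ?_).trans tsum_zero
      have : D.W.eta i = 0 := funext fun x => D.W.eta_eq_zero_of_r hi.symm x
      refine D'.piece_eq_zero φ fun x _ => ?_
      rw [this]
      simp
  obtain ⟨a, ham, hab, -, ha0, ha⟩ := hC D D' ℓ hℓ hℓ' hF hlam i hi
  set c := D.W.c i
  set r := D.W.r i
  -- The summand 1 keeps the normalizing constant positive even if C = 0.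
  have hbt : ((C : ℝ≥0∞) + 1) * D'.lam ≠ ⊤ := ENNReal.mul_ne_top (by simp) D'.lam_ne_top
  set b : ℝ := (((C : ℝ≥0∞) + 1) * D'.lam).toReal with hb
  have hb0 : 0 < b := ENNReal.toReal_pos (mul_ne_zero (by simp) hlam0) hbt
  have hr : 0 < 20 * r := by positivity
  have hv : 0 < volume.real (Metric.ball c (20 * r)) := by
    rw [volume_real_ball c hr]
    have := volume_real_unitBall_pos n
    positivity
  refine ⟨((b * volume.real (Metric.ball c (20 * r)) ^ (1 / p) : ℝ) : ℂ), _,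
    isAtom_of_bounded (c := c) ham hr hb0 ?_ ?_ ha0, ?_, fun φ hφ => ?_⟩
  · filter_upwards [hab] with x hx hxS
    rwa [Set.indicator_of_notMem hxS, nonpos_iff_eq_zero, enorm_eq_zero] at hx
  · filter_upwards [hab] with x hx
    have h1 : ‖a x‖ₑ ≤ ((C : ℝ≥0∞) + 1) * D'.lam := by
      refine hx.trans ((Set.indicator_le_self' (fun _ _ => zero_le) x).trans ?_)
      exact mul_le_mul_left le_self_add _
    rw [hb, ← toReal_enorm]
    exact ENNReal.toReal_mono hbt h1
  · have e : ‖((b * volume.real (Metric.ball c (20 * r)) ^ (1 / p) : ℝ) : ℂ)‖ₑ =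
        ENNReal.ofReal (b * volume.real (Metric.ball c (20 * r)) ^ (1 / p)) := by
      rw [← ofReal_norm, Complex.norm_real, Real.norm_of_nonneg (by positivity)]
    rw [e, ENNReal.ofReal_rpow_of_nonneg (by positivity) hp0.le,
      Real.mul_rpow hb0.le (by positivity), ← Real.rpow_mul hv.le, one_div_mul_cancel hp0.ne',
      Real.rpow_one, ENNReal.ofReal_mul (by positivity), ← ENNReal.ofReal_rpow_of_pos hb0, hb,
      ENNReal.ofReal_toReal hbt, Measure.real, ENNReal.ofReal_toReal measure_ball_lt_top.ne,
      ENNReal.mul_rpow_of_nonneg _ _ hp0.le, volume_ball_eq c hr, volume_ball_eq c hi, mul_pow,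
      ENNReal.ofReal_mul (by positivity), ENNReal.ofReal_pow (by norm_num), ENNReal.ofReal_ofNat]
    refine le_of_eq ?_
    ring
  · rw [ha φ hφ, ← integral_const_mul]
    refine integral_congr_ae (ae_of_all _ fun x => ?_)
    simp only
    rw [← mul_assoc, ← mul_assoc, mul_inv_cancel₀, one_mul]
    exact_mod_cast (by positivity : b * volume.real (Metric.ball c (20 * r)) ^ (1 / p) ≠ 0)

/-- The two halves of the sum over ℤ telescope to b 0 and to L - b 0. -/
theorem eq_of_hasSum_telescope {b : ℤ → ℂ} {S L : ℂ} (hS : HasSum (fun k => b k - b (k + 1)) S)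
    (h0 : Tendsto (fun N : ℕ => b N) atTop (𝓝 0))
    (hL : Tendsto (fun N : ℕ => b (-N)) atTop (𝓝 L)) : S = L := by
  have h1 : HasSum (fun N : ℕ => b N - b (N + 1)) (b 0) := by
    have hs : Summable fun N : ℕ => b (N : ℤ) - b ((N : ℤ) + 1) :=
      hS.summable.comp_injective (i := fun N : ℕ => (N : ℤ)) Nat.cast_injective
    refine (hs.hasSum_iff_tendsto_nat).2 ?_
    have e : ∀ N : ℕ, ∑ i ∈ Finset.range N, (b (i : ℤ) - b ((i : ℤ) + 1)) = b 0 - b N := by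
      intro N
      have := Finset.sum_range_sub' (fun i : ℕ => b (i : ℤ)) N
      simpa using this
    simp only [e]
    simpa using h0.const_sub (b 0)
  have h2 : HasSum (fun N : ℕ => b (-(N + 1)) - b (-(N + 1) + 1)) (L - b 0) := by
    have hs : Summable fun N : ℕ => b (-((N : ℤ) + 1)) - b (-((N : ℤ) + 1) + 1) :=
      hS.summable.comp_injective (i := fun N : ℕ => -((N : ℤ) + 1)) fun a b h => by
        simpa using h
    refine (hs.hasSum_iff_tendsto_nat).2 ?_
    have e : ∀ N : ℕ, ∑ i ∈ Finset.range N, (b (-((i : ℤ) + 1)) - b (-((i : ℤ) + 1) + 1)) =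
        b (-N) - b 0 := by
      intro N
      have := Finset.sum_range_sub (fun i : ℕ => b (-(i : ℤ))) N
      simpa using this
    simp only [e]
    exact hL.sub_const (b 0)
  have h3 := h1.of_nat_of_neg_add_one (f := fun k => b k - b (k + 1)) h2
  rw [hS.unique h3]
  ring

/-- The dyadic layer-cake bound, integrated. It makes the coefficients of the decompositions below
summable in ℓ^p. -/
theorem tsum_zpow_volume_lt_le {n : ℕ} {p : ℝ} (hp : 0 < p) : ∃ C : ℝ≥0, ∀ M : E n → ℝ≥0∞,
    Measurable M → ∑' k : ℤ, ((2 : ℝ≥0∞) ^ k) ^ p * volume {x | (2 : ℝ≥0∞) ^ k < M x} ≤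
      C * ∫⁻ x, M x ^ p := by
  obtain ⟨C, hC⟩ := tsum_zpow_rpow_lt_le hp
  refine ⟨C, fun M hM => ?_⟩
  have hset : ∀ k : ℤ, MeasurableSet {x | (2 : ℝ≥0∞) ^ k < M x} := fun k =>
    measurableSet_lt measurable_const hM
  have e : ∀ k : ℤ, ((2 : ℝ≥0∞) ^ k) ^ p * volume {x | (2 : ℝ≥0∞) ^ k < M x} =
      ∫⁻ x, if (2 : ℝ≥0∞) ^ k < M x then ((2 : ℝ≥0∞) ^ k) ^ p else 0 := by
    intro k
    rw [← setLIntegral_const, ← lintegral_indicator (hset k)]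
    refine lintegral_congr fun x => ?_
    simp only [Set.indicator_apply, Set.mem_ofPred_eq]
  simp_rw [e]
  rw [← lintegral_tsum fun k => (Measurable.ite (hset k) measurable_const measurable_const).aemeasurable,
    ← lintegral_const_mul' _ _ ENNReal.coe_ne_top]
  exact lintegral_mono fun x => hC (M x)

/-- A functional controlled by a function in `L^p`, `p ≤ 1`, on bump functions is in `H^p`. -/
theorem exists_atomic_of_bump {n : ℕ} (hn : 0 < n) {p : ℝ} (hp0 : 0 < p)
    (hp : (n : ℝ) / (n + 1) < p) (hp1 : p ≤ 1) :
    ∃ C : ℝ≥0, ∀ (ℓ : (E n → ℂ) →ₗ[ℂ] ℂ) (M : E n → ℝ≥0∞), LowerSemicontinuous M →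
      ∫⁻ x, M x ^ p < ⊤ →
      (∀ φ x r a, 0 < r → IsBump φ x r a → ∀ y ∈ Metric.closedBall x (10 * r),
        ‖ℓ φ‖ₑ ≤ ENNReal.ofReal (a * r ^ n) * M y) →
      ∃ T : 𝓢'(E n, ℂ), atomicNorm p T ≤ C * (∫⁻ x, M x ^ p) ^ (1 / p) ∧
        ∀ φ : 𝓢(E n, ℂ), HasCompactSupport φ → T φ = ℓ φ := by
  obtain ⟨C₁, hC₁⟩ := Level.exists_atom hn hp0
  obtain ⟨C₂, hC₂⟩ := tsum_zpow_volume_lt_le (n := n) hp0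
  obtain ⟨C₃, hC₃⟩ := Level.enorm_sub_tsum_piece_le hn 0
  have hK : ((C₁ : ℝ≥0∞) * 2 ^ p * C₂) ^ (1 / p) ≠ ⊤ :=
    ENNReal.rpow_ne_top_of_nonneg (by positivity) (ENNReal.mul_ne_top (ENNReal.mul_ne_top
      ENNReal.coe_ne_top (ENNReal.rpow_ne_top_of_nonneg hp0.le (by simp))) ENNReal.coe_ne_top)
  refine ⟨(((C₁ : ℝ≥0∞) * 2 ^ p * C₂) ^ (1 / p)).toNNReal, fun ℓ M hM hI hℓ => ?_⟩
  rw [ENNReal.coe_toNNReal hK]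
  set I := ∫⁻ x, M x ^ p with hIdef
  have h2z : ∀ k : ℤ, (2 : ℝ≥0∞) ^ k ≠ ⊤ := fun k => ENNReal.zpow_ne_top (by simp) (by simp) k
  have h2p : ∀ k : ℤ, (2 : ℝ≥0∞) ^ k ≠ 0 := fun k => (ENNReal.zpow_pos (by simp) (by simp) k).ne'
  have h2s : ∀ k : ℤ, (2 : ℝ≥0∞) ^ (k + 1) = 2 ^ k * 2 := fun k => by
    rw [ENNReal.zpow_add (by simp) (by simp), zpow_one]
  have hsum := hC₂ M hM.measurable
  rw [← hIdef] at hsum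
  have hCI : C₂ * I < ⊤ := ENNReal.mul_lt_top ENNReal.coe_lt_top hI
  have hterm : ∀ k : ℤ, ((2 : ℝ≥0∞) ^ k) ^ p * volume {x | (2 : ℝ≥0∞) ^ k < M x} ≤ C₂ * I :=
    fun k => (ENNReal.le_tsum k).trans hsum
  have hpk : ∀ k : ℤ, ((2 : ℝ≥0∞) ^ k) ^ p ≠ 0 := fun k => by
    simp [ENNReal.rpow_eq_zero_iff, h2p k, h2z k]
  have hvol : ∀ k : ℤ, volume {x | (2 : ℝ≥0∞) ^ k < M x} < ⊤ := fun k =>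
    ENNReal.lt_top_of_mul_ne_top_right ((hterm k).trans_lt hCI).ne (hpk k)
  -- One Whitney decomposition for each level 2^k. The superlevel sets are open by semicontinuity
  -- and of finite volume by the dyadic layer-cake bound.
  choose D hDF hDlam using fun k : ℤ => exists_level hn hM (h2z k) (hvol k)
  have hcompl : ∀ k, (D k).Fᶜ = {x | (2 : ℝ≥0∞) ^ k < M x} := fun k => by
    rw [hDF]; ext x; simp
  have hB : ∀ k, (D k).Bounds ℓ := by
    rintro k φ x r a hr hφ ⟨y, hyF, hy⟩
    refine (hℓ φ x r a hr hφ y hy).trans (mul_le_mul_right ?_ _)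
    rw [hDF] at hyF
    rw [hDlam]
    exact hyF
  have hmono : ∀ k, (D k).F ⊆ (D (k + 1)).F := by
    intro k x hx
    rw [hDF] at hx ⊢
    exact le_trans (show M x ≤ 2 ^ k from hx) (ENNReal.zpow_le_of_le (by norm_num) (by omega))
  have hlam : ∀ k, (D k).lam ≤ (D (k + 1)).lam := by
    intro k
    rw [hDlam, hDlam]
    exact ENNReal.zpow_le_of_le (by norm_num) (by omega)
  choose l a ha hl hla using fun (k : ℤ) (i : ℕ) => hC₁ (D k) (D (k + 1)) ℓ (hB k) (hB (k + 1))
    (hmono k) (hlam k) (by rw [hDlam]; exact h2p _) i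
  let e : ℕ ≃ ℤ × ℕ := (Denumerable.eqv (ℤ × ℕ)).symm
  have hls : ∑' j, ‖l (e j).1 (e j).2‖ₑ ^ p ≤ C₁ * 2 ^ p * C₂ * I := by
    rw [e.tsum_eq fun q : ℤ × ℕ => ‖l q.1 q.2‖ₑ ^ p, ENNReal.tsum_prod (f := fun k i => ‖l k i‖ₑ ^ p)]
    have h1 : ∀ k, ∑' i, ‖l k i‖ₑ ^ p ≤
        C₁ * 2 ^ p * (((2 : ℝ≥0∞) ^ k) ^ p * volume {x | (2 : ℝ≥0∞) ^ k < M x}) := by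
      intro k
      refine (ENNReal.tsum_le_tsum (hl k)).trans ?_
      rw [ENNReal.tsum_mul_left, ENNReal.tsum_mul_left, hDlam, h2s,
        ENNReal.mul_rpow_of_nonneg _ _ hp0.le, ← hcompl]
      calc _ ≤ C₁ * (((2 : ℝ≥0∞) ^ k) ^ p * 2 ^ p * volume (D k).Fᶜ) :=
            mul_le_mul_right (mul_le_mul_right ((D k).W.tsum_volume_le (D k).ball_subset_compl) _) _
        _ = _ := by ring
    refine (ENNReal.tsum_le_tsum h1).trans ?_
    rw [ENNReal.tsum_mul_left, mul_assoc _ (C₂ : ℝ≥0∞)]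
    exact mul_le_mul_right hsum _
  have hlt : ∑' j, ‖l (e j).1 (e j).2‖ₑ ^ p < ⊤ := by
    refine hls.trans_lt (ENNReal.mul_lt_top (ENNReal.mul_lt_top (ENNReal.mul_lt_top
      ENNReal.coe_lt_top (ENNReal.rpow_lt_top_of_nonneg hp0.le (by simp))) ENNReal.coe_lt_top) hI)
  obtain ⟨T, hT⟩ := exists_tempered_of_atoms hp0 hp hp1 (l := fun j => l (e j).1 (e j).2)
    (a := fun j => a (e j).1 (e j).2) (fun j => ha _ _) hlt
  refine ⟨T, (atomicNorm_le _ _ (fun j => ha _ _) hT).trans ?_, fun φ hφc => ?_⟩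
  · rw [← ENNReal.mul_rpow_of_nonneg _ _ (by positivity)]
    exact ENNReal.rpow_le_rpow hls (by positivity)
  have hφ : IsTestFunction Set.univ φ := ⟨φ.smooth ⊤, hφc, Set.subset_univ _⟩
  have h1 : HasSum (fun q : ℤ × ℕ => (D q.1).atomPart (D (q.1 + 1)) ℓ q.2 φ) (T φ) := by
    have h := hT φ
    have h' : HasSum ((fun q : ℤ × ℕ => l q.1 q.2 * ∫ x, a q.1 q.2 x * φ x) ∘ e) (T φ) := h
    rw [e.hasSum_iff] at h'
    refine h'.congr_fun fun q => ?_
    exact hla q.1 q.2 φ hφ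
  set b : ℤ → ℂ := fun k => ∑' i, (D k).piece ℓ (fun _ => 1) i φ with hb
  have h2 : HasSum (fun k => b k - b (k + 1)) (T φ) :=
    h1.prod_fiberwise fun k => (D k).hasSum_atomPart (D (k + 1)) hn (hB k) (hB (k + 1)) (hmono k) hφ
  refine eq_of_hasSum_telescope h2 ?_ ?_
  · obtain ⟨L, hL⟩ := hφ.exists_fderiv_le
    rw [tendsto_zero_iff_enorm_tendsto_zero]
    have hn' : (0 : ℝ) < n := by exact_mod_cast hn
    -- The bad part at level 2^k is of size 2^k |{M > 2^k}|^(1+1/n), hence at most a constant times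
    -- 2^(-ks). The exponent s is positive exactly because p > n/(n+1), so the bad parts tend to 0
    -- as k → +∞.
    set s : ℝ := p * (1 + 1 / n) - 1 with hs
    have hs0 : 0 < s := by
      rw [div_lt_iff₀ (by positivity)] at hp
      have : p * (1 + 1 / n) = p * (n + 1) / n := by field_simp
      rw [hs, this, sub_pos, one_lt_div hn']
      exact hp
    have hV0 := (volume_unitBall_pos n).ne'
    set V := volume (Metric.ball (0 : E n) 1)
    set A : ℝ≥0∞ := ENNReal.ofReal (8 * L * levelConst n 1) * (C₂ * I / V) ^ (1 + 1 / n : ℝ) with hA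
    have hAt : A ≠ ⊤ := ENNReal.mul_ne_top ENNReal.ofReal_ne_top
      (ENNReal.rpow_ne_top_of_nonneg (by positivity) (ENNReal.div_ne_top hCI.ne hV0))
    have hbd : ∀ N : ℕ, ‖b N‖ₑ ≤ A * ((2 : ℝ≥0∞) ^ (-s)) ^ N := by
      intro N
      refine enorm_tsum_le_tsum_enorm.trans
        (((D N).tsum_enorm_piece_one_le hn (hB N) hφ.1 hL).trans ?_)
      rw [hDlam, hcompl, hA, mul_assoc (ENNReal.ofReal _), mul_assoc (ENNReal.ofReal _)]
      refine mul_le_mul_right ?_ _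
      have hvN : volume {x | (2 : ℝ≥0∞) ^ (N : ℤ) < M x} / V ≤
          C₂ * I / V * ((2 : ℝ≥0∞) ^ (N : ℤ)) ^ (-p) := by
        rw [ENNReal.rpow_neg, ENNReal.div_eq_inv_mul, ENNReal.div_eq_inv_mul, mul_assoc]
        refine mul_le_mul_right ?_ _
        rw [← div_eq_mul_inv, ENNReal.le_div_iff_mul_le (Or.inl (hpk _))
          (Or.inl (ENNReal.rpow_ne_top_of_nonneg hp0.le (h2z _))), mul_comm]
        exact hterm N
      calc _ ≤ (C₂ * I / V * ((2 : ℝ≥0∞) ^ (N : ℤ)) ^ (-p)) ^ (1 + 1 / n : ℝ) * 2 ^ (N : ℤ) :=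
            mul_le_mul_left (ENNReal.rpow_le_rpow hvN (by positivity)) _
        _ = _ := by
          rw [ENNReal.mul_rpow_of_nonneg _ _ (by positivity), mul_assoc]
          congr 1
          rw [← ENNReal.rpow_intCast, ← ENNReal.rpow_mul, ← ENNReal.rpow_mul,
            ← ENNReal.rpow_add _ _ (by simp) (by simp), ← ENNReal.rpow_natCast, ← ENNReal.rpow_mul]
          congr 1
          rw [hs]
          push_cast
          ring
    have h20 : (2 : ℝ≥0∞) ^ (-s) < 1 := by
      rw [ENNReal.rpow_neg, ENNReal.inv_lt_one]
      exact ENNReal.one_lt_rpow (by norm_num) hs0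
    have hlim := ENNReal.Tendsto.const_mul (a := A)
      (ENNReal.tendsto_pow_atTop_nhds_zero_of_lt_one h20) (Or.inr hAt)
    rw [mul_zero] at hlim
    exact tendsto_of_tendsto_of_tendsto_of_le_of_le tendsto_const_nhds hlim (fun _ => zero_le) hbd
  -- As k → -∞ the good part ℓ(φ) - b_k is at most C·2^k times the L¹ norm of φ, so b_k tends to
  -- ℓ(φ).
  · have hφi : ∫⁻ x, ‖φ x‖ₑ < ⊤ :=
      (hφ.1.continuous.integrable_of_hasCompactSupport hφ.2.1).2
    rw [tendsto_iff_edist_tendsto_0]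
    have hbd : ∀ N : ℕ, edist (b (-N)) (ℓ φ) ≤ C₃ * (∫⁻ x, ‖φ x‖ₑ) * ((2 : ℝ≥0∞)⁻¹) ^ N := by
      intro N
      have h := hC₃ (D (-N)) ℓ (hB _) _ _ _ _ (D (-N)).adapted_one φ hφ
      simp only [one_smul, Measure.restrict_univ] at h
      rw [hDlam] at h
      rw [edist_comm, edist_eq_enorm_sub]
      refine h.trans (le_of_eq ?_)
      rw [ENNReal.zpow_neg, zpow_natCast, ENNReal.inv_pow]
      ring
    have h20 : (2 : ℝ≥0∞)⁻¹ < 1 := ENNReal.inv_lt_one.2 (by norm_num)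
    have hlim := ENNReal.Tendsto.const_mul (a := C₃ * (∫⁻ x, ‖φ x‖ₑ))
      (ENNReal.tendsto_pow_atTop_nhds_zero_of_lt_one h20)
      (Or.inr (ENNReal.mul_lt_top ENNReal.coe_lt_top hφi).ne)
    rw [mul_zero] at hlim
    exact tendsto_of_tendsto_of_tendsto_of_le_of_le tendsto_const_nhds hlim (fun _ => zero_le) hbd

theorem le_one_add_rpow {p : ℝ} (hp : 1 ≤ p) (x : ℝ≥0∞) : x ≤ 1 + x ^ p := by
  rcases le_total x 1 with h | h
  · exact h.trans le_self_add
  · exact (ENNReal.le_rpow_self_of_one_le h hp).trans le_add_self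

/-- A functional controlled by a function in `L^p`, `p ≥ 1`, on bump functions is in `L^p`. -/
theorem exists_represents_of_bump {n : ℕ} {p : ℝ} (hp1 : 1 ≤ p) :
    ∃ C : ℝ≥0, ∀ (ℓ : (E n → ℂ) →ₗ[ℂ] ℂ) (M : E n → ℝ≥0∞), LowerSemicontinuous M →
      ∫⁻ x, M x ^ p < ⊤ →
      (∀ φ x r a, 0 < r → IsBump φ x r a → ∀ y ∈ Metric.closedBall x (10 * r),
        ‖ℓ φ‖ₑ ≤ ENNReal.ofReal (a * r ^ n) * M y) →
      ∃ (T : 𝓢'(E n, ℂ)) (h : E n → ℂ), Represents T h ∧ MemLp h (ENNReal.ofReal p) volume ∧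
        eLpNorm h (ENNReal.ofReal p) volume ≤ C * (∫⁻ x, M x ^ p) ^ (1 / p) ∧
        ∀ φ : 𝓢(E n, ℂ), HasCompactSupport φ → T φ = ℓ φ := by
  obtain ⟨C, hC⟩ := enorm_le_lintegral_of_isBump n
  refine ⟨C, fun ℓ M hM hI hℓ => ?_⟩
  have hp0 : 0 < p := by linarith
  have h1 := hC ℓ M hM.measurable (fun K hK => by
    calc ∫⁻ y in K, M y ≤ ∫⁻ y in K, (1 + M y ^ p) := lintegral_mono fun y => le_one_add_rpow hp1 _
      _ = volume K + ∫⁻ y in K, M y ^ p := by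
          rw [lintegral_add_left measurable_const, setLIntegral_one]
      _ < ⊤ := ENNReal.add_lt_top.2 ⟨hK.measure_lt_top, (setLIntegral_le_lintegral _ _).trans_lt hI⟩)
    1 one_pos (fun φ x ε a hε _ hφ y hy => hℓ φ x ε a hε hφ y
      (Metric.closedBall_subset_closedBall (by linarith) hy))
  have hint : Integrable fun x : E n => (1 + ‖x‖) ^ (-((n + 1 : ℕ) : ℝ)) :=
    integrable_one_add_norm (by rw [finrank_euclideanSpace_fin]; exact_mod_cast Nat.lt_succ_self n)
  -- Since M ≤ 1 + M^p, the weight M becomes integrable after division by (1+|y|)^(n+1), as the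
  -- representation theorem requires.
  have hwN : ∫⁻ y, C * M y / ENNReal.ofReal ((1 + ‖y‖) ^ (n + 1)) < ⊤ := by
    have hle : ∀ y : E n, C * M y / ENNReal.ofReal ((1 + ‖y‖) ^ (n + 1)) ≤
        C * (‖(1 + ‖y‖) ^ (-((n + 1 : ℕ) : ℝ))‖ₑ + M y ^ p) := by
      intro y
      have h0 : (0 : ℝ) < (1 + ‖y‖) ^ (n + 1) := by positivity
      rw [mul_div_assoc]
      refine mul_le_mul_right ?_ _
      have e : ‖(1 + ‖y‖) ^ (-((n + 1 : ℕ) : ℝ))‖ₑ = (ENNReal.ofReal ((1 + ‖y‖) ^ (n + 1)))⁻¹ := by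
        rw [Real.enorm_of_nonneg (by positivity), Real.rpow_neg (by positivity), Real.rpow_natCast,
          ENNReal.ofReal_inv_of_pos h0]
      rw [e, ENNReal.div_eq_inv_mul]
      set w := (ENNReal.ofReal ((1 + ‖y‖) ^ (n + 1)))⁻¹
      have hw : w ≤ 1 := by
        rw [ENNReal.inv_le_one, ENNReal.one_le_ofReal]
        exact one_le_pow₀ (by linarith [norm_nonneg y])
      calc w * M y ≤ w * (1 + M y ^ p) := mul_le_mul_right (le_one_add_rpow hp1 _) _
        _ = w + w * M y ^ p := by rw [mul_add, mul_one]
        _ ≤ w + 1 * M y ^ p := by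
            refine add_le_add le_rfl ?_
            exact mul_le_mul_left hw _
        _ = _ := by rw [one_mul]
    refine (lintegral_mono hle).trans_lt ?_
    rw [lintegral_const_mul' _ _ ENNReal.coe_ne_top]
    refine ENNReal.mul_lt_top ENNReal.coe_lt_top ?_
    rw [lintegral_add_right _ (hM.measurable.pow_const p)]
    exact ENNReal.add_lt_top.2 ⟨hint.2, hI⟩
  obtain ⟨h, hm, hle, -, hrep⟩ := exists_eq_integral_of_enorm_le ℓ (w := fun y => C * M y)
    (hM.measurable.const_mul _) (n + 1) hwN (fun φ hφ => by
      refine (h1 φ hφ).trans (le_of_eq ?_)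
      rw [← lintegral_const_mul' _ _ ENNReal.coe_ne_top]
      refine lintegral_congr fun y => ?_
      ring)
  have hnorm : eLpNorm h (ENNReal.ofReal p) volume ≤ C * (∫⁻ x, M x ^ p) ^ (1 / p) := by
    rw [eLpNorm_eq_lintegral_rpow_enorm_toReal (by simpa using hp0) ENNReal.ofReal_ne_top,
      ENNReal.toReal_ofReal hp0.le]
    calc (∫⁻ x, ‖h x‖ₑ ^ p) ^ (1 / p) ≤ (∫⁻ x, (C * M x) ^ p) ^ (1 / p) := by
          refine ENNReal.rpow_le_rpow (lintegral_mono_ae ?_) (by positivity)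
          filter_upwards [hle] with x hx
          exact ENNReal.rpow_le_rpow hx hp0.le
      _ = _ := by
          simp_rw [ENNReal.mul_rpow_of_nonneg _ _ hp0.le]
          rw [lintegral_const_mul' _ _ (ENNReal.rpow_ne_top_of_nonneg hp0.le ENNReal.coe_ne_top),
            ENNReal.mul_rpow_of_nonneg _ _ (by positivity), ← ENNReal.rpow_mul,
            mul_one_div_cancel hp0.ne', ENNReal.rpow_one]
  obtain ⟨T, hT⟩ := exists_represents (n + 1) hm ⟨(hm.norm.aemeasurable.div (by fun_prop)).aestronglyMeasurable, by
    refine (lintegral_mono_ae ?_).trans_lt hwN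
    filter_upwards [hle] with x hx
    have h0 : (0 : ℝ) < (1 + ‖x‖) ^ (n + 1) := by positivity
    rw [Real.enorm_of_nonneg (by positivity), ENNReal.ofReal_div_of_pos h0, ofReal_norm]
    exact ENNReal.div_le_div_right hx _⟩
  refine ⟨T, h, hT, ⟨hm, hnorm.trans_lt (ENNReal.mul_lt_top ENNReal.coe_lt_top
    (ENNReal.rpow_lt_top_of_nonneg (by positivity) hI.ne))⟩, hnorm, fun φ hφ => ?_⟩
  rw [(hT.2 φ).2, hrep φ ⟨φ.smooth ⊤, hφ, Set.subset_univ _⟩]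

/-- A functional controlled by a function in `L^p` on bump functions is in `H^p`. -/
theorem exists_hardy_of_bump {n : ℕ} (hn : 0 < n) {p : ℝ} (hp : (n : ℝ) / (n + 1) < p) :
    ∃ C : ℝ≥0, ∀ (ℓ : (E n → ℂ) →ₗ[ℂ] ℂ) (M : E n → ℝ≥0∞), LowerSemicontinuous M →
      ∫⁻ x, M x ^ p < ⊤ →
      (∀ φ x r a, 0 < r → IsBump φ x r a → ∀ y ∈ Metric.closedBall x (10 * r),
        ‖ℓ φ‖ₑ ≤ ENNReal.ofReal (a * r ^ n) * M y) →
      ∃ T : 𝓢'(E n, ℂ), hardyNorm p T ≤ C * (∫⁻ x, M x ^ p) ^ (1 / p) ∧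
        (1 ≤ p → ∃ h : E n → ℂ, MemLp h (ENNReal.ofReal p) volume ∧ Represents T h) ∧
        ∀ φ : 𝓢(E n, ℂ), HasCompactSupport φ → T φ = ℓ φ := by
  have hp0 : 0 < p := lt_of_le_of_lt (by positivity) hp
  rcases lt_or_ge 1 p with h1 | h1
  · obtain ⟨C, hC⟩ := exists_represents_of_bump (n := n) h1.le
    refine ⟨C, fun ℓ M hM hI hℓ => ?_⟩
    obtain ⟨T, h, hTh, hmem, hnorm, hT⟩ := hC ℓ M hM hI hℓ
    refine ⟨T, ?_, fun _ => ⟨h, hmem, hTh⟩, hT⟩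
    rw [hardyNorm, if_pos h1]
    exact (iInf₂_le h hTh).trans hnorm
  · obtain ⟨C, hC⟩ := exists_atomic_of_bump hn hp0 hp h1
    refine ⟨C, fun ℓ M hM hI hℓ => ?_⟩
    obtain ⟨T, hnorm, hT⟩ := hC ℓ M hM hI hℓ
    refine ⟨T, ?_, fun h1' => ?_, hT⟩
    · rwa [hardyNorm, if_neg h1.not_gt]
    -- Here p = 1. The atomic construction and the L¹ representation agree on compactly supported
    -- Schwartz functions, hence are the same tempered distribution.
    · obtain ⟨C', hC'⟩ := exists_represents_of_bump (n := n) h1'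
      obtain ⟨T', h, hTh, hmem, -, hT'⟩ := hC' ℓ M hM hI hℓ
      have : T = T' := tempered_ext fun φ hφ => by rw [hT φ hφ, hT' φ hφ]
      exact ⟨h, hmem, this ▸ hTh⟩

/-! ### Lipschitz functions with compact support -/

/-- Rademacher's theorem gives convergence of the difference quotients almost everywhere, and the
Lipschitz constant dominates them. -/
theorem tendsto_integral_slope {d : ℕ} {a k : E d → ℂ} {L : ℝ≥0} (ha : LipschitzWith L a)
    (hk : Integrable k) (v : E d) :
    Tendsto (fun s : ℝ => ∫ t, k t * (s⁻¹ • (a (t + s • v) - a t))) (𝓝[≠] 0)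
      (𝓝 (∫ t, k t * fderiv ℝ a t v)) := by
  refine tendsto_integral_filter_of_dominated_convergence (fun t => ‖k t‖ * (L * ‖v‖)) ?_ ?_
    (hk.norm.mul_const _) ?_
  · refine Eventually.of_forall fun s => ?_
    refine hk.1.mul (Continuous.aestronglyMeasurable ?_)
    have := ha.continuous
    fun_prop
  · filter_upwards [self_mem_nhdsWithin] with s hs
    refine ae_of_all _ fun t => ?_
    rw [norm_mul]
    refine mul_le_mul_of_nonneg_left ?_ (norm_nonneg _)
    rw [norm_smul, norm_inv, inv_mul_le_iff₀ (norm_pos_iff.2 hs)]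
    refine (ha.norm_sub_le _ _).trans (le_of_eq ?_)
    rw [add_sub_cancel_left, norm_smul]
    ring
  · filter_upwards [ha.ae_differentiableAt (μ := volume)] with t ht
    exact ((ht.hasFDerivAt.hasLineDerivAt v).tendsto_slope_zero).const_mul (k t)

theorem norm_fderiv_apply_le {d : ℕ} {a : E d → ℂ} {L : ℝ≥0} (ha : LipschitzWith L a) (x v : E d) :
    ‖fderiv ℝ a x v‖ ≤ L * ‖v‖ :=
  ((fderiv ℝ a x).le_opNorm v).trans
    (mul_le_mul_of_nonneg_right (norm_fderiv_le_of_lipschitz ℝ ha) (norm_nonneg _))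

/-- Integration by parts for Lipschitz functions: translation invariance moves each difference
quotient from φ to a, with the opposite direction, before passing to the limit. -/
theorem integral_mul_fderiv_eq {d : ℕ} {a φ : E d → ℂ} {L L' : ℝ≥0} (ha : LipschitzWith L a)
    (hφ : LipschitzWith L' φ) (hai : Integrable a) (hφi : Integrable φ)
    (hb : ∀ w, Integrable fun t => a t * φ (t + w)) (v : E d) :
    ∫ t, a t * fderiv ℝ φ t v = -∫ t, fderiv ℝ a t v * φ t := by
  have h1 := tendsto_integral_slope hφ hai v
  have h2 := tendsto_integral_slope ha hφi (-v)
  have e : ∀ s : ℝ, ∫ t, a t * (s⁻¹ • (φ (t + s • v) - φ t)) =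
      ∫ t, φ t * (s⁻¹ • (a (t + s • -v) - a t)) := by
    intro s
    have h3 : ∫ t, a t * φ (t + s • v) = ∫ t, φ t * a (t + s • -v) := by
      rw [← integral_add_right_eq_self (fun t => φ t * a (t + s • -v)) (s • v)]
      refine integral_congr_ae (ae_of_all _ fun t => ?_)
      simp [mul_comm]
    have hb0 : Integrable fun t => a t * φ t := by simpa using hb 0
    have hb' : Integrable fun t => φ t * a (t + s • -v) := by
      have := (hb (s • v)).comp_add_right (s • -v)
      refine this.congr (ae_of_all _ fun t => ?_)
      simp [mul_comm]
    have e1 : ∀ t, a t * (s⁻¹ • (φ (t + s • v) - φ t)) =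
        (s⁻¹ : ℂ) * (a t * φ (t + s • v) - a t * φ t) := by
      intro t
      rw [Complex.real_smul]
      push_cast
      ring
    have e2 : ∀ t, φ t * (s⁻¹ • (a (t + s • -v) - a t)) =
        (s⁻¹ : ℂ) * (φ t * a (t + s • -v) - a t * φ t) := by
      intro t
      rw [Complex.real_smul]
      push_cast
      ring
    simp_rw [e1, e2]
    rw [integral_const_mul, integral_const_mul, integral_sub (hb _) hb0, integral_sub hb' hb0, h3]
  simp_rw [e] at h1
  rw [tendsto_nhds_unique h1 h2, ← integral_neg]
  refine integral_congr_ae (ae_of_all _ fun t => ?_)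
  simp [mul_comm]

theorem IsTestFunction.lipschitzWith {d : ℕ} {φ : E d → ℂ} {Ω : Set (E d)}
    (hφ : IsTestFunction Ω φ) : ∃ L : ℝ≥0, LipschitzWith L φ := by
  obtain ⟨L, hL⟩ := hφ.exists_fderiv_le
  exact ⟨L, lipschitzWith_of_nnnorm_fderiv_le (𝕜 := ℝ)
    (fun x => hφ.1.contDiffAt.differentiableAt (by simp)) hL⟩

theorem enorm_grad_le {d : ℕ} {a : E d → ℂ} {L : ℝ≥0} (ha : LipschitzWith L a) (x : E d) :
    ‖grad a x‖ₑ ≤ d * L := by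
  have h1 : ‖grad a x‖ ≤ d * L := by
    have h2 : ∀ i, ‖grad a x i‖ ≤ L := fun i => by
      have := norm_fderiv_apply_le ha x (EuclideanSpace.single i 1)
      rwa [PiLp.norm_single, norm_one, mul_one] at this
    have h3 : grad a x = ∑ i, EuclideanSpace.single i (grad a x i) := by
      ext j
      simp
    rw [h3]
    refine (norm_sum_le _ _).trans ?_
    calc ∑ i, ‖EuclideanSpace.single i (grad a x i)‖ ≤ ∑ _i : Fin d, (L : ℝ) :=
          Finset.sum_le_sum fun i _ => by rw [PiLp.norm_single]; exact h2 i
      _ = _ := by simp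
  rw [← ofReal_norm]
  refine (ENNReal.ofReal_le_ofReal h1).trans (le_of_eq ?_)
  rw [ENNReal.ofReal_mul (by positivity), ENNReal.ofReal_natCast, ENNReal.ofReal_coe_nnreal]

theorem measurable_grad {d : ℕ} (a : E d → ℂ) : Measurable (grad a) := by
  unfold grad
  refine (WithLp.measurable_toLp 2 _).comp (measurable_pi_lambda _ fun i => ?_)
  exact measurable_fderiv_apply_const ℝ a _

theorem grad_eq_zero {d : ℕ} {a : E d → ℂ} {x : E d} (hx : x ∉ tsupport a) : grad a x = 0 := by
  have : fderiv ℝ a x = 0 := by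
    rw [(notMem_tsupport_iff_eventuallyEq.1 hx).fderiv_eq]
    exact fderiv_const_apply _
  ext i
  simp [grad, this]

theorem tendsto_eLpNorm_of_dominated {d : ℕ} {F : Type*} [NormedAddCommGroup F] {p : ℝ}
    (hp : 0 < p) {f : ℕ → E d → F} {g : E d → ℝ≥0∞} (hf : ∀ k, AEStronglyMeasurable (f k) volume)
    (hg : ∫⁻ x, g x ^ p < ⊤) (hle : ∀ k, ∀ᵐ x, ‖f k x‖ₑ ≤ g x)
    (hlim : ∀ᵐ x, Tendsto (fun k => f k x) atTop (𝓝 0)) :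
    Tendsto (fun k => eLpNorm (f k) (ENNReal.ofReal p) volume) atTop (𝓝 0) := by
  have h1 : Tendsto (fun k => ∫⁻ x, ‖f k x‖ₑ ^ p) atTop (𝓝 (∫⁻ _ : E d, 0)) := by
    refine tendsto_lintegral_of_dominated_convergence' _ (fun k => (hf k).enorm.pow_const p)
      (fun k => ?_) hg.ne ?_
    · filter_upwards [hle k] with x hx
      exact ENNReal.rpow_le_rpow hx hp.le
    · filter_upwards [hlim] with x hx
      have := ((tendsto_zero_iff_enorm_tendsto_zero.1 hx).ennrpow_const p)
      rwa [ENNReal.zero_rpow_of_pos hp] at this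
  rw [lintegral_zero] at h1
  have h2 := h1.ennrpow_const (1 / p)
  rw [ENNReal.zero_rpow_of_pos (by positivity)] at h2
  refine h2.congr fun k => ?_
  rw [eLpNorm_eq_lintegral_rpow_enorm_toReal (by simpa using hp) ENNReal.ofReal_ne_top,
    ENNReal.toReal_ofReal hp.le]

theorem hasWeakGradOn_of_lipschitz {d : ℕ} {a : E d → ℂ} {L : ℝ≥0} (ha : LipschitzWith L a)
    (hc : HasCompactSupport a) : HasWeakGradOn Set.univ a (grad a) := by
  refine ⟨(ha.continuous.locallyIntegrable).locallyIntegrableOn _, ?_, fun φ hφ i => ?_⟩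
  · refine LocallyIntegrable.locallyIntegrableOn ?_ _
    refine (locallyIntegrable_const ((d : ℝ) * L)).mono
      (measurable_grad a).aestronglyMeasurable (ae_of_all _ fun x => ?_)
    have h := enorm_grad_le ha x
    rw [Real.norm_of_nonneg (by positivity), ← ENNReal.ofReal_le_ofReal_iff (by positivity),
      ofReal_norm, ENNReal.ofReal_mul (by positivity), ENNReal.ofReal_natCast,
      ENNReal.ofReal_coe_nnreal]
    exact h
  · obtain ⟨L', hL'⟩ := hφ.lipschitzWith
    simp only [Measure.restrict_univ]
    exact integral_mul_fderiv_eq ha hL' (ha.continuous.integrable_of_hasCompactSupport hc)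
      (hφ.1.continuous.integrable_of_hasCompactSupport hφ.2.1) (fun w => by
        have h1 := hφ.1.continuous
        have h2 := ha.continuous
        exact Continuous.integrable_of_hasCompactSupport (by fun_prop) hc.mul_right) _

/-- A Lipschitz function with compact support is a homogeneous Sobolev function. -/
theorem exists_tendsto_grad_of_lipschitz {d : ℕ} {a : E d → ℂ} {L : ℝ≥0} (ha : LipschitzWith L a)
    (hc : HasCompactSupport a) {q : ℝ} (hq : 0 < q) :
    ∃ φ : ℕ → E d → ℂ, (∀ k, IsTestFunction Set.univ (φ k)) ∧
      Tendsto (fun k => eLpNorm (fun x => grad (φ k) x - grad a x) (ENNReal.ofReal q) volume) atTop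
        (𝓝 0) := by
  let ρ : ℕ → ContDiffBump (0 : E d) := fun k =>
    ⟨1 / (2 * ((k : ℝ) + 1)), 1 / ((k : ℝ) + 1), by positivity,
      one_div_lt_one_div_of_lt (by positivity) (by linarith [(Nat.cast_nonneg k : (0 : ℝ) ≤ k)])⟩
  set m : ℕ → E d → ℂ := fun k =>
    convolution ((ρ k).normed volume) a (ContinuousLinearMap.lsmul ℝ ℝ) volume with hm
  have hai := ha.continuous.integrable_of_hasCompactSupport (μ := volume) hc
  have hmc : ∀ k, ContDiff ℝ ∞ (m k) := fun k =>
    (ρ k).hasCompactSupport_normed.contDiff_convolution_left _ (ρ k).contDiff_normed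
      ha.continuous.locallyIntegrable
  have hms : ∀ k, HasCompactSupport (m k) := fun k => (ρ k).hasCompactSupport_normed.convolution _ hc
  have hmx : ∀ k x, m k x = ∫ t, ((ρ k).normed volume (x - t) : ℂ) * a t := by
    intro k x
    simp only [hm, convolution_eq_swap, ContinuousLinearMap.lsmul_apply, Complex.real_smul]
  have hk : ∀ k x, Integrable fun t => ((ρ k).normed volume (x - t) : ℂ) := fun k x =>
    ((ρ k).integrable_normed.comp_sub_left x).ofReal
  have hb : ∀ k (x w : E d), Integrable fun t => ((ρ k).normed volume (x - t) : ℂ) * a (t + w) := by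
    intro k x w
    have h1 := ha.continuous
    have h2 : Continuous ((ρ k).normed (volume : Measure (E d))) := (ρ k).continuous_normed
    refine Continuous.integrable_of_hasCompactSupport (by fun_prop) ?_
    exact (hc.comp_homeomorph (Homeomorph.addRight w)).mul_left
  -- The derivative falls on the Lipschitz factor: translating the mollification amounts to
  -- translating a, and the difference quotients of a converge under the integral.
  have hgrad : ∀ k x v, fderiv ℝ (m k) x v =
      ∫ t, ((ρ k).normed volume (x - t) : ℂ) * fderiv ℝ a t v := by
    intro k x v
    have h1 := ((((hmc k).contDiffAt (x := x)).differentiableAt (by simp)).hasFDerivAt.hasLineDerivAt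
      v).tendsto_slope_zero
    have h2 := tendsto_integral_slope ha (hk k x) v
    refine tendsto_nhds_unique h1 (h2.congr fun s => ?_)
    have e1 : m k (x + s • v) = ∫ t, ((ρ k).normed volume (x - t) : ℂ) * a (t + s • v) := by
      rw [hmx, ← integral_add_right_eq_self _ (s • v)]
      refine integral_congr_ae (ae_of_all _ fun t => ?_)
      simp
    have hb0 : Integrable fun t => ((ρ k).normed volume (x - t) : ℂ) * a t := by
      simpa using hb k x 0
    rw [e1, hmx, ← integral_sub (hb k x _) hb0, ← integral_smul]
    refine integral_congr_ae (ae_of_all _ fun t => ?_)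
    simp only [Complex.real_smul]
    ring
  have hlip : ∀ k, LipschitzWith L (m k) := by
    intro k
    refine LipschitzWith.of_dist_le_mul fun x y => ?_
    rw [dist_eq_norm, hm]
    simp only [convolution_def, ContinuousLinearMap.lsmul_apply]
    have hi : ∀ z, Integrable fun t => (ρ k).normed volume t • a (z - t) := by
      intro z
      have h1 := ha.continuous
      have h2 : Continuous ((ρ k).normed (volume : Measure (E d))) := (ρ k).continuous_normed
      exact Continuous.integrable_of_hasCompactSupport (by fun_prop)
        (ρ k).hasCompactSupport_normed.smul_right
    rw [← integral_sub (hi x) (hi y)]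
    have h3 : ∀ t, ‖(ρ k).normed volume t • a (x - t) - (ρ k).normed volume t • a (y - t)‖ ≤
        (ρ k).normed volume t * (L * dist x y) := by
      intro t
      rw [← smul_sub, norm_smul, Real.norm_of_nonneg ((ρ k).nonneg_normed t)]
      refine mul_le_mul_of_nonneg_left ?_ ((ρ k).nonneg_normed t)
      refine (ha.norm_sub_le _ _).trans (le_of_eq ?_)
      rw [sub_sub_sub_cancel_right, dist_eq_norm]
    refine (norm_integral_le_of_norm_le ((ρ k).integrable_normed.mul_const _)
      (ae_of_all _ h3)).trans (le_of_eq ?_)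
    rw [integral_mul_const, (ρ k).integral_normed, one_mul]
  set K := Metric.cthickening 1 (tsupport a) with hK
  have hKc : IsCompact K := IsCompact.cthickening hc
  have hsub : ∀ k, tsupport (m k) ⊆ K := by
    intro k
    refine closure_minimal ?_ hKc.isClosed
    refine (support_convolution_subset_swap _).trans ?_
    rintro _ ⟨y, hy, z, hz, rfl⟩
    rw [(ρ k).support_normed_eq, Metric.mem_ball, dist_zero_right] at hz
    refine Metric.mem_cthickening_of_dist_le _ y _ _ (subset_tsupport _ hy) ?_
    simp only [dist_self_add_left]
    refine hz.le.trans ?_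
    change 1 / ((k : ℝ) + 1) ≤ 1
    rw [div_le_one (by positivity)]
    linarith [(Nat.cast_nonneg k : (0 : ℝ) ≤ k)]
  refine ⟨m, fun k => ⟨hmc k, hms k, Set.subset_univ _⟩, ?_⟩
  -- The gradients of the mollifications are bounded by dL, supported in one compact neighbourhood
  -- of the support, and converge almost everywhere to the gradient of a.
  refine tendsto_eLpNorm_of_dominated hq (g := K.indicator fun _ => d * L + d * L)
    (fun k => ((measurable_grad _).sub (measurable_grad _)).aestronglyMeasurable) ?_
    (fun k => ae_of_all _ fun x => ?_) ?_
  · have : ∀ x, (K.indicator (fun _ => ((d : ℝ≥0∞) * L + d * L)) x) ^ q =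
        K.indicator (fun _ => ((d : ℝ≥0∞) * L + d * L) ^ q) x := by
      intro x
      by_cases hx : x ∈ K
      · simp only [Set.indicator_of_mem hx]
      · simp only [Set.indicator_of_notMem hx, ENNReal.zero_rpow_of_pos hq]
    simp_rw [this]
    rw [lintegral_indicator hKc.measurableSet, setLIntegral_const]
    refine ENNReal.mul_lt_top (ENNReal.rpow_lt_top_of_nonneg hq.le ?_) hKc.measure_lt_top
    exact ENNReal.add_ne_top.2 ⟨ENNReal.mul_ne_top (by simp) (by simp),
      ENNReal.mul_ne_top (by simp) (by simp)⟩
  · by_cases hx : x ∈ K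
    · rw [Set.indicator_of_mem hx]
      exact enorm_sub_le.trans (add_le_add (enorm_grad_le (hlip k) x) (enorm_grad_le ha x))
    · rw [grad_eq_zero (fun h => hx (hsub k h)),
        grad_eq_zero (fun h => hx (Metric.self_subset_cthickening _ h)), sub_zero, enorm_zero]
      exact zero_le
  · have hρ0 : Tendsto (fun k => (ρ k).rOut) atTop (𝓝 0) :=
      tendsto_one_div_add_atTop_nhds_zero_nat
    have hρ1 : ∀ᶠ k in atTop, (ρ k).rOut ≤ 2 * (ρ k).rIn := Eventually.of_forall fun k => by
      change 1 / ((k : ℝ) + 1) ≤ 2 * (1 / (2 * ((k : ℝ) + 1)))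
      refine le_of_eq ?_
      field_simp
    have hli : ∀ v, LocallyIntegrable (fun t => fderiv ℝ a t v) (volume : Measure (E d)) := fun v =>
      (locallyIntegrable_const ((L : ℝ) * ‖v‖)).mono
        (measurable_fderiv_apply_const ℝ a v).aestronglyMeasurable (ae_of_all _ fun x => by
          rw [Real.norm_of_nonneg (by positivity)]
          exact norm_fderiv_apply_le ha x v)
    have hall : ∀ᵐ x : E d, ∀ i, Tendsto (fun k => convolution ((ρ k).normed volume)
        (fun t => fderiv ℝ a t (EuclideanSpace.single i 1)) (ContinuousLinearMap.lsmul ℝ ℝ) volume x)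
        atTop (𝓝 (fderiv ℝ a x (EuclideanSpace.single i 1))) := ae_all_iff.2 fun i =>
      ContDiffBump.ae_convolution_tendsto_right_of_locallyIntegrable hρ0 hρ1 (hli _)
    filter_upwards [hall] with x hx
    have hg : Tendsto (fun k => grad (m k) x) atTop (𝓝 (grad a x)) := by
      refine ((PiLp.continuous_toLp 2 fun _ : Fin d => ℂ).tendsto _).comp (tendsto_pi_nhds.2 fun i => ?_)
      refine (hx i).congr fun k => ?_
      rw [hgrad, convolution_eq_swap]
      simp only [ContinuousLinearMap.lsmul_apply, Complex.real_smul]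
    simpa using hg.sub_const (grad a x)

theorem memLp_grad_of_lipschitz {d : ℕ} {a : E d → ℂ} {L : ℝ≥0} (ha : LipschitzWith L a)
    (hc : HasCompactSupport a) (q : ℝ≥0∞) : MemLp (grad a) q volume := by
  have h1 : MemLp (fun _ : E d => (d : ℝ) * L) q (volume.restrict (tsupport a)) := by
    have : IsFiniteMeasure (volume.restrict (tsupport a)) := ⟨by
      rw [Measure.restrict_apply_univ]; exact hc.isCompact.measure_lt_top⟩
    exact memLp_const _
  have h2 : MemLp ((tsupport a).indicator fun _ : E d => (d : ℝ) * L) q volume :=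
    (memLp_indicator_iff_restrict (isClosed_tsupport a).measurableSet).2 h1
  refine h2.of_le_enorm (measurable_grad a).aestronglyMeasurable (ae_of_all _ fun x => ?_)
  by_cases hx : x ∈ tsupport a
  · rw [Set.indicator_of_mem hx, Real.enorm_of_nonneg (by positivity),
      ENNReal.ofReal_mul (by positivity), ENNReal.ofReal_natCast, ENNReal.ofReal_coe_nnreal]
    exact enorm_grad_le ha x
  · rw [grad_eq_zero hx, enorm_zero]
    exact zero_le

/-! ### Lipschitz pieces -/

theorem WhitneyCover.dist_eta_le {d : ℕ} {ρ : E d → ℝ} (W : WhitneyCover ρ)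
    (hρ : ∀ x y, |ρ x - ρ y| ≤ dist x y / 64) (m : ℕ) (x y : E d) :
    |W.eta m x - W.eta m y| ≤ etaConst d / W.r m * dist x y := by
  rw [← Real.norm_eq_abs, dist_eq_norm]
  exact Convex.norm_image_sub_le_of_norm_fderiv_le (𝕜 := ℝ)
    (fun x _ => (W.eta_contDiff m).contDiffAt.differentiableAt (by simp))
    (fun x _ => W.norm_fderiv_eta_le' hρ m x) convex_univ (Set.mem_univ _) (Set.mem_univ _)

namespace Level

variable {n : ℕ} (D : Level n) {g : E n → ℂ} {Λ : ℝ≥0}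

/-- Some zero of g lies at distance 64r from the centre, and 71 = 64 + 7. -/
theorem norm_le_of_lipschitz (hg : LipschitzWith Λ g) (hg0 : ∀ x ∈ D.F, g x = 0) {i : ℕ}
    (hi : 0 < D.W.r i) {x : E n} (hx : x ∈ Metric.closedBall (D.W.c i) (7 * D.W.r i)) :
    ‖g x‖ ≤ Λ * (71 * D.W.r i) := by
  obtain ⟨y, hy, h⟩ := D.isClosed.exists_infDist_eq_dist D.nonempty (D.W.c i)
  rw [D.infDist_c hi] at h
  have h1 := hg.dist_le_mul x y
  rw [hg0 y hy, dist_zero_right] at h1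
  refine h1.trans (mul_le_mul_of_nonneg_left ?_ Λ.2)
  rw [Metric.mem_closedBall] at hx
  linarith [dist_triangle x (D.W.c i) y]

/-- The factor 1/r from the gradient of η_i is cancelled by |g| ≤ 71Λr on the Whitney ball. The
pieces therefore have Lipschitz constants of order Λ, whatever their scale. -/
theorem lipschitzWith_eta_smul (hg : LipschitzWith Λ g) (hg0 : ∀ x ∈ D.F, g x = 0) (i : ℕ) :
    LipschitzWith ((1 + 71 * etaConst n) * Λ) fun x => D.W.eta i x • g x := by
  rcases (D.W.r_nonneg i).eq_or_lt with hi | hi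
  · rw [D.eta_smul_eq_zero hi.symm]
    exact LipschitzWith.const 0 |>.weaken zero_le
  have key : ∀ x y, x ∈ Metric.closedBall (D.W.c i) (7 * D.W.r i) →
      ‖D.W.eta i x • g x - D.W.eta i y • g y‖ ≤ (1 + 71 * etaConst n) * Λ * dist x y := by
    intro x y hx
    have e : D.W.eta i x • g x - D.W.eta i y • g y =
        (D.W.eta i x - D.W.eta i y) • g x + D.W.eta i y • (g x - g y) := by
      rw [sub_smul, smul_sub]; abel
    rw [e]
    refine (norm_add_le _ _).trans ?_
    rw [norm_smul, norm_smul, Real.norm_eq_abs, Real.norm_eq_abs]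
    have h1 := D.W.dist_eta_le D.lipschitz i x y
    have h2 := D.norm_le_of_lipschitz hg hg0 hi hx
    have h3 : ‖g x - g y‖ ≤ Λ * dist x y := by rw [← dist_eq_norm]; exact hg.dist_le_mul x y
    calc _ ≤ etaConst n / D.W.r i * dist x y * (Λ * (71 * D.W.r i)) + 1 * (Λ * dist x y) := by
          gcongr
          exact D.W.abs_eta_le_one i y
      _ = _ := by field_simp; ring
  have hout : ∀ x ∉ Metric.closedBall (D.W.c i) (7 * D.W.r i), D.W.eta i x • g x = 0 := by
    intro x hx
    rw [D.W.eta_eq_zero (fun h' => hx (Metric.ball_subset_closedBall h')), zero_smul]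
  refine LipschitzWith.of_dist_le_mul fun x y => ?_
  rw [dist_eq_norm]
  push_cast
  by_cases hx : x ∈ Metric.closedBall (D.W.c i) (7 * D.W.r i)
  · exact key x y hx
  by_cases hy : y ∈ Metric.closedBall (D.W.c i) (7 * D.W.r i)
  · rw [norm_sub_rev, dist_comm]
    exact key y x hy
  · rw [hout x hx, hout y hy, sub_zero, norm_zero]
    positivity

theorem tsupport_eta_smul_subset (i : ℕ) (g : E n → ℂ) :
    tsupport (fun x => D.W.eta i x • g x) ⊆ Metric.closedBall (D.W.c i) (7 * D.W.r i) :=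
  ((tsupport_smul_subset _ g).trans Set.inter_subset_left).trans (D.W.tsupport_eta_subset i)

theorem hasCompactSupport_eta_smul (i : ℕ) (g : E n → ℂ) :
    HasCompactSupport fun x => D.W.eta i x • g x :=
  (isCompact_closedBall _ _).of_isClosed_subset (isClosed_tsupport _)
    (D.tsupport_eta_smul_subset i g)

theorem hasSum_eta_smul_apply (hg0 : ∀ x ∈ D.F, g x = 0) (x : E n) :
    HasSum (fun i => D.W.eta i x • g x) (g x) := by
  by_cases hx : x ∈ D.F
  · simp only [hg0 x hx, smul_zero]
    exact hasSum_zero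
  obtain ⟨N, hN⟩ := D.W.exists_sum_eta_eq_one (K := {x}) isCompact_singleton
    (fun y hy => D.infDist_pos (by rwa [Set.mem_singleton_iff.1 hy]))
  have e : g x = ∑ i ∈ Finset.range N, D.W.eta i x • g x := by
    rw [← Finset.sum_smul, (hN x rfl).1, one_smul]
  have h : HasSum (fun i => D.W.eta i x • g x) _ := hasSum_sum_of_ne_finset_zero
    (s := Finset.range N) (fun i hi => by rw [(hN x rfl).2 i (by simpa using hi), zero_smul])
  rwa [← e] at h

/-- Each piece has height of order Λr on a ball of radius of order r, which gives Λr^(n+1). It is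
the counterpart, for Lipschitz pieces, of the bound for the bad part of a functional. -/
theorem tsum_lintegral_eta_smul_le (hn : 0 < n) (hg : LipschitzWith Λ g)
    (hg0 : ∀ x ∈ D.F, g x = 0) :
    ∑' i, ∫⁻ x, ‖D.W.eta i x • g x‖ₑ ≤ Λ * (71 * 8 ^ n * volume (Metric.ball (0 : E n) 1)) *
      (volume D.Fᶜ / volume (Metric.ball (0 : E n) 1)) ^ (1 + 1 / n : ℝ) := by
  have h1 : ∀ i, ∫⁻ x, ‖D.W.eta i x • g x‖ₑ ≤
      Λ * (71 * 8 ^ n * volume (Metric.ball (0 : E n) 1)) *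
        ENNReal.ofReal (D.W.r i ^ (n + 1)) := by
    intro i
    rcases (D.W.r_nonneg i).eq_or_lt with hi | hi
    · have h := D.eta_smul_eq_zero hi.symm g
      have h' : ∀ x, D.W.eta i x • g x = 0 := fun x => congrFun h x
      simp only [h', enorm_zero, lintegral_zero]
      exact zero_le
    have h2 : ∀ x, ‖D.W.eta i x • g x‖ₑ ≤ (Metric.ball (D.W.c i) (8 * D.W.r i)).indicator
        (fun _ => ENNReal.ofReal (Λ * (71 * D.W.r i))) x := by
      intro x
      by_cases hx : x ∈ Metric.ball (D.W.c i) (7 * D.W.r i)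
      · rw [Set.indicator_of_mem (Metric.ball_subset_ball (by linarith) hx), ← ofReal_norm]
        refine ENNReal.ofReal_le_ofReal ?_
        rw [norm_smul, Real.norm_eq_abs]
        calc _ ≤ 1 * (Λ * (71 * D.W.r i)) := by
              gcongr
              · exact D.W.abs_eta_le_one i x
              · exact D.norm_le_of_lipschitz hg hg0 hi (Metric.ball_subset_closedBall hx)
          _ = _ := one_mul _
      · rw [D.W.eta_eq_zero hx, zero_smul, enorm_zero]
        exact zero_le
    refine (lintegral_mono h2).trans (le_of_eq ?_)
    rw [lintegral_indicator measurableSet_ball, setLIntegral_const,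
      volume_ball_eq _ (by positivity), mul_pow, ENNReal.ofReal_mul (by positivity),
      ENNReal.ofReal_mul (by positivity), ENNReal.ofReal_mul (by positivity), pow_succ,
      ENNReal.ofReal_mul (by positivity), ENNReal.ofReal_pow (by norm_num), ENNReal.ofReal_ofNat,
      ENNReal.ofReal_ofNat, ENNReal.ofReal_coe_nnreal]
    ring
  refine (ENNReal.tsum_le_tsum h1).trans ?_
  rw [ENNReal.tsum_mul_left]
  exact mul_le_mul_right (D.tsum_r_pow_succ_le hn) _

/-- Bounded overlap of the supports. No piece is felt on F, which makes the dyadic sum in the case p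
> 1 stop at the level h(x). -/
theorem tsum_enorm_grad_eta_smul_le (hg : LipschitzWith Λ g) (hg0 : ∀ x ∈ D.F, g x = 0) (x : E n) :
    ∑' i, ‖grad (fun x => D.W.eta i x • g x) x‖ₑ ≤
      D.Fᶜ.indicator (fun _ => (n * ((1 + 71 * etaConst n) * Λ : ℝ≥0) * 43 ^ n : ℝ≥0∞)) x := by
  have h1 : ∀ i, ‖grad (fun x => D.W.eta i x • g x) x‖ₑ ≤
      D.Fᶜ.indicator (fun _ => (n * ((1 + 71 * etaConst n) * Λ : ℝ≥0) : ℝ≥0∞)) x *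
        (Metric.ball (D.W.c i) (20 * D.W.r i)).indicator 1 x := by
    intro i
    by_cases hx : x ∈ Metric.closedBall (D.W.c i) (7 * D.W.r i)
    · rcases (D.W.r_nonneg i).eq_or_lt with hi | hi
      · rw [D.eta_smul_eq_zero hi.symm, grad_eq_zero (by simp), enorm_zero]
        exact zero_le
      rw [Set.indicator_of_mem (show x ∈ D.Fᶜ from D.notMem_of_mem_ball hx hi),
        Set.indicator_of_mem (Metric.closedBall_subset_ball (by linarith) hx), Pi.one_apply, mul_one]
      exact enorm_grad_le (D.lipschitzWith_eta_smul hg hg0 i) x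
    · rw [grad_eq_zero (fun h => hx (D.tsupport_eta_smul_subset i g h)), enorm_zero]
      exact zero_le
  refine (ENNReal.tsum_le_tsum h1).trans ?_
  rw [ENNReal.tsum_mul_left]
  refine (mul_le_mul_right (D.W.tsum_overlap_le D.lipschitz x) _).trans (le_of_eq ?_)
  by_cases hx : x ∈ D.Fᶜ
  · simp only [Set.indicator_of_mem hx]
  · simp only [Set.indicator_of_notMem hx, zero_mul]

end Level

/-! ### Regular atoms from Lipschitz functions -/

theorem enorm_ofReal_mul_rpow {p b v : ℝ} (hp : 0 < p) (hb : 0 ≤ b) (hv : 0 ≤ v) :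
    ‖((b * v ^ (1 / p) : ℝ) : ℂ)‖ₑ ^ p = ENNReal.ofReal b ^ p * ENNReal.ofReal v := by
  rw [← ofReal_norm, Complex.norm_real, Real.norm_of_nonneg (by positivity),
    ENNReal.ofReal_mul hb, ENNReal.mul_rpow_of_nonneg _ _ hp.le,
    ← ENNReal.ofReal_rpow_of_nonneg hv (by positivity), ← ENNReal.rpow_mul,
    one_div_mul_cancel hp.ne', ENNReal.rpow_one]

theorem isHomSobolev_of_lipschitz {d : ℕ} {a : E d → ℂ} {L : ℝ≥0} (ha : LipschitzWith L a)
    (hc : HasCompactSupport a) {q : ℝ} (hq : 0 < q) : IsHomSobolev (ENNReal.ofReal q) a (grad a) :=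
  ⟨hasWeakGradOn_of_lipschitz ha hc, memLp_grad_of_lipschitz ha hc _,
    exists_tendsto_grad_of_lipschitz ha hc hq⟩

/-- Integration by parts against a cutoff equal to 1 near the support. It supplies the mean-zero
condition for the derivatives of Lipschitz pieces. -/
theorem integral_fderiv_eq_zero {d : ℕ} {a : E d → ℂ} {L : ℝ≥0} (ha : LipschitzWith L a)
    {c : E d} {r : ℝ} (hr : 0 < r) (hsupp : tsupport a ⊆ Metric.closedBall c r) (v : E d) :
    ∫ t, fderiv ℝ a t v = 0 := by
  let b : ContDiffBump c := ⟨2 * r, 3 * r, by positivity, by linarith⟩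
  set φ : E d → ℂ := fun x => (b x : ℂ) with hφdef
  have hφ : IsTestFunction Set.univ φ :=
    ⟨Complex.ofRealCLM.contDiff.comp b.contDiff,
      b.hasCompactSupport.comp_left (g := fun t : ℝ => (t : ℂ)) Complex.ofReal_zero,
      Set.subset_univ _⟩
  have hφ1 : ∀ x ∈ Metric.closedBall c (2 * r), φ x = 1 := fun x hx => by
    simp only [hφdef, b.one_of_mem_closedBall hx, Complex.ofReal_one]
  have hc : HasCompactSupport a :=
    (isCompact_closedBall c r).of_isClosed_subset (isClosed_tsupport _) hsupp
  obtain ⟨L', hL'⟩ := hφ.lipschitzWith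
  have h := integral_mul_fderiv_eq ha hL' (ha.continuous.integrable_of_hasCompactSupport hc)
      (hφ.1.continuous.integrable_of_hasCompactSupport hφ.2.1) (fun w => by
        have h1 := hφ.1.continuous
        have h2 := ha.continuous
        exact Continuous.integrable_of_hasCompactSupport (by fun_prop) hc.mul_right) v
  have h0 : ∫ t, a t * fderiv ℝ φ t v = 0 := by
    rw [← integral_zero (E d) ℂ]
    refine integral_congr_ae (ae_of_all _ fun t => ?_)
    by_cases ht : t ∈ tsupport a
    · have : φ =ᶠ[𝓝 t] fun _ => 1 := by
        filter_upwards [Metric.closedBall_mem_nhds_of_mem (x := t) (c := c) (ε := 2 * r)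
          (Metric.closedBall_subset_ball (by linarith) (hsupp ht))] with y hy
        exact hφ1 y hy
      simp [this.fderiv_eq]
    · simp [image_eq_zero_of_notMem_tsupport ht]
  rw [h0, eq_comm, neg_eq_zero] at h
  rw [← h]
  refine integral_congr_ae (ae_of_all _ fun t => ?_)
  by_cases ht : t ∈ tsupport a
  · simp only
    rw [hφ1 t (Metric.closedBall_subset_closedBall (by linarith) (hsupp ht)), mul_one]
  · have : fderiv ℝ a t = 0 := by
      rw [(notMem_tsupport_iff_eventuallyEq.1 ht).fderiv_eq]
      exact fderiv_const_apply _
    simp [this]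

theorem RegularAtom.partialDist_apply {n : ℕ} {p : ℝ} (a : RegularAtom n p) (i : Fin n)
    (φ : 𝓢(E n, ℂ)) : a.partialDist i φ = ∫ x, a.gradient x i * φ x := by
  rw [RegularAtom.partialDist, Lp.toTemperedDistribution_apply]
  refine integral_congr_ae ?_
  filter_upwards [MemLp.coeFn_toLp (a.isHomSobolev.2.1.continuousLinearMap_comp
      (EuclideanSpace.proj i : V n →L[ℂ] ℂ))] with x hx
  rw [hx, smul_eq_mul, mul_comm]
  rfl

theorem cube_subset_ball {n : ℕ} (hn : 0 < n) {c : E n} {r : ℝ} (hr : 0 < r) :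
    cube (WithLp.toLp 2 fun i => c i - r) (2 * r) ⊆ Metric.ball c (2 * n * r) := by
  intro x hx
  rw [Metric.mem_ball, dist_eq_norm]
  have h3 : x - c = ∑ i, EuclideanSpace.single i ((x - c) i) := by
    ext j
    simp
  rw [h3]
  have hn' : (1 : ℝ) ≤ n := by exact_mod_cast hn
  calc _ ≤ ∑ i, ‖EuclideanSpace.single i ((x - c) i)‖ := norm_sum_le _ _
    _ ≤ ∑ _i : Fin n, r := by
        refine Finset.sum_le_sum fun i _ => ?_
        rw [PiLp.norm_single, Real.norm_eq_abs, abs_le]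
        have := hx i
        simp only [PiLp.sub_apply] at this ⊢
        constructor <;> linarith [this.1, this.2]
    _ = n * r := by simp
    _ < _ := by nlinarith

theorem closedBall_subset_cube {n : ℕ} {c : E n} {r : ℝ} :
    Metric.closedBall c r ⊆ cube (WithLp.toLp 2 fun i => c i - r) (2 * r) := by
  intro x hx i
  rw [Metric.mem_closedBall, dist_eq_norm] at hx
  have h := (PiLp.norm_apply_le (x - c) i).trans hx
  rw [Real.norm_eq_abs, abs_le, PiLp.sub_apply] at h
  simp only
  constructor <;> linarith [h.1, h.2]

/-- The normalization of a Lipschitz function as a regular atom. -/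
theorem exists_regularAtom {n : ℕ} (hn : 0 < n) {p : ℝ} (hp : 0 < p) :
    ∃ C : ℝ≥0, ∀ (A : E n → ℂ) (L : ℝ≥0) (c : E n) (r : ℝ), LipschitzWith L A →
      tsupport A ⊆ Metric.closedBall c (7 * r) → 0 < L → 0 < r →
      ∃ (l : ℂ) (R : RegularAtom n p), ‖l‖ₑ ^ p ≤ C * (L ^ p * volume (Metric.ball c r)) ∧
        ∀ i, ∃ (m : ℂ) (a : E n → ℂ), IsAtom p a ∧
          ‖m‖ₑ ^ p ≤ C * (L ^ p * volume (Metric.ball c r)) ∧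
          ∀ φ : 𝓢(E n, ℂ), l * R.partialDist i φ = m * ∫ x, a x * φ x ∧
            l * R.partialDist i φ =
              -∫ x, A x * fderiv ℝ φ x (EuclideanSpace.single i (1 : ℝ)) := by
  have hn' : (0 : ℝ) < n := by exact_mod_cast hn
  -- The first summand pays for the regular atom: gradient at most nL, on a cube contained in a ball
  -- of radius 14nr. The second pays for the atoms of H^p, which live on the ball of radius 8r.
  refine ⟨(n : ℝ≥0) ^ p * (14 * n) ^ n + 8 ^ n, fun A L c r hA hsupp hL hr => ?_⟩
  have hL' : (0 : ℝ) < L := hL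
  have hcs : HasCompactSupport A :=
    (isCompact_closedBall c _).of_isClosed_subset (isClosed_tsupport _) hsupp
  set Q := cube (WithLp.toLp 2 fun i => c i - 7 * r) (2 * (7 * r)) with hQ
  have hQsub : Q ⊆ Metric.ball c (2 * n * (7 * r)) := cube_subset_ball hn (by positivity)
  have hsubQ : Metric.closedBall c (7 * r) ⊆ Q := closedBall_subset_cube
  have hQt : volume Q ≠ ⊤ := ((measure_mono hQsub).trans_lt measure_ball_lt_top).ne
  have hQ0 : volume Q ≠ 0 := ((Metric.measure_closedBall_pos volume c (by positivity)).trans_le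
    (measure_mono hsubQ)).ne'
  set v := volume.real Q with hv
  have hv0 : 0 < v := ENNReal.toReal_pos hQ0 hQt
  set s : ℝ := n * L * v ^ (1 / p) with hs
  have hs0 : 0 < s := by positivity
  set B : E n → ℂ := fun x => s⁻¹ • A x with hB
  have hBL : LipschitzWith (Real.toNNReal s⁻¹ * L) B := by
    refine LipschitzWith.of_dist_le_mul fun x y => ?_
    rw [dist_eq_norm, hB]
    simp only
    rw [← smul_sub, norm_smul, Real.norm_of_nonneg (by positivity), NNReal.coe_mul,
      Real.coe_toNNReal _ (by positivity), mul_assoc, ← dist_eq_norm]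
    exact mul_le_mul_of_nonneg_left (hA.dist_le_mul x y) (by positivity)
  have hBc : HasCompactSupport B := hcs.smul_left (f := fun _ => s⁻¹)
  have hgB : ∀ x i, grad B x i = (s⁻¹ : ℂ) * grad A x i := by
    intro x i
    change fderiv ℝ (s⁻¹ • A) x _ = _
    rw [fderiv_const_smul_field]
    change s⁻¹ • fderiv ℝ A x _ = _
    rw [Complex.real_smul]
    push_cast
    rfl
  have hsob : IsHomSobolev 2 B (grad B) := by
    have := isHomSobolev_of_lipschitz hBL hBc (q := 2) two_pos
    rwa [ENNReal.ofReal_ofNat] at this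
  let R : RegularAtom n p :=
    { toFun := B
      gradient := grad B
      isHomSobolev := hsob
      exists_cube := by
        refine ⟨WithLp.toLp 2 fun i => c i - 7 * r, 2 * (7 * r), by positivity,
          ae_of_all _ fun x hx => ?_, ?_⟩
        · rw [hB]
          simp only
          rw [image_eq_zero_of_notMem_tsupport (fun h => hx (hsubQ (hsupp h))), smul_zero]
        · rw [← hQ]
          have h1 : ∀ᵐ x ∂(volume.restrict Q), ‖grad B x‖ ≤ v ^ (-(1 / p)) := by
            refine ae_of_all _ fun x => ?_
            have h := enorm_grad_le hBL x
            rw [← ofReal_norm, ENNReal.coe_mul, ← ENNReal.ofReal_natCast,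
              ← ENNReal.ofReal_coe_nnreal, ← ENNReal.ofReal_coe_nnreal,
              ← ENNReal.ofReal_mul (by positivity), ← ENNReal.ofReal_mul (by positivity),
              ENNReal.ofReal_le_ofReal_iff (by positivity), Real.coe_toNNReal _ (by positivity)] at h
            refine h.trans (le_of_eq ?_)
            rw [hs, Real.rpow_neg hv0.le]
            field_simp
          refine (eLpNorm_le_of_ae_bound h1).trans (le_of_eq ?_)
          rw [Measure.restrict_apply_univ, ← ENNReal.ofReal_rpow_of_pos hv0, hv, Measure.real,
            ENNReal.ofReal_toReal hQt, ← ENNReal.rpow_add _ _ hQ0 hQt]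
          congr 1
          rw [ENNReal.toReal_ofNat]
          ring }
  have hvol : ENNReal.ofReal v ≤ (14 * n) ^ n * volume (Metric.ball c r) := by
    rw [hv, Measure.real, ENNReal.ofReal_toReal hQt]
    refine (measure_mono hQsub).trans (le_of_eq ?_)
    rw [volume_ball_eq c (by positivity), volume_ball_eq c hr, show 2 * (n : ℝ) * (7 * r) = (14 * n) * r by ring,
      mul_pow, ENNReal.ofReal_mul (by positivity),
      ENNReal.ofReal_pow (by positivity), ENNReal.ofReal_mul (by positivity), ENNReal.ofReal_ofNat,
      ENNReal.ofReal_natCast, mul_assoc]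
  refine ⟨((n * L * v ^ (1 / p) : ℝ) : ℂ), R, ?_, fun i => ?_⟩
  · rw [enorm_ofReal_mul_rpow hp (by positivity) hv0.le, ENNReal.ofReal_mul (by positivity),
      ENNReal.ofReal_natCast, ENNReal.ofReal_coe_nnreal, ENNReal.mul_rpow_of_nonneg _ _ hp.le]
    have hcoe : ((n : ℝ≥0) ^ p * (14 * n) ^ n + 8 ^ n : ℝ≥0) =
        ((n : ℝ≥0∞) ^ p * (14 * n) ^ n + 8 ^ n : ℝ≥0∞) := by
      push_cast
      rw [ENNReal.coe_rpow_of_nonneg _ hp.le]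
      simp
    rw [hcoe, add_mul]
    refine le_trans ?_ le_self_add
    calc _ ≤ (n : ℝ≥0∞) ^ p * (L : ℝ≥0∞) ^ p * ((14 * n) ^ n * volume (Metric.ball c r)) :=
          mul_le_mul_right hvol _
      _ = _ := by ring
  -- Each partial derivative of the piece is itself a multiple of an atom of H^p, being bounded by
  -- L, compactly supported and of mean zero. The quasi-norm of Ḣ^(1,p) asks for convergence in H^p,
  -- and this is what provides it.
  · set e : E n := EuclideanSpace.single i (1 : ℝ) with he
    have hr8 : 0 < 8 * r := by positivity
    have hv8 : 0 < volume.real (Metric.ball c (8 * r)) := by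
      rw [volume_real_ball c hr8]
      have := volume_real_unitBall_pos n
      positivity
    have hae := (measurable_fderiv_apply_const ℝ A e).aestronglyMeasurable (μ := volume)
    have hatom := isAtom_of_bounded (p := p) (c := c) (r := 8 * r) (b := L) hae hr8 hL'
      (ae_of_all _ fun x hx => by
        have : grad A x = 0 := grad_eq_zero fun h => hx
          (Metric.closedBall_subset_ball (by linarith) (hsupp h))
        exact congrArg (fun w : V n => w i) this)
      (ae_of_all _ fun x => by
        have := norm_fderiv_apply_le hA x e
        rwa [he, PiLp.norm_single, norm_one, mul_one] at this)
      (integral_fderiv_eq_zero hA (by positivity) hsupp e)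
    refine ⟨((L * volume.real (Metric.ball c (8 * r)) ^ (1 / p) : ℝ) : ℂ), _, hatom, ?_,
      fun φ => ?_⟩
    · rw [enorm_ofReal_mul_rpow hp (NNReal.coe_nonneg L) hv8.le, ENNReal.ofReal_coe_nnreal, Measure.real,
        ENNReal.ofReal_toReal measure_ball_lt_top.ne]
      push_cast
      rw [add_mul]
      refine le_trans (le_of_eq ?_) le_add_self
      rw [volume_ball_eq c hr8, volume_ball_eq c hr, mul_pow, ENNReal.ofReal_mul (by positivity),
        ENNReal.ofReal_pow (by norm_num), ENNReal.ofReal_ofNat]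
      ring
    have h1 : (s : ℂ) * R.partialDist i φ = ∫ x, fderiv ℝ A x e * φ x := by
      rw [R.partialDist_apply, ← integral_const_mul]
      refine integral_congr_ae (ae_of_all _ fun x => ?_)
      change (s : ℂ) * (grad B x i * φ x) = _
      rw [hgB, ← mul_assoc, ← mul_assoc, mul_inv_cancel₀ (by exact_mod_cast hs0.ne'), one_mul]
      rfl
    rw [← hs]
    refine ⟨?_, ?_⟩
    · rw [h1, ← integral_const_mul]
      refine integral_congr_ae (ae_of_all _ fun x => ?_)
      simp only
      rw [← mul_assoc, ← mul_assoc, mul_inv_cancel₀, one_mul]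
      exact_mod_cast (by positivity : (L : ℝ) * volume.real (Metric.ball c (8 * r)) ^ (1 / p) ≠ 0)
    · obtain ⟨S, -, -, hS⟩ := exists_schwartz_bound 0 φ
      have hφL : LipschitzWith S.toNNReal φ := by
        refine lipschitzWith_of_nnnorm_fderiv_le (𝕜 := ℝ)
          (fun x => (φ.smooth ⊤).contDiffAt.differentiableAt (by simp)) fun x => ?_
        rw [← NNReal.coe_le_coe]
        exact (hS x).trans (Real.le_coe_toNNReal S)
      rw [h1, integral_mul_fderiv_eq hA hφL (hA.continuous.integrable_of_hasCompactSupport hcs)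
        φ.integrable (fun w => by
          have h1 := φ.continuous
          have h2 := hA.continuous
          exact Continuous.integrable_of_hasCompactSupport (by fun_prop) hcs.mul_right) e, neg_neg]

/-! ### Functions with a Hajłasz gradient -/

/-- The level-set bound raised to the power 1 + 1/n. The remaining power of 2^k is -(p(1+1/n) - 1),
negative for p > n/(n+1). -/
theorem zpow_mul_rpow_le {n : ℕ} {p : ℝ} (hp : 0 < p) {k : ℤ} {v J V : ℝ≥0∞}
    (h : ((2 : ℝ≥0∞) ^ k) ^ p * v ≤ J) :
    (2 : ℝ≥0∞) ^ k * (v / V) ^ (1 + 1 / n : ℝ) ≤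
      (J / V) ^ (1 + 1 / n : ℝ) * ((2 : ℝ≥0∞) ^ k) ^ (-(p * (1 + 1 / n) - 1)) := by
  have h2z : (2 : ℝ≥0∞) ^ k ≠ ⊤ := ENNReal.zpow_ne_top (by simp) (by simp) k
  have h2p : (2 : ℝ≥0∞) ^ k ≠ 0 := (ENNReal.zpow_pos (by simp) (by simp) k).ne'
  have hpk : ((2 : ℝ≥0∞) ^ k) ^ p ≠ 0 := by simp [ENNReal.rpow_eq_zero_iff, h2p, h2z]
  have hv : v / V ≤ J / V * ((2 : ℝ≥0∞) ^ k) ^ (-p) := by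
    rw [ENNReal.rpow_neg, ENNReal.div_eq_inv_mul, ENNReal.div_eq_inv_mul, mul_assoc]
    refine mul_le_mul_right ?_ _
    rw [← div_eq_mul_inv, ENNReal.le_div_iff_mul_le (Or.inl hpk)
      (Or.inl (ENNReal.rpow_ne_top_of_nonneg hp.le h2z)), mul_comm]
    exact h
  calc _ ≤ (2 : ℝ≥0∞) ^ k * (J / V * ((2 : ℝ≥0∞) ^ k) ^ (-p)) ^ (1 + 1 / n : ℝ) :=
        mul_le_mul_right (ENNReal.rpow_le_rpow hv (by positivity)) _
    _ = (J / V) ^ (1 + 1 / n : ℝ) *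
        (((2 : ℝ≥0∞) ^ k) ^ (1 : ℝ) * (((2 : ℝ≥0∞) ^ k) ^ (-p)) ^ (1 + 1 / n : ℝ)) := by
      rw [ENNReal.mul_rpow_of_nonneg _ _ (by positivity), ENNReal.rpow_one]
      ring
    _ = _ := by
      rw [← ENNReal.rpow_mul, ← ENNReal.rpow_add _ _ h2p h2z]
      congr 2
      ring

theorem coe_zpow_two (k : ℤ) : (((2 : ℝ≥0) ^ k : ℝ≥0) : ℝ≥0∞) = (2 : ℝ≥0∞) ^ k := by
  rw [ENNReal.coe_zpow two_ne_zero, ENNReal.coe_ofNat]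

/-- The Lipschitz constants in the decomposition of a function with a Hajłasz gradient. -/
def hajlaszConst : ℝ≥0 := 6 * lipschitzExtensionConstant ℂ

theorem hajlaszConst_pos : 0 < hajlaszConst :=
  mul_pos (by norm_num) (lipschitzExtensionConstant_pos ℂ)

/-- The decomposition of a function with a Hajłasz gradient into Lipschitz pieces. -/
theorem exists_lipschitz_pieces {n : ℕ} (hn : 0 < n) {p : ℝ} (hp : (n : ℝ) / (n + 1) < p)
    {f : E n → ℂ} {h : E n → ℝ≥0∞} (hh : LowerSemicontinuous h) (hI : ∫⁻ x, h x ^ p < ⊤)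
    (hf : ∀ x y, h x < ⊤ → h y < ⊤ → ‖f x - f y‖ₑ ≤ ‖x - y‖ₑ * (h x + h y)) :
    ∃ (D : ℤ → Level n) (g : ℤ → E n → ℂ), (∀ k, (D k).F = {x | h x ≤ 2 ^ k}) ∧
      (∀ k, LipschitzWith (hajlaszConst * 2 ^ k) (g k)) ∧ (∀ k, ∀ x ∈ (D k).F, g k x = 0) ∧
      AEStronglyMeasurable f volume ∧ (Integrable fun x => ‖f x‖ / (1 + ‖x‖) ^ (n + 2)) ∧
      ∀ ψ : E n → ℂ, Continuous ψ → HasCompactSupport ψ → ∫ x, ψ x = 0 → ∀ S : ℂ,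
        HasSum (fun q : ℤ × ℕ => ∫ x, (D q.1).W.eta q.2 x • g q.1 x * ψ x) S →
          S = ∫ x, f x * ψ x := by
  have hp0 : 0 < p := lt_of_le_of_lt (by positivity) hp
  have hn' : (0 : ℝ) < n := by exact_mod_cast hn
  obtain ⟨C₂, hC₂⟩ := tsum_zpow_volume_lt_le (n := n) hp0
  have h2z : ∀ k : ℤ, (2 : ℝ≥0∞) ^ k ≠ ⊤ := fun k => ENNReal.zpow_ne_top (by simp) (by simp) k
  have h2p : ∀ k : ℤ, (2 : ℝ≥0∞) ^ k ≠ 0 := fun k => (ENNReal.zpow_pos (by simp) (by simp) k).ne'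
  set I := ∫⁻ x, h x ^ p with hIdef
  have hCI : C₂ * I < ⊤ := ENNReal.mul_lt_top ENNReal.coe_lt_top hI
  have hterm : ∀ k : ℤ, ((2 : ℝ≥0∞) ^ k) ^ p * volume {x | (2 : ℝ≥0∞) ^ k < h x} ≤ C₂ * I :=
    fun k => (ENNReal.le_tsum k).trans (hC₂ h hh.measurable)
  have hpk : ∀ k : ℤ, ((2 : ℝ≥0∞) ^ k) ^ p ≠ 0 := fun k => by
    simp [ENNReal.rpow_eq_zero_iff, h2p k, h2z k]
  have hvol : ∀ k : ℤ, volume {x | (2 : ℝ≥0∞) ^ k < h x} < ⊤ := fun k =>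
    ENNReal.lt_top_of_mul_ne_top_right ((hterm k).trans_lt hCI).ne (hpk k)
  choose D hDF hDlam using fun k : ℤ => exists_level hn hh (h2z k) (hvol k)
  have hcompl : ∀ k, (D k).Fᶜ = {x | (2 : ℝ≥0∞) ^ k < h x} := fun k => by
    rw [hDF]; ext x; simp
  have hmem : ∀ k x, x ∈ (D k).F ↔ h x ≤ 2 ^ k := fun k x => by rw [hDF]; rfl
  -- On the set where h ≤ 2^k the Hajłasz inequality is a Lipschitz condition with constant 2·2^k,
  -- and f extends from there to all of ℝⁿ at the cost of a constant factor.
  have hlip : ∀ k, LipschitzOnWith (2 * 2 ^ k) f (D k).F := by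
    intro k x hx y hy
    rw [hmem] at hx hy
    rw [edist_eq_enorm_sub, edist_eq_enorm_sub, mul_comm, ENNReal.coe_mul, coe_zpow_two]
    refine (hf x y (hx.trans_lt (h2z k).lt_top) (hy.trans_lt (h2z k).lt_top)).trans ?_
    refine mul_le_mul_right ((add_le_add hx hy).trans (le_of_eq ?_)) _
    rw [ENNReal.coe_ofNat, two_mul]
  choose fk hfk hfkeq using fun k => (hlip k).extend_finite_dimension
  set κ := lipschitzExtensionConstant ℂ with hκ
  set g : ℤ → E n → ℂ := fun k x => fk (k + 1) x - fk k x with hgdef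
  have h2s : ∀ k : ℤ, (2 : ℝ≥0) ^ (k + 1) = 2 * 2 ^ k := fun k => by
    rw [zpow_add₀ two_ne_zero, zpow_one, mul_comm]
  -- The extensions at the levels k+1 and k have constants 4 and 2 times 2^k, up to the extension
  -- constant, which accounts for the 6 in `hajlaszConst`.
  have hg : ∀ k, LipschitzWith (hajlaszConst * 2 ^ k) (g k) := by
    intro k
    refine ((hfk (k + 1)).sub (hfk k)).weaken (le_of_eq ?_)
    rw [h2s, hajlaszConst, ← hκ]
    ring
  have hmono : ∀ k x, x ∈ (D k).F → x ∈ (D (k + 1)).F := by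
    intro k x hx
    rw [hmem] at hx ⊢
    exact hx.trans (ENNReal.zpow_le_of_le (by norm_num) (by omega))
  have hg0 : ∀ k, ∀ x ∈ (D k).F, g k x = 0 := by
    intro k x hx
    simp only [hgdef]
    rw [← hfkeq k hx, ← hfkeq (k + 1) (hmono k x hx), sub_self]
  have hae : ∀ᵐ x, h x < ⊤ := by
    filter_upwards [ae_lt_top (hh.measurable.pow_const p) hI.ne] with x hx
    by_contra h'
    rw [not_lt, top_le_iff] at h'
    rw [h', ENNReal.top_rpow_of_pos hp0] at hx
    exact lt_irrefl _ hx
  have hev : ∀ x, h x < ⊤ → ∀ᶠ N : ℕ in atTop, fk N x = f x := by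
    intro x hx
    obtain ⟨N, hN⟩ := ENNReal.exists_nat_gt hx.ne
    filter_upwards [eventually_ge_atTop N] with M hM
    refine (hfkeq M ?_).symm
    rw [hmem, zpow_natCast]
    refine hN.le.trans ?_
    exact_mod_cast hM.trans Nat.lt_two_pow_self.le
  have hfm : AEStronglyMeasurable f volume := by
    refine aestronglyMeasurable_of_tendsto_ae atTop
      (fun N : ℕ => (hfk N).continuous.aestronglyMeasurable) ?_
    filter_upwards [hae] with x hx
    exact tendsto_const_nhds.congr' ((hev x hx).mono fun N hN => hN.symm)
  -- the integrals of the differences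
  set V := volume (Metric.ball (0 : E n) 1) with hV
  have hV0 : V ≠ 0 := (volume_unitBall_pos n).ne'
  have hVt : V ≠ ⊤ := (volume_unitBall_lt_top n).ne
  set s : ℝ := p * (1 + 1 / n) - 1 with hs
  have hs0 : 0 < s := by
    rw [div_lt_iff₀ (by positivity)] at hp
    have : p * (1 + 1 / n) = p * (n + 1) / n := by field_simp
    rw [hs, this, sub_pos, one_lt_div hn']
    exact hp
  set B : ℝ≥0∞ := hajlaszConst * (71 * 8 ^ n * V) * (C₂ * I / V) ^ (1 + 1 / n : ℝ) with hB
  have hBt : B ≠ ⊤ := ENNReal.mul_ne_top (ENNReal.mul_ne_top (by simp) (ENNReal.mul_ne_top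
    (by finiteness) hVt)) (ENNReal.rpow_ne_top_of_nonneg (by positivity) (ENNReal.div_ne_top hCI.ne hV0))
  have hsumA : ∀ k, ∑' i, ∫⁻ x, ‖(D k).W.eta i x • g k x‖ₑ ≤ B * ((2 : ℝ≥0∞) ^ k) ^ (-s) := by
    intro k
    refine ((D k).tsum_lintegral_eta_smul_le hn (hg k) (hg0 k)).trans ?_
    rw [ENNReal.coe_mul, coe_zpow_two, hcompl]
    calc _ = hajlaszConst * (71 * 8 ^ n * V) * ((2 : ℝ≥0∞) ^ k *
          (volume {x | (2 : ℝ≥0∞) ^ k < h x} / V) ^ (1 + 1 / n : ℝ)) := by ring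
      _ ≤ hajlaszConst * (71 * 8 ^ n * V) * _ := mul_le_mul_right (zpow_mul_rpow_le hp0 (hterm k)) _
      _ = _ := by rw [hB]; ring
  have hgint : ∀ k, ∫⁻ x, ‖g k x‖ₑ ≤ B * ((2 : ℝ≥0∞) ^ k) ^ (-s) := by
    intro k
    refine le_trans ?_ (hsumA k)
    rw [← lintegral_tsum fun i => ?_]
    · refine lintegral_mono fun x => ?_
      conv_lhs => rw [← ((D k).hasSum_eta_smul_apply (hg0 k) x).tsum_eq]
      exact enorm_tsum_le_tsum_enorm
    · exact ((((D k).W.eta_contDiff i).continuous.smul (hg k).continuous).aestronglyMeasurable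
        (μ := volume)).enorm
  have h2r : ∀ k : ℤ, ((2 : ℝ≥0∞) ^ k) ^ (-s) ≠ ⊤ := fun k => by
    simp [ENNReal.rpow_eq_top_iff, h2p k, h2z k]
  have h2s1 : (2 : ℝ≥0∞) ^ (-s) < 1 := by
    rw [ENNReal.rpow_neg, ENNReal.inv_lt_one]
    exact ENNReal.one_lt_rpow (by norm_num) hs0
  set B' : ℝ≥0∞ := B * (1 - (2 : ℝ≥0∞) ^ (-s))⁻¹ with hB'
  have hB't : B' ≠ ⊤ := ENNReal.mul_ne_top hBt (ENNReal.inv_ne_top.2 (tsub_pos_of_lt h2s1).ne')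
  -- Where h is finite, f agrees with f_N for large N, so f - f_k is the finite sum of the g_j with
  -- k ≤ j < N. The L¹ norms of the g_j decay geometrically.
  have hdiff : ∀ k, ∫⁻ x, ‖f x - fk k x‖ₑ ≤ B' * ((2 : ℝ≥0∞) ^ k) ^ (-s) := by
    intro k
    have h1 : ∀ᵐ x, ‖f x - fk k x‖ₑ ≤ ∑' j : ℕ, ‖g (k + j) x‖ₑ := by
      filter_upwards [hae] with x hx
      obtain ⟨N, hN1, hN2⟩ := ((hev x hx).and (eventually_ge_atTop k.toNat)).exists
      have hNk : k ≤ N := by omega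
      set J := ((N : ℤ) - k).toNat with hJ
      have hJk : k + (J : ℤ) = N := by omega
      have e : f x - fk k x = ∑ j ∈ Finset.range J, g (k + j) x := by
        have := Finset.sum_range_sub (fun j : ℕ => fk (k + j) x) J
        simp only [Nat.cast_zero, add_zero, hJk, Nat.cast_add, Nat.cast_one] at this
        rw [← hN1, ← this]
        refine Finset.sum_congr rfl fun j _ => ?_
        simp only [hgdef, add_assoc]
      rw [e]
      exact (enorm_sum_le _ _).trans (ENNReal.sum_le_tsum _)
    refine (lintegral_mono_ae h1).trans ?_
    rw [lintegral_tsum fun j => ((hg _).continuous.aestronglyMeasurable).enorm]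
    have h2 : ∀ j : ℕ, ∫⁻ x, ‖g (k + j) x‖ₑ ≤
        B * ((2 : ℝ≥0∞) ^ k) ^ (-s) * ((2 : ℝ≥0∞) ^ (-s)) ^ j := by
      intro j
      refine (hgint _).trans (le_of_eq ?_)
      rw [mul_assoc, ENNReal.zpow_add (by simp) (by simp), ENNReal.mul_rpow_of_ne_top (h2z _) (h2z _),
        zpow_natCast, ← ENNReal.rpow_natCast 2 j, ← ENNReal.rpow_natCast (2 ^ (-s)) j,
        ← ENNReal.rpow_mul, ← ENNReal.rpow_mul, mul_comm (j : ℝ), hB]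
      ring
    refine (ENNReal.tsum_le_tsum h2).trans (le_of_eq ?_)
    rw [ENNReal.tsum_mul_left, ENNReal.tsum_geometric, hB']
    ring
  have hdi : ∀ k, Integrable fun x => f x - fk k x := fun k =>
    ⟨hfm.sub (hfk k).continuous.aestronglyMeasurable, (hdiff k).trans_lt
      (ENNReal.mul_lt_top hB't.lt_top (h2r k).lt_top)⟩
  refine ⟨D, g, hDF, hg, hg0, hfm, ?_, fun ψ hψ hψc hψ0 S hS => ?_⟩
  · have hint : Integrable fun x : E n => (1 + ‖x‖) ^ (-((n + 1 : ℕ) : ℝ)) :=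
      integrable_one_add_norm (by
        rw [finrank_euclideanSpace_fin]; exact_mod_cast Nat.lt_succ_self n)
    set L : ℝ := κ * (2 * 2 ^ (0 : ℤ)) with hL
    -- The function f is the sum of an integrable function and the Lipschitz function f_0. One of
    -- the n+2 powers absorbs the linear growth of f_0, the other n+1 give integrability.
    have hbd : ∀ x, ‖f x‖ / (1 + ‖x‖) ^ (n + 2) ≤
        ‖f x - fk 0 x‖ + (‖fk 0 0‖ + L) * (1 + ‖x‖) ^ (-((n + 1 : ℕ) : ℝ)) := by
      intro x
      have h1 : (1 : ℝ) ≤ 1 + ‖x‖ := by linarith [norm_nonneg x]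
      have h2 := (hfk 0).norm_sub_le x 0
      rw [sub_zero] at h2
      push_cast at h2
      have h3 : ‖f x‖ ≤ ‖f x - fk 0 x‖ + (‖fk 0 0‖ + L) * (1 + ‖x‖) := by
        have h4 : ‖f x‖ ≤ ‖f x - fk 0 x‖ + ‖fk 0 x - fk 0 0‖ + ‖fk 0 0‖ := by
          calc ‖f x‖ = ‖(f x - fk 0 x) + (fk 0 x - fk 0 0) + fk 0 0‖ := by congr 1; ring
            _ ≤ _ := norm_add₃_le
        have h5 : 0 ≤ ‖fk 0 0‖ * ‖x‖ := by positivity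
        have h6 : 0 ≤ L := by positivity
        have h7 : ‖fk 0 x - fk 0 0‖ ≤ L * ‖x‖ := h2
        nlinarith
      rw [div_le_iff₀ (by positivity), add_mul]
      refine h3.trans (add_le_add ?_ (le_of_eq ?_))
      · exact le_mul_of_one_le_right (norm_nonneg _) (one_le_pow₀ h1)
      · rw [mul_assoc, Real.rpow_neg (by positivity), Real.rpow_natCast, pow_succ _ (n + 1)]
        field_simp
    refine Integrable.mono' (((hdi 0).norm).add (hint.const_mul (‖fk 0 0‖ + L)))
      (hfm.norm.aemeasurable.div (by fun_prop)).aestronglyMeasurable (ae_of_all _ fun x => ?_)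
    rw [Real.norm_of_nonneg (by positivity)]
    exact hbd x
  · obtain ⟨M, hM⟩ := hψc.exists_bound_of_continuous hψ
    have hψi := hψ.integrable_of_hasCompactSupport (μ := volume) hψc
    have hdψ : ∀ k, Integrable fun x => (f x - fk k x) * ψ x := fun k =>
      (hdi k).mul_bdd hψ.aestronglyMeasurable (ae_of_all _ hM)
    have hfkψ : ∀ k, Integrable fun x => fk k x * ψ x := fun k =>
      ((hfk k).continuous.mul hψ).integrable_of_hasCompactSupport hψc.mul_left
    set b : ℤ → ℂ := fun k => ∫ x, (f x - fk k x) * ψ x with hb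
    -- With b_k = ∫(f - f_k)ψ, the difference b_k - b_(k+1) is the integral of g_kψ, split by the
    -- Whitney partition of unity.
    have h1 : ∀ k, HasSum (fun i => ∫ x, (D k).W.eta i x • g k x * ψ x) (b k - b (k + 1)) := by
      intro k
      have e : b k - b (k + 1) = ∫ x, ∑' i, (D k).W.eta i x • g k x * ψ x := by
        simp only [hb]
        rw [← integral_sub (hdψ k) (hdψ (k + 1))]
        refine integral_congr_ae (ae_of_all _ fun x => ?_)
        simp only
        rw [(((D k).hasSum_eta_smul_apply (hg0 k) x).mul_right (ψ x)).tsum_eq, hgdef]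
        ring
      rw [e]
      have hcont : ∀ i, Continuous fun x => (D k).W.eta i x • g k x * ψ x := fun i =>
        (((D k).W.eta_contDiff i).continuous.smul (hg k).continuous).mul hψ
      refine hasSum_integral_of_summable_integral_norm
        (fun i => (hcont i).integrable_of_hasCompactSupport hψc.mul_left) ?_
      have hle : ∀ i, ∫⁻ x, ‖(D k).W.eta i x • g k x * ψ x‖ₑ ≤
          (∫⁻ x, ‖(D k).W.eta i x • g k x‖ₑ) * ENNReal.ofReal M := by
        intro i
        rw [← lintegral_mul_const' _ _ ENNReal.ofReal_ne_top]
        refine lintegral_mono fun x => ?_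
        rw [enorm_mul]
        refine mul_le_mul_right ?_ _
        rw [← ofReal_norm]
        exact ENNReal.ofReal_le_ofReal (hM x)
      have hlt : ∑' i, ∫⁻ x, ‖(D k).W.eta i x • g k x * ψ x‖ₑ ≠ ⊤ := by
        refine ((ENNReal.tsum_le_tsum hle).trans_lt ?_).ne
        rw [ENNReal.tsum_mul_right]
        refine ENNReal.mul_lt_top ((hsumA k).trans_lt (ENNReal.mul_lt_top hBt.lt_top
          (h2r k).lt_top)) ENNReal.ofReal_lt_top
      refine (ENNReal.summable_toReal hlt).congr fun i => ?_
      rw [integral_norm_eq_lintegral_enorm (hcont i).aestronglyMeasurable]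
    refine eq_of_hasSum_telescope (hS.prod_fiberwise h1) ?_ ?_
    · rw [tendsto_zero_iff_enorm_tendsto_zero]
      have hbd : ∀ N : ℕ, ‖b N‖ₑ ≤ B' * ENNReal.ofReal M * ((2 : ℝ≥0∞) ^ (-s)) ^ N := by
        intro N
        refine (enorm_integral_le_lintegral_enorm _).trans ?_
        calc ∫⁻ x, ‖(f x - fk N x) * ψ x‖ₑ ≤ ∫⁻ x, ‖f x - fk N x‖ₑ * ENNReal.ofReal M := by
              refine lintegral_mono fun x => ?_
              rw [enorm_mul]
              refine mul_le_mul_right ?_ _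
              rw [← ofReal_norm]
              exact ENNReal.ofReal_le_ofReal (hM x)
          _ = (∫⁻ x, ‖f x - fk N x‖ₑ) * ENNReal.ofReal M :=
              lintegral_mul_const' _ _ ENNReal.ofReal_ne_top
          _ ≤ B' * ((2 : ℝ≥0∞) ^ (N : ℤ)) ^ (-s) * ENNReal.ofReal M :=
              mul_le_mul_left (hdiff N) _
          _ = _ := by
              rw [zpow_natCast, ← ENNReal.rpow_natCast, ← ENNReal.rpow_natCast, ← ENNReal.rpow_mul,
                ← ENNReal.rpow_mul, mul_comm (N : ℝ)]
              ring
      have hlim := ENNReal.Tendsto.const_mul (a := B' * ENNReal.ofReal M)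
        (ENNReal.tendsto_pow_atTop_nhds_zero_of_lt_one h2s1)
        (Or.inr (ENNReal.mul_ne_top hB't ENNReal.ofReal_ne_top))
      rw [mul_zero] at hlim
      exact tendsto_of_tendsto_of_tendsto_of_le_of_le tendsto_const_nhds hlim (fun _ => zero_le) hbd
    · have hfψ : Integrable fun x => f x * ψ x := by
        refine ((hdψ 0).add (hfkψ 0)).congr (ae_of_all _ fun x => ?_)
        simp only [Pi.add_apply]
        ring
      have e : ∀ k, b k = (∫ x, f x * ψ x) - ∫ x, fk k x * ψ x := by
        intro k
        rw [← integral_sub hfψ (hfkψ k)]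
        refine integral_congr_ae (ae_of_all _ fun x => ?_)
        simp only
        ring
      have hxψ : Integrable fun x => ‖x‖ * ‖ψ x‖ :=
        (continuous_norm.mul hψ.norm).integrable_of_hasCompactSupport hψc.norm.mul_left
      -- Only the oscillation of f_(-N) counts because ψ has mean zero, and its Lipschitz constant
      -- is of order 2^(-N). Without the mean-zero condition the limit would see an additive
      -- constant.
      have h0 : Tendsto (fun N : ℕ => ∫ x, fk (-N) x * ψ x) atTop (𝓝 0) := by
        have hbd : ∀ N : ℕ, ‖∫ x, fk (-N) x * ψ x‖ ≤
            κ * 2 * (∫ x, ‖x‖ * ‖ψ x‖) * (1 / 2 : ℝ) ^ N := by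
          intro N
          have e1 : ∫ x, fk (-N) x * ψ x = ∫ x, (fk (-N) x - fk (-N) 0) * ψ x := by
            have h3 : ∫ x, fk (-N) 0 * ψ x = 0 := by rw [integral_const_mul, hψ0, mul_zero]
            rw [← sub_zero (∫ x, fk (-N) x * ψ x), ← h3, ← integral_sub (hfkψ _) (hψi.const_mul _)]
            refine integral_congr_ae (ae_of_all _ fun x => ?_)
            simp only
            ring
          rw [e1]
          refine (norm_integral_le_of_norm_le (hxψ.const_mul (κ * 2 * (1 / 2 : ℝ) ^ N))
            (ae_of_all _ fun x => ?_)).trans (le_of_eq ?_)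
          · rw [norm_mul, ← mul_assoc]
            refine mul_le_mul_of_nonneg_right ?_ (norm_nonneg _)
            refine ((hfk (-N)).norm_sub_le x 0).trans (le_of_eq ?_)
            push_cast
            rw [sub_zero, zpow_neg, zpow_natCast, one_div, inv_pow]
            ring
          · rw [integral_const_mul]
            ring
        refine squeeze_zero_norm hbd ?_
        have := (tendsto_pow_atTop_nhds_zero_of_lt_one (r := (1 / 2 : ℝ)) (by norm_num)
          (by norm_num)).const_mul (κ * 2 * (∫ x, ‖x‖ * ‖ψ x‖))
        rwa [mul_zero] at this
      have h3 := h0.const_sub (∫ x, f x * ψ x)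
      rw [sub_zero] at h3
      exact h3.congr fun N => (e _).symm

theorem RegularAtom.nonempty {n : ℕ} (hn : 0 < n) {p : ℝ} (hp : 0 < p) :
    Nonempty (RegularAtom n p) := by
  obtain ⟨_, hC⟩ := exists_regularAtom hn hp
  obtain ⟨_, R, _⟩ := hC (fun _ => 0) 1 0 1 (LipschitzWith.const 0 |>.weaken zero_le)
    (by simp) one_pos one_pos
  exact ⟨R⟩

theorem integral_fderiv_testFunction {d : ℕ} {φ : E d → ℂ} (hφ : IsTestFunction Set.univ φ)
    (v : E d) : ∫ x, fderiv ℝ φ x v = 0 := by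
  obtain ⟨L, hL⟩ := hφ.lipschitzWith
  obtain ⟨r, hr⟩ := hφ.2.1.isCompact.isBounded.subset_closedBall 0
  exact integral_fderiv_eq_zero hL (r := max r 1) (by positivity)
    (hr.trans (Metric.closedBall_subset_closedBall (le_max_left _ _))) v

theorem continuous_fderiv_testFunction {d : ℕ} {φ : E d → ℂ} (hφ : IsTestFunction Set.univ φ)
    (v : E d) : Continuous fun x => fderiv ℝ φ x v :=
  (hφ.1.continuous_fderiv (by simp)).clm_apply continuous_const

theorem hasCompactSupport_fderiv_testFunction {d : ℕ} {φ : E d → ℂ}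
    (hφ : IsTestFunction Set.univ φ) (v : E d) : HasCompactSupport fun x => fderiv ℝ φ x v :=
  (hφ.2.1.fderiv ℝ).comp_left (g := fun w : E d →L[ℝ] ℂ => w v) rfl

/-- The Lipschitz pieces are multiples of regular atoms, and their derivatives multiples of atoms of
H^p, with coefficients to the power p of order 2^(kp) times the volume of the Whitney ball. These
sum to a constant times ∫h^p. Derivatives of test functions have mean zero, so the series of
derivatives of the pieces represents the gradient of f. -/
theorem exists_atomicHardySobolev_of_hajlasz {n : ℕ} (hn : 0 < n) {p : ℝ}
    (hp : (n : ℝ) / (n + 1) < p) (hp1 : p ≤ 1) : ∃ C : ℝ≥0, ∀ (f : E n → ℂ) (h : E n → ℝ≥0∞),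
    LowerSemicontinuous h → ∫⁻ x, h x ^ p < ⊤ →
    (∀ x y, h x < ⊤ → h y < ⊤ → ‖f x - f y‖ₑ ≤ ‖x - y‖ₑ * (h x + h y)) →
    ∃ F : 𝓢'(E n, ℂ), Represents F f ∧
      atomicHardySobolevNorm p F ≤ C * (∫⁻ x, h x ^ p) ^ (1 / p) := by
  have hp0 : 0 < p := lt_of_le_of_lt (by positivity) hp
  obtain ⟨C₁, hC₁⟩ := exists_regularAtom hn hp0
  obtain ⟨C₂, hC₂⟩ := tsum_zpow_volume_lt_le (n := n) hp0
  set K : ℝ≥0 := (1 + 71 * etaConst n) * hajlaszConst with hK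
  have hK0 : 0 < K := mul_pos (by positivity) hajlaszConst_pos
  set B : ℝ≥0∞ := C₁ * (K : ℝ≥0∞) ^ p * C₂ with hB
  have hBt : B ≠ ⊤ := ENNReal.mul_ne_top (ENNReal.mul_ne_top ENNReal.coe_ne_top
    (ENNReal.rpow_ne_top_of_nonneg hp0.le ENNReal.coe_ne_top)) ENNReal.coe_ne_top
  refine ⟨(B ^ (1 / p)).toNNReal, fun f h hh hI hf => ?_⟩
  rw [ENNReal.coe_toNNReal (ENNReal.rpow_ne_top_of_nonneg (by positivity) hBt)]
  set I := ∫⁻ x, h x ^ p with hIdef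
  obtain ⟨D, g, hDF, hg, hg0, hfm, hfi, hfS⟩ := exists_lipschitz_pieces hn hp hh hI hf
  obtain ⟨F, hF⟩ := exists_represents (n + 2) hfm hfi
  refine ⟨F, hF, ?_⟩
  have hAL : ∀ k i, LipschitzWith (K * 2 ^ k) fun x => (D k).W.eta i x • g k x := fun k i =>
    ((D k).lipschitzWith_eta_smul (hg k) (hg0 k) i).weaken (le_of_eq (by rw [hK]; ring))
  have key : ∀ (k : ℤ) (i : ℕ), ∃ (l : ℂ) (R : RegularAtom n p),
      ‖l‖ₑ ^ p ≤ C₁ * ((K * (2 : ℝ≥0∞) ^ k) ^ p * volume (Metric.ball ((D k).W.c i) ((D k).W.r i))) ∧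
      ∀ j, ∃ (m : ℂ) (a : E n → ℂ), IsAtom p a ∧
        ‖m‖ₑ ^ p ≤ C₁ * ((K * (2 : ℝ≥0∞) ^ k) ^ p *
          volume (Metric.ball ((D k).W.c i) ((D k).W.r i))) ∧
        ∀ φ : 𝓢(E n, ℂ), l * R.partialDist j φ = m * ∫ x, a x * φ x ∧
          l * R.partialDist j φ = -∫ x, (D k).W.eta i x • g k x *
            fderiv ℝ φ x (EuclideanSpace.single j (1 : ℝ)) := by
    intro k i
    rcases ((D k).W.r_nonneg i).eq_or_lt with hi | hi
    · obtain ⟨R⟩ := RegularAtom.nonempty hn hp0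
      have h0 := (D k).eta_smul_eq_zero hi.symm (g k)
      have h0' : ∀ x, (D k).W.eta i x • g k x = 0 := fun x => congrFun h0 x
      refine ⟨0, R, ?_, fun j => ⟨0, fun _ => 0, isAtom_zero p, ?_, fun φ => ?_⟩⟩
      · rw [enorm_zero, ENNReal.zero_rpow_of_pos hp0]; exact zero_le
      · rw [enorm_zero, ENNReal.zero_rpow_of_pos hp0]; exact zero_le
      · simp [h0']
    · obtain ⟨l, R, hl, hR⟩ := hC₁ _ (K * 2 ^ k) ((D k).W.c i) ((D k).W.r i) (hAL k i)
        ((D k).tsupport_eta_smul_subset i (g k)) (mul_pos hK0 (by positivity)) hi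
      rw [ENNReal.coe_mul, coe_zpow_two] at hl hR
      exact ⟨l, R, hl, hR⟩
  choose l R hl m a ha hm hla using key
  let e : ℕ ≃ ℤ × ℕ := (Denumerable.eqv (ℤ × ℕ)).symm
  have hcompl : ∀ k, (D k).Fᶜ = {x | (2 : ℝ≥0∞) ^ k < h x} := fun k => by
    rw [hDF]; ext x; simp
  have hsum : ∀ t : ℤ → ℕ → ℂ, (∀ k i, ‖t k i‖ₑ ^ p ≤ C₁ * ((K * (2 : ℝ≥0∞) ^ k) ^ p *
      volume (Metric.ball ((D k).W.c i) ((D k).W.r i)))) →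
      ∑' j, ‖t (e j).1 (e j).2‖ₑ ^ p ≤ B * I := by
    intro t ht
    rw [e.tsum_eq fun q : ℤ × ℕ => ‖t q.1 q.2‖ₑ ^ p, ENNReal.tsum_prod (f := fun k i => ‖t k i‖ₑ ^ p)]
    have h1 : ∀ k, ∑' i, ‖t k i‖ₑ ^ p ≤
        C₁ * (K : ℝ≥0∞) ^ p * (((2 : ℝ≥0∞) ^ k) ^ p * volume {x | (2 : ℝ≥0∞) ^ k < h x}) := by
      intro k
      refine (ENNReal.tsum_le_tsum (ht k)).trans ?_
      rw [ENNReal.tsum_mul_left, ENNReal.tsum_mul_left, ENNReal.mul_rpow_of_nonneg _ _ hp0.le,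
        ← hcompl]
      calc _ ≤ C₁ * ((K : ℝ≥0∞) ^ p * ((2 : ℝ≥0∞) ^ k) ^ p * volume (D k).Fᶜ) :=
            mul_le_mul_right (mul_le_mul_right ((D k).W.tsum_volume_le (D k).ball_subset_compl) _) _
        _ = _ := by ring
    refine (ENNReal.tsum_le_tsum h1).trans ?_
    rw [ENNReal.tsum_mul_left, hB, mul_assoc _ (C₂ : ℝ≥0∞)]
    exact mul_le_mul_right (hC₂ h hh.measurable) _
  have hBI : B * I < ⊤ := ENNReal.mul_lt_top hBt.lt_top hI
  refine iInf_le_of_le (fun j => l (e j).1 (e j).2) (iInf_le_of_le (fun j => R (e j).1 (e j).2)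
    (iInf_le_of_le (fun i => ?_) ?_))
  swap
  · rw [← ENNReal.mul_rpow_of_nonneg _ _ (by positivity)]
    exact ENNReal.rpow_le_rpow (hsum l hl) (by positivity)
  set v : E n := EuclideanSpace.single i (1 : ℝ) with hv
  have hmt : ∑' j, ‖m (e j).1 (e j).2 i‖ₑ ^ p < ⊤ :=
    (hsum (fun k j => m k j i) fun k j => hm k j i).trans_lt hBI
  obtain ⟨T, hT⟩ := exists_tempered_of_atoms hp0 hp hp1 (l := fun j => m (e j).1 (e j).2 i)
    (a := fun j => a (e j).1 (e j).2 i) (fun j => ha _ _ _) hmt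
  have hTF : LineDeriv.lineDerivOp v F = T := by
    refine tempered_ext fun φ hφc => ?_
    have hφ : IsTestFunction Set.univ φ := ⟨φ.smooth ⊤, hφc, Set.subset_univ _⟩
    have h1 := (hT φ).neg
    have h2 : HasSum ((fun q : ℤ × ℕ => ∫ x, (D q.1).W.eta q.2 x • g q.1 x * fderiv ℝ φ x v) ∘ e)
        (-T φ) := by
      refine h1.congr_fun fun j => ?_
      rw [← (hla _ _ i φ).1, (hla _ _ i φ).2, neg_neg]
      rfl
    rw [e.hasSum_iff] at h2
    have h3 := hfS _ (continuous_fderiv_testFunction hφ v) (hasCompactSupport_fderiv_testFunction hφ v)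
      (integral_fderiv_testFunction hφ v) _ h2
    rw [TemperedDistribution.lineDerivOp_apply_apply, map_neg, (hF.2 _).2, eq_comm, ← neg_eq_iff_eq_neg,
      h3]
    rfl
  -- The remainder after N terms is again a series of atoms, so its atomic quasi-norm is controlled
  -- by the tail of a convergent series.
  have hle : ∀ N, atomicNorm p (LineDeriv.lineDerivOp v F -
      ∑ j ∈ Finset.range N, l (e j).1 (e j).2 • (R (e j).1 (e j).2).partialDist i) ≤
      (∑' j, ‖m (e (j + N)).1 (e (j + N)).2 i‖ₑ ^ p) ^ (1 / p) := by
    intro N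
    refine atomicNorm_le (fun j => m (e (j + N)).1 (e (j + N)).2 i)
      (fun j => a (e (j + N)).1 (e (j + N)).2 i) (fun j => ha _ _ _) fun φ => ?_
    have h1 := (hasSum_nat_add_iff' N).2 (hT φ)
    have h2 : ∀ M, (∑ j ∈ Finset.range M, l (e j).1 (e j).2 • (R (e j).1 (e j).2).partialDist i) φ =
        ∑ j ∈ Finset.range M, l (e j).1 (e j).2 * (R (e j).1 (e j).2).partialDist i φ := by
      intro M
      induction M with
      | zero => simp
      | succ M ih =>
        rw [Finset.sum_range_succ, Finset.sum_range_succ, ← ih]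
        rfl
    have e1 : (LineDeriv.lineDerivOp v F - ∑ j ∈ Finset.range N,
        l (e j).1 (e j).2 • (R (e j).1 (e j).2).partialDist i) φ = T φ -
        ∑ j ∈ Finset.range N, m (e j).1 (e j).2 i * ∫ x, a (e j).1 (e j).2 i x * φ x := by
      rw [hTF, ← Finset.sum_congr rfl fun j _ => (hla _ _ i φ).1, ← h2]
      rfl
    rw [e1]
    exact h1
  have hlim := (ENNReal.tendsto_sum_nat_add (fun j => ‖m (e j).1 (e j).2 i‖ₑ ^ p)
    hmt.ne).ennrpow_const (1 / p)
  rw [ENNReal.zero_rpow_of_pos (by positivity)] at hlim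
  exact tendsto_of_tendsto_of_tendsto_of_le_of_le tendsto_const_nhds hlim (fun _ => zero_le) hle

theorem exists_lipschitzWith_sum {d : ℕ} {A : ℕ → E d → ℂ} {L : ℕ → ℝ≥0}
    (hA : ∀ j, LipschitzWith (L j) (A j)) (hc : ∀ j, HasCompactSupport (A j)) (N : ℕ) :
    (LipschitzWith (∑ j ∈ Finset.range N, L j) fun x => ∑ j ∈ Finset.range N, A j x) ∧
      HasCompactSupport fun x => ∑ j ∈ Finset.range N, A j x := by
  induction N with
  | zero =>
    simp only [Finset.range_zero, Finset.sum_empty]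
    exact ⟨LipschitzWith.const 0, HasCompactSupport.zero⟩
  | succ N ih =>
    simp only [Finset.sum_range_succ]
    exact ⟨ih.1.add (hA N), ih.2.add (hc N)⟩

theorem ae_grad_sum {d : ℕ} {A : ℕ → E d → ℂ} {L : ℕ → ℝ≥0}
    (hA : ∀ j, LipschitzWith (L j) (A j)) : ∀ᵐ x, ∀ N,
      grad (fun y => ∑ j ∈ Finset.range N, A j y) x = ∑ j ∈ Finset.range N, grad (A j) x := by
  filter_upwards [ae_all_iff.2 fun j => (hA j).ae_differentiableAt] with x hx N
  ext i
  rw [grad, fderiv_fun_sum fun j _ => hx j]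
  simp [grad, WithLp.ofLp_sum, Finset.sum_apply]

theorem hasSum_coord {ι : Type*} {d : ℕ} {w : ι → V d} {s : V d} (h : HasSum w s) (i : Fin d) :
    HasSum (fun j => w j i) (s i) :=
  h.mapL (EuclideanSpace.proj i : V d →L[ℂ] ℂ)

/-- The gradients of the pieces sum absolutely, almost everywhere, to a function G dominated by h in
L^p, and termwise integration by parts identifies G as the weak gradient of f. The partial sums are
Lipschitz with compact support, so they are limits of test functions in the gradient norm and
converge to f there by domination. -/
theorem isHomSobolev_of_tsum {d : ℕ} {p : ℝ} (hp : 1 ≤ p) {f : E d → ℂ} {A : ℕ → E d → ℂ}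
    {L : ℕ → ℝ≥0} {h : E d → ℝ≥0∞} (hA : ∀ j, LipschitzWith (L j) (A j))
    (hc : ∀ j, HasCompactSupport (A j)) (hI : ∫⁻ x, h x ^ p < ⊤) (hh : Measurable h)
    (hsum : ∀ x, ∑' j, ‖grad (A j) x‖ₑ ≤ h x) (hf : LocallyIntegrable f)
    (hfS : ∀ ψ : E d → ℂ, Continuous ψ → HasCompactSupport ψ → ∫ x, ψ x = 0 → ∀ S : ℂ,
      HasSum (fun j => ∫ x, A j x * ψ x) S → S = ∫ x, f x * ψ x) :
    ∃ G : E d → V d, IsHomSobolev (ENNReal.ofReal p) f G ∧ ∀ x, ‖G x‖ₑ ≤ h x := by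
  have hp0 : 0 < p := by linarith
  have hht : ∀ᵐ x, h x < ⊤ := by
    filter_upwards [ae_lt_top (hh.pow_const p) hI.ne] with x hx
    by_contra h1
    rw [not_lt_top_iff.1 h1, ENNReal.top_rpow_of_pos hp0] at hx
    exact lt_irrefl _ hx
  set G : E d → V d := fun x => ∑' j, grad (A j) x with hG
  have hGs : ∀ x, h x < ⊤ → HasSum (fun j => grad (A j) x) (G x) := fun x hx =>
    Summable.hasSum <| Summable.of_norm <| by
      simpa using ENNReal.summable_toReal ((hsum x).trans_lt hx).ne
  have hGle : ∀ x, ‖G x‖ₑ ≤ h x := fun x => enorm_tsum_le_tsum_enorm.trans (hsum x)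
  have hGm : AEStronglyMeasurable G volume := by
    refine aestronglyMeasurable_of_tendsto_ae atTop
      (f := fun N x => ∑ j ∈ Finset.range N, grad (A j) x) (fun N => ?_) ?_
    · exact (Finset.measurable_fun_sum _ fun j _ => measurable_grad (A j)).aestronglyMeasurable
    · filter_upwards [hht] with x hx
      exact (hGs x hx).tendsto_sum_nat
  have hpne : ENNReal.ofReal p ≠ 0 := by simpa using hp0
  have hGLp : MemLp G (ENNReal.ofReal p) volume := by
    refine ⟨hGm, ?_⟩
    rw [eLpNorm_lt_top_iff_lintegral_rpow_enorm_lt_top hpne ENNReal.ofReal_ne_top,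
      ENNReal.toReal_ofReal hp0.le]
    exact (lintegral_mono fun x => ENNReal.rpow_le_rpow (hGle x) hp0.le).trans_lt hI
  have hGloc : LocallyIntegrable G :=
    hGLp.locallyIntegrable (by rw [← ENNReal.ofReal_one]; exact ENNReal.ofReal_le_ofReal hp)
  refine ⟨G, ⟨⟨hf.locallyIntegrableOn _, hGloc.locallyIntegrableOn _, fun φ hφ i => ?_⟩, hGLp, ?_⟩,
    hGle⟩
  · rw [Measure.restrict_univ]
    set v : E d := EuclideanSpace.single i (1 : ℝ) with hv
    obtain ⟨Lφ, hLφ⟩ := hφ.lipschitzWith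
    obtain ⟨b, hb⟩ := hφ.2.1.exists_bound_of_continuous hφ.1.continuous
    have hφi : Integrable φ := hφ.1.continuous.integrable_of_hasCompactSupport hφ.2.1
    have hi : ∀ w : V d, ‖w i‖ₑ ≤ ‖w‖ₑ := fun w => by
      rw [← ofReal_norm, ← ofReal_norm]
      exact ENNReal.ofReal_le_ofReal (PiLp.norm_apply_le w i)
    have hmi : ∀ j, Measurable fun x => grad (A j) x i := fun j =>
      (EuclideanSpace.proj i : V d →L[ℂ] ℂ).measurable.comp (measurable_grad (A j))
    have hm : ∀ j, AEStronglyMeasurable (fun x => grad (A j) x i * φ x) volume := fun j =>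
      (hmi j).aestronglyMeasurable.mul hφ.1.continuous.aestronglyMeasurable
    have hfin : ∑' j, ∫⁻ x, ‖grad (A j) x i * φ x‖ₑ < ⊤ := by
      rw [← lintegral_tsum fun j => (hm j).enorm]
      calc ∫⁻ x, ∑' j, ‖grad (A j) x i * φ x‖ₑ ≤ ∫⁻ x, (‖φ x‖ₑ + h x ^ p * ENNReal.ofReal b) := by
            refine lintegral_mono fun x => ?_
            calc ∑' j, ‖grad (A j) x i * φ x‖ₑ ≤ ∑' j, ‖grad (A j) x‖ₑ * ‖φ x‖ₑ :=
                  ENNReal.tsum_le_tsum fun j => by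
                    rw [enorm_mul]; exact mul_le_mul_left (hi _) _
              _ ≤ (1 + h x ^ p) * ‖φ x‖ₑ := by
                  rw [ENNReal.tsum_mul_right]
                  exact mul_le_mul_left ((hsum x).trans (le_one_add_rpow hp _)) _
              _ ≤ _ := by
                  rw [add_mul, one_mul]
                  refine add_le_add le_rfl (mul_le_mul_right ?_ _)
                  rw [← ofReal_norm]
                  exact ENNReal.ofReal_le_ofReal (hb x)
        _ < ⊤ := by
            rw [lintegral_add_right _ ((hh.pow_const p).mul_const _),
              lintegral_mul_const _ (hh.pow_const p)]
            exact ENNReal.add_lt_top.2 ⟨hφi.2, ENNReal.mul_lt_top hI ENNReal.ofReal_lt_top⟩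
    have h1 : HasSum (fun j => ∫ x, grad (A j) x i * φ x) (∫ x, G x i * φ x) := by
      have e1 : ∫ x, G x i * φ x = ∑' j, ∫ x, grad (A j) x i * φ x := by
        rw [← integral_tsum hm hfin.ne]
        refine integral_congr_ae ?_
        filter_upwards [hht] with x hx
        have h3 : HasSum (fun j => grad (A j) x i) (G x i) :=
          hasSum_coord (hGs x hx) i
        rw [← h3.tsum_eq, tsum_mul_right]
      rw [e1]
      refine (summable_of_tsum_enorm_lt_top (lt_of_le_of_lt ?_ hfin)).hasSum
      exact ENNReal.tsum_le_tsum fun j => enorm_integral_le_lintegral_enorm _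
    have h2 : HasSum (fun j => ∫ x, A j x * fderiv ℝ φ x v) (-∫ x, G x i * φ x) := by
      refine h1.neg.congr_fun fun j => ?_
      refine integral_mul_fderiv_eq (hA j) hLφ
        ((hA j).continuous.integrable_of_hasCompactSupport (hc j)) hφi (fun w => ?_) v
      exact ((hA j).continuous.mul (hφ.1.continuous.comp (by fun_prop))).integrable_of_hasCompactSupport
        (hc j).mul_right
    exact (hfS _ (continuous_fderiv_testFunction hφ v) (hasCompactSupport_fderiv_testFunction hφ v)
      (integral_fderiv_testFunction hφ v) _ h2).symm
  · set a : ℕ → E d → ℂ := fun N y => ∑ j ∈ Finset.range N, A j y with ha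
    -- Approximate the N-th partial sum by a test function within 1/(N+1). The triangle inequality
    -- then passes to the limit.
    have h1 : ∀ N, ∃ φ, IsTestFunction Set.univ φ ∧
        eLpNorm (fun x => grad φ x - grad (a N) x) (ENNReal.ofReal p) volume ≤ ((N : ℝ≥0∞) + 1)⁻¹ := by
      intro N
      obtain ⟨φ, hφ, hlim⟩ := exists_tendsto_grad_of_lipschitz
        (exists_lipschitzWith_sum hA hc N).1 (exists_lipschitzWith_sum hA hc N).2 hp0
      obtain ⟨k, hk⟩ := (hlim.eventually (gt_mem_nhds
        (show (0 : ℝ≥0∞) < ((N : ℝ≥0∞) + 1)⁻¹ by simp))).exists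
      exact ⟨φ k, hφ k, hk.le⟩
    choose φ hφ hle using h1
    refine ⟨φ, hφ, ?_⟩
    have h2 : Tendsto (fun N => eLpNorm (fun x => grad (a N) x - G x) (ENNReal.ofReal p) volume)
        atTop (𝓝 0) := by
      refine tendsto_eLpNorm_of_dominated hp0 (g := fun x => 2 * h x)
        (fun N => (measurable_grad _).aestronglyMeasurable.sub hGm) ?_ (fun N => ?_) ?_
      · simp only [ENNReal.mul_rpow_of_nonneg _ _ hp0.le]
        rw [lintegral_const_mul _ (hh.pow_const p)]
        exact ENNReal.mul_lt_top (ENNReal.rpow_lt_top_of_nonneg hp0.le (by norm_num)) hI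
      · filter_upwards [ae_grad_sum hA] with x hx
        rw [hx N, two_mul]
        refine enorm_sub_le.trans (add_le_add ?_ (hGle x))
        exact (enorm_sum_le _ _).trans ((ENNReal.sum_le_tsum _).trans (hsum x))
      · filter_upwards [ae_grad_sum hA, hht] with x hx hxt
        have h3 := (hGs x hxt).tendsto_sum_nat.sub_const (G x)
        rw [sub_self] at h3
        exact h3.congr fun N => congrArg (· - G x) (hx N).symm
    have h3 : Tendsto (fun N : ℕ => ((N : ℝ≥0∞) + 1)⁻¹) atTop (𝓝 0) := by
      have := (tendsto_add_atTop_iff_nat 1).2 ENNReal.tendsto_inv_nat_nhds_zero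
      simpa using this
    have h4 := h3.add h2
    rw [add_zero] at h4
    refine tendsto_of_tendsto_of_tendsto_of_le_of_le tendsto_const_nhds h4 (fun _ => zero_le)
      fun N => ?_
    have e1 : (fun x => grad (φ N) x - G x) =
        (fun x => grad (φ N) x - grad (a N) x) + fun x => grad (a N) x - G x := by
      ext1 x; simp
    change eLpNorm (fun x => grad (φ N) x - G x) _ _ ≤ _
    rw [e1]
    refine (eLpNorm_add_le ((measurable_grad _).sub (measurable_grad _)).aestronglyMeasurable
      ((measurable_grad _).aestronglyMeasurable.sub hGm) ?_).trans (add_le_add (hle N) le_rfl)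
    rw [← ENNReal.ofReal_one]; exact ENNReal.ofReal_le_ofReal hp

/-- For p > 1 no cancellation is needed. At x only the levels with 2^k < h(x) contribute, each with
total gradient of order 2^k, and the geometric sum is of order h(x). -/
theorem exists_hardySobolev_of_hajlasz {n : ℕ} (hn : 0 < n) {p : ℝ}
    (hp : (n : ℝ) / (n + 1) < p) : ∃ C : ℝ≥0, ∀ (f : E n → ℂ) (h : E n → ℝ≥0∞),
    LowerSemicontinuous h → ∫⁻ x, h x ^ p < ⊤ →
    (∀ x y, h x < ⊤ → h y < ⊤ → ‖f x - f y‖ₑ ≤ ‖x - y‖ₑ * (h x + h y)) →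
      hardySobolevNorm p f ≤ C * (∫⁻ x, h x ^ p) ^ (1 / p) := by
  rcases le_or_gt p 1 with hp1 | hp1
  · obtain ⟨C, hC⟩ := exists_atomicHardySobolev_of_hajlasz hn hp hp1
    refine ⟨C, fun f h hh hI hf => ?_⟩
    obtain ⟨F, hF, hle⟩ := hC f h hh hI hf
    rw [hardySobolevNorm, if_neg (not_lt.2 hp1)]
    exact iInf_le_of_le F (iInf_le_of_le hF hle)
  have hp0 : 0 < p := by linarith
  obtain ⟨C₁, hC₁⟩ := tsum_zpow_rpow_lt_le one_pos
  set K : ℝ≥0 := n * ((1 + 71 * etaConst n) * hajlaszConst) * 43 ^ n with hK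
  refine ⟨K * C₁, fun f h hh hI hf => ?_⟩
  obtain ⟨D, g, hDF, hg, hg0, hfm, hfi, hfS⟩ := exists_lipschitz_pieces hn hp hh hI hf
  obtain ⟨F, hF⟩ := exists_represents (n + 2) hfm hfi
  let e : ℕ ≃ ℤ × ℕ := (Denumerable.eqv (ℤ × ℕ)).symm
  have hsum : ∀ x, ∑' j, ‖grad (fun y => (D (e j).1).W.eta (e j).2 y • g (e j).1 y) x‖ₑ ≤
      ((K * C₁ : ℝ≥0) : ℝ≥0∞) * h x := by
    intro x
    rw [e.tsum_eq fun q : ℤ × ℕ => ‖grad (fun y => (D q.1).W.eta q.2 y • g q.1 y) x‖ₑ,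
      ENNReal.tsum_prod (f := fun k i => ‖grad (fun y => (D k).W.eta i y • g k y) x‖ₑ)]
    calc _ ≤ ∑' k : ℤ, (K : ℝ≥0∞) * (if (2 : ℝ≥0∞) ^ k < h x then ((2 : ℝ≥0∞) ^ k) ^ (1 : ℝ) else 0) := by
          refine ENNReal.tsum_le_tsum fun k =>
            ((D k).tsum_enorm_grad_eta_smul_le (hg k) (hg0 k) x).trans ?_
          by_cases hx : (2 : ℝ≥0∞) ^ k < h x
          · rw [Set.indicator_of_mem (by rw [hDF]; simpa using hx), if_pos hx, ENNReal.rpow_one, hK]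
            push_cast
            rw [coe_zpow_two]
            apply le_of_eq
            ring
          · rw [Set.indicator_of_notMem (by rw [hDF]; simpa using hx)]
            exact zero_le
      _ ≤ _ := by
          rw [ENNReal.tsum_mul_left, ENNReal.coe_mul K C₁, mul_assoc (K : ℝ≥0∞)]
          have h1 := hC₁ (h x)
          rw [ENNReal.rpow_one] at h1
          exact mul_le_mul_right h1 (K : ℝ≥0∞)
  have hI' : ∫⁻ x, (((K * C₁ : ℝ≥0) : ℝ≥0∞) * h x) ^ p =
      ((K * C₁ : ℝ≥0) : ℝ≥0∞) ^ p * ∫⁻ x, h x ^ p := by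
    simp only [ENNReal.mul_rpow_of_nonneg _ _ hp0.le]
    exact lintegral_const_mul _ (hh.measurable.pow_const p)
  obtain ⟨G, hG, hGle⟩ := isHomSobolev_of_tsum hp1.le
    (A := fun j y => (D (e j).1).W.eta (e j).2 y • g (e j).1 y)
    (fun j => (D (e j).1).lipschitzWith_eta_smul (hg _) (hg0 _) (e j).2)
    (fun j => (D (e j).1).hasCompactSupport_eta_smul _ _)
    (by rw [hI']; exact ENNReal.mul_lt_top (ENNReal.rpow_lt_top_of_nonneg hp0.le ENNReal.coe_ne_top) hI)
    (hh.measurable.const_mul _) hsum hF.1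
    (fun ψ hψ hψc hψ0 S hS => hfS ψ hψ hψc hψ0 S (by rw [← e.hasSum_iff]; exact hS))
  rw [hardySobolevNorm, if_pos hp1]
  refine iInf_le_of_le G (iInf_le_of_le hG ?_)
  rw [eLpNorm_eq_lintegral_rpow_enorm_toReal (by simpa using hp0) ENNReal.ofReal_ne_top,
    ENNReal.toReal_ofReal hp0.le]
  calc (∫⁻ x, ‖G x‖ₑ ^ p) ^ (1 / p) ≤ (∫⁻ x, (((K * C₁ : ℝ≥0) : ℝ≥0∞) * h x) ^ p) ^ (1 / p) := by
        gcongr with x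
        exact hGle x
    _ = _ := by
        rw [hI', ENNReal.mul_rpow_of_nonneg _ _ (by positivity), ← ENNReal.rpow_mul,
          mul_one_div_cancel hp0.ne', ENNReal.rpow_one]

/-! ### Coordinates -/

/-- The point `(x, t)`. -/
def pt {n : ℕ} (x : E n) (t : ℝ) : E (n + 1) :=
  WithLp.toLp 2 (Fin.snoc (α := fun _ => ℝ) (fun i => x i) t)

theorem horiz_pt {n : ℕ} (x : E n) (t : ℝ) : horiz (pt x t) = x := by
  ext i; simp [horiz, pt]

theorem height_pt {n : ℕ} (x : E n) (t : ℝ) : height (pt x t) = t := by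
  simp [height, pt]

theorem pt_zero {n : ℕ} (x : E n) : pt x 0 = bdryPt x := rfl

theorem norm_sq_eq {n : ℕ} (X : E (n + 1)) : ‖X‖ ^ 2 = ‖horiz X‖ ^ 2 + height X ^ 2 := by
  rw [EuclideanSpace.norm_sq_eq, EuclideanSpace.norm_sq_eq, Fin.sum_univ_castSucc]
  simp [horiz, height]

theorem horiz_sub {n : ℕ} (X Y : E (n + 1)) : horiz (X - Y) = horiz X - horiz Y := by
  ext i; simp [horiz]

theorem height_sub {n : ℕ} (X Y : E (n + 1)) : height (X - Y) = height X - height Y := by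
  simp [height]

theorem dist_horiz_le {n : ℕ} (X Y : E (n + 1)) : dist (horiz X) (horiz Y) ≤ dist X Y := by
  rw [dist_eq_norm, dist_eq_norm, ← horiz_sub]
  have := norm_sq_eq (X - Y)
  exact abs_le_of_sq_le_sq' (by nlinarith [sq_nonneg (height (X - Y))]) (norm_nonneg _) |>.2

theorem abs_height_sub_le {n : ℕ} (X Y : E (n + 1)) : |height X - height Y| ≤ dist X Y := by
  rw [dist_eq_norm, ← height_sub]
  have := norm_sq_eq (X - Y)
  exact abs_le_of_sq_le_sq (by nlinarith [sq_nonneg ‖horiz (X - Y)‖]) (norm_nonneg _)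

theorem dist_le_horiz_add_height {n : ℕ} (X Y : E (n + 1)) :
    dist X Y ≤ dist (horiz X) (horiz Y) + |height X - height Y| := by
  rw [dist_eq_norm, dist_eq_norm, ← horiz_sub, ← height_sub]
  have h1 := norm_sq_eq (X - Y)
  refine abs_le_of_sq_le_sq' ?_ (by positivity) |>.2
  have : 0 ≤ ‖horiz (X - Y)‖ * |height (X - Y)| := by positivity
  nlinarith [sq_abs (height (X - Y))]

theorem contDiff_horiz (n : ℕ) : ContDiff ℝ ∞ (horiz : E (n + 1) → E n) :=
  contDiff_euclidean.2 fun i => (EuclideanSpace.proj i.castSucc : E (n + 1) →L[ℝ] ℝ).contDiff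

theorem contDiff_height (n : ℕ) : ContDiff ℝ ∞ (height : E (n + 1) → ℝ) :=
  (EuclideanSpace.proj (Fin.last n) : E (n + 1) →L[ℝ] ℝ).contDiff

theorem continuous_horiz (n : ℕ) : Continuous (horiz : E (n + 1) → E n) :=
  (contDiff_horiz n).continuous

theorem continuous_height (n : ℕ) : Continuous (height : E (n + 1) → ℝ) :=
  (contDiff_height n).continuous

theorem isOpen_halfSpace (n : ℕ) (σ : ℝ) : IsOpen (halfSpace n σ) :=
  isOpen_lt continuous_const (continuous_const.mul (continuous_height n))

theorem measurePreserving_horiz_height (n : ℕ) :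
    MeasurePreserving (fun X : E (n + 1) => (horiz X, height X)) volume (volume.prod volume) := by
  have h1 := EuclideanSpace.volume_preserving_symm_measurableEquiv_toLp (Fin (n + 1))
  have h2 := volume_preserving_piFinSuccAbove (fun _ : Fin (n + 1) => ℝ) (Fin.last n)
  have h3 := (EuclideanSpace.volume_preserving_symm_measurableEquiv_toLp (Fin n)).symm
  have h4 : MeasurePreserving (Prod.swap : ℝ × (Fin n → ℝ) → _) volume volume :=
    Measure.measurePreserving_swap
  have h5 := (h3.prod (MeasurePreserving.id (volume : Measure ℝ))).comp (h4.comp (h2.comp h1))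
  have e : (fun X : E (n + 1) => (horiz X, height X)) =
      Prod.map (MeasurableEquiv.toLp 2 (Fin n → ℝ)).symm.symm id ∘ Prod.swap ∘
        MeasurableEquiv.piFinSuccAbove (fun _ => ℝ) (Fin.last n) ∘
          (MeasurableEquiv.toLp 2 (Fin (n + 1) → ℝ)).symm := by
    funext X
    refine Prod.ext ?_ rfl
    ext i
    simp only [horiz, Function.comp_apply, Prod.map_fst, MeasurableEquiv.piFinSuccAbove]
    simp
    rfl
  rw [e]
  exact h5

theorem lintegral_mul_horiz_height {n : ℕ} {f : E n → ℝ≥0∞} {g : ℝ → ℝ≥0∞} (hf : Measurable f)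
    (hg : Measurable g) :
    ∫⁻ X : E (n + 1), f (horiz X) * g (height X) = (∫⁻ x, f x) * ∫⁻ t, g t := by
  rw [← lintegral_prod_mul hf.aemeasurable hg.aemeasurable]
  exact (measurePreserving_horiz_height n).lintegral_comp
    (f := fun z : E n × ℝ => f z.1 * g z.2)
    ((hf.comp measurable_fst).mul (hg.comp measurable_snd))

theorem lintegral_sign_mul {σ : ℝ} (hσ : σ = 1 ∨ σ = -1) {g : ℝ → ℝ≥0∞} (hg : Measurable g) :
    ∫⁻ t, g (σ * t) = ∫⁻ t, g t := by
  rcases hσ with rfl | rfl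
  · simp
  · simp only [neg_one_mul]
    exact (Measure.measurePreserving_neg (volume : Measure ℝ)).lintegral_comp hg

theorem abs_sign {σ : ℝ} (hσ : σ = 1 ∨ σ = -1) : |σ| = 1 := by
  rcases hσ with rfl | rfl <;> simp

theorem abs_sign_height_sub_le {n : ℕ} {σ : ℝ} (hσ : σ = 1 ∨ σ = -1) (X Y : E (n + 1)) :
    |σ * height X - σ * height Y| ≤ dist X Y := by
  rw [← mul_sub, abs_mul, abs_sign hσ, one_mul]
  exact abs_height_sub_le X Y

/-! ### The non-tangential maximal function -/

theorem isOpen_setOf_mem_cone {n : ℕ} (σ : ℝ) (X : E (n + 1)) : IsOpen {x₀ : E n | X ∈ cone σ x₀} := by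
  change IsOpen {x₀ : E n | ‖x₀ - horiz X‖ < σ * height X}
  exact isOpen_lt (by fun_prop) continuous_const

/-- For a fixed X the vertices whose cone contains X form an open set, so the maximal function is a
supremum of multiples of indicators of open sets. -/
theorem lowerSemicontinuous_ntMax {n : ℕ} (σ : ℝ) (F : E (n + 1) → V (n + 1)) :
    LowerSemicontinuous (ntMax σ F) := by
  refine lowerSemicontinuous_iSup fun X => ?_
  have h := (isOpen_setOf_mem_cone (n := n) σ X).lowerSemicontinuous_indicator
    (y := (⨍⁻ Y in Metric.ball X (σ * height X / 4), ‖F Y‖ₑ ^ 2 ∂volume) ^ (1 / 2 : ℝ)) zero_le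
  convert h using 1
  funext x₀
  by_cases hx : X ∈ cone σ x₀
  · rw [Set.indicator_of_mem (by exact hx)]; simp [hx]
  · rw [Set.indicator_of_notMem (by exact hx)]; simp [hx]

theorem le_ntMax {n : ℕ} {σ : ℝ} (F : E (n + 1) → V (n + 1)) {x₀ : E n} {X : E (n + 1)}
    (hX : X ∈ cone σ x₀) :
    (⨍⁻ Y in Metric.ball X (σ * height X / 4), ‖F Y‖ₑ ^ 2 ∂volume) ^ (1 / 2 : ℝ) ≤ ntMax σ F x₀ :=
  le_iSup₂_of_le X hX le_rfl

theorem laverage_le_laverage_sq {α : Type*} [MeasurableSpace α] {μ : Measure α} {s : Set α}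
    (h0 : μ s ≠ 0) (ht : μ s ≠ ⊤) {f : α → ℝ≥0∞} (hf : AEMeasurable f (μ.restrict s)) :
    ⨍⁻ x in s, f x ∂μ ≤ (⨍⁻ x in s, f x ^ 2 ∂μ) ^ (1 / 2 : ℝ) := by
  have h1 := ENNReal.lintegral_mul_le_Lp_mul_Lq (μ.restrict s) Real.HolderConjugate.two_two hf
    (aemeasurable_const (b := 1))
  simp only [Pi.mul_apply, mul_one, lintegral_one, Measure.restrict_apply_univ,
    ENNReal.rpow_two, one_pow] at h1
  rw [setLAverage_eq, setLAverage_eq, ENNReal.div_rpow_of_nonneg _ _ (by norm_num)]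
  refine ENNReal.div_le_of_le_mul (h1.trans (le_of_eq ?_))
  have h2 : μ s ^ (1 / 2 : ℝ) ≠ 0 := by simp [h0, ht]
  have h3 : μ s ^ (1 / 2 : ℝ) ≠ ⊤ := ENNReal.rpow_ne_top_of_nonneg (by norm_num) ht
  rw [ENNReal.mul_comm_div]
  congr 1
  rw [ENNReal.eq_div_iff h2 h3, ← ENNReal.rpow_add _ _ h0 ht]
  norm_num

/-- The Whitney box `{(y, t) : y ∈ B(x, r), 0 < σ t < r}`. -/
def bdryBox {n : ℕ} (σ : ℝ) (x : E n) (r : ℝ) : Set (E (n + 1)) :=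
  {X | horiz X ∈ Metric.ball x r ∧ 0 < σ * height X ∧ σ * height X < r}

theorem isOpen_bdryBox {n : ℕ} (σ : ℝ) (x : E n) (r : ℝ) : IsOpen (bdryBox σ x r) :=
  (Metric.isOpen_ball.preimage (continuous_horiz n)).inter
    ((isOpen_lt continuous_const (continuous_const.mul (continuous_height n))).inter
      (isOpen_lt (continuous_const.mul (continuous_height n)) continuous_const))

/-- A point Y at height s lies in the averaging ball of every X in B(Y, s/5). Averaging over such X
and exchanging the integrals replaces the integrand by its Whitney averages, on a box of twice the
size. -/
theorem lintegral_bdryBox_le_laverage {n : ℕ} {σ : ℝ} (hσ : σ = 1 ∨ σ = -1) {γ : E (n + 1) → ℝ≥0∞}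
    (hγ : Measurable γ) (x : E n) (r : ℝ) :
    ∫⁻ Y in bdryBox σ x r, γ Y ≤ 2 ^ (n + 1) * ∫⁻ X in bdryBox σ x (2 * r),
      ⨍⁻ Y in Metric.ball X (σ * height X / 4), γ Y ∂volume := by
  set v := volume (Metric.ball (0 : E (n + 1)) 1) with hv
  have hv0 : v ≠ 0 := (volume_unitBall_pos _).ne'
  have hvt : v ≠ ⊤ := (volume_unitBall_lt_top _).ne
  set κ : E (n + 1) → ℝ≥0∞ := fun X => (ENNReal.ofReal ((σ * height X / 4) ^ (n + 1)) * v)⁻¹ with hκ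
  have hκm : Measurable κ :=
    (((((continuous_const.mul (continuous_height n)).div_const 4).pow (n + 1)).measurable.ennreal_ofReal).mul_const
      v).inv
  set S : Set (E (n + 1) × E (n + 1)) := {z | z.1 ∈ bdryBox σ x (2 * r) ∧
    dist z.2 z.1 < σ * height z.1 / 4} with hS
  have hSm : MeasurableSet S := by
    refine (((isOpen_bdryBox σ x (2 * r)).preimage continuous_fst).inter
      (isOpen_lt (continuous_snd.dist continuous_fst) ?_)).measurableSet
    exact (continuous_const.mul ((continuous_height n).comp continuous_fst)).div_const 4
  set k : E (n + 1) × E (n + 1) → ℝ≥0∞ := S.indicator fun z => κ z.1 with hk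
  have hkm : Measurable k := (hκm.comp measurable_fst).indicator hSm
  have h1 : ∀ Y ∈ bdryBox σ x r, 1 ≤ 2 ^ (n + 1) * ∫⁻ X, k (X, Y) := by
    rintro Y ⟨hY, hY0, hYr⟩
    set s := σ * height Y with hs
    -- The height of X lies between 4s/5 and 6s/5. So its averaging ball contains Y and has radius
    -- at most 2s/5, twice that of B(Y, s/5); hence the factor 2^(n+1).
    have hle : ∀ X ∈ Metric.ball Y (s / 5), (ENNReal.ofReal ((2 * (s / 5)) ^ (n + 1)) * v)⁻¹ ≤ k (X, Y) := by
      intro X hX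
      have hd : dist X Y < s / 5 := hX
      have h2 := abs_sign_height_sub_le hσ X Y
      rw [abs_le] at h2
      have h3 := dist_horiz_le X Y
      have hmem : (X, Y) ∈ S := by
        refine ⟨⟨?_, ?_, ?_⟩, ?_⟩
        · rw [Metric.mem_ball] at hY ⊢
          linarith [dist_triangle (horiz X) (horiz Y) x]
        · change 0 < σ * height X
          linarith
        · change σ * height X < 2 * r
          linarith
        · change dist Y X < σ * height X / 4
          rw [dist_comm]; linarith
      rw [hk, Set.indicator_of_mem hmem, hκ, ENNReal.inv_le_inv]
      refine mul_le_mul_left (ENNReal.ofReal_le_ofReal ?_) _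
      exact pow_le_pow_left₀ (by linarith) (by linarith) _
    calc (1 : ℝ≥0∞) = 2 ^ (n + 1) * ((ENNReal.ofReal ((2 * (s / 5)) ^ (n + 1)) * v)⁻¹ *
          volume (Metric.ball Y (s / 5))) := by
          rw [volume_ball_eq Y (by positivity), mul_pow, ENNReal.ofReal_mul (by positivity), ← hv,
            ENNReal.ofReal_pow (by norm_num : (0 : ℝ) ≤ 2), ENNReal.ofReal_ofNat, mul_left_comm,
            ← mul_assoc (2 ^ (n + 1)), ENNReal.inv_mul_cancel]
          · exact mul_ne_zero (mul_ne_zero (by simp) (by simpa using by positivity)) hv0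
          · exact ENNReal.mul_ne_top (ENNReal.mul_ne_top (by simp) ENNReal.ofReal_ne_top) hvt
      _ = 2 ^ (n + 1) * ∫⁻ _ in Metric.ball Y (s / 5), (ENNReal.ofReal ((2 * (s / 5)) ^ (n + 1)) * v)⁻¹ := by
          rw [setLIntegral_const]
      _ ≤ _ := by
          refine mul_le_mul_right ?_ _
          exact (setLIntegral_mono' measurableSet_ball hle).trans (setLIntegral_le_lintegral _ _)
  calc ∫⁻ Y in bdryBox σ x r, γ Y
      ≤ ∫⁻ Y in bdryBox σ x r, 2 ^ (n + 1) * ∫⁻ X, k (X, Y) * γ Y := by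
        refine setLIntegral_mono' (isOpen_bdryBox σ x r).measurableSet fun Y hY => ?_
        have h2 : Measurable fun X => k (X, Y) := hkm.comp measurable_prodMk_right
        rw [lintegral_mul_const _ h2, ← mul_assoc]
        exact le_mul_of_one_le_left zero_le (h1 Y hY)
    _ ≤ ∫⁻ Y, 2 ^ (n + 1) * ∫⁻ X, k (X, Y) * γ Y := setLIntegral_le_lintegral _ _
    _ = 2 ^ (n + 1) * ∫⁻ X, ∫⁻ Y, k (X, Y) * γ Y := by
        rw [lintegral_const_mul, lintegral_lintegral_swap]
        · exact ((hkm.comp measurable_swap).mul (hγ.comp measurable_fst)).aemeasurable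
        · exact Measurable.lintegral_prod_right'
            (f := fun z : E (n + 1) × E (n + 1) => k (z.2, z.1) * γ z.1)
            ((hkm.comp measurable_swap).mul (hγ.comp measurable_fst))
    _ ≤ _ := by
        refine mul_le_mul_right ?_ _
        rw [← lintegral_indicator (isOpen_bdryBox σ x (2 * r)).measurableSet]
        refine lintegral_mono fun X => ?_
        by_cases hX : X ∈ bdryBox σ x (2 * r)
        · rw [Set.indicator_of_mem hX, setLAverage_eq, volume_ball_eq X (by linarith [hX.2.1]),
            div_eq_mul_inv, mul_comm, ← lintegral_const_mul _ hγ,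
            ← lintegral_indicator measurableSet_ball]
          refine lintegral_mono fun Y => ?_
          by_cases hY : Y ∈ Metric.ball X (σ * height X / 4)
          · rw [Set.indicator_of_mem hY, hk, Set.indicator_of_mem (by exact ⟨hX, hY⟩)]
          · rw [Set.indicator_of_notMem hY, hk, Set.indicator_of_notMem fun h => hY h.2, zero_mul]
        · rw [Set.indicator_of_notMem hX]
          refine le_of_eq ?_
          simp only [hk]
          rw [lintegral_eq_zero_of_ae_eq_zero]
          refine ae_of_all _ fun Y => ?_
          change S.indicator (fun z => κ z.1) (X, Y) * γ Y = 0
          rw [Set.indicator_of_notMem fun h : (X, Y) ∈ S => hX h.1, zero_mul]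

theorem lintegral_Ioo_rpow {b R : ℝ} (hb : b < 1) (hR : 0 < R) :
    ∫⁻ t in Set.Ioo 0 R, ENNReal.ofReal (t ^ (-b)) = ENNReal.ofReal (R ^ (1 - b) / (1 - b)) := by
  have h1 : IntegrableOn (fun t : ℝ => t ^ (-b)) (Set.Ioo 0 R) :=
    (intervalIntegral.integrableOn_Ioo_rpow_iff hR).2 (by linarith)
  rw [← ofReal_integral_eq_lintegral_ofReal h1]
  · congr 1
    rw [← integral_Ioc_eq_integral_Ioo, ← intervalIntegral.integral_of_le hR.le,
      integral_rpow (Or.inl (by linarith)), Real.zero_rpow (by linarith), sub_zero]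
    congr 1 <;> ring_nf
  · filter_upwards [ae_restrict_mem measurableSet_Ioo] with t ht
    exact Real.rpow_nonneg ht.1.le _

/-- The value w(X) at height t is at most N on a whole ball of radius t, so w(X)^q ≤ C t^(-n) J,
where J is the integral of N^q over the doubled ball. Keep one factor w^q ≤ N^q for the integration
in x and use this bound for the remaining power of w. The resulting singularity in t is integrable,
and J is controlled by the maximal function of N^q. -/
theorem exists_lintegral_bdryBox_le {n : ℕ} (hn : 0 < n) {q : ℝ} (hq : (n : ℝ) / (n + 1) < q)
    (hq1 : q ≤ 1) : ∃ C : ℝ≥0, ∀ (σ : ℝ), σ = 1 ∨ σ = -1 → ∀ (w : E (n + 1) → ℝ≥0∞) (N : E n → ℝ≥0∞),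
      Measurable N → (∀ X x₀, X ∈ cone σ x₀ → w X ≤ N x₀) → ∀ x r, 0 < r →
        ∀ y ∈ Metric.ball x (21 * r),
        ∫⁻ X in bdryBox σ x r, w X ≤
          C * (ENNReal.ofReal (r ^ (n + 1)) * hlMax (fun z => N z ^ q) y ^ (1 / q)) := by
  have hq0 : 0 < q := lt_of_le_of_lt (by positivity) hq
  set v := volume (Metric.ball (0 : E n) 1) with hv
  have hv0 : v ≠ 0 := (volume_unitBall_pos _).ne'
  have hvt : v ≠ ⊤ := (volume_unitBall_lt_top _).ne
  -- The exponent in w = w^q (w^q)^β. The integrand in t is t^(-nβ), and nβ < 1 is equivalent to q >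
  -- n/(n+1), while q ≤ 1 gives β ≥ 0.
  set β : ℝ := 1 / q - 1 with hβ
  have hβ0 : 0 ≤ β := by rw [hβ, sub_nonneg]; exact (one_le_div hq0).2 hq1
  have hnβ : n * β < 1 := by
    rw [div_lt_iff₀ (by positivity)] at hq
    rw [hβ, mul_sub, mul_one_div, sub_lt_iff_lt_add, div_lt_iff₀ hq0]
    linarith
  set K : ℝ≥0∞ := v⁻¹ ^ β * ENNReal.ofReal (1 / (1 - n * β)) * (ENNReal.ofReal (21 ^ n) * v) ^ (1 / q)
    with hK
  have hKt : K ≠ ⊤ := by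
    refine ENNReal.mul_ne_top (ENNReal.mul_ne_top ?_ ENNReal.ofReal_ne_top) ?_
    · exact ENNReal.rpow_ne_top_of_nonneg hβ0 (ENNReal.inv_ne_top.2 hv0)
    · exact ENNReal.rpow_ne_top_of_nonneg (by positivity) (ENNReal.mul_ne_top ENNReal.ofReal_ne_top hvt)
  refine ⟨K.toNNReal, fun σ hσ w N hN hw x r hr y hy => ?_⟩
  rw [ENNReal.coe_toNNReal hKt]
  set J := ∫⁻ z in Metric.ball x (2 * r), N z ^ q with hJ
  have hpt : ∀ X ∈ bdryBox σ x r, w X ≤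
      (Metric.ball x r).indicator (fun z => N z ^ q) (horiz X) *
        (Set.Ioo 0 r).indicator (fun t => J ^ β * (v⁻¹ ^ β * ENNReal.ofReal (t ^ (-(n * β))))) (σ * height X) := by
    rintro X ⟨hX, hX0, hXr⟩
    set t := σ * height X with ht
    have hcone : ∀ z ∈ Metric.ball (horiz X) t, w X ≤ N z := fun z hz => hw X z (by
      rw [Metric.mem_ball, dist_eq_norm] at hz; exact hz)
    rw [Set.indicator_of_mem hX, Set.indicator_of_mem (by exact ⟨hX0, hXr⟩)]
    have h1 : w X ^ q * (ENNReal.ofReal (t ^ n) * v) ≤ J := by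
      rw [hv, ← volume_ball_eq (horiz X) hX0, ← setLIntegral_const]
      refine (setLIntegral_mono' measurableSet_ball fun z hz =>
        ENNReal.rpow_le_rpow (hcone z hz) hq0.le).trans (lintegral_mono_set ?_)
      exact Metric.ball_subset_ball' (by rw [Metric.mem_ball] at hX; linarith)
    have ht0 : ENNReal.ofReal (t ^ n) ≠ 0 := by simpa using by positivity
    have h2 : w X ^ q ≤ J * (v⁻¹ * ENNReal.ofReal ((t ^ n)⁻¹)) := by
      rw [ENNReal.ofReal_inv_of_pos (by positivity), ← ENNReal.mul_inv (Or.inl hv0) (Or.inl hvt),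
        ← div_eq_mul_inv, ENNReal.le_div_iff_mul_le (Or.inl (mul_ne_zero hv0 ht0))
          (Or.inl (ENNReal.mul_ne_top hvt ENNReal.ofReal_ne_top)), mul_comm v]
      exact h1
    have h3 : w X = w X ^ q * (w X ^ q) ^ β := by
      rw [← ENNReal.rpow_mul, ← ENNReal.rpow_add_of_nonneg _ _ hq0.le (by positivity), hβ]
      have : q + q * (1 / q - 1) = 1 := by field_simp; ring
      rw [this, ENNReal.rpow_one]
    rw [h3]
    refine mul_le_mul' (ENNReal.rpow_le_rpow (hcone _ (Metric.mem_ball_self hX0)) hq0.le) ?_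
    refine (ENNReal.rpow_le_rpow h2 hβ0).trans (le_of_eq ?_)
    rw [ENNReal.mul_rpow_of_nonneg _ _ hβ0, ENNReal.mul_rpow_of_nonneg _ _ hβ0,
      ENNReal.ofReal_rpow_of_pos (by positivity), ← Real.rpow_natCast, ← Real.rpow_neg hX0.le,
      ← Real.rpow_mul hX0.le, neg_mul]
  have hgm : Measurable fun t : ℝ => (Set.Ioo 0 r).indicator
      (fun t => J ^ β * (v⁻¹ ^ β * ENNReal.ofReal (t ^ (-(n * β))))) t :=
    Measurable.indicator (((measurable_id.pow_const _).ennreal_ofReal.const_mul _).const_mul _)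
      measurableSet_Ioo
  have hJle : J ≤ ∫⁻ z in Metric.ball x (21 * r), N z ^ q :=
    lintegral_mono_set (Metric.ball_subset_ball (by linarith))
  calc ∫⁻ X in bdryBox σ x r, w X
      ≤ ∫⁻ X, (Metric.ball x r).indicator (fun z => N z ^ q) (horiz X) * (Set.Ioo 0 r).indicator
          (fun t => J ^ β * (v⁻¹ ^ β * ENNReal.ofReal (t ^ (-(n * β))))) (σ * height X) :=
        (setLIntegral_mono' (isOpen_bdryBox σ x r).measurableSet hpt).trans (setLIntegral_le_lintegral _ _)
    _ = (∫⁻ z in Metric.ball x r, N z ^ q) * (J ^ β * (v⁻¹ ^ β *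
          ENNReal.ofReal (r ^ (1 - n * β) / (1 - n * β)))) := by
        refine (lintegral_mul_horiz_height ((hN.pow_const q).indicator measurableSet_ball)
          (hgm.comp (measurable_const_mul σ))).trans ?_
        simp only [Function.comp_apply]
        rw [lintegral_indicator measurableSet_ball,
          lintegral_sign_mul hσ hgm, lintegral_indicator measurableSet_Ioo, lintegral_const_mul,
          lintegral_const_mul, lintegral_Ioo_rpow hnβ hr]
        · exact (measurable_id.pow_const _).ennreal_ofReal
        · exact (measurable_id.pow_const _).ennreal_ofReal.const_mul _
    _ ≤ J * (J ^ β * (v⁻¹ ^ β * ENNReal.ofReal (r ^ (1 - n * β) / (1 - n * β)))) :=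
        mul_le_mul_left (lintegral_mono_set (Metric.ball_subset_ball (by linarith))) _
    _ = J ^ (1 / q) * (v⁻¹ ^ β * (ENNReal.ofReal (1 / (1 - n * β)) * ENNReal.ofReal (r ^ (1 - n * β)))) := by
        rw [← ENNReal.ofReal_mul (by rw [one_div, inv_nonneg]; linarith), one_div_mul_eq_div, ← mul_assoc]
        congr 1
        nth_rw 1 [← ENNReal.rpow_one J]
        rw [← ENNReal.rpow_add_of_nonneg _ _ zero_le_one hβ0, hβ]
        congr 1; ring
    _ ≤ (hlMax (fun z => N z ^ q) y * (ENNReal.ofReal ((21 * r) ^ n) * v)) ^ (1 / q) *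
          (v⁻¹ ^ β * (ENNReal.ofReal (1 / (1 - n * β)) * ENNReal.ofReal (r ^ (1 - n * β)))) := by
        refine mul_le_mul_left (ENNReal.rpow_le_rpow ?_ (by positivity)) _
        rw [hv, ← volume_ball_eq x (by positivity)]
        exact hJle.trans (lintegral_ball_le_hlMax _ hy)
    _ = K * (ENNReal.ofReal (r ^ n) ^ (1 / q) * ENNReal.ofReal (r ^ (1 - n * β)) *
          hlMax (fun z => N z ^ q) y ^ (1 / q)) := by
        rw [mul_pow, ENNReal.ofReal_mul (by positivity), hK]
        simp only [ENNReal.mul_rpow_of_nonneg _ _ (show (0 : ℝ) ≤ 1 / q by positivity)]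
        ring
    _ = _ := by
        congr 2
        rw [ENNReal.ofReal_rpow_of_pos (by positivity), ← ENNReal.ofReal_mul (by positivity),
          ← Real.rpow_natCast, ← Real.rpow_mul hr.le, ← Real.rpow_add hr, ← Real.rpow_natCast r (n + 1)]
        congr 2
        rw [hβ]; push_cast; ring

theorem quasiMeasurePreserving_horiz (n : ℕ) :
    Measure.QuasiMeasurePreserving (horiz : E (n + 1) → E n) volume volume :=
  Measure.quasiMeasurePreserving_fst.comp (measurePreserving_horiz_height n).quasiMeasurePreserving

theorem ball_subset_halfSpace {n : ℕ} {σ : ℝ} (hσ : σ = 1 ∨ σ = -1) {X : E (n + 1)} {r : ℝ}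
    (hr : r ≤ σ * height X) : Metric.ball X r ⊆ halfSpace n σ := by
  intro Y hY
  have h1 := abs_sign_height_sub_le hσ Y X
  rw [abs_le] at h1
  rw [Metric.mem_ball] at hY
  change 0 < σ * height Y
  linarith

theorem height_pos_of_mem_cone {n : ℕ} {σ : ℝ} {x₀ : E n} {X : E (n + 1)} (hX : X ∈ cone σ x₀) :
    0 < σ * height X :=
  lt_of_le_of_lt (norm_nonneg _) hX

/-- Whitney averages of |∇u| are dominated by the L² averages in `ntMax`, so the box estimate
applies to them on the doubled box; 42 is 21 times 2. A measurable majorant stands in for |G|, which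
is only measurable on the half-space. -/
theorem exists_lintegral_grad_bdryBox_le {n : ℕ} (hn : 0 < n) {q : ℝ} (hq : (n : ℝ) / (n + 1) < q)
    (hq1 : q ≤ 1) : ∃ C : ℝ≥0, ∀ (σ : ℝ), σ = 1 ∨ σ = -1 → ∀ (G : E (n + 1) → V (n + 1)),
      AEStronglyMeasurable G (volume.restrict (halfSpace n σ)) → ∀ x r, 0 < r →
        ∀ y ∈ Metric.ball x (42 * r),
        ∫⁻ X in bdryBox σ x r, ‖G X‖ₑ ≤
          C * (ENNReal.ofReal (r ^ (n + 1)) * hlMax (fun z => ntMax σ G z ^ q) y ^ (1 / q)) := by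
  obtain ⟨C, hC⟩ := exists_lintegral_bdryBox_le hn hq hq1
  refine ⟨2 ^ (n + 1) * C * 2 ^ (n + 1), fun σ hσ G hG x r hr y hy => ?_⟩
  set γ : E (n + 1) → ℝ≥0∞ := hG.enorm.mk _ with hγ
  have hγm : Measurable γ := hG.enorm.measurable_mk
  have hγe : ∀ᵐ X, X ∈ halfSpace n σ → ‖G X‖ₑ = γ X :=
    (ae_restrict_iff' (isOpen_halfSpace n σ).measurableSet).1 hG.enorm.ae_eq_mk
  have h1 : ∫⁻ X in bdryBox σ x r, ‖G X‖ₑ = ∫⁻ X in bdryBox σ x r, γ X := by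
    refine setLIntegral_congr_fun_ae (isOpen_bdryBox σ x r).measurableSet ?_
    filter_upwards [hγe] with X hX hX'
    exact hX hX'.2.1
  rw [h1]
  refine (lintegral_bdryBox_le_laverage hσ hγm x r).trans ?_
  have h2 := hC σ hσ (fun X => ⨍⁻ Y in Metric.ball X (σ * height X / 4), γ Y ∂volume) (ntMax σ G)
    (lowerSemicontinuous_ntMax σ G).measurable (fun X x₀ hX => by
      have hX0 := height_pos_of_mem_cone hX
      refine le_trans ?_ (le_ntMax G hX)
      refine (laverage_le_laverage_sq (Metric.measure_ball_pos _ _ (by positivity)).ne'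
        measure_ball_lt_top.ne hγm.aemeasurable).trans (le_of_eq ?_)
      congr 1
      rw [setLAverage_eq, setLAverage_eq]
      congr 1
      refine setLIntegral_congr_fun_ae measurableSet_ball ?_
      filter_upwards [hγe] with Y hY hY'
      rw [hY (ball_subset_halfSpace hσ (by linarith) hY')]) x (2 * r) (by positivity) y
      (by rwa [show 21 * (2 * r) = 42 * r by ring])
  refine (mul_le_mul_right h2 _).trans (le_of_eq ?_)
  rw [mul_pow, ENNReal.ofReal_mul (by positivity), ENNReal.ofReal_pow (by norm_num), ENNReal.ofReal_ofNat]
  push_cast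
  ring

/-! ### The energy form -/

theorem norm_sum_mul_le {d : ℕ} (a b : V d) : ‖∑ i, a i * b i‖ ≤ ‖a‖ * ‖b‖ := by
  refine (norm_sum_le _ _).trans ?_
  simp only [norm_mul]
  rw [EuclideanSpace.norm_eq, EuclideanSpace.norm_eq]
  exact Real.sum_mul_le_sqrt_mul_sqrt _ _ _

theorem energy_eq {n : ℕ} (A : Coeff n) (G : E (n + 1) → V (n + 1)) (Φ : E (n + 1) → ℂ)
    (X : E (n + 1)) : energy A G Φ X =
      ∑ i, (WithLp.toLp 2 (A (horiz X) *ᵥ (G X).ofLp) : V (n + 1)) i * grad Φ X i := by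
  simp only [energy, Matrix.mulVec, dotProduct, Finset.sum_mul]

theorem ae_enorm_energy_le {n : ℕ} {Λ : ℝ} (hΛ : 0 < Λ) {A : Coeff n} (hA : IsUniformlyElliptic Λ A) :
    ∀ᵐ X : E (n + 1), ∀ (G : E (n + 1) → V (n + 1)) (Φ : E (n + 1) → ℂ),
      ‖energy A G Φ X‖ₑ ≤ ENNReal.ofReal Λ * (‖G X‖ₑ * ‖grad Φ X‖ₑ) := by
  filter_upwards [(quasiMeasurePreserving_horiz n).ae hA.2] with X hX G Φ
  rw [energy_eq, ← ofReal_norm, ← ofReal_norm, ← ofReal_norm, ← ENNReal.ofReal_mul (norm_nonneg _),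
    ← ENNReal.ofReal_mul hΛ.le, ← mul_assoc]
  refine ENNReal.ofReal_le_ofReal ((norm_sum_mul_le _ _).trans ?_)
  exact mul_le_mul_of_nonneg_right (hX (G X)).2 (norm_nonneg _)

theorem aestronglyMeasurable_energy {n : ℕ} {Λ : ℝ} {A : Coeff n} (hA : IsUniformlyElliptic Λ A)
    {Ω : Set (E (n + 1))} {G : E (n + 1) → V (n + 1)}
    (hG : AEStronglyMeasurable G (volume.restrict Ω)) (Φ : E (n + 1) → ℂ) :
    AEStronglyMeasurable (energy A G Φ) (volume.restrict Ω) := by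
  have hcoord : ∀ {F : E (n + 1) → V (n + 1)} (j : Fin (n + 1)),
      AEStronglyMeasurable F (volume.restrict Ω) →
      AEStronglyMeasurable (fun X => F X j) (volume.restrict Ω) := fun j hF =>
    (EuclideanSpace.proj j : V (n + 1) →L[ℂ] ℂ).continuous.comp_aestronglyMeasurable hF
  refine Finset.aestronglyMeasurable_fun_sum _ fun i _ =>
    Finset.aestronglyMeasurable_fun_sum _ fun j _ => ?_
  exact ((((hA.1 i j).comp_quasiMeasurePreserving (quasiMeasurePreserving_horiz n)).restrict).mul
    (hcoord j hG)).mul (hcoord i (measurable_grad Φ).aestronglyMeasurable)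

theorem grad_add {d : ℕ} {φ ψ : E d → ℂ} {X : E d} (hφ : DifferentiableAt ℝ φ X)
    (hψ : DifferentiableAt ℝ ψ X) : grad (φ + ψ) X = grad φ X + grad ψ X := by
  ext i; simp [grad, fderiv_add hφ hψ]

theorem grad_smul {d : ℕ} {φ : E d → ℂ} {X : E d} (hφ : DifferentiableAt ℝ φ X) (c : ℂ) :
    grad (c • φ) X = c • grad φ X := by
  ext i; simp [grad, fderiv_const_smul hφ]

theorem IsTestFunction.differentiableAt {d : ℕ} {φ : E d → ℂ} {Ω : Set (E d)}
    (hφ : IsTestFunction Ω φ) (X : E d) : DifferentiableAt ℝ φ X :=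
  hφ.1.contDiffAt.differentiableAt (by simp)

theorem energy_add {n : ℕ} (A : Coeff n) (G : E (n + 1) → V (n + 1)) {Φ Ψ : E (n + 1) → ℂ}
    {Ω : Set (E (n + 1))} (hΦ : IsTestFunction Ω Φ) (hΨ : IsTestFunction Ω Ψ) (X : E (n + 1)) :
    energy A G (Φ + Ψ) X = energy A G Φ X + energy A G Ψ X := by
  simp only [energy_eq, grad_add (hΦ.differentiableAt X) (hΨ.differentiableAt X),
    PiLp.add_apply, mul_add, Finset.sum_add_distrib]

theorem energy_smul {n : ℕ} (A : Coeff n) (G : E (n + 1) → V (n + 1)) {Φ : E (n + 1) → ℂ}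
    {Ω : Set (E (n + 1))} (hΦ : IsTestFunction Ω Φ) (c : ℂ) (X : E (n + 1)) :
    energy A G (c • Φ) X = c * energy A G Φ X := by
  simp only [energy_eq, grad_smul (hΦ.differentiableAt X), PiLp.smul_apply, smul_eq_mul,
    Finset.mul_sum, mul_left_comm]

theorem exists_tsupport_subset_bdryBox {n : ℕ} {Φ : E (n + 1) → ℂ} (hΦ : HasCompactSupport Φ) :
    ∃ R : ℝ, 0 < R ∧ ∀ σ : ℝ, σ = 1 ∨ σ = -1 →
      tsupport Φ ∩ halfSpace n σ ⊆ bdryBox σ (0 : E n) R := by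
  obtain ⟨R, hR⟩ := hΦ.isCompact.isBounded.subset_closedBall (0 : E (n + 1))
  refine ⟨max R 0 + 1, by positivity, fun σ hσ X hX => ?_⟩
  have h1 : dist X 0 ≤ R := hR hX.1
  have h2 := dist_horiz_le X 0
  have h3 := abs_sign_height_sub_le hσ X 0
  have e1 : horiz (0 : E (n + 1)) = 0 := by ext i; simp [horiz]
  have e2 : height (0 : E (n + 1)) = 0 := by simp [height]
  rw [e1] at h2
  rw [e2, mul_zero, sub_zero] at h3
  have h4 := le_max_left R 0
  exact ⟨by rw [Metric.mem_ball]; linarith, hX.2, by linarith [le_abs_self (σ * height X)]⟩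

/-- `∇u` is integrable up to the boundary. -/
def IntegrableToBdry {n : ℕ} (σ : ℝ) (G : E (n + 1) → V (n + 1)) : Prop :=
  ∀ r, IntegrableOn G (bdryBox σ (0 : E n) r)

/-- The exceptional null set does not depend on Φ. For functions with a common Lipschitz constant
the bound is one integrable majorant, ready for dominated convergence. -/
theorem ae_norm_energy_le_indicator {n : ℕ} {Λ : ℝ} (hΛ : 0 < Λ) {A : Coeff n}
    (hA : IsUniformlyElliptic Λ A) {σ : ℝ} (G : E (n + 1) → V (n + 1)) {x : E n} {R : ℝ} {L : ℝ≥0} :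
    ∀ᵐ X ∂volume.restrict (halfSpace n σ), ∀ Φ : E (n + 1) → ℂ, LipschitzWith L Φ →
      tsupport Φ ∩ halfSpace n σ ⊆ bdryBox σ x R → ‖energy A G Φ X‖ ≤
        (bdryBox σ x R).indicator (fun X => Λ * ((n + 1 : ℕ) * L) * ‖G X‖) X := by
  filter_upwards [ae_restrict_of_ae (ae_enorm_energy_le hΛ hA),
    ae_restrict_mem (isOpen_halfSpace n σ).measurableSet] with X hX hXH Φ hL hR
  have hle : ‖energy A G Φ X‖ ≤ Λ * (‖G X‖ * ‖grad Φ X‖) := by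
    have h1 := hX G Φ
    rwa [← ofReal_norm, ← ofReal_norm, ← ofReal_norm, ← ENNReal.ofReal_mul (norm_nonneg _),
      ← ENNReal.ofReal_mul hΛ.le, ENNReal.ofReal_le_ofReal_iff (by positivity)] at h1
  by_cases hXs : X ∈ tsupport Φ
  · rw [Set.indicator_of_mem (hR ⟨hXs, hXH⟩)]
    refine hle.trans ?_
    have h2 : ‖grad Φ X‖ ≤ (n + 1 : ℕ) * L := by
      have h3 := enorm_grad_le hL X
      rwa [← ofReal_norm, ← ENNReal.ofReal_natCast, ← ENNReal.ofReal_coe_nnreal,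
        ← ENNReal.ofReal_mul (by positivity), ENNReal.ofReal_le_ofReal_iff (by positivity)] at h3
    rw [mul_assoc, mul_comm ‖G X‖]
    gcongr
  · rw [grad_eq_zero hXs, norm_zero, mul_zero, mul_zero] at hle
    exact hle.trans (Set.indicator_nonneg (fun X _ => by positivity) X)

theorem integrableOn_energy {n : ℕ} {Λ : ℝ} (hΛ : 0 < Λ) {A : Coeff n} (hA : IsUniformlyElliptic Λ A)
    {σ : ℝ} (hσ : σ = 1 ∨ σ = -1) {G : E (n + 1) → V (n + 1)}
    (hGm : AEStronglyMeasurable G (volume.restrict (halfSpace n σ))) (hG : IntegrableToBdry σ G)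
    {Φ : E (n + 1) → ℂ} (hΦ : IsTestFunction Set.univ Φ) :
    IntegrableOn (energy A G Φ) (halfSpace n σ) := by
  obtain ⟨L, hL⟩ := hΦ.lipschitzWith
  obtain ⟨R, -, hR⟩ := exists_tsupport_subset_bdryBox hΦ.2.1
  refine Integrable.mono' (g := (bdryBox σ (0 : E n) R).indicator
    fun X => Λ * ((n + 1 : ℕ) * L) * ‖G X‖) ?_ (aestronglyMeasurable_energy hA hGm Φ) ?_
  · exact (IntegrableOn.integrable_indicator ((hG R).norm.const_mul _)
      (isOpen_bdryBox σ _ R).measurableSet).restrict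
  · filter_upwards [ae_norm_energy_le_indicator hΛ hA G] with X hX
    exact hX Φ hL (hR σ hσ)

/-! ### Independence of the extension -/

theorem exists_lipschitzWith_smoothTransition : ∃ L : ℝ≥0, LipschitzWith L Real.smoothTransition := by
  have hc : Continuous (deriv Real.smoothTransition) :=
    Real.smoothTransition.contDiff.continuous_deriv (n := 1) le_rfl
  obtain ⟨b, hb⟩ := (isCompact_Icc (a := (0 : ℝ)) (b := 1)).exists_bound_of_continuousOn hc.continuousOn
  refine ⟨(max b 0).toNNReal, lipschitzWith_of_nnnorm_deriv_le
    (Real.smoothTransition.contDiff (n := 1)).differentiable_one fun x => ?_⟩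
  rw [← NNReal.coe_le_coe, coe_nnnorm, Real.coe_toNNReal _ (le_max_right _ _)]
  by_cases hx : x ∈ Set.Icc (0 : ℝ) 1
  · exact (hb x hx).trans (le_max_left _ _)
  · have h0 : deriv Real.smoothTransition x = 0 := by
      rw [Set.mem_Icc, not_and_or, not_le, not_le] at hx
      rcases hx with hx | hx
      · have : Real.smoothTransition =ᶠ[𝓝 x] fun _ => 0 := by
          filter_upwards [gt_mem_nhds hx] with y hy
          exact Real.smoothTransition.zero_of_nonpos hy.le
        rw [this.deriv_eq, deriv_const]
      · have : Real.smoothTransition =ᶠ[𝓝 x] fun _ => 1 := by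
          filter_upwards [lt_mem_nhds hx] with y hy
          exact Real.smoothTransition.one_of_one_le hy.le
        rw [this.deriv_eq, deriv_const]
    rw [h0, norm_zero]
    exact le_max_right _ _

theorem lipschitzWith_horiz (n : ℕ) : LipschitzWith 1 (horiz : E (n + 1) → E n) :=
  LipschitzWith.of_dist_le_mul fun X Y => by simpa using dist_horiz_le X Y

theorem norm_le_of_trace_eq_zero {n : ℕ} {Φ : E (n + 1) → ℂ} {L : ℝ≥0} (hL : LipschitzWith L Φ)
    (h0 : ∀ x, Φ (bdryPt x) = 0) (X : E (n + 1)) : ‖Φ X‖ ≤ L * |height X| := by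
  have h1 := hL.dist_le_mul X (bdryPt (horiz X))
  rw [h0, dist_zero_right] at h1
  refine h1.trans (mul_le_mul_of_nonneg_left ?_ L.coe_nonneg)
  have h2 := dist_le_horiz_add_height X (bdryPt (horiz X))
  rwa [← pt_zero, horiz_pt, height_pt, dist_self, zero_add, sub_zero] at h2

/-- Multiply Φ by a cutoff that vanishes below height 1/(k+1) and is 1 above 2/(k+1). Its gradient
is of order k, but only where |Φ| ≤ L|t| ≤ 2L/(k+1), so the products are uniformly Lipschitz. They
are admissible in the equation, and integrability of ∇u up to the boundary gives the limit. -/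
theorem integral_energy_eq_zero {n : ℕ} {Λ : ℝ} (hΛ : 0 < Λ) {A : Coeff n}
    (hA : IsUniformlyElliptic Λ A) {σ : ℝ} (hσ : σ = 1 ∨ σ = -1) {G : E (n + 1) → V (n + 1)}
    (hGm : AEStronglyMeasurable G (volume.restrict (halfSpace n σ))) (hG : IntegrableToBdry σ G)
    (hu : ∀ Φ, IsTestFunction (halfSpace n σ) Φ → ∫ X in halfSpace n σ, energy A G Φ X = 0)
    {Φ : E (n + 1) → ℂ} (hΦ : IsTestFunction Set.univ Φ) (h0 : ∀ x, Φ (bdryPt x) = 0) :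
    ∫ X in halfSpace n σ, energy A G Φ X = 0 := by
  obtain ⟨L, hL⟩ := hΦ.lipschitzWith
  obtain ⟨R, -, hR⟩ := exists_tsupport_subset_bdryBox hΦ.2.1
  obtain ⟨c, hc⟩ := exists_lipschitzWith_smoothTransition
  set ψ : ℕ → E (n + 1) → ℝ := fun k X => Real.smoothTransition ((k + 1) * (σ * height X) - 1) with hψ
  have hψs : ∀ k, ContDiff ℝ ∞ (ψ k) := fun k =>
    Real.smoothTransition.contDiff.comp
      ((contDiff_const.mul (contDiff_const.mul (contDiff_height n))).sub contDiff_const)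
  have hcont : Continuous fun X : E (n + 1) => σ * height X :=
    continuous_const.mul (continuous_height n)
  have hψ0 : ∀ (k : ℕ) X, ((k : ℝ) + 1) * (σ * height X) ≤ 1 → ψ k X = 0 := fun k X h =>
    Real.smoothTransition.zero_of_nonpos (by linarith)
  have hψ1 : ∀ (k : ℕ) X, 2 ≤ ((k : ℝ) + 1) * (σ * height X) → ψ k X = 1 := fun k X h =>
    Real.smoothTransition.one_of_one_le (by linarith)
  have hψL : ∀ k : ℕ, LipschitzWith (c * (k + 1)) (ψ k) := fun k => by
    refine hc.comp (LipschitzWith.of_dist_le_mul fun X Y => ?_)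
    have := abs_sign_height_sub_le hσ X Y
    rw [Real.dist_eq, sub_sub_sub_cancel_right, ← mul_sub, abs_mul, abs_of_nonneg (by positivity)]
    push_cast
    gcongr
  set Ψ : ℕ → E (n + 1) → ℂ := fun k X => ψ k X • Φ X with hΨ
  have hts : ∀ k, tsupport (Ψ k) ⊆ tsupport Φ := fun k => tsupport_smul_subset_right (ψ k) Φ
  have hΨt : ∀ k, IsTestFunction (halfSpace n σ) (Ψ k) := by
    intro k
    refine ⟨(hψs k).smul hΦ.1, hΦ.2.1.smul_left (f := ψ k), ?_⟩
    have h1 : tsupport (Ψ k) ⊆ {X | 1 ≤ ((k : ℝ) + 1) * (σ * height X)} := by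
      refine closure_minimal (fun X hX => ?_) (isClosed_le continuous_const (continuous_const.mul hcont))
      by_contra h
      exact hX (by simp only [hΨ]; rw [hψ0 k X (not_le.1 h).le, zero_smul])
    intro X hX
    have h2 : 1 ≤ ((k : ℝ) + 1) * (σ * height X) := h1 hX
    by_contra h3
    have h4 : σ * height X ≤ 0 := not_lt.1 h3
    nlinarith [mul_nonneg (show (0 : ℝ) ≤ (k : ℝ) + 1 by positivity) (neg_nonneg.2 h4)]
  have hΨL : ∀ k, LipschitzWith (L + 2 * c * L) (Ψ k) := by
    intro k
    refine lipschitzWith_of_nnnorm_fderiv_le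
      (fun X => (hΨt k).differentiableAt X) fun X => ?_
    rw [← NNReal.coe_le_coe, coe_nnnorm]
    refine (norm_fderiv_smul_le (hψs k) hΦ.1 X).trans ?_
    have h1 : |ψ k X| ≤ 1 := by
      rw [abs_of_nonneg (Real.smoothTransition.nonneg _)]
      exact Real.smoothTransition.le_one _
    have h2 : ‖fderiv ℝ Φ X‖ ≤ L := norm_fderiv_le_of_lipschitz ℝ hL
    have h3 : ‖fderiv ℝ (ψ k) X‖ * ‖Φ X‖ ≤ 2 * c * L := by
      have hz : ∀ b : ℝ, ψ k =ᶠ[𝓝 X] (fun _ => b) → ‖fderiv ℝ (ψ k) X‖ * ‖Φ X‖ ≤ 2 * c * L := by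
        intro b hb
        rw [hb.fderiv_eq, fderiv_fun_const, Pi.zero_apply, norm_zero, zero_mul]
        positivity
      rcases lt_or_ge 2 (((k : ℝ) + 1) * (σ * height X)) with h4 | h4
      · refine hz 1 ?_
        filter_upwards [((continuous_const.mul hcont).tendsto X).eventually (lt_mem_nhds h4)] with Y hY
        exact hψ1 k Y hY.le
      rcases lt_or_ge (((k : ℝ) + 1) * (σ * height X)) 0 with h5 | h5
      · refine hz 0 ?_
        filter_upwards [((continuous_const.mul hcont).tendsto X).eventually (gt_mem_nhds h5)] with Y hY
        have h6 : ((k : ℝ) + 1) * (σ * height Y) < 0 := hY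
        exact hψ0 k Y (by linarith)
      · have h6 : ‖fderiv ℝ (ψ k) X‖ ≤ c * (k + 1) := by
          simpa using norm_fderiv_le_of_lipschitz ℝ (x₀ := X) (hψL k)
        have h7 := norm_le_of_trace_eq_zero hL h0 X
        have h8 : ((k : ℝ) + 1) * |height X| ≤ 2 := by
          have : |height X| = |σ * height X| := by rw [abs_mul, abs_sign hσ, one_mul]
          rw [this, ← abs_of_nonneg (show (0 : ℝ) ≤ (k : ℝ) + 1 by positivity), ← abs_mul,
            abs_of_nonneg h5]
          exact h4
        calc ‖fderiv ℝ (ψ k) X‖ * ‖Φ X‖ ≤ (c * (k + 1)) * (L * |height X|) := by gcongr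
          _ = c * L * ((k + 1) * |height X|) := by ring
          _ ≤ c * L * 2 := by gcongr
          _ = _ := by ring
    push_cast
    have h4 : |ψ k X| * ‖fderiv ℝ Φ X‖ ≤ 1 * L := by gcongr
    linarith
  have hlim : Tendsto (fun k => ∫ X in halfSpace n σ, energy A G (Ψ k) X) atTop
      (𝓝 (∫ X in halfSpace n σ, energy A G Φ X)) := by
    refine tendsto_integral_of_dominated_convergence ((bdryBox σ (0 : E n) R).indicator
      fun X => Λ * ((n + 1 : ℕ) * (L + 2 * c * L : ℝ≥0)) * ‖G X‖)
      (fun k => aestronglyMeasurable_energy hA hGm _) ?_ (fun k => ?_) ?_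
    · exact (IntegrableOn.integrable_indicator ((hG R).norm.const_mul _)
      (isOpen_bdryBox σ _ R).measurableSet).restrict
    · filter_upwards [ae_norm_energy_le_indicator hΛ hA G] with X hX
      exact hX _ (hΨL k) ((Set.inter_subset_inter_left _ (hts k)).trans (hR σ hσ))
    · filter_upwards [ae_restrict_mem (isOpen_halfSpace n σ).measurableSet] with X hX
      have hX0 : 0 < σ * height X := hX
      obtain ⟨K, hK⟩ := exists_nat_gt (2 / (σ * height X))
      refine tendsto_const_nhds.congr' ?_
      filter_upwards [eventually_ge_atTop K] with k hk
      have h2 : 2 < ((k : ℝ) + 1) * (σ * height X) := by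
        rw [div_lt_iff₀ hX0] at hK
        have : (K : ℝ) ≤ k := by exact_mod_cast hk
        nlinarith
      have h3 : Ψ k =ᶠ[𝓝 X] Φ := by
        filter_upwards [((continuous_const.mul hcont).tendsto X).eventually (lt_mem_nhds h2)] with Y hY
        simp only [hΨ]
        rw [hψ1 k Y hY.le, one_smul]
      rw [energy_eq, energy_eq, grad, grad, h3.fderiv_eq]
  refine tendsto_nhds_unique hlim ?_
  simp only [fun k => hu _ (hΨt k)]
  exact tendsto_const_nhds

/-! ### Extension of boundary functions, and the co-normal derivative. -/

theorem exists_bdryCutoff : ∃ (χ : ℝ → ℝ) (L : ℝ≥0), ContDiff ℝ ∞ χ ∧ LipschitzWith L χ ∧ χ 0 = 1 ∧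
    (∀ s, |χ s| ≤ 1) ∧ ∀ s, 2 ≤ |s| → χ s = 0 := by
  let b : ContDiffBump (0 : ℝ) := ⟨1, 2, one_pos, one_lt_two⟩
  obtain ⟨L, hL⟩ := (b.contDiff (n := 1)).lipschitzWith_of_hasCompactSupport b.hasCompactSupport
    (by simp)
  refine ⟨b, L, b.contDiff, hL, b.one_of_mem_closedBall (by simp [b]), fun s => ?_, fun s hs => ?_⟩
  · rw [abs_of_nonneg b.nonneg]; exact b.le_one
  · exact b.zero_of_le_dist (by simpa [b] using hs)

/-- A cutoff function on `ℝ`. -/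
def cutoff : ℝ → ℝ := exists_bdryCutoff.choose

/-- A Lipschitz constant of the cutoff function. -/
def cutoffLip : ℝ≥0 := exists_bdryCutoff.choose_spec.choose

theorem contDiff_cutoff : ContDiff ℝ ∞ cutoff := exists_bdryCutoff.choose_spec.choose_spec.1

theorem lipschitzWith_cutoff : LipschitzWith cutoffLip cutoff :=
  exists_bdryCutoff.choose_spec.choose_spec.2.1

theorem cutoff_zero : cutoff 0 = 1 := exists_bdryCutoff.choose_spec.choose_spec.2.2.1

theorem abs_cutoff_le (s : ℝ) : |cutoff s| ≤ 1 := exists_bdryCutoff.choose_spec.choose_spec.2.2.2.1 s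

theorem cutoff_eq_zero {s : ℝ} (hs : 2 ≤ |s|) : cutoff s = 0 :=
  exists_bdryCutoff.choose_spec.choose_spec.2.2.2.2 s hs

/-- The extension `φ(x) χ(t / r)` of a function on the boundary. -/
def extend {n : ℕ} (φ : E n → ℂ) (r : ℝ) (X : E (n + 1)) : ℂ :=
  cutoff (height X / r) • φ (horiz X)

theorem extend_bdryPt {n : ℕ} (φ : E n → ℂ) (r : ℝ) (x : E n) : extend φ r (bdryPt x) = φ x := by
  rw [extend, ← pt_zero, height_pt, horiz_pt, zero_div, cutoff_zero, one_smul]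

theorem tsupport_extend_subset {n : ℕ} {φ : E n → ℂ} {r : ℝ} (hr : 0 < r) {x : E n} {ρ : ℝ}
    (hφ : tsupport φ ⊆ Metric.closedBall x ρ) :
    tsupport (extend φ r) ⊆ {X | horiz X ∈ Metric.closedBall x ρ ∧ |height X| ≤ 2 * r} := by
  refine closure_minimal (fun X hX => ?_) ?_
  · rw [Function.mem_support, extend, smul_ne_zero_iff] at hX
    refine ⟨hφ (subset_tsupport _ hX.2), ?_⟩
    by_contra h
    refine hX.1 (cutoff_eq_zero ?_)
    rw [abs_div, abs_of_pos hr, le_div_iff₀ hr]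
    exact (not_le.1 h).le
  · exact (Metric.isClosed_closedBall.preimage (continuous_horiz n)).inter
      (isClosed_le (continuous_height n).abs continuous_const)

theorem isTestFunction_extend {n : ℕ} {φ : E n → ℂ} (hφ : IsTestFunction Set.univ φ) {r : ℝ}
    (hr : 0 < r) : IsTestFunction Set.univ (extend φ r) := by
  obtain ⟨ρ, hρ⟩ := hφ.2.1.isCompact.isBounded.subset_closedBall (0 : E n)
  refine ⟨?_, ?_, Set.subset_univ _⟩
  · exact (contDiff_cutoff.comp ((contDiff_height n).div_const r)).smul (hφ.1.comp (contDiff_horiz n))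
  · refine (isCompact_closedBall (bdryPt (0 : E n)) (ρ + 2 * r)).of_isClosed_subset
      (isClosed_tsupport _) ((tsupport_extend_subset hr hρ).trans fun X hX => ?_)
    have h1 := dist_le_horiz_add_height X (bdryPt (0 : E n))
    rw [← pt_zero, horiz_pt, height_pt, sub_zero] at h1
    exact h1.trans (add_le_add hX.1 hX.2)

/-- The vertical cutoff acts at the same scale r as the bump, so both terms of the product rule are
of order a/r. -/
theorem lipschitzWith_extend {n : ℕ} {φ : E n → ℂ} {x : E n} {r a : ℝ} (hr : 0 < r)
    (hφ : IsBump φ x r a) :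
    LipschitzWith ((1 + cutoffLip) * (a / r).toNNReal) (extend φ r) := by
  have ha := hφ.nonneg
  have hLφ : LipschitzWith (a / r).toNNReal φ :=
    lipschitzWith_of_nnnorm_fderiv_le (hφ.isTestFunction.differentiableAt) fun y => by
      rw [← NNReal.coe_le_coe, coe_nnnorm, Real.coe_toNNReal _ (by positivity)]
      exact hφ.fderiv_le y
  have hLχ : LipschitzWith (cutoffLip * (1 / r).toNNReal) fun X : E (n + 1) => cutoff (height X / r) := by
    refine lipschitzWith_cutoff.comp (LipschitzWith.of_dist_le_mul fun X Y => ?_)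
    rw [Real.dist_eq, ← sub_div, abs_div, abs_of_pos hr, Real.coe_toNNReal _ (by positivity),
      one_div_mul_eq_div]
    gcongr
    exact abs_height_sub_le X Y
  refine lipschitzWith_of_nnnorm_fderiv_le
    (isTestFunction_extend hφ.isTestFunction hr).differentiableAt fun X => ?_
  rw [← NNReal.coe_le_coe, coe_nnnorm]
  refine (norm_fderiv_smul_le (ψ := fun X : E (n + 1) => cutoff (height X / r))
    (φ := fun X => φ (horiz X)) (contDiff_cutoff.comp ((contDiff_height n).div_const r))
    (hφ.contDiff.comp (contDiff_horiz n)) X).trans ?_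
  have h1 : ‖fderiv ℝ (fun X : E (n + 1) => φ (horiz X)) X‖ ≤ a / r := by
    have := norm_fderiv_le_of_lipschitz ℝ (x₀ := X) (hLφ.comp (lipschitzWith_horiz n))
    rwa [mul_one, Real.coe_toNNReal _ (by positivity)] at this
  have h2 : ‖fderiv ℝ (fun X : E (n + 1) => cutoff (height X / r)) X‖ ≤ cutoffLip * (1 / r) := by
    have := norm_fderiv_le_of_lipschitz ℝ (x₀ := X) hLχ
    rwa [NNReal.coe_mul, Real.coe_toNNReal _ (by positivity)] at this
  calc _ ≤ 1 * (a / r) + cutoffLip * (1 / r) * a := by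
        gcongr
        · exact abs_cutoff_le _
        · exact hφ.norm_le _
    _ = _ := by
        push_cast
        rw [Real.coe_toNNReal _ (by positivity)]
        ring

/-- Every compactly supported Schwartz function on the boundary is the trace of its extension, and
such functions determine a tempered distribution. -/
theorem isConormal_unique {n : ℕ} {A : Coeff n} {σ : ℝ} (hσ : σ = 1 ∨ σ = -1)
    {G : E (n + 1) → V (n + 1)} {g g' : 𝓢'(E n, ℂ)} (hg : IsConormal A σ G g)
    (hg' : IsConormal A σ G g') : g' = g := by
  refine tempered_ext fun φ hφ => ?_
  have hφt : IsTestFunction Set.univ φ := ⟨φ.smooth ⊤, hφ, Set.subset_univ _⟩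
  have ht := isTestFunction_extend hφt one_pos
  have e : traceTest _ ht = φ := by
    ext x
    rw [traceTest_apply, extend_bdryPt]
  have h1 := (hg _ ht).2
  rw [(hg' _ ht).2, e] at h1
  have hσ0 : (σ : ℂ) ≠ 0 := by rcases hσ with rfl | rfl <;> simp
  exact mul_left_cancel₀ hσ0 h1

/-- The form Φ ↦ ∫A∇u·∇Φ depends only on the trace of Φ. For a bump it is computed with an extension
at the scale of the bump, and the box estimate bounds it by C a r^n times a function in L^p. -/
theorem exists_conormal {n : ℕ} (hn : 0 < n) {Λ p : ℝ} (hΛ : 0 < Λ) (hp : (n : ℝ) / (n + 1) < p) :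
    ∃ C : ℝ≥0, ∀ A : Coeff n, IsUniformlyElliptic Λ A → ∀ σ : ℝ, σ = 1 ∨ σ = -1 →
      ∀ (u : E (n + 1) → ℂ) (G : E (n + 1) → V (n + 1)), IsSolution A (halfSpace n σ) u G →
        lpQuasiNorm p (ntMax σ G) < ⊤ → ∃ g : 𝓢'(E n, ℂ),
          hardyNorm p g ≤ C * lpQuasiNorm p (ntMax σ G) ∧ IsConormal A σ G g ∧
          (1 ≤ p → ∃ h : E n → ℂ, MemLp h (ENNReal.ofReal p) volume ∧ Represents g h) := by
  have hp0 : 0 < p := lt_of_le_of_lt (by positivity) hp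
  have hn1 : (n : ℝ) / (n + 1) < 1 := by rw [div_lt_one (by positivity)]; linarith
  -- The box estimate needs n/(n+1) < q ≤ 1, and the maximal theorem is used on L^(p/q), which needs
  -- q < p.
  obtain ⟨q, hq, hqm⟩ := exists_between (lt_min hp hn1)
  have hq1 : q ≤ 1 := (hqm.trans_le (min_le_right _ _)).le
  have hqp : q < p := hqm.trans_le (min_le_left _ _)
  have hq0 : 0 < q := lt_of_le_of_lt (by positivity) hq
  obtain ⟨C₁, hC₁⟩ := exists_lintegral_grad_bdryBox_le hn hq hq1
  obtain ⟨C₂, hC₂⟩ := exists_hardy_of_bump hn hp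
  obtain ⟨C₃, hC₃⟩ := lintegral_hlMax_rpow_le hn (s := p / q) ((one_lt_div hq0).2 hqp)
  set K : ℝ≥0 := Λ.toNNReal * ((n + 1 : ℕ) * (1 + cutoffLip)) * C₁ * 3 ^ (n + 1) with hK
  refine ⟨C₂ * (K * C₃ ^ (1 / p)), fun A hA σ hσ u G hu hN => ?_⟩
  set N := ntMax σ G with hNdef
  have hNm : Measurable N := (lowerSemicontinuous_ntMax σ G).measurable
  have hI : ∫⁻ x, N x ^ p < ⊤ := (ENNReal.rpow_lt_top_iff_of_pos (by positivity)).1 hN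
  have hGm : AEStronglyMeasurable G (volume.restrict (halfSpace n σ)) :=
    hu.2.2.1.2.1.aestronglyMeasurable
  set H : E n → ℝ≥0∞ := fun y => hlMax (fun z => N z ^ q) y ^ (1 / q) with hH
  have hHI : ∫⁻ y, H y ^ p ≤ C₃ * ∫⁻ x, N x ^ p := by
    have h1 := hC₃ (fun z => N z ^ q) (hNm.pow_const q)
    simp only [← ENNReal.rpow_mul, mul_div_cancel₀ _ hq0.ne'] at h1
    simp only [hH, ← ENNReal.rpow_mul, one_div_mul_eq_div]
    exact h1
  have hHm : Measurable H := (lowerSemicontinuous_hlMax _).measurable.pow_const _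
  have hHlsc : LowerSemicontinuous fun y => (K : ℝ≥0∞) * H y := by
    refine Continuous.comp_lowerSemicontinuous
      (g := fun t : ℝ≥0∞ => (K : ℝ≥0∞) * t ^ (1 / q)) ?_ (lowerSemicontinuous_hlMax _) ?_
    · exact (ENNReal.continuous_const_mul ENNReal.coe_ne_top).comp ENNReal.continuous_rpow_const
    · exact fun s t hst => mul_le_mul_right (ENNReal.rpow_le_rpow hst (by positivity)) _
  have hHft : ∀ᵐ y, H y < ⊤ := by
    filter_upwards [ae_lt_top (hHm.pow_const p) (hHI.trans_lt (ENNReal.mul_lt_top ENNReal.coe_lt_top hI)).ne]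
      with y hy
    exact (ENNReal.rpow_lt_top_iff_of_pos hp0).1 hy
  -- The maximal function is finite almost everywhere, hence at some point of any ball, and the box
  -- estimate is applied at such a point.
  have hG : IntegrableToBdry σ G := by
    intro r
    refine ⟨hGm.mono_measure (Measure.restrict_mono (fun X hX => hX.2.1) le_rfl), ?_⟩
    rcases le_or_gt r 0 with hr | hr
    · have : bdryBox σ (0 : E n) r = ∅ := by
        ext X
        simp only [Set.mem_empty_iff_false, iff_false]
        exact fun h => by linarith [h.2.1, h.2.2]
      rw [this, Measure.restrict_empty]
      exact hasFiniteIntegral_zero_measure _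
    · obtain ⟨y, hy, hyt⟩ : ∃ y ∈ Metric.ball (0 : E n) (42 * r), H y < ⊤ := by
        by_contra! h
        have h2 : volume (Metric.ball (0 : E n) (42 * r)) = 0 :=
          measure_mono_null (fun y hy => not_lt.2 (h y hy)) (ae_iff.1 hHft)
        exact (Metric.measure_ball_pos volume (0 : E n) (by positivity)).ne' h2
      exact (hC₁ σ hσ G hGm 0 r hr y hy).trans_lt (ENNReal.mul_lt_top ENNReal.coe_lt_top
        (ENNReal.mul_lt_top ENNReal.ofReal_lt_top hyt))
  have hint := fun {Φ : E (n + 1) → ℂ} (hΦ : IsTestFunction Set.univ Φ) =>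
    integrableOn_energy hΛ hA hσ hGm hG hΦ
  -- The difference of two extensions has zero trace.
  have hindep : ∀ {Φ Ψ : E (n + 1) → ℂ}, IsTestFunction Set.univ Φ → IsTestFunction Set.univ Ψ →
      (∀ x, Φ (bdryPt x) = Ψ (bdryPt x)) →
      ∫ X in halfSpace n σ, energy A G Φ X = ∫ X in halfSpace n σ, energy A G Ψ X := by
    intro Φ Ψ hΦ hΨ h
    have hΨ' : IsTestFunction Set.univ ((-1 : ℂ) • Ψ) :=
      ⟨by exact hΨ.1.const_smul (-1 : ℂ), hΨ.2.1.smul_left (f := fun _ => (-1 : ℂ)), Set.subset_univ _⟩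
    have h1 := integral_energy_eq_zero hΛ hA hσ hGm hG hu.2.2.2 (Φ := Φ + (-1 : ℂ) • Ψ)
      ⟨hΦ.1.add hΨ'.1, hΦ.2.1.add hΨ'.2.1, Set.subset_univ _⟩ (fun x => by simp [h])
    simp only [fun X => energy_add A G hΦ hΨ' X, fun X => energy_smul A G hΨ (-1) X] at h1
    rw [integral_add (hint hΦ) ((hint hΨ).const_mul _), integral_const_mul, neg_one_mul,
      ← sub_eq_add_neg, sub_eq_zero] at h1
    exact h1
  obtain ⟨ℓ, hℓ⟩ := exists_linearMap_of_test
    (fun φ : E n → ℂ => (σ : ℂ) * ∫ X in halfSpace n σ, energy A G (extend φ 1) X)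
    (fun φ ψ hφ hψ => by
      have e : extend (φ + ψ) 1 = extend φ 1 + extend ψ 1 := by
        ext X; simp [extend]
      simp only [e, fun X => energy_add A G (isTestFunction_extend hφ one_pos)
        (isTestFunction_extend hψ one_pos) X]
      rw [integral_add (hint (isTestFunction_extend hφ one_pos))
        (hint (isTestFunction_extend hψ one_pos)), mul_add])
    (fun c φ hφ => by
      have e : extend (c • φ) 1 = c • extend φ 1 := by
        ext X; simp [extend]; ring
      simp only [e, fun X => energy_smul A G (isTestFunction_extend hφ one_pos) c X]
      rw [integral_const_mul]; ring)
  have hℓΦ : ∀ {φ : E n → ℂ}, IsTestFunction Set.univ φ → ∀ {Φ : E (n + 1) → ℂ},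
      IsTestFunction Set.univ Φ → (∀ x, Φ (bdryPt x) = φ x) →
      ℓ φ = σ * ∫ X in halfSpace n σ, energy A G Φ X := by
    intro φ hφ Φ hΦ h
    rw [hℓ φ hφ, hindep (isTestFunction_extend hφ one_pos) hΦ fun x => by rw [extend_bdryPt, h]]
  obtain ⟨T, hT, hTp, hTφ⟩ := hC₂ ℓ (fun y => K * H y) hHlsc
    (by
      simp only [ENNReal.mul_rpow_of_nonneg _ _ hp0.le]
      rw [lintegral_const_mul _ (hHm.pow_const p)]
      exact ENNReal.mul_lt_top (ENNReal.rpow_lt_top_of_nonneg hp0.le ENNReal.coe_ne_top)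
        (hHI.trans_lt (ENNReal.mul_lt_top ENNReal.coe_lt_top hI)))
    (fun φ x r a hr hφ y hy => by
      have ha := hφ.nonneg
      -- The functional was defined with extensions at scale 1. By independence of the extension it
      -- may be evaluated with one at scale r.
      have hext := isTestFunction_extend hφ.isTestFunction hr
      have hbox : tsupport (extend φ r) ∩ halfSpace n σ ⊆ bdryBox σ x (3 * r) := by
        rintro X ⟨hX, hXH⟩
        have h1 := tsupport_extend_subset hr hφ.tsupport_subset hX
        have h2 : dist (horiz X) x ≤ r := h1.1
        refine ⟨by rw [Metric.mem_ball]; linarith, hXH, ?_⟩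
        have h3 : |σ * height X| = |height X| := by rw [abs_mul, abs_sign hσ, one_mul]
        linarith [le_abs_self (σ * height X), h1.2]
      have hbound : ∀ᵐ X ∂volume.restrict (halfSpace n σ), ‖energy A G (extend φ r) X‖ₑ ≤
          (bdryBox σ x (3 * r)).indicator (fun X => (Λ.toNNReal * ((n + 1 : ℕ) * ((1 + cutoffLip) *
            (a / r).toNNReal)) : ℝ≥0) * ‖G X‖ₑ) X := by
        filter_upwards [ae_norm_energy_le_indicator hΛ hA G] with X hX
        have h1 := hX _ (lipschitzWith_extend hr hφ) hbox
        by_cases hXb : X ∈ bdryBox σ x (3 * r)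
        · rw [Set.indicator_of_mem hXb] at h1 ⊢
          rw [← ofReal_norm, ← ofReal_norm, ← ENNReal.ofReal_coe_nnreal, ← ENNReal.ofReal_mul (NNReal.coe_nonneg _)]
          refine ENNReal.ofReal_le_ofReal (h1.trans (le_of_eq ?_))
          push_cast
          rw [Real.coe_toNNReal _ hΛ.le]
        · rw [Set.indicator_of_notMem hXb] at h1 ⊢
          rw [norm_le_zero_iff.1 h1, enorm_zero]
      have hσe : ‖(σ : ℂ)‖ₑ = 1 := by rcases hσ with rfl | rfl <;> simp
      rw [hℓΦ hφ.isTestFunction hext fun z => extend_bdryPt φ r z, enorm_mul, hσe, one_mul]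
      have hy' : y ∈ Metric.ball x (42 * (3 * r)) := by
        rw [Metric.mem_closedBall] at hy; rw [Metric.mem_ball]; linarith
      calc _ ≤ ∫⁻ X in halfSpace n σ, ‖energy A G (extend φ r) X‖ₑ := enorm_integral_le_lintegral_enorm _
        _ ≤ _ := lintegral_mono_ae hbound
        _ ≤ ∫⁻ X, _ := setLIntegral_le_lintegral _ _
        _ = (Λ.toNNReal * ((n + 1 : ℕ) * ((1 + cutoffLip) * (a / r).toNNReal)) : ℝ≥0) *
            ∫⁻ X in bdryBox σ x (3 * r), ‖G X‖ₑ := by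
            rw [lintegral_indicator (isOpen_bdryBox σ x _).measurableSet,
              lintegral_const_mul' _ _ ENNReal.coe_ne_top]
        _ ≤ (Λ.toNNReal * ((n + 1 : ℕ) * ((1 + cutoffLip) * (a / r).toNNReal)) : ℝ≥0) *
            (C₁ * (ENNReal.ofReal ((3 * r) ^ (n + 1)) * H y)) :=
            mul_le_mul_right (hC₁ σ hσ G hGm x (3 * r) (by positivity) y hy') _
        _ = _ := by
            have e : a * r ^ n = a / r * r ^ (n + 1) := by rw [pow_succ]; field_simp
            rw [e, ENNReal.ofReal_mul (by positivity), mul_pow, ENNReal.ofReal_mul (by positivity), hK,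
              ENNReal.ofReal_pow (by norm_num : (0 : ℝ) ≤ 3), ENNReal.ofReal_ofNat]
            push_cast
            rw [show ENNReal.ofReal (a / r) = ((a / r).toNNReal : ℝ≥0∞) from rfl]
            ring)
  refine ⟨T, hT.trans ?_, fun Φ hΦ => ⟨hint hΦ, ?_⟩, hTp⟩
  · have e : (∫⁻ y, ((K : ℝ≥0∞) * H y) ^ p) ^ (1 / p) = K * (∫⁻ y, H y ^ p) ^ (1 / p) := by
      simp only [ENNReal.mul_rpow_of_nonneg _ _ hp0.le]
      rw [lintegral_const_mul _ (hHm.pow_const p), ENNReal.mul_rpow_of_nonneg _ _ (by positivity),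
        ← ENNReal.rpow_mul, mul_one_div_cancel hp0.ne', ENNReal.rpow_one]
    rw [e, lpQuasiNorm]
    push_cast
    rw [mul_assoc, mul_assoc]
    refine mul_le_mul_right (mul_le_mul_right ?_ _) _
    rw [ENNReal.coe_rpow_of_nonneg _ (by positivity), ← ENNReal.mul_rpow_of_nonneg _ _ (by positivity)]
    exact ENNReal.rpow_le_rpow hHI (by positivity)
  · have hφ : IsTestFunction Set.univ (traceTest Φ hΦ) := by
      refine ⟨(traceTest Φ hΦ).smooth ⊤, ?_, Set.subset_univ _⟩
      exact hΦ.2.1.comp_isClosedEmbedding (bdryPt_isometry n).isClosedEmbedding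
    rw [hTφ _ hφ.2.1, hℓΦ hφ hΦ fun x => (traceTest_apply Φ hΦ x).symm, ← mul_assoc]
    have : (σ : ℂ) * σ = 1 := by rcases hσ with rfl | rfl <;> simp
    rw [this, one_mul]

/-! ### A Poincaré inequality on balls -/

theorem IsTestFunction.memLp {d : ℕ} {Ω : Set (E d)} {φ : E d → ℂ} (hφ : IsTestFunction Ω φ)
    (p : ℝ≥0∞) (μ : Measure (E d)) [IsFiniteMeasureOnCompacts μ] : MemLp φ p μ :=
  hφ.1.continuous.memLp_of_hasCompactSupport hφ.2.1

theorem IsTestFunction.setIntegral_mul {d : ℕ} {Ω : Set (E d)} {φ : E d → ℂ}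
    (hφ : IsTestFunction Ω φ) (f : E d → ℂ) : ∫ x in Ω, f x * φ x = ∫ x, f x * φ x :=
  setIntegral_eq_integral_of_forall_compl_eq_zero fun x hx => by
    rw [image_eq_zero_of_notMem_tsupport fun h => hx (hφ.2.2 h), mul_zero]

/-- Test functions are dense in L²(U): an L² function orthogonal to all of them vanishes by the
fundamental lemma of the calculus of variations. The bound thus extends to L²(U) and is applied to
the conjugate of f. -/
theorem eLpNorm_two_le_of_test {d : ℕ} {U : Set (E d)} (hU : IsOpen U) {f : E d → ℂ}
    (hf : MemLp f 2 (volume.restrict U)) {K : ℝ}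
    (h : ∀ φ, IsTestFunction U φ →
      ‖∫ x in U, f x * φ x‖ ≤ K * (eLpNorm φ 2 (volume.restrict U)).toReal) :
    eLpNorm f 2 (volume.restrict U) ≤ ENNReal.ofReal K := by
  set μ := volume.restrict U with hμ
  let S : Submodule ℂ (Lp ℂ 2 μ) :=
    { carrier := {g | ∃ φ, IsTestFunction U φ ∧ g =ᵐ[μ] φ}
      add_mem' := by
        rintro g g' ⟨φ, hφ, hg⟩ ⟨φ', hφ', hg'⟩
        refine ⟨φ + φ', ⟨hφ.1.add hφ'.1, hφ.2.1.add hφ'.2.1,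
          (tsupport_add φ φ').trans (Set.union_subset hφ.2.2 hφ'.2.2)⟩, ?_⟩
        exact (Lp.coeFn_add g g').trans (hg.add hg')
      zero_mem' := ⟨0, ⟨contDiff_const, HasCompactSupport.zero, by simp⟩, Lp.coeFn_zero _ _ _⟩
      smul_mem' := by
        rintro c g ⟨φ, hφ, hg⟩
        refine ⟨c • φ, ⟨by exact hφ.1.const_smul c, hφ.2.1.smul_left (f := fun _ => c),
          (tsupport_smul_subset_right (fun _ => c) φ).trans hφ.2.2⟩, ?_⟩
        exact (Lp.coeFn_smul c g).trans (hg.const_smul c) }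
  have hperp : Sᗮ = ⊥ := by
    rw [Submodule.eq_bot_iff]
    intro g hg
    rw [Submodule.mem_orthogonal] at hg
    have hgl : LocallyIntegrableOn g U := by
      rw [locallyIntegrableOn_iff hU.isLocallyClosed]
      intro k hk hkc
      have h1 : MemLp g 2 (volume.restrict k) :=
        (Lp.memLp g).mono_measure (Measure.restrict_mono hk le_rfl)
      have : IsFiniteMeasure (volume.restrict k) := ⟨by
        rw [Measure.restrict_apply_univ]; exact hkc.measure_lt_top⟩
      exact h1.integrable (by norm_num)
    have h2 := hU.ae_eq_zero_of_integral_contDiff_smul_eq_zero hgl (fun φ hφ hφc hφU => by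
      have hφt : IsTestFunction U fun x => (φ x : ℂ) :=
        ⟨Complex.ofRealCLM.contDiff.comp hφ, hφc.comp_left (g := fun t : ℝ => (t : ℂ)) rfl,
          (closure_mono (s := Function.support fun x => (φ x : ℂ)) (t := Function.support φ)
            fun x hx h0 => hx (by simp [h0])).trans hφU⟩
      have h3 := hg ((hφt.memLp 2 μ).toLp _) ⟨_, hφt, (hφt.memLp 2 μ).coeFn_toLp⟩
      rw [L2.inner_def] at h3
      calc ∫ x, φ x • g x = ∫ x, g x * (φ x : ℂ) := by
            refine integral_congr_ae (ae_of_all _ fun x => ?_)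
            change φ x • g x = g x * (φ x : ℂ)
            rw [Complex.real_smul, mul_comm]
        _ = ∫ x in U, g x * (φ x : ℂ) := (hφt.setIntegral_mul _).symm
        _ = 0 := by
            rw [← h3]
            refine integral_congr_ae ?_
            filter_upwards [(hφt.memLp 2 μ).coeFn_toLp] with x hx
            rw [hx]
            simp)
    refine Lp.ext ?_
    refine EventuallyEq.trans ?_ (Lp.coeFn_zero _ _ _).symm
    exact (ae_restrict_iff' hU.measurableSet).2 h2
  have hdense : Dense (S : Set (Lp ℂ 2 μ)) := by
    rw [dense_iff_closure_eq, ← Submodule.topologicalClosure_coe,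
      Submodule.topologicalClosure_eq_top_iff.2 hperp, Submodule.top_coe]
  have hf' : MemLp (fun x => star (f x)) 2 μ := hf.star
  set F := hf'.toLp _ with hF
  have hle : ∀ g : Lp ℂ 2 μ, ‖inner ℂ F g‖ ≤ K * ‖g‖ := by
    intro g
    refine isClosed_property (p := fun g : Lp ℂ 2 μ => ‖inner ℂ F g‖ ≤ K * ‖g‖) hdense.denseRange_val
      (isClosed_le (by fun_prop) (by fun_prop)) (fun g => ?_) g
    obtain ⟨φ, hφ, hg⟩ := g.2
    have h1 : inner ℂ F (g : Lp ℂ 2 μ) = ∫ x in U, f x * φ x := by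
      rw [L2.inner_def]
      refine integral_congr_ae ?_
      filter_upwards [hf'.coeFn_toLp, hg] with x hx hx'
      rw [hx, hx']
      simp [mul_comm]
    rw [h1, Lp.norm_def, eLpNorm_congr_ae hg]
    exact h φ hφ
  have h1 := hle F
  rw [inner_self_eq_norm_sq_to_K] at h1
  have h2 : ‖F‖ ≤ max K 0 := by
    rcases (norm_nonneg F).eq_or_lt with h0 | h0
    · rw [← h0]; exact le_max_right _ _
    · refine le_trans ?_ (le_max_left _ _)
      have h3 : ‖F‖ * ‖F‖ ≤ K * ‖F‖ := by
        calc ‖F‖ * ‖F‖ = ‖((‖F‖ : ℝ) : ℂ) ^ 2‖ := by simp [sq]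
          _ ≤ _ := h1
      exact le_of_mul_le_mul_right h3 h0
  have h3 : eLpNorm (fun x => star (f x)) 2 μ = eLpNorm f 2 μ :=
    eLpNorm_congr_norm_ae (ae_of_all _ fun x => norm_star _)
  rw [← h3, ← ENNReal.ofReal_toReal hf'.2.ne, ← Lp.norm_toLp _ hf']
  rcases le_total K 0 with hK | hK
  · rw [max_eq_right hK] at h2
    exact (ENNReal.ofReal_le_ofReal h2).trans (by simp)
  · rw [max_eq_left hK] at h2
    exact ENNReal.ofReal_le_ofReal h2

theorem fderiv_apply_eq_sum {d : ℕ} (φ : E d → ℂ) (x h : E d) :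
    fderiv ℝ φ x h = ∑ i, (h i : ℂ) * grad φ x i := by
  have e : h = ∑ i, h i • EuclideanSpace.single i (1 : ℝ) := by
    ext j
    simp [WithLp.ofLp_sum, Finset.sum_apply, Pi.single_apply]
  conv_lhs => rw [e, map_sum]
  refine Finset.sum_congr rfl fun i _ => ?_
  rw [map_smul, Complex.real_smul]
  rfl

theorem norm_sum_ofReal_mul_le {d : ℕ} (h : E d) (w : V d) : ‖∑ i, (h i : ℂ) * w i‖ ≤ ‖h‖ * ‖w‖ := by
  refine (norm_sum_le _ _).trans ?_
  simp only [norm_mul, Complex.norm_real]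
  rw [EuclideanSpace.norm_eq, EuclideanSpace.norm_eq]
  exact Real.sum_mul_le_sqrt_mul_sqrt _ _ _

theorem IsTestFunction.comp_sub_right {d : ℕ} {φ : E d → ℂ} (hφ : IsTestFunction Set.univ φ)
    {Ω : Set (E d)} {w : E d} (hw : ∀ x ∈ tsupport φ, x + w ∈ Ω) :
    IsTestFunction Ω fun x => φ (x - w) := by
  have hsub : tsupport (fun x => φ (x - w)) = (fun x => x - w) ⁻¹' tsupport φ :=
    tsupport_comp_eq_preimage φ (Homeomorph.subRight w)
  refine ⟨hφ.1.comp (contDiff_id.sub contDiff_const),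
    hφ.2.1.comp_homeomorph (Homeomorph.subRight w), ?_⟩
  rw [hsub]
  intro x hx
  simpa using hw _ hx

theorem norm_integral_sum_mul_le {d : ℕ} {μ : Measure (E d)} {G : E d → V d} {φ : E d → ℂ}
    (hG : MemLp G 2 μ) (hφ : MemLp φ 2 μ) (h : E d) :
    ‖∫ x, (∑ i, (h i : ℂ) * G x i) * φ x ∂μ‖ ≤
      ‖h‖ * (eLpNorm G 2 μ).toReal * (eLpNorm φ 2 μ).toReal := by
  have h1 : ‖∫ x, (∑ i, (h i : ℂ) * G x i) * φ x ∂μ‖ₑ ≤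
      ENNReal.ofReal ‖h‖ * (eLpNorm G 2 μ * eLpNorm φ 2 μ) := by
    calc _ ≤ ∫⁻ x, ‖(∑ i, (h i : ℂ) * G x i) * φ x‖ₑ ∂μ := enorm_integral_le_lintegral_enorm _
      _ ≤ ∫⁻ x, ENNReal.ofReal ‖h‖ * (‖G x‖ₑ * ‖φ x‖ₑ) ∂μ := by
          refine lintegral_mono fun x => ?_
          rw [enorm_mul, ← mul_assoc]
          refine mul_le_mul_left ?_ _
          rw [← ofReal_norm, ← ofReal_norm, ← ENNReal.ofReal_mul (norm_nonneg _)]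
          exact ENNReal.ofReal_le_ofReal (norm_sum_ofReal_mul_le h (G x))
      _ = ENNReal.ofReal ‖h‖ * ∫⁻ x, ‖G x‖ₑ * ‖φ x‖ₑ ∂μ :=
          lintegral_const_mul' _ _ ENNReal.ofReal_ne_top
      _ ≤ _ := by
          refine mul_le_mul_right ?_ _
          have h2 := ENNReal.lintegral_mul_le_Lp_mul_Lq μ Real.HolderConjugate.two_two hG.1.enorm hφ.1.enorm
          rw [eLpNorm_eq_lintegral_rpow_enorm_toReal (by norm_num) (by norm_num),
            eLpNorm_eq_lintegral_rpow_enorm_toReal (by norm_num) (by norm_num), ENNReal.toReal_ofNat]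
          exact h2
  have h3 := ENNReal.toReal_mono (ENNReal.mul_ne_top ENNReal.ofReal_ne_top
    (ENNReal.mul_ne_top hG.2.ne hφ.2.ne)) h1
  rwa [toReal_enorm, ENNReal.toReal_mul, ENNReal.toReal_mul, ENNReal.toReal_ofReal (norm_nonneg _),
    ← mul_assoc] at h3

/-- By duality it suffices to test on φ supported in the overlap. The function s ↦ ∫uφ(· - sh) has
as derivative the integral of h·G against the translate of φ, and it is compared at s = 0 and s = 1.
This takes the place of smoothing u. -/
theorem eLpNorm_translate_sub_le {d : ℕ} {c : E d} {ρ : ℝ} {u : E d → ℂ} {G : E d → V d}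
    (hu : MemLp u 2 (volume.restrict (Metric.ball c ρ)))
    (hG : MemLp G 2 (volume.restrict (Metric.ball c ρ)))
    (hw : HasWeakGradOn (Metric.ball c ρ) u G) (h : E d) :
    eLpNorm (fun x => u (x + h) - u x) 2
        (volume.restrict (Metric.ball c ρ ∩ (fun x => x + h) ⁻¹' Metric.ball c ρ)) ≤
      ENNReal.ofReal ‖h‖ * eLpNorm G 2 (volume.restrict (Metric.ball c ρ)) := by
  set B := Metric.ball c ρ with hB
  set U := B ∩ (fun x => x + h) ⁻¹' B with hU
  have hUo : IsOpen U := Metric.isOpen_ball.inter (Metric.isOpen_ball.preimage (by fun_prop))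
  have hmp := (measurePreserving_add_right volume h).restrict_preimage
    (Metric.isOpen_ball (x := c) (ε := ρ)).measurableSet
  have hu1 : MemLp (fun x => u (x + h)) 2 (volume.restrict U) :=
    (hu.comp_measurePreserving hmp).mono_measure
      (Measure.restrict_mono Set.inter_subset_right le_rfl)
  have hu2 : MemLp u 2 (volume.restrict U) :=
    hu.mono_measure (Measure.restrict_mono Set.inter_subset_left le_rfl)
  have : IsFiniteMeasure (volume.restrict B) := ⟨by
    rw [Measure.restrict_apply_univ]; exact measure_ball_lt_top⟩
  have hui : Integrable u (volume.restrict B) := hu.integrable (by norm_num)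
  rw [← ENNReal.ofReal_toReal hG.2.ne, ← ENNReal.ofReal_mul (norm_nonneg _)]
  refine eLpNorm_two_le_of_test hUo (hu1.sub hu2) fun φ hφ => ?_
  have hφ' : IsTestFunction Set.univ φ := ⟨hφ.1, hφ.2.1, Set.subset_univ _⟩
  obtain ⟨L, hL⟩ := hφ'.lipschitzWith
  set F : ℝ → ℂ := fun s => ∫ x in B, u x * φ (x - s • h) with hF
  have hφc : ∀ w : E d, Continuous fun x => φ (x - w) := fun w =>
    hφ.1.continuous.comp (by fun_prop)
  obtain ⟨b, hb⟩ := hφ.2.1.exists_bound_of_continuous hφ.1.continuous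
  have hderiv : ∀ s, HasDerivAt F (∫ x in B, u x * fderiv ℝ φ (x - s • h) (-h)) s := by
    intro s
    refine (hasDerivAt_integral_of_dominated_loc_of_deriv_le (𝕜 := ℝ) (s := Set.univ)
      (F := fun s x => u x * φ (x - s • h)) (F' := fun s x => u x * fderiv ℝ φ (x - s • h) (-h))
      (bound := fun x => ‖u x‖ * (L * ‖h‖)) univ_mem ?_ ?_ ?_ ?_ ?_ ?_).2
    · exact Eventually.of_forall fun s => hu.1.mul (hφc _).aestronglyMeasurable
    · exact hui.mul_bdd (hφc _).aestronglyMeasurable (ae_of_all _ fun x => hb _)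
    · exact hu.1.mul ((continuous_fderiv_testFunction hφ' (-h)).comp
        (by fun_prop)).aestronglyMeasurable
    · refine ae_of_all _ fun x s _ => ?_
      rw [norm_mul]
      refine mul_le_mul_of_nonneg_left ?_ (norm_nonneg _)
      have := norm_fderiv_apply_le hL (x - s • h) (-h)
      rwa [norm_neg] at this
    · exact hui.norm.mul_const _
    · refine ae_of_all _ fun x s _ => ?_
      have h1 : HasDerivAt (fun s : ℝ => x - s • h) (-h) s := by
        simpa using ((hasDerivAt_id s).smul_const h).const_sub x
      exact ((hφ'.differentiableAt (x - s • h)).hasFDerivAt.comp_hasDerivAt s h1).const_mul (u x)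
  have hbound : ∀ s ∈ Set.Icc (0 : ℝ) 1, ‖∫ x in B, u x * fderiv ℝ φ (x - s • h) (-h)‖ ≤
      ‖h‖ * (eLpNorm G 2 (volume.restrict B)).toReal * (eLpNorm φ 2 (volume.restrict U)).toReal := by
    intro s hs
    -- A point x of the support has both x and x + h in the ball. By convexity x + sh stays in it,
    -- so every translate is admissible in the definition of the weak gradient.
    have hφs : IsTestFunction B fun x => φ (x - s • h) := hφ'.comp_sub_right fun x hx => by
      have h1 := hφ.2.2 hx
      have h2 : x + s • h = (1 - s) • x + s • (x + h) := by module
      rw [h2]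
      have hcv : Convex ℝ B := convex_ball c ρ
      exact hcv h1.1 h1.2 (by linarith [hs.2]) hs.1 (by ring)
    have e1 : ∀ x, fderiv ℝ φ (x - s • h) (-h) =
        -∑ i, (h i : ℂ) * grad (fun x => φ (x - s • h)) x i := by
      intro x
      rw [map_neg, fderiv_apply_eq_sum]
      simp only [grad, fderiv_comp_sub]
    have hgi : ∀ i, Integrable (fun x => u x * ((h i : ℂ) * grad (fun x => φ (x - s • h)) x i))
        (volume.restrict B) := by
      intro i
      refine hui.mul_bdd (c := ‖(h i : ℂ)‖ * (L * ‖(EuclideanSpace.single i (1 : ℝ) : E d)‖)) ?_ ?_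
      · exact ((continuous_const.mul (continuous_fderiv_testFunction
          (⟨hφs.1, hφs.2.1, Set.subset_univ _⟩ : IsTestFunction Set.univ _) _))).aestronglyMeasurable
      · refine ae_of_all _ fun x => ?_
        rw [norm_mul]
        refine mul_le_mul_of_nonneg_left ?_ (norm_nonneg _)
        exact norm_fderiv_apply_le
          (hL.comp (LipschitzWith.of_dist_le_mul (K := 1) fun x y => by simp) |>.weaken (by simp)) _ _
    have hGi : ∀ i, Integrable (fun x => (h i : ℂ) * G x i * φ (x - s • h)) (volume.restrict B) := by
      intro i
      have hGi : Integrable (fun x => G x i) (volume.restrict B) :=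
        (EuclideanSpace.proj i : V d →L[ℂ] ℂ).integrable_comp (hG.integrable (by norm_num))
      exact (hGi.const_mul _).mul_bdd (hφc _).aestronglyMeasurable (ae_of_all _ fun x => hb _)
    have e2 : ∫ x in B, u x * fderiv ℝ φ (x - s • h) (-h) =
        ∫ x in B, (∑ i, (h i : ℂ) * G x i) * φ (x - s • h) := by
      simp only [e1, mul_neg, integral_neg, Finset.mul_sum, Finset.sum_mul]
      rw [integral_finsetSum _ fun i _ => hgi i, integral_finsetSum _ fun i _ => hGi i,
        ← Finset.sum_neg_distrib]
      refine Finset.sum_congr rfl fun i _ => ?_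
      have h3 := hw.2.2 _ hφs i
      have e3 : ∀ x, u x * ((h i : ℂ) * grad (fun x => φ (x - s • h)) x i) =
        (h i : ℂ) * (u x * grad (fun x => φ (x - s • h)) x i) := fun x => by ring
      simp only [e3, mul_assoc]
      rw [integral_const_mul, integral_const_mul, h3, mul_neg, neg_neg]
    rw [e2]
    refine (norm_integral_sum_mul_le hG (hφs.memLp 2 _) h).trans ?_
    refine mul_le_mul_of_nonneg_left (ENNReal.toReal_mono (hφ.memLp 2 _).2.ne ?_) (by positivity)
    calc eLpNorm (fun x => φ (x - s • h)) 2 (volume.restrict B)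
        ≤ eLpNorm (fun x => φ (x - s • h)) 2 volume := eLpNorm_restrict_le _ _ _ _
      _ = eLpNorm φ 2 volume := eLpNorm_comp_measurePreserving hφ.1.continuous.aestronglyMeasurable
          (measurePreserving_sub_right volume (s • h))
      _ = eLpNorm φ 2 (volume.restrict U) := by
          refine (eLpNorm_restrict_eq_of_support_subset ?_).symm
          exact (subset_tsupport _).trans hφ.2.2
  have h1 := Convex.norm_image_sub_le_of_norm_hasDerivWithin_le
    (fun s _ => (hderiv s).hasDerivWithinAt) hbound (convex_Icc (0 : ℝ) 1)
    (Set.left_mem_Icc.2 zero_le_one) (Set.right_mem_Icc.2 zero_le_one)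
  rw [sub_zero, norm_one, mul_one] at h1
  refine le_of_eq_of_le (congrArg norm ?_) h1
  have hφU : ∀ x, x ∉ U → φ x = 0 := fun x hx => image_eq_zero_of_notMem_tsupport fun h => hx (hφ.2.2 h)
  have e1 : F 1 = ∫ x in U, u (x + h) * φ x := by
    rw [hφ.setIntegral_mul fun x => u (x + h)]
    simp only [hF, one_smul]
    rw [← integral_add_right_eq_self (fun x => B.indicator (fun x => u x * φ (x - h)) x) h |>.trans
      (integral_indicator Metric.isOpen_ball.measurableSet)]
    refine integral_congr_ae (ae_of_all _ fun x => ?_)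
    change B.indicator (fun x => u x * φ (x - h)) (x + h) = u (x + h) * φ x
    by_cases hx : x + h ∈ B
    · rw [Set.indicator_of_mem hx, add_sub_cancel_right]
    · rw [Set.indicator_of_notMem hx, hφU x fun h' => hx h'.2, mul_zero]
  have e0 : F 0 = ∫ x in U, u x * φ x := by
    simp only [hF, zero_smul, sub_zero]
    rw [hφ.setIntegral_mul]
    exact setIntegral_eq_integral_of_forall_compl_eq_zero fun x hx => by
      rw [hφU x fun h' => hx h'.1, mul_zero]
  rw [e1, e0, ← integral_sub]
  · exact integral_congr_ae (ae_of_all _ fun x => sub_mul _ _ _)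
  · exact hu1.integrable_mul (hφ.memLp 2 _)
  · exact hu2.integrable_mul (hφ.memLp 2 _)

/-- The constant is a value of u at a well-chosen point. The double integral of |u(y) - u(x)|² over
the ball, written with h = y - x and |h| < 2ρ, is bounded by the translation estimate, so some x
does no worse than the average. The factor 2^d is the ratio of the volumes of the balls of radii 2ρ
and ρ. -/
theorem exists_lintegral_enorm_sub_sq_le {d : ℕ} {c : E d} {ρ : ℝ} (hρ : 0 < ρ) {u : E d → ℂ}
    {G : E d → V d} (hu : MemLp u 2 (volume.restrict (Metric.ball c ρ)))
    (hG : MemLp G 2 (volume.restrict (Metric.ball c ρ)))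
    (hw : HasWeakGradOn (Metric.ball c ρ) u G) :
    ∃ b : ℂ, ∫⁻ x in Metric.ball c ρ, ‖u x - b‖ₑ ^ 2 ≤
      2 ^ d * ENNReal.ofReal ((2 * ρ) ^ 2) * ∫⁻ x in Metric.ball c ρ, ‖G x‖ₑ ^ 2 := by
  set B := Metric.ball c ρ with hB
  have hBm : MeasurableSet B := measurableSet_ball
  set v := hu.1.mk u with hv
  have hvm : Measurable v := hu.1.stronglyMeasurable_mk.measurable
  have hvu : ∀ᵐ x, x ∈ B → u x = v x := (ae_restrict_iff' hBm).1 hu.1.ae_eq_mk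
  set J := ∫⁻ x in B, ‖G x‖ₑ ^ 2 with hJ
  have hsq : ∀ {F : Type} [NormedAddCommGroup F] (f : E d → F) (μ : Measure (E d)),
      eLpNorm f 2 μ ^ 2 = ∫⁻ x, ‖f x‖ₑ ^ 2 ∂μ := by
    intro F _ f μ
    rw [eLpNorm_eq_lintegral_rpow_enorm_toReal (by norm_num) (by norm_num), ENNReal.toReal_ofNat,
      ← ENNReal.rpow_natCast, ← ENNReal.rpow_mul]
    simp
  set D : E d → E d → ℝ≥0∞ := fun x h => B.indicator 1 x * B.indicator 1 (x + h) * ‖v (x + h) - v x‖ₑ ^ 2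
    with hD
  have hDm : Measurable (Function.uncurry D) := by
    have h1 : Measurable (B.indicator (1 : E d → ℝ≥0∞)) := measurable_one.indicator hBm
    have h2 : Measurable fun z : E d × E d => z.1 + z.2 := measurable_fst.add measurable_snd
    exact ((h1.comp measurable_fst).mul (h1.comp h2)).mul
      (((hvm.comp h2).sub (hvm.comp measurable_fst)).enorm.pow_const 2)
  have hDh : ∀ h, ∫⁻ x, D x h ≤
      (Metric.ball (0 : E d) (2 * ρ)).indicator (fun _ => ENNReal.ofReal ((2 * ρ) ^ 2) * J) h := by
    intro h
    by_cases hh : h ∈ Metric.ball (0 : E d) (2 * ρ)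
    · rw [Set.indicator_of_mem hh]
      have hh' : ‖h‖ ≤ 2 * ρ := by rw [mem_ball_zero_iff] at hh; exact hh.le
      have hUm : MeasurableSet (B ∩ (fun x => x + h) ⁻¹' B) :=
        hBm.inter (measurable_add_const h hBm)
      calc ∫⁻ x, D x h = ∫⁻ x in B ∩ (fun x => x + h) ⁻¹' B, ‖v (x + h) - v x‖ₑ ^ 2 := by
            rw [← lintegral_indicator hUm]
            refine lintegral_congr fun x => ?_
            by_cases h1 : x ∈ B
            · by_cases h2 : x + h ∈ B
              · rw [Set.indicator_of_mem (by exact ⟨h1, h2⟩)]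
                simp [hD, h1, h2]
              · rw [Set.indicator_of_notMem fun h3 => h2 h3.2]
                simp [hD, h2]
            · rw [Set.indicator_of_notMem fun h3 => h1 h3.1]
              simp [hD, h1]
        _ = ∫⁻ x in B ∩ (fun x => x + h) ⁻¹' B, ‖u (x + h) - u x‖ₑ ^ 2 := by
            refine setLIntegral_congr_fun_ae hUm ?_
            filter_upwards [hvu, (measurePreserving_add_right volume h).quasiMeasurePreserving.ae hvu]
              with x h1 h2 hx
            rw [h1 hx.1, h2 hx.2]
        _ = eLpNorm (fun x => u (x + h) - u x) 2
              (volume.restrict (B ∩ (fun x => x + h) ⁻¹' B)) ^ 2 := (hsq _ _).symm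
        _ ≤ (ENNReal.ofReal ‖h‖ * eLpNorm G 2 (volume.restrict B)) ^ 2 :=
            pow_le_pow_left' (eLpNorm_translate_sub_le hu hG hw h) 2
        _ ≤ _ := by
            rw [mul_pow, hsq, ← ENNReal.ofReal_pow (norm_nonneg _)]
            exact mul_le_mul_left (ENNReal.ofReal_le_ofReal
              (pow_le_pow_left₀ (norm_nonneg _) hh' 2)) _
    · rw [Set.indicator_of_notMem hh]
      refine le_of_eq ?_
      rw [lintegral_eq_zero_of_ae_eq_zero]
      refine ae_of_all _ fun x => ?_
      change B.indicator 1 x * B.indicator 1 (x + h) * ‖v (x + h) - v x‖ₑ ^ 2 = 0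
      by_cases h1 : x ∈ B
      · have h2 : x + h ∉ B := fun h2 => hh (by
          rw [mem_ball_zero_iff]
          have := dist_triangle_right (x + h) x c
          rw [dist_eq_norm, add_sub_cancel_left] at this
          rw [hB, Metric.mem_ball] at h1 h2
          linarith)
        simp [h2]
      · simp [h1]
  have hB0 : volume B ≠ 0 := (Metric.measure_ball_pos _ _ hρ).ne'
  have hBt : volume B ≠ ⊤ := measure_ball_lt_top.ne
  have htot : ∫⁻ x in B, ∫⁻ h, D x h ≤ ENNReal.ofReal ((2 * ρ) ^ 2) * J * volume (Metric.ball (0 : E d) (2 * ρ)) := by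
    calc ∫⁻ x in B, ∫⁻ h, D x h ≤ ∫⁻ x, ∫⁻ h, D x h := setLIntegral_le_lintegral _ _
      _ = ∫⁻ h, ∫⁻ x, D x h := lintegral_lintegral_swap hDm.aemeasurable
      _ ≤ _ := lintegral_mono hDh
      _ = _ := by rw [lintegral_indicator measurableSet_ball, setLIntegral_const]
  -- A point of the ball where the inner integral is at most its average over the ball.
  obtain ⟨x, hx, hle⟩ := exists_le_setLAverage hB0 hBt
    (f := fun x => ∫⁻ h, D x h) hDm.lintegral_prod_right'.aemeasurable
  refine ⟨v x, ?_⟩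
  have h1 : ∫⁻ h, D x h = ∫⁻ y in B, ‖u y - v x‖ₑ ^ 2 := by
    have h2 : ∀ h, D x h = B.indicator (fun y => ‖v y - v x‖ₑ ^ 2) (x + h) := by
      intro h
      by_cases h2 : x + h ∈ B
      · simp [hD, hx, h2]
      · simp [hD, h2]
    simp only [h2]
    rw [lintegral_add_left_eq_self (fun y => B.indicator (fun y => ‖v y - v x‖ₑ ^ 2) y) x,
      lintegral_indicator hBm]
    refine setLIntegral_congr_fun_ae hBm ?_
    filter_upwards [hvu] with y hy hyB
    rw [hy hyB]
  rw [← h1]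
  refine hle.trans ?_
  rw [setLAverage_eq]
  refine (ENNReal.div_le_div_right htot _).trans (le_of_eq ?_)
  rw [hB, volume_ball_eq (0 : E d) (show 0 < 2 * ρ by positivity), volume_ball_eq c hρ, mul_pow 2 ρ d,
    ENNReal.ofReal_mul (by positivity), ENNReal.ofReal_pow (by norm_num : (0 : ℝ) ≤ 2), ENNReal.ofReal_ofNat]
  rw [hB, volume_ball_eq c hρ] at hB0 hBt
  rw [mul_assoc (2 ^ d : ℝ≥0∞), ← mul_assoc, mul_div_assoc, ENNReal.div_self hB0 hBt, mul_one]
  ring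

/-! ### Local estimates for solutions and non-tangential limits. -/

theorem MemL2Loc.memLp_ball {d : ℕ} {F : Type*} [NormedAddCommGroup F] {Ω : Set (E d)} {f : E d → F}
    (hf : MemL2Loc Ω f) {X : E d} {r : ℝ} (h : Metric.closedBall X r ⊆ Ω) :
    MemLp f 2 (volume.restrict (Metric.ball X r)) :=
  (hf _ h (isCompact_closedBall X r)).mono_measure
    (Measure.restrict_mono Metric.ball_subset_closedBall le_rfl)

theorem MemL2Loc.mono {d : ℕ} {F : Type*} [NormedAddCommGroup F] {Ω Ω' : Set (E d)} {f : E d → F}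
    (hf : MemL2Loc Ω f) (h : Ω' ⊆ Ω) : MemL2Loc Ω' f := fun K hK hKc => hf K (hK.trans h) hKc

theorem IsTestFunction.mono {d : ℕ} {Ω Ω' : Set (E d)} {φ : E d → ℂ} (hφ : IsTestFunction Ω' φ)
    (h : Ω' ⊆ Ω) : IsTestFunction Ω φ := ⟨hφ.1, hφ.2.1, hφ.2.2.trans h⟩

theorem setIntegral_eq_of_test {d : ℕ} {Ω Ω' : Set (E d)} {φ : E d → ℂ} (hφ : IsTestFunction Ω' φ)
    (h : Ω' ⊆ Ω) {f : E d → ℂ} (hf : ∀ x, x ∉ tsupport φ → f x = 0) :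
    ∫ x in Ω', f x = ∫ x in Ω, f x := by
  rw [setIntegral_eq_integral_of_forall_compl_eq_zero fun x hx => hf x fun h' => hx (hφ.2.2 h'),
    setIntegral_eq_integral_of_forall_compl_eq_zero fun x hx => hf x fun h' => hx (h (hφ.2.2 h'))]

theorem HasWeakGradOn.mono {d : ℕ} {Ω Ω' : Set (E d)} {u : E d → ℂ} {G : E d → V d}
    (hw : HasWeakGradOn Ω u G) (h : Ω' ⊆ Ω) : HasWeakGradOn Ω' u G := by
  refine ⟨hw.1.mono_set h, hw.2.1.mono_set h, fun φ hφ i => ?_⟩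
  rw [setIntegral_eq_of_test hφ h, setIntegral_eq_of_test hφ h, hw.2.2 φ (hφ.mono h) i]
  · exact fun x hx => by rw [image_eq_zero_of_notMem_tsupport hx, mul_zero]
  · exact fun x hx => by rw [grad_eq_zero hx, PiLp.zero_apply, mul_zero]

/-- Derivatives of test functions have integral zero. -/
theorem HasWeakGradOn.sub_const {d : ℕ} {Ω : Set (E d)} (hΩ : IsOpen Ω) {u : E d → ℂ} {G : E d → V d}
    (hw : HasWeakGradOn Ω u G) (b : ℂ) : HasWeakGradOn Ω (fun x => u x - b) G := by
  have hb : LocallyIntegrableOn (fun _ : E d => b) Ω :=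
    (locallyIntegrable_const b).locallyIntegrableOn Ω
  refine ⟨hw.1.sub hb, hw.2.1, fun φ hφ i => ?_⟩
  rw [← hw.2.2 φ hφ i]
  have hφ' := hφ.mono (Set.subset_univ Ω)
  have hgc : Continuous fun x => grad φ x i := continuous_fderiv_testFunction hφ' _
  have hgs : HasCompactSupport fun x => grad φ x i := hasCompactSupport_fderiv_testFunction hφ' _
  have hz : ∀ x, x ∉ tsupport φ → grad φ x i = 0 := fun x hx => by
    rw [grad_eq_zero hx, PiLp.zero_apply]
  have h1 : ∫ x in Ω, b * grad φ x i = 0 := by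
    rw [integral_const_mul, setIntegral_eq_of_test hφ (Set.subset_univ Ω) hz, Measure.restrict_univ]
    rw [show ∫ x, grad φ x i = 0 from integral_fderiv_testFunction hφ' _, mul_zero]
  have h2 : IntegrableOn (fun x => u x * grad φ x i) Ω := by
    have h3 : IntegrableOn (fun x => u x * grad φ x i) (tsupport φ) := by
      obtain ⟨c, hc⟩ := hgs.exists_bound_of_continuous hgc
      exact (hw.1.integrableOn_compact_subset hφ.2.2 hφ.2.1).mul_bdd
        hgc.aestronglyMeasurable (ae_of_all _ hc)
    exact h3.of_forall_sdiff_eq_zero hΩ.measurableSet fun x hx => by rw [hz x hx.2, mul_zero]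
  simp only [sub_mul]
  rw [integral_sub h2 ((hgc.integrable_of_hasCompactSupport hgs).const_mul b).integrableOn, h1, sub_zero]

theorem IsSolution.sub_const {n : ℕ} {A : Coeff n} {Ω Ω' : Set (E (n + 1))} {u : E (n + 1) → ℂ}
    {G : E (n + 1) → V (n + 1)} (hu : IsSolution A Ω u G) (hΩ' : IsOpen Ω') (h : Ω' ⊆ Ω) (b : ℂ) :
    IsSolution A Ω' (fun X => u X - b) G := by
  refine ⟨fun K hK hKc => ?_, hu.2.1.mono h, (hu.2.2.1.mono h).sub_const hΩ' b, fun Φ hΦ => ?_⟩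
  · have : IsFiniteMeasure (volume.restrict K) := ⟨by
      rw [Measure.restrict_apply_univ]; exact hKc.measure_lt_top⟩
    exact (hu.1.mono h K hK hKc).sub (memLp_const b)
  · rw [setIntegral_eq_of_test hΦ h, hu.2.2.2 Φ (hΦ.mono h)]
    intro X hX
    simp [energy_eq, grad_eq_zero hX]

/-- Apply the De Giorgi–Nash estimate to u - b on the ball of radius τ/4 that occurs in `ntMax`,
where b is the constant of the Poincaré inequality. The L² average of u - b is then at most Cτ times
that of ∇u. -/
theorem exists_oscillation_le {n : ℕ} (C₀ : ℝ) {α : ℝ} (hα : 0 < α) (hC₀ : 0 < C₀) :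
    ∃ C : ℝ≥0, ∀ A : Coeff n, SatisfiesDGN A C₀ α → ∀ σ : ℝ, σ = 1 ∨ σ = -1 →
      ∀ (u : E (n + 1) → ℂ) (G : E (n + 1) → V (n + 1)), IsSolution A (halfSpace n σ) u G →
        ContinuousOn u (halfSpace n σ) → ∀ x₀, ∀ X ∈ cone σ x₀,
          ∀ Y ∈ Metric.ball X (σ * height X / 8), ∀ Z ∈ Metric.ball X (σ * height X / 8),
            ‖u Y - u Z‖ₑ ≤ C * ENNReal.ofReal (σ * height X) * ntMax σ G x₀ := by
  refine ⟨(C₀ * 2 ^ α).toNNReal * ((2 : ℝ≥0) ^ (n + 1)) ^ (1 / 2 : ℝ),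
    fun A hA σ hσ u G hu huc x₀ X hX => ?_⟩
  have hτ := height_pos_of_mem_cone hX
  set τ := σ * height X with hτdef
  set B := Metric.ball X (τ / 4) with hB
  have hcl : Metric.closedBall X (τ / 4) ⊆ halfSpace n σ :=
    (Metric.closedBall_subset_ball (by linarith)).trans (ball_subset_halfSpace hσ (le_refl τ))
  have hBH : B ⊆ halfSpace n σ := Metric.ball_subset_closedBall.trans hcl
  obtain ⟨b, hb⟩ := exists_lintegral_enorm_sub_sq_le (ρ := τ / 4) (by positivity)
    (hu.1.memLp_ball hcl) (hu.2.1.memLp_ball hcl) (hu.2.2.1.mono hBH)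
  obtain ⟨v, hv, hvD⟩ := hA B _ G Metric.isOpen_ball
    ((convex_ball X (τ / 4)).isPathConnected ⟨X, Metric.mem_ball_self (by positivity)⟩).isConnected
    (hu.sub_const Metric.isOpen_ball hBH b)
  have hR : 2 * (τ / 8) = τ / 4 := by ring
  have hvb := hvD X (τ / 8) (by positivity) (by rw [hR])
  rw [hR] at hvb
  have hv0 : volume B ≠ 0 := (Metric.measure_ball_pos _ _ (by positivity)).ne'
  have havg : (⨍⁻ W in B, ‖v W‖ₑ ^ 2 ∂volume) ^ (1 / 2 : ℝ) ≤
      ((2 : ℝ≥0∞) ^ (n + 1)) ^ (1 / 2 : ℝ) * ENNReal.ofReal τ * ntMax σ G x₀ := by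
    calc (⨍⁻ W in B, ‖v W‖ₑ ^ 2 ∂volume) ^ (1 / 2 : ℝ)
        = (⨍⁻ W in B, ‖u W - b‖ₑ ^ 2 ∂volume) ^ (1 / 2 : ℝ) := by
          congr 1
          rw [setLAverage_eq, setLAverage_eq]
          congr 1
          refine lintegral_congr_ae ?_
          filter_upwards [hv] with W hW
          rw [hW]
      _ ≤ (2 ^ (n + 1) * ENNReal.ofReal ((2 * (τ / 4)) ^ 2) * ⨍⁻ W in B, ‖G W‖ₑ ^ 2 ∂volume) ^ (1 / 2 : ℝ) := by
          refine ENNReal.rpow_le_rpow ?_ (by norm_num)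
          rw [setLAverage_eq, setLAverage_eq, ← mul_div_assoc]
          exact ENNReal.div_le_div_right hb _
      _ ≤ _ := by
          rw [ENNReal.mul_rpow_of_nonneg _ _ (by norm_num), ENNReal.mul_rpow_of_nonneg _ _ (by norm_num)]
          refine mul_le_mul' (mul_le_mul_right ?_ _) (le_ntMax G hX)
          rw [ENNReal.ofReal_rpow_of_nonneg (by positivity) (by norm_num), ← Real.sqrt_eq_rpow,
            Real.sqrt_sq (by positivity)]
          exact ENNReal.ofReal_le_ofReal (by linarith)
  have hvK : ∀ Y ∈ Metric.ball X (τ / 8), ∀ Z ∈ Metric.ball X (τ / 8), ‖v Y - v Z‖ₑ ≤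
      (((C₀ * 2 ^ α).toNNReal * ((2 : ℝ≥0) ^ (n + 1)) ^ (1 / 2 : ℝ) : ℝ≥0) : ℝ≥0∞) *
        ENNReal.ofReal τ * ntMax σ G x₀ := by
    intro Y hY Z hZ
    refine (hvb Y hY Z hZ).trans ?_
    rw [ENNReal.coe_mul, ENNReal.coe_rpow_of_nonneg _ (by norm_num)]
    push_cast
    rw [mul_assoc, mul_assoc]
    refine mul_le_mul' (ENNReal.ofReal_le_ofReal ?_) (havg.trans (le_of_eq (mul_assoc _ _ _)))
    refine mul_le_mul_of_nonneg_left (Real.rpow_le_rpow (by positivity) ?_ hα.le) hC₀.le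
    rw [div_le_iff₀ (by positivity), ← dist_eq_norm]
    rw [Metric.mem_ball] at hY hZ
    linarith [dist_triangle_right Y Z X]
  -- The estimate holds for a representative v that equals u - b only almost everywhere. The set of
  -- equality is dense, and continuity of u carries the bound to all points.
  have hS : ∀ᵐ W, W ∈ B → v W = u W - b := (ae_restrict_iff' measurableSet_ball).1 hv
  have hdense : Dense {W | W ∈ B → v W = u W - b} := Measure.dense_of_ae hS
  have hseq : ∀ Y ∈ Metric.ball X (τ / 8), ∃ y : ℕ → E (n + 1),
      (∀ k, y k ∈ Metric.ball X (τ / 8) ∧ v (y k) = u (y k) - b) ∧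
        Tendsto (fun k => u (y k)) atTop (𝓝 (u Y)) := by
    intro Y hY
    obtain ⟨y, hy, hlim⟩ := mem_closure_iff_seq_limit.1
      (hdense.open_subset_closure_inter Metric.isOpen_ball hY)
    have hsub : Metric.ball X (τ / 8) ⊆ B := Metric.ball_subset_ball (by linarith)
    refine ⟨y, fun k => ⟨(hy k).1, (hy k).2 (hsub (hy k).1)⟩, ?_⟩
    exact ((huc.continuousAt ((isOpen_halfSpace n σ).mem_nhds (hBH (hsub hY)))).tendsto).comp hlim
  intro Y hY Z hZ
  obtain ⟨y, hy, hylim⟩ := hseq Y hY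
  obtain ⟨z, hz, hzlim⟩ := hseq Z hZ
  refine le_of_tendsto (hylim.sub hzlim).enorm (Eventually.of_forall fun k => ?_)
  have h1 := hvK _ (hy k).1 _ (hz k).1
  rwa [(hy k).2, (hz k).2, sub_sub_sub_cancel_right] at h1

theorem dist_pt_pt_le {n : ℕ} (x y : E n) (s t : ℝ) : dist (pt x s) (pt y t) ≤ dist x y + |s - t| := by
  have := dist_le_horiz_add_height (pt x s) (pt y t)
  rwa [horiz_pt, horiz_pt, height_pt, height_pt] at this

theorem pt_horiz_height {n : ℕ} (X : E (n + 1)) : pt (horiz X) (height X) = X := by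
  ext i
  refine Fin.lastCases ?_ (fun j => ?_) i
  · simp [pt, height]
  · simp [pt, horiz]

/-- Down the axis of the cone the heights shrink by the factor 15/16, and the geometric series
contributes 16 = 1/(1 - 15/16). At height τ, 16 horizontal steps, each shorter than τ/16, lead from
the axis to X. Together they give 32. -/
theorem exists_nt_limit {n : ℕ} {σ : ℝ} (hσ : σ = 1 ∨ σ = -1) {u : E (n + 1) → ℂ} {x₀ : E n} {K : ℝ}
    (hK : 0 ≤ K) (h : ∀ X ∈ cone σ x₀, ∀ Y ∈ Metric.ball X (σ * height X / 8),
      ∀ Z ∈ Metric.ball X (σ * height X / 8), ‖u Y - u Z‖ ≤ K * (σ * height X)) :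
    ∃ b : ℂ, ∀ X ∈ cone σ x₀, ‖u X - b‖ ≤ 32 * (K * (σ * height X)) := by
  have hσσ : ∀ t, σ * (σ * t) = t := fun t => by rcases hσ with rfl | rfl <;> simp
  have hσabs : ∀ t, |σ * t| = |t| := fun t => by rw [abs_mul, abs_sign hσ, one_mul]
  have hmem : ∀ {y : E n} {t : ℝ}, ‖x₀ - y‖ < t → pt y (σ * t) ∈ cone σ x₀ := fun {y t} hy => by
    change ‖x₀ - horiz (pt y (σ * t))‖ < σ * height (pt y (σ * t))
    rwa [horiz_pt, height_pt, hσσ]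
  have hstep : ∀ {y : E n} {t : ℝ}, ‖x₀ - y‖ < t → ∀ {y' : E n} {t' : ℝ},
      dist y' y + |t' - t| < t / 8 → ‖u (pt y' (σ * t')) - u (pt y (σ * t))‖ ≤ K * t := by
    intro y t hy y' t' hd
    have h0 : 0 < t := lt_of_le_of_lt (norm_nonneg _) hy
    have h1 := h _ (hmem hy) (pt y' (σ * t')) ?_ (pt y (σ * t)) ?_
    · rwa [height_pt, hσσ] at h1
    · rw [height_pt, hσσ, Metric.mem_ball]
      refine (dist_pt_pt_le _ _ _ _).trans_lt ?_
      rwa [← mul_sub, hσabs]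
    · rw [height_pt, hσσ]; exact Metric.mem_ball_self (by positivity)
  set v : ℝ → ℂ := fun t => u (pt x₀ (σ * t)) with hv
  -- Induction on the number of steps. One step costs Kt, and the remaining ones cost 16K·(15/16)t =
  -- 15Kt.
  have hv1 : ∀ k : ℕ, ∀ t s : ℝ, 0 < t → (15 / 16) ^ k * t ≤ s → s ≤ t → ‖v s - v t‖ ≤ 16 * (K * t) := by
    intro k
    induction k with
    | zero =>
      intro t s ht h1 h2
      rw [pow_zero, one_mul] at h1
      rw [le_antisymm h2 h1, sub_self, norm_zero]
      positivity
    | succ k ih =>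
      intro t s ht h1 h2
      rcases le_or_gt (15 / 16 * t) s with h3 | h3
      · have h4 : ‖v s - v t‖ ≤ K * t := hstep (by simpa using ht) (by
          rw [dist_self, abs_of_nonpos (by linarith)]; linarith)
        nlinarith [mul_nonneg hK ht.le]
      · have h4 : ‖v (15 / 16 * t) - v t‖ ≤ K * t := hstep (by simpa using ht) (by
          rw [dist_self, abs_of_nonpos (by linarith)]; linarith)
        have h5 := ih (15 / 16 * t) s (by positivity) (by rw [pow_succ] at h1; linarith) h3.le
        have h6 : ‖v s - v t‖ ≤ ‖v s - v (15 / 16 * t)‖ + ‖v (15 / 16 * t) - v t‖ := norm_sub_le_norm_sub_add_norm_sub _ _ _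
        nlinarith
  have hv2 : ∀ t s : ℝ, 0 < s → s ≤ t → ‖v s - v t‖ ≤ 16 * (K * t) := by
    intro t s hs hst
    have ht : 0 < t := hs.trans_le hst
    obtain ⟨k, hk⟩ := exists_pow_lt_of_lt_one (div_pos hs ht) (show (15 / 16 : ℝ) < 1 by norm_num)
    rw [lt_div_iff₀ ht] at hk
    exact hv1 k t s ht hk.le hst
  have hpos : ∀ k : ℕ, 0 < 1 / ((k : ℝ) + 1) := fun k => Nat.one_div_pos_of_nat
  have hcau : CauchySeq fun k : ℕ => v (1 / ((k : ℝ) + 1)) := by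
    refine cauchySeq_of_le_tendsto_0 (fun N : ℕ => 16 * (K * (1 / ((N : ℝ) + 1)))) (fun k m N hk hm => ?_) ?_
    · have key : ∀ a b : ℕ, N ≤ a → a ≤ b →
          ‖v (1 / ((b : ℝ) + 1)) - v (1 / ((a : ℝ) + 1))‖ ≤ 16 * (K * (1 / ((N : ℝ) + 1))) := by
        intro a b hNa hab
        refine (hv2 _ _ (hpos b) (Nat.one_div_le_one_div hab)).trans ?_
        have := Nat.one_div_le_one_div (α := ℝ) hNa
        gcongr
      rw [dist_eq_norm]
      rcases le_total k m with h1 | h1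
      · rw [norm_sub_rev]; exact key k m hk h1
      · exact key m k hm h1
    · have := (tendsto_one_div_add_atTop_nhds_zero_nat (𝕜 := ℝ)).const_mul K |>.const_mul 16
      simpa using this
  obtain ⟨b, hb⟩ := cauchySeq_tendsto_of_complete hcau
  have hvb : ∀ t, 0 < t → ‖v t - b‖ ≤ 16 * (K * t) := by
    intro t ht
    refine le_of_tendsto (hb.const_sub (v t)).norm ?_
    filter_upwards [(tendsto_one_div_add_atTop_nhds_zero_nat (𝕜 := ℝ)).eventually (gt_mem_nhds ht)] with k hk
    rw [norm_sub_rev]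
    exact hv2 t _ (hpos k) hk.le
  refine ⟨b, fun X hX => ?_⟩
  have hτ := height_pos_of_mem_cone hX
  set τ := σ * height X with hτd
  set y := horiz X with hy
  have hXe : X = pt y (σ * τ) := by rw [hτd, hσσ, hy, pt_horiz_height]
  have hyτ : ‖x₀ - y‖ < τ := hX
  -- The intermediate points stay in the cone because they are convex combinations of the axis point
  -- and X at the same height.
  have hh : ∀ j : ℕ, j ≤ 16 → ‖u (pt (x₀ + ((j : ℝ) / 16) • (y - x₀)) (σ * τ)) - v τ‖ ≤ j * (K * τ) := by
    intro j
    induction j with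
    | zero => intro _; simp [hv]
    | succ j ih =>
      intro hj
      have h1 := ih (by omega)
      have hj' : (j : ℝ) / 16 ≤ 1 := by
        rw [div_le_one (by norm_num)]; exact_mod_cast (by omega : j ≤ 16)
      have h2 : ‖u (pt (x₀ + (((j + 1 : ℕ) : ℝ) / 16) • (y - x₀)) (σ * τ)) -
          u (pt (x₀ + ((j : ℝ) / 16) • (y - x₀)) (σ * τ))‖ ≤ K * τ := by
        refine hstep ?_ ?_
        · rw [sub_add_cancel_left, norm_neg, norm_smul, Real.norm_of_nonneg (by positivity), norm_sub_rev]
          nlinarith [norm_nonneg (x₀ - y)]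
        · have e : x₀ + (((j + 1 : ℕ) : ℝ) / 16) • (y - x₀) - (x₀ + ((j : ℝ) / 16) • (y - x₀)) =
              (1 / 16 : ℝ) • (y - x₀) := by
            push_cast; module
          rw [dist_eq_norm, e, norm_smul, norm_sub_rev, sub_self, abs_zero, add_zero,
            Real.norm_of_nonneg (by norm_num)]
          linarith
      have h3 := norm_sub_le_norm_sub_add_norm_sub (u (pt (x₀ + (((j + 1 : ℕ) : ℝ) / 16) • (y - x₀)) (σ * τ)))
        (u (pt (x₀ + ((j : ℝ) / 16) • (y - x₀)) (σ * τ))) (v τ)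
      push_cast at *
      linarith
  have h16 := hh 16 le_rfl
  have e : x₀ + (((16 : ℕ) : ℝ) / 16) • (y - x₀) = y := by norm_num
  rw [e, ← hXe] at h16
  have h1 := norm_sub_le_norm_sub_add_norm_sub (u X) (v τ) b
  have h2 := hvb τ hτ
  push_cast at h16
  linarith

/-- Makes the non-tangential filter nontrivial, so that limits are unique. -/
theorem bdryPt_mem_closure_cone {n : ℕ} {σ : ℝ} (hσ : σ = 1 ∨ σ = -1) (x : E n) :
    bdryPt x ∈ closure (cone σ x) := by
  have hlim : Tendsto (fun t : ℝ => pt x (σ * t)) (𝓝[>] 0) (𝓝 (bdryPt x)) := by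
    rw [tendsto_iff_dist_tendsto_zero]
    refine squeeze_zero (g := fun t : ℝ => |t|) (fun _ => dist_nonneg) (fun t => ?_) ?_
    · have h1 := dist_pt_pt_le x x (σ * t) 0
      rwa [dist_self, zero_add, sub_zero, abs_mul, abs_sign hσ, one_mul] at h1
    · have h2 : Tendsto (fun t : ℝ => |t|) (𝓝 0) (𝓝 |0|) := continuous_abs.tendsto 0
      rw [abs_zero] at h2
      exact h2.mono_left nhdsWithin_le_nhds
  refine mem_closure_of_tendsto hlim ?_
  filter_upwards [self_mem_nhdsWithin] with t ht
  change ‖x - horiz (pt x (σ * t))‖ < σ * height (pt x (σ * t))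
  rw [horiz_pt, height_pt, sub_self, norm_zero]
  rcases hσ with rfl | rfl <;> simpa using ht

theorem NTConverges.ae_eq {n : ℕ} {σ : ℝ} (hσ : σ = 1 ∨ σ = -1) {u : E (n + 1) → ℂ} {f f' : E n → ℂ}
    (hf : NTConverges σ u f) (hf' : NTConverges σ u f') : f' =ᵐ[volume] f := by
  filter_upwards [hf, hf'] with x hx hx'
  have : (𝓝[cone σ x] (bdryPt x)).NeBot :=
    mem_closure_iff_nhdsWithin_neBot.1 (bdryPt_mem_closure_cone hσ x)
  exact tendsto_nhds_unique hx' hx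

/-- The trace f(x) is the limit in the cone wherever N is finite. Its rate of convergence is
Ct·N(x), so comparing f(x) and f(y) at a point common to both cones yields a Hajłasz gradient in
L^p. -/
theorem exists_nt_trace {n : ℕ} (hn : 0 < n) {C₀ α p : ℝ} (hα : 0 < α) (hC₀ : 0 < C₀)
    (hp : (n : ℝ) / (n + 1) < p) :
    ∃ C : ℝ≥0, ∀ A : Coeff n, SatisfiesDGN A C₀ α → ∀ σ : ℝ, σ = 1 ∨ σ = -1 →
      ∀ (u : E (n + 1) → ℂ) (G : E (n + 1) → V (n + 1)), IsSolution A (halfSpace n σ) u G →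
        ContinuousOn u (halfSpace n σ) → lpQuasiNorm p (ntMax σ G) < ⊤ →
        ∃ f : E n → ℂ, hardySobolevNorm p f ≤ C * lpQuasiNorm p (ntMax σ G) ∧ NTConverges σ u f := by
  have hp0 : 0 < p := lt_of_le_of_lt (by positivity) hp
  obtain ⟨C₁, hC₁⟩ := exists_oscillation_le (n := n) C₀ hα hC₀
  obtain ⟨C₂, hC₂⟩ := exists_hardySobolev_of_hajlasz hn hp
  -- The 32 comes from chaining in the cone. The added 1 keeps K nonzero, so that finiteness of
  -- K·N(x) implies that of N(x).
  set K : ℝ≥0 := 32 * (C₁ + 1) with hK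
  refine ⟨C₂ * K, fun A hA σ hσ u G hu huc hN => ?_⟩
  set N := ntMax σ G with hNdef
  have hNlsc : LowerSemicontinuous N := lowerSemicontinuous_ntMax σ G
  have hI : ∫⁻ x, N x ^ p < ⊤ := (ENNReal.rpow_lt_top_iff_of_pos (by positivity)).1 hN
  have hNt : ∀ᵐ x, N x < ⊤ := by
    filter_upwards [ae_lt_top (hNlsc.measurable.pow_const p) hI.ne] with x hx
    exact (ENNReal.rpow_lt_top_iff_of_pos hp0).1 hx
  have hex : ∀ x₀, ∃ b : ℂ, N x₀ < ⊤ → ∀ X ∈ cone σ x₀,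
      ‖u X - b‖ₑ ≤ ENNReal.ofReal (σ * height X) * (K * N x₀) := by
    intro x₀
    by_cases hx : N x₀ < ⊤
    · have hKt : (C₁ : ℝ≥0∞) * N x₀ ≠ ⊤ := ENNReal.mul_ne_top ENNReal.coe_ne_top hx.ne
      obtain ⟨b, hb⟩ := exists_nt_limit hσ (u := u) (x₀ := x₀) (K := ((C₁ : ℝ≥0∞) * N x₀).toReal)
        ENNReal.toReal_nonneg (fun X hX Y hY Z hZ => by
          have h1 := hC₁ A hA σ hσ u G hu huc x₀ X hX Y hY Z hZ
          rw [mul_right_comm, ← ofReal_norm, ← ENNReal.ofReal_toReal hKt,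
            ← ENNReal.ofReal_mul ENNReal.toReal_nonneg,
            ENNReal.ofReal_le_ofReal_iff
              (mul_nonneg ENNReal.toReal_nonneg (height_pos_of_mem_cone hX).le)] at h1
          exact h1)
      refine ⟨b, fun _ X hX => ?_⟩
      have hτ := (height_pos_of_mem_cone hX).le
      rw [← ofReal_norm]
      refine (ENNReal.ofReal_le_ofReal (hb X hX)).trans ?_
      rw [ENNReal.ofReal_mul (by norm_num), ENNReal.ofReal_mul ENNReal.toReal_nonneg,
        ENNReal.ofReal_toReal hKt, ENNReal.ofReal_ofNat, hK]
      push_cast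
      calc 32 * (C₁ * N x₀ * ENNReal.ofReal (σ * height X)) =
            ENNReal.ofReal (σ * height X) * (32 * C₁ * N x₀) := by ring
        _ ≤ _ := mul_le_mul_right (mul_le_mul_left (mul_le_mul_right le_self_add _) _) _
    · exact ⟨0, fun h => absurd h hx⟩
  choose f hf using hex
  refine ⟨f, ?_, ?_⟩
  · have hlsc : LowerSemicontinuous fun x => (K : ℝ≥0∞) * N x :=
      Continuous.comp_lowerSemicontinuous (g := fun t : ℝ≥0∞ => (K : ℝ≥0∞) * t)
        (ENNReal.continuous_const_mul ENNReal.coe_ne_top) hNlsc fun s t hst => mul_le_mul_right hst _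
    have e : ∫⁻ x, ((K : ℝ≥0∞) * N x) ^ p = (K : ℝ≥0∞) ^ p * ∫⁻ x, N x ^ p := by
      simp only [ENNReal.mul_rpow_of_nonneg _ _ hp0.le]
      exact lintegral_const_mul _ (hNlsc.measurable.pow_const p)
    have hK0 : (K : ℝ≥0∞) ≠ 0 := by
      rw [hK]
      exact ENNReal.coe_ne_zero.2 (by positivity)
    have hfin : ∀ x, (K : ℝ≥0∞) * N x < ⊤ → N x < ⊤ := fun x hx =>
      lt_top_iff_ne_top.2 fun h => by
        rw [h, ENNReal.mul_top hK0] at hx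
        exact lt_irrefl _ hx
    refine (hC₂ f (fun x => K * N x) hlsc ?_ fun x y hx hy => ?_).trans (le_of_eq ?_)
    · rw [e]
      exact ENNReal.mul_lt_top (ENNReal.rpow_lt_top_of_nonneg hp0.le ENNReal.coe_ne_top) hI
    · rcases eq_or_ne x y with rfl | hxy
      · simp
      · have hd : 0 < ‖x - y‖ := norm_pos_iff.2 (sub_ne_zero.2 hxy)
        have hσσ : σ * (σ * ‖x - y‖) = ‖x - y‖ := by rcases hσ with rfl | rfl <;> simp
        -- The point over the midpoint at height |x - y| is at horizontal distance |x - y|/2 from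
        -- both x and y, hence in both cones.
        set Z := pt (midpoint ℝ x y) (σ * ‖x - y‖) with hZ
        have hht : σ * height Z = ‖x - y‖ := by rw [hZ, height_pt, hσσ]
        have hZx : Z ∈ cone σ x := by
          change ‖x - horiz Z‖ < σ * height Z
          rw [hht, hZ, horiz_pt, ← dist_eq_norm, dist_left_midpoint, dist_eq_norm,
            Real.norm_of_nonneg (by norm_num)]
          linarith
        have hZy : Z ∈ cone σ y := by
          change ‖y - horiz Z‖ < σ * height Z
          rw [hht, hZ, horiz_pt, ← dist_eq_norm, dist_comm, dist_midpoint_right, dist_eq_norm,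
            Real.norm_of_nonneg (by norm_num)]
          linarith
        have h1 := hf x (hfin x hx) Z hZx
        have h2 := hf y (hfin y hy) Z hZy
        rw [hht, ofReal_norm] at h1 h2
        rw [mul_add]
        calc ‖f x - f y‖ₑ = ‖(u Z - f y) - (u Z - f x)‖ₑ := by congr 1; ring
          _ ≤ ‖u Z - f y‖ₑ + ‖u Z - f x‖ₑ := enorm_sub_le
          _ ≤ _ := by rw [add_comm]; exact add_le_add h1 h2
    · rw [e, ENNReal.mul_rpow_of_nonneg _ _ (by positivity), ← ENNReal.rpow_mul,
        mul_one_div_cancel hp0.ne', ENNReal.rpow_one, lpQuasiNorm, ENNReal.coe_mul C₂ K,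
        mul_assoc (C₂ : ℝ≥0∞)]
  · filter_upwards [hNt] with x hx
    have hfx := hf x hx
    have hKt : (K : ℝ≥0∞) * N x ≠ ⊤ := ENNReal.mul_ne_top ENNReal.coe_ne_top hx.ne
    have h0 : Tendsto (fun X : E (n + 1) => ENNReal.ofReal (σ * height X) * (K * N x))
        (𝓝[cone σ x] (bdryPt x)) (𝓝 0) := by
      have h1 : Tendsto (fun X : E (n + 1) => ENNReal.ofReal (σ * height X))
          (𝓝[cone σ x] (bdryPt x)) (𝓝 (ENNReal.ofReal (σ * height (bdryPt x)))) :=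
        ((ENNReal.continuous_ofReal.comp (continuous_const.mul (continuous_height n))).tendsto _).mono_left
          nhdsWithin_le_nhds
      rw [← pt_zero, height_pt, mul_zero, ENNReal.ofReal_zero] at h1
      have h2 := ENNReal.Tendsto.mul_const (b := K * N x) h1 (Or.inr hKt)
      rwa [zero_mul] at h2
    rw [tendsto_iff_edist_tendsto_0]
    refine tendsto_of_tendsto_of_tendsto_of_le_of_le' tendsto_const_nhds h0
      (Eventually.of_forall fun _ => zero_le) ?_
    filter_upwards [self_mem_nhdsWithin] with X hX
    rw [edist_eq_enorm_sub]
    exact hfx X hX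

end

end EllipticBoundary

theorem lemma5p1 (n : ℕ) (hn : 2 ≤ n) (Λ C₀ α p : ℝ) (hΛ : 0 < Λ) (hC₀ : 0 < C₀)
    (hα₀ : 0 < α) (hα₁ : α ≤ 1) (hp : (n : ℝ) / (n + 1) < p) :
    ∃ C : ℝ≥0, ∀ A : Coeff n, IsUniformlyElliptic Λ A →
      SatisfiesDGN A C₀ α → SatisfiesDGN (adjointCoeff A) C₀ α →
      ∀ σ : ℝ, σ = 1 ∨ σ = -1 →
      ∀ (u : E (n + 1) → ℂ) (G : E (n + 1) → V (n + 1)),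
        IsSolution A (halfSpace n σ) u G → ContinuousOn u (halfSpace n σ) →
        lpQuasiNorm p (ntMax σ G) < ⊤ →
        (∃ g : 𝓢'(E n, ℂ),
          hardyNorm p g ≤ C * lpQuasiNorm p (ntMax σ G) ∧
          IsConormal A σ G g ∧
          (1 ≤ p → ∃ h : E n → ℂ, MemLp h (ENNReal.ofReal p) volume ∧ Represents g h) ∧
          ∀ g' : 𝓢'(E n, ℂ), hardyNorm p g' < ⊤ → IsConormal A σ G g' → g' = g) ∧
        (∃ f : E n → ℂ,
          hardySobolevNorm p f ≤ C * lpQuasiNorm p (ntMax σ G) ∧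
          NTConverges σ u f ∧
          ∀ f' : E n → ℂ, hardySobolevNorm p f' < ⊤ → NTConverges σ u f' →
            f' =ᵐ[volume] f) := by
  have hn0 : 0 < n := by omega
  obtain ⟨C₁, hC₁⟩ := exists_conormal hn0 hΛ hp
  obtain ⟨C₂, hC₂⟩ := exists_nt_trace hn0 hα₀ hC₀ hp
  refine ⟨C₁ + C₂, fun A hA hD _ σ hσ u G hu huc hN => ⟨?_, ?_⟩⟩
  · obtain ⟨g, hg, hgc, hgp⟩ := hC₁ A hA σ hσ u G hu hN
    refine ⟨g, hg.trans ?_, hgc, hgp, fun g' _ hg' => isConormal_unique hσ hgc hg'⟩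
    gcongr
    exact le_self_add
  · obtain ⟨f, hf, hfu⟩ := hC₂ A hD σ hσ u G hu huc hN
    refine ⟨f, hf.trans ?_, hfu, fun f' _ hf' => hfu.ae_eq hσ hf'⟩
    gcongr
    exact le_add_self
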